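/- **Setting.** Fix $d\ge 2$. For $L\ge 1$ let $\mathbb T_L=(\mathbb Z/(2L+1)\mathbb Z)^d$, and let $E(\mathbb T_L)$ be its set of nearest-neighbour edges, with a fixed orientation. Write $\nabla f(e)=f(y)-f(x)$ for the positively oriented edge $e=(x,y)$, and $\nabla\cdot g(x)=\sum_{e=(x,y)}g(e)-\sum_{e=(y,x)}g(e)$. The box $\Lambda_r=\{-r,\dots,r\}^d$ ($0\le r\le L$) is seen as a subset of $\mathbb T_L$, $|x|$ is the Euclidean norm of the representative of $x\in\mathbb T_L$ in $\Lambda_L$, and $|x|_*=|x|+1$. For $U\subseteq\mathbb T_L$, $E(U)$ is the set of edges with both endpoints in $U$, and $\|u\|_{\underline L^q(U)}=\big(|U|^{-1}\sum_{e\in E(U)}|u(e)|^q\big)^{1/q}$ for $u:E(\mathbb T_L)\to[0,\infty]$, where $|U|$ is the number of vertices of $U$. Let $V:\mathbb R\to\mathbb R$ be $C^2$ and convex, with $0<c_-\le\liminf_{|x|\to\infty}V''(x)/|x|^{r-2}\le\limsup_{|x|\to\infty}V''(x)/|x|^{r-2}\le c_+<\infty$ for some $r>2$. Let $\mu_{\mathbb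 T_L}$ be the probability measure proportional to $\exp(-\sum_{e}V(\nabla\phi(e)))\,d\phi$ on $\{\phi:\mathbb T_L\to\mathbb R:\sum_x\phi(x)=0\}$. Let $\phi_L$ be the Langevin dynamic $d\phi_L(t,x)=\nabla\cdot V'(\nabla\phi_L)(t,x)\,dt+\sqrt2\,dB_t(x)$, $t\ge 0$, where $(B(x))_{x\in\mathbb T_L}$ are independent Brownian motions and $\phi_L(0,\cdot)$ has law $\mu_{\mathbb T_L}$ and is independent of them. Let $\mathbf a(t,e)=V''(\nabla\phi_L(t,e))\ge 0$ for $t\ge 0$, and extend $\mathbf a$ to $t<0$ in any way that keeps it nonnegative and continuous in time (for instance by extending the Langevin dynamic to a stationary process on $\mathbb R$). Set $\mathbf a^{(t)}(t',e)=\mathbf a(t-t',e)$. Let $P_{\mathbf a}$ be the solution of $\partial_tP_{\mathbf a}=\nabla\cdot\mathbf a\nabla P_{\mathbf a}$ on $(0,\infty)\times\mathbb T_L$ with $P_{\mathbf a}(0,x)=\mathbf 1_{\{x=0\}}-|\mathbb T_L|^{-1}$. **Functionals.** Fix $p,p'\in(d,\infty)$ and $\delta>0$, to be regarded as chosen depending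 only on $d$, such that $k_t=\delta(1+t)^{-p-3}$ and $K_t=k_t+\int_t^\infty sk_s\,ds$ satisfy $\int_t^{s'}K_{s-t}K_{s'-s}\,ds\le K_{s'-t}$ for $0<t\le s'$ and $\int_0^\infty K_s\,ds\le1$. Put $$\lambda_d=\tfrac{2d+2}{d+2},\quad\kappa_d=\tfrac{d\lambda_d}{d-\lambda_d},\quad\sigma_d=\tfrac{2\kappa_d}{\kappa_d-2},\quad\tau_d=\tfrac{2\lambda_d}{2-\lambda_d},\quad\lambda_d'=\tfrac{2d+3}{d+2},\quad\tau_d'=\tfrac{2\lambda_d'}{2-\lambda_d'},\quad\theta_d=\tfrac23\cdot\tfrac{2d+3}{2d+2},$$ $$\tfrac1{\theta_c}=1+\tfrac{dp+2p}{dp+2d}\big(\tfrac{p'}d-1\big),\quad\alpha=(1-\theta_c)\tfrac d{d+2}+\theta_c\tfrac p{p+2},\quad\beta=(1-\theta_c)\tfrac2{d+2},\quad\gamma=\theta_c\tfrac2{p+2}.$$ For an environment $\mathbf a$, define $w(t,e)\ge 0$ by $$w(t,e)^2=\int_t^\infty k_{s-t}\,\frac{\mathbf a(s,e)\wedge1}{(s-t)^{-1}\sum_{e'\cap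 e\ne\emptyset}\int_t^s\mathbf a(s',e')\vee1\,ds'}\,ds,$$ where the sum is over the edges $e'$ sharing at least one endpoint with $e$. With values in $[0,\infty]$ (and the conventions $0^{-1}=\infty$, $\infty^{-1}=0$, $0\cdot\infty=0$) let $$\mathcal M_{p'}(t)=1+\big(1+\|w(t,\cdot)\|_{\underline L^{\sigma_d}(\mathbb T_L)}\|w^{-1}(t,\cdot)\|_{\underline L^{\tau_d}(\mathbb T_L)}\big)^2\sup_{1\le r\le L}\|w^{-1}(t,\cdot)\|^2_{\underline L^{p'}(\Lambda_r)},$$ $$\mathcal M_0(t)=1+\sup_{0\le r\le L}\|\mathbf a(t,\cdot)^{1/2}\|^2_{\underline L^{\sigma_d}(\Lambda_r)}\big(1+\|w^{-1}(t,\cdot)\|^2_{\underline L^{\tau_d'}(\Lambda_r)}\big),\qquad\mathcal M_1(t)=1+\int_t^\infty K_{s-t}\,\mathcal M_0(s)^{\frac p{2(1-\theta_d)}}\,ds,$$ $$\mathcal M_2(t)=1+\sup_{x\in\mathbb T_L}\frac{\sum_{e\ni x}\mathbf a(t,e)}{|x|_*^{(p-2)/(p-1)}},\quad\mathcal M_3(t)=1+\Big(\int_t^\infty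 K_{s-t}\,\mathcal M_{p'}(s)^{\alpha/\beta}\,ds\Big)^{\beta},\quad\mathcal M_4(t)=1+\sup_{s\in[t,t+1]}\|w(s,\cdot)^{-1}\|^2_{\underline L^d(\mathbb T_L)},$$ $$\mathscr M_1=\Big(\sup_{t\ge1}\frac1t\int_0^t\mathcal M_1(s)^{2/p}\,ds\Big)^{p/2},\qquad\mathscr M_2=\Big(\sup_{t\ge1}\frac1t\int_0^t\mathcal M_2(s)\,ds\Big)^{p-1},$$ $$\mathscr M_3=\Big(\inf_{t\ge1}\frac1t\int_0^t\mathcal M_3(s)^{-1/\alpha}\,ds\Big)^{-\alpha/\gamma},\qquad\mathscr M_4=\Big(\inf_{t\ge1}\frac1t\int_0^t\mathcal M_4(s)^{-1}\,ds\Big)^{-1},$$ $$\mathscr M=\big((\mathscr M_1+\mathscr M_2)\mathscr M_3\big)^{\frac\gamma{1-\alpha-\gamma}},\qquad\mathscr M'=\mathscr M_3^{\frac{2\gamma}{d\beta+p\gamma}+\frac\gamma\alpha}\,\mathscr M_4 .$$ Write $\mathscr M,\mathscr M'$ for these functionals of $\mathbf a$, and $\mathscr M^{(t)}$ for the functional $\mathscr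 M$ computed for the reversed environment $\mathbf a^{(t)}$. **Proposition 4.7 (on-diagonal heat kernel decay).** There exists a constant $C\in[1,\infty)$, depending only on $d$ (through $d,p,p',\delta$) and in particular not on $V$ or $L$, such that, almost surely, for every $t\ge0$, $$P_{\mathbf a}(t,0)\le\frac{C\sqrt{\mathscr M\,\mathscr M^{(t)}}}{(1+t)^{d/2}}\exp\Big(-\frac t{C\,\mathscr M'L^2}\Big),$$ where the exponential is $1$ if $\mathscr M'=\infty$, and the bound is void if $\mathscr M\,\mathscr M^{(t)}=\infty$. -/

import Mathlib

open MeasureTheory ProbabilityTheory Set Filter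
open scoped NNReal ENNReal

noncomputable section

namespace GradPhi

/-! ### The torus, its edges, gradients and divergences -/

/-- The torus `(ℤ / (2L+1)ℤ)^d`. -/
abbrev Torus (d L : ℕ) : Type := Fin d → ZMod (2 * L + 1)

/-- The (unoriented) nearest-neighbour edges of the torus: `(x, i)` is the edge between `x` and
`x + e_i`. For `L ≥ 1` every edge is listed exactly once. -/
abbrev Edge (d L : ℕ) : Type := Torus d L × Fin d

variable {d L : ℕ}

/-- The neighbour `x + e_i` of `x`. -/
def shift (x : Torus d L) (i : Fin d) : Torus d L := x + Pi.single i 1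

/-- First endpoint of a positively oriented edge. An orientation is a map
`o : Edge d L → Bool`; if `o (x, i)` is true then the positive orientation of the edge `(x, i)` is
from `x` to `x + e_i`, otherwise it is from `x + e_i` to `x`. -/
def edgeSrc (o : Edge d L → Bool) (e : Edge d L) : Torus d L :=
  if o e then e.1 else shift e.1 e.2

/-- Second endpoint of a positively oriented edge. -/
def edgeTgt (o : Edge d L → Bool) (e : Edge d L) : Torus d L :=
  if o e then shift e.1 e.2 else e.1

/-- `x ∈ e`: the vertex `x` is an endpoint of the edge `e`. -/
def IsEndpoint (x : Torus d L) (e : Edge d L) : Prop := x = e.1 ∨ x = shift e.1 e.2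

/-- `e ∩ e' ≠ ∅`: the two edges share at least one endpoint (in particular `e ∩ e ≠ ∅`). -/
def EdgesMeet (e e' : Edge d L) : Prop := ∃ x, IsEndpoint x e ∧ IsEndpoint x e'

/-- Discrete gradient `∇f(e) = f(y) - f(x)` over the positively oriented edge `e = (x, y)`. -/
def grad (o : Edge d L → Bool) (f : Torus d L → ℝ) (e : Edge d L) : ℝ :=
  f (edgeTgt o e) - f (edgeSrc o e)

open Classical in
/-- Discrete divergence of a function defined on the positively oriented edges:
`∑_{e = (x, y)} g(e) - ∑_{e = (y, x)} g(e)`. -/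
def divergence (o : Edge d L → Bool) (g : Edge d L → ℝ) (x : Torus d L) : ℝ :=
  (∑ e : Edge d L with edgeSrc o e = x, g e) - ∑ e : Edge d L with edgeTgt o e = x, g e

/-- Euclidean norm of the representative in `{-L, …, L}^d` of a point of the torus. -/
def torusNorm (x : Torus d L) : ℝ := √(∑ i, ((x i).valMinAbs : ℝ) ^ 2)

/-- The box `Λ_r = {-r, …, r}^d`, seen as a subset of the torus. -/
def box (d L r : ℕ) : Finset (Torus d L) :=
  Finset.univ.filter fun x => ∀ i, |(x i).valMinAbs| ≤ (r : ℤ)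

open Classical in
/-- `E(U)`: the edges with both endpoints in `U`. -/
def edgesIn (U : Finset (Torus d L)) : Finset (Edge d L) :=
  Finset.univ.filter fun e => e.1 ∈ U ∧ shift e.1 e.2 ∈ U

/-- Normalized `L^q` norm over `U` of a `[0,∞]`-valued function of the edges:
`(|U|⁻¹ ∑_{e ∈ E(U)} u(e)^q)^{1/q}`, where `|U|` is the number of vertices of `U`. -/
def normAvg (q : ℝ) (U : Finset (Torus d L)) (u : Edge d L → ℝ≥0∞) : ℝ≥0∞ :=
  ((U.card : ℝ≥0∞)⁻¹ * ∑ e ∈ edgesIn U, u e ^ q) ^ (1 / q)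

/-! ### Heat kernel -/

/-- `H` is the heat kernel `(t, x) ↦ P_a(t, x; s, y)`: for `t > s` it solves
`∂_t H = ∇ · a ∇ H`, it is continuous on `[s, ∞)`, and `H(s, ·) = δ_y - 1 / |T_L|`. -/
structure IsHeatKernel (o : Edge d L → Bool) (a : ℝ → Edge d L → ℝ) (s : ℝ) (y : Torus d L)
    (H : ℝ → Torus d L → ℝ) : Prop where
  continuousOn : ∀ x, ContinuousOn (fun t => H t x) (Ici s)
  hasDerivAt : ∀ t, s < t → ∀ x,
    HasDerivAt (fun t => H t x) (divergence o (fun e => a t e * grad o (H t) e) x) t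
  initial : ∀ x, H s x = (if x = y then 1 else 0) - 1 / (Fintype.card (Torus d L) : ℝ)

/-! ### Potential, Gibbs measure, Langevin dynamic -/

/-- `V` is twice continuously differentiable, convex, and `V''` grows like `|x|^{r-2}` for some
exponent `r > 2`. -/
structure IsPotential (V : ℝ → ℝ) : Prop where
  contDiff : ContDiff ℝ 2 V
  convexOn : ConvexOn ℝ univ V
  growth : ∃ r cm cp : ℝ, 2 < r ∧ 0 < cm ∧ 0 < cp ∧
    (cm : EReal) ≤
      liminf (fun x : ℝ => ((iteratedDeriv 2 V x / |x| ^ (r - 2) : ℝ) : EReal)) (cocompact ℝ) ∧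
    limsup (fun x : ℝ => ((iteratedDeriv 2 V x / |x| ^ (r - 2) : ℝ) : EReal)) (cocompact ℝ)
      ≤ (cp : EReal)

/-- The space of functions on the torus whose sum vanishes, with the `L²` scalar product. -/
def zeroSum (d L : ℕ) : Submodule ℝ (EuclideanSpace ℝ (Torus d L)) where
  carrier := {f | ∑ x, f x = 0}
  add_mem' := by
    intro f g hf hg
    simp only [mem_ofPred_eq, PiLp.add_apply, Finset.sum_add_distrib] at hf hg ⊢
    rw [hf, hg, add_zero]
  zero_mem' := by simp
  smul_mem' := by
    intro c f hf
    simp only [mem_ofPred_eq, PiLp.smul_apply, smul_eq_mul, ← Finset.mul_sum] at hf ⊢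
    rw [hf, mul_zero]

/-- Lebesgue measure on the space of functions whose sum vanishes: the Haar measure which gives
mass one to the unit cubes of orthonormal bases. -/
def lebesgueZeroSum (d L : ℕ) : Measure (zeroSum d L) :=
  (stdOrthonormalBasis ℝ (zeroSum d L)).toBasis.addHaar

/-- The density `exp (- ∑_e V(∇φ(e)))`. -/
def gibbsWeight (o : Edge d L → Bool) (V : ℝ → ℝ) (f : zeroSum d L) : ℝ≥0∞ :=
  ENNReal.ofReal (Real.exp (- ∑ e : Edge d L, V (grad o (fun x => (f : EuclideanSpace ℝ (Torus d L)) x) e)))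

/-- The Gibbs measure with potential `V`, as a measure on the space of all functions on the
torus (it is carried by the functions whose sum vanishes). -/
def gibbsMeasure (o : Edge d L → Bool) (V : ℝ → ℝ) : Measure (Torus d L → ℝ) :=
  ((∫⁻ f, gibbsWeight o V f ∂(lebesgueZeroSum d L))⁻¹ •
    (lebesgueZeroSum d L).withDensity (gibbsWeight o V)).map
      (fun (f : zeroSum d L) x => (f : EuclideanSpace ℝ (Torus d L)) x)

/-- The Langevin dynamic: `B x`, for `x` in the torus, are independent Brownian motions, `φ₀` is
sampled according to the Gibbs measure independently of the Brownian motions, and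
`dφ(t, x) = ∇ · V'(∇φ)(t, x) dt + √2 dB_t(x)` for `t ≥ 0`, with `φ(0, ·) = φ₀`
(an equation with additive noise, written in integrated form). -/
structure IsLangevin {Ω : Type*} [MeasurableSpace Ω] (P : Measure Ω) (o : Edge d L → Bool)
    (V : ℝ → ℝ) (B : Torus d L → ℝ≥0 → Ω → ℝ) (φ₀ : Ω → Torus d L → ℝ)
    (φ : Ω → ℝ → Torus d L → ℝ) : Prop where
  brownian : ∀ x, IsBrownianReal (B x) P
  indep : iIndepFun (fun x ω (t : ℝ≥0) => B x t ω) P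
  initialLaw : HasLaw φ₀ (gibbsMeasure o V) P
  indepInitial : IndepFun φ₀ (fun ω x (t : ℝ≥0) => B x t ω) P
  continuousOn : ∀ᵐ ω ∂P, ∀ x, ContinuousOn (fun t => φ ω t x) (Ici 0)
  equation : ∀ᵐ ω ∂P, ∀ t : ℝ≥0, ∀ x,
    φ ω t x = φ₀ ω x
      + (∫ s in (0 : ℝ)..t, divergence o (fun e => deriv V (grad o (φ ω s) e)) x)
      + √2 * B x t ω

/-! ### Kernels and exponents -/

/-- `k_t = δ (1 + t)^{-(p+3)}`. -/
def kSmall (p δ t : ℝ) : ℝ := δ / (1 + t) ^ (p + 3)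

/-- `K_t = k_t + ∫_t^∞ s k_s ds`. -/
def kBig (p δ t : ℝ) : ℝ := kSmall p δ t + ∫ s in Ioi t, s * kSmall p δ s

/-- The smallness condition on `δ`: `K * K ≤ K` and `∫ K ≤ 1`. -/
structure KernelSmall (p δ : ℝ) : Prop where
  conv_le : ∀ t s' : ℝ, 0 < t → t ≤ s' →
    ∫ s in t..s', kBig p δ (s - t) * kBig p δ (s' - s) ≤ kBig p δ (s' - t)
  integral_le : ∫ s in Ioi (0 : ℝ), kBig p δ s ≤ 1

def lambdaD (d : ℕ) : ℝ := (2 * d + 2) / (d + 2)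

def kappaD (d : ℕ) : ℝ := d * lambdaD d / (d - lambdaD d)

def sigmaD (d : ℕ) : ℝ := 2 * kappaD d / (kappaD d - 2)

def tauD (d : ℕ) : ℝ := 2 * lambdaD d / (2 - lambdaD d)

def lambdaD' (d : ℕ) : ℝ := (2 * d + 3) / (d + 2)

def tauD' (d : ℕ) : ℝ := 2 * lambdaD' d / (2 - lambdaD' d)

def thetaD (d : ℕ) : ℝ := 2 / 3 * ((2 * d + 3) / (2 * d + 2))

/-- `1 / θ_c = 1 + (dp + 2p) / (dp + 2d) * (p' / d - 1)`. -/
def thetaC (d : ℕ) (p p' : ℝ) : ℝ :=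
  1 / (1 + (d * p + 2 * p) / (d * p + 2 * d) * (p' / d - 1))

def alphaE (d : ℕ) (p p' : ℝ) : ℝ :=
  (1 - thetaC d p p') * (d / (d + 2)) + thetaC d p p' * (p / (p + 2))

def betaE (d : ℕ) (p p' : ℝ) : ℝ := (1 - thetaC d p p') * (2 / (d + 2))

def gammaE (d : ℕ) (p p' : ℝ) : ℝ := thetaC d p p' * (2 / (p + 2))

/-! ### Moderated environment and maximal functionals

Here `a : ℝ → Edge d L → ℝ` is an environment `(t, e) ↦ a(t, e)`; only the times `t ≥ 0` enter the
functionals below. They take values in `[0, ∞]`. -/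

open Classical in
/-- `w(t, e)`, the square root of
`∫_t^∞ k_{s-t} (a(s,e) ∧ 1) / ((s-t)⁻¹ ∑_{e' ∩ e ≠ ∅} ∫_t^s a(s',e') ∨ 1 ds') ds`. -/
def modEnv (p δ : ℝ) (a : ℝ → Edge d L → ℝ) (t : ℝ) (e : Edge d L) : ℝ :=
  √(∫ s in Ioi t, kSmall p δ (s - t) *
    (min (a s e) 1 /
      ((s - t)⁻¹ * ∑ e' : Edge d L with EdgesMeet e e', ∫ s' in t..s, max (a s' e') 1)))

/-- `w(t, ·)` with values in `[0, ∞]`. -/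
def wE (p δ : ℝ) (a : ℝ → Edge d L → ℝ) (t : ℝ) (e : Edge d L) : ℝ≥0∞ :=
  ENNReal.ofReal (modEnv p δ a t e)

/-- `w⁻¹(t, ·)` with values in `[0, ∞]` (infinite where `w` vanishes). -/
def wInv (p δ : ℝ) (a : ℝ → Edge d L → ℝ) (t : ℝ) (e : Edge d L) : ℝ≥0∞ := (wE p δ a t e)⁻¹

/-- `𝓜_{p'}(t)`. -/
def calMp' (p p' δ : ℝ) (a : ℝ → Edge d L → ℝ) (t : ℝ) : ℝ≥0∞ :=
  1 + (1 + normAvg (sigmaD d) Finset.univ (wE p δ a t)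
        * normAvg (tauD d) Finset.univ (wInv p δ a t)) ^ 2
      * ⨆ r ∈ Finset.Icc 1 L, normAvg p' (box d L r) (wInv p δ a t) ^ 2

/-- `𝓜_0(t)`. -/
def calM0 (p δ : ℝ) (a : ℝ → Edge d L → ℝ) (t : ℝ) : ℝ≥0∞ :=
  1 + ⨆ r ∈ Finset.Icc 0 L,
    normAvg (sigmaD d) (box d L r) (fun e => ENNReal.ofReal √(a t e)) ^ 2
      * (1 + normAvg (tauD' d) (box d L r) (wInv p δ a t) ^ 2)

/-- `𝓜_1(t)`. -/
def calM1 (p δ : ℝ) (a : ℝ → Edge d L → ℝ) (t : ℝ) : ℝ≥0∞ :=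
  1 + ∫⁻ s in Ioi t, ENNReal.ofReal (kBig p δ (s - t))
    * calM0 p δ a s ^ (p / (2 * (1 - thetaD d)))

open Classical in
/-- `𝓜_2(t)`, with `|x|_* = |x| + 1`. -/
def calM2 (p : ℝ) (a : ℝ → Edge d L → ℝ) (t : ℝ) : ℝ≥0∞ :=
  1 + ⨆ x : Torus d L, ENNReal.ofReal
    ((∑ e : Edge d L with IsEndpoint x e, a t e) / (torusNorm x + 1) ^ ((p - 2) / (p - 1)))

/-- `𝓜_3(t)`. -/
def calM3 (p p' δ : ℝ) (a : ℝ → Edge d L → ℝ) (t : ℝ) : ℝ≥0∞ :=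
  1 + (∫⁻ s in Ioi t, ENNReal.ofReal (kBig p δ (s - t))
    * calMp' p p' δ a s ^ (alphaE d p p' / betaE d p p')) ^ betaE d p p'

/-- `𝓜_4(t)`. -/
def calM4 (p δ : ℝ) (a : ℝ → Edge d L → ℝ) (t : ℝ) : ℝ≥0∞ :=
  1 + ⨆ s ∈ Icc t (t + 1), normAvg (d : ℝ) Finset.univ (wInv p δ a s) ^ 2

/-- The time average `t⁻¹ ∫_0^t f(s) ds`. -/
def timeAvg (f : ℝ → ℝ≥0∞) (t : ℝ) : ℝ≥0∞ :=
  (ENNReal.ofReal t)⁻¹ * ∫⁻ s in Ioc 0 t, f s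

/-- `ℳ_1`. -/
def scrM1 (p δ : ℝ) (a : ℝ → Edge d L → ℝ) : ℝ≥0∞ :=
  (⨆ t ∈ Ici (1 : ℝ), timeAvg (fun s => calM1 p δ a s ^ (2 / p)) t) ^ (p / 2)

/-- `ℳ_2`. -/
def scrM2 (p : ℝ) (a : ℝ → Edge d L → ℝ) : ℝ≥0∞ :=
  (⨆ t ∈ Ici (1 : ℝ), timeAvg (fun s => calM2 p a s) t) ^ (p - 1)

/-- `ℳ_3`. -/
def scrM3 (p p' δ : ℝ) (a : ℝ → Edge d L → ℝ) : ℝ≥0∞ :=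
  (⨅ t ∈ Ici (1 : ℝ), timeAvg (fun s => calM3 p p' δ a s ^ (-(1 / alphaE d p p'))) t)
    ^ (-(alphaE d p p' / gammaE d p p'))

/-- `ℳ_4`. -/
def scrM4 (p δ : ℝ) (a : ℝ → Edge d L → ℝ) : ℝ≥0∞ :=
  (⨅ t ∈ Ici (1 : ℝ), timeAvg (fun s => (calM4 p δ a s)⁻¹) t)⁻¹

/-- `ℳ = ((ℳ_1 + ℳ_2) ℳ_3)^{γ / (1 - α - γ)}`. -/
def scrM (p p' δ : ℝ) (a : ℝ → Edge d L → ℝ) : ℝ≥0∞ :=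
  ((scrM1 p δ a + scrM2 p a) * scrM3 p p' δ a)
    ^ (gammaE d p p' / (1 - alphaE d p p' - gammaE d p p'))

/-- `ℳ' = ℳ_3^{2γ / (dβ + pγ) + γ / α} ℳ_4`. -/
def scrM' (p p' δ : ℝ) (a : ℝ → Edge d L → ℝ) : ℝ≥0∞ :=
  scrM3 p p' δ a ^ (2 * gammaE d p p' / (d * betaE d p p' + p * gammaE d p p')
      + gammaE d p p' / alphaE d p p')
    * scrM4 p δ a

/-- The environment reversed at time `t`: `a^{(t)}(t', e) = a(t - t', e)`. -/
def reversed (t : ℝ) (a : ℝ → Edge d L → ℝ) : ℝ → Edge d L → ℝ := fun t' e => a (t - t') e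

end GradPhi

end

open GradPhi

/-! The estimate is deterministic: it holds for every environment that is nonnegative and continuous
in time, and the almost sure statement follows path by path. Let v be the solution started from the
indicator of the origin, and q the analogous solution for the environment reversed at time t. Since
∇·a∇ is symmetric, the sum over x of v(s,x) q(t-s,x) does not depend on s. After subtraction of the
means, the heat kernel at the origin at time t is the scalar product of the centered v and q at time
t/2. Cauchy–Schwarz (`IsHeat.centered_le`) then leaves only the decay of ℓ² energies
(`exists_nrg_centered_le`), used once for a and once for its reversal.

As a may vanish, the dissipation Σ a(∇v)² does not control ∇v at a fixed time. The moderated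
environment w repairs this. The gradient at time t is compared through the equation with the
gradient at a later time s, and the change is paid for by the dissipation in between on neighbouring
edges. Hence w(t)²(∇v(t))² is bounded by a K-average of future dissipation (`IsSol.moderation`). All
energies are therefore averaged with `avgK`, and K * K ≤ K allows averages to be iterated at no cost
(`avgK_avgK_le`).

The averaged dissipation is bounded below by an anchored Nash inequality (`exists_nash`), proved by
comparing a function with its box averages at two scales. Up to a term due to the finite volume, it
bounds the energy by the moderated Dirichlet energy, the ℓ¹ norm (equal to 1 for v) and the moment Σ
|x|_*^p v². The growth of this moment is driven by a term Σ a |x|_*^{p-2} v². A Sobolev inequality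
on dyadic shells (`exists_sum_starSum_mul_rpow_mul_sq_le`) bounds it by a small multiple of the
weighted moderated gradient, which is absorbed, plus a lower-order moment; this gives
`exists_avgK_eMom_le`.

The moment bound needs energy decay and the energy decay needs the moment bound. The circle closes
by induction over unit time steps (`exists_nrg_le`), because the constant assumed for the energy
returns only with the power γ/(β+γ) < 1. Past time L² the centered solution satisfies a mean-zero
Nash inequality, giving polynomial decay, and a Poincaré inequality, giving exponential decay. Their
geometric mean (`geom_interp`) has the factor t^{-d/2} and the exponential at once. -/

namespace GradPhi

/-! ### Geometry of the torus -/

section Geometry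

variable {d L : ℕ}

/-- The supremum norm of the representative in `{-L, …, L}^d`. -/
def supNorm (x : Torus d L) : ℕ := Finset.univ.sup fun i => (x i).valMinAbs.natAbs

lemma supNorm_le_iff {x : Torus d L} {r : ℕ} :
    supNorm x ≤ r ↔ ∀ i, (x i).valMinAbs.natAbs ≤ r := by
  simp [supNorm, Finset.sup_le_iff]

lemma natAbs_le_supNorm (x : Torus d L) (i : Fin d) : (x i).valMinAbs.natAbs ≤ supNorm x :=
  supNorm_le_iff.1 le_rfl i

lemma mem_box {x : Torus d L} {r : ℕ} : x ∈ box d L r ↔ supNorm x ≤ r := by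
  simp only [box, Finset.mem_filter, Finset.mem_univ, true_and, supNorm_le_iff]
  refine forall_congr' fun i => ?_
  rw [Int.abs_eq_natAbs]; norm_cast

lemma supNorm_le (x : Torus d L) : supNorm x ≤ L :=
  supNorm_le_iff.2 fun i => (ZMod.natAbs_valMinAbs_le _).trans (by omega)

lemma box_eq_univ {r : ℕ} (h : L ≤ r) : box d L r = Finset.univ := by
  ext x; simp [mem_box, (supNorm_le x).trans h]

lemma supNorm_zero : supNorm (0 : Torus d L) = 0 := by
  have : supNorm (0 : Torus d L) ≤ 0 := supNorm_le_iff.2 fun i => by simp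
  omega

lemma supNorm_neg (x : Torus d L) : supNorm (-x) = supNorm x := by
  simp [supNorm, ZMod.natAbs_valMinAbs_neg]

lemma supNorm_add_le (x y : Torus d L) : supNorm (x + y) ≤ supNorm x + supNorm y := by
  refine supNorm_le_iff.2 fun i => (ZMod.natAbs_valMinAbs_add_le _ _).trans ?_
  exact (Int.natAbs_add_le _ _).trans
    (add_le_add (natAbs_le_supNorm x i) (natAbs_le_supNorm y i))

lemma supNorm_le_add (x y : Torus d L) : supNorm x ≤ supNorm (x + y) + supNorm y := by
  have h := supNorm_add_le (x + y) (-y)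
  rwa [add_neg_cancel_right, supNorm_neg] at h

lemma natAbs_valMinAbs_one_le : ((1 : ZMod (2 * L + 1)).valMinAbs).natAbs ≤ 1 := by
  rcases Nat.eq_zero_or_pos L with h | h
  · exact (ZMod.natAbs_valMinAbs_le _).trans (by omega)
  · have := ZMod.valMinAbs_natCast_of_le_half (n := 2 * L + 1) (a := 1) (by omega)
    simp only [Nat.cast_one] at this
    simp [this]

lemma supNorm_single_le (i : Fin d) : supNorm (Pi.single i 1 : Torus d L) ≤ 1 := by
  refine supNorm_le_iff.2 fun j => ?_
  by_cases h : j = i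
  · subst h; simpa using natAbs_valMinAbs_one_le
  · simp [Pi.single_eq_of_ne h]

lemma supNorm_shift_le (x : Torus d L) (i : Fin d) : supNorm (shift x i) ≤ supNorm x + 1 :=
  (supNorm_add_le _ _).trans (by have := supNorm_single_le (L := L) i; omega)

lemma supNorm_le_shift (x : Torus d L) (i : Fin d) : supNorm x ≤ supNorm (shift x i) + 1 :=
  (supNorm_le_add x (Pi.single i 1)).trans
    (by have := supNorm_single_le (L := L) i; unfold shift; omega)

lemma torusNorm_le (x : Torus d L) : torusNorm x ≤ d * supNorm x := by
  apply Real.sqrt_le_iff.2 ⟨by positivity, ?_⟩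
  rcases Nat.eq_zero_or_pos d with rfl | hd
  · simp
  calc ∑ i, ((x i).valMinAbs : ℝ) ^ 2 ≤ ∑ _i : Fin d, (supNorm x : ℝ) ^ 2 := by
        refine Finset.sum_le_sum fun i _ => ?_
        rw [← sq_abs, ← Int.cast_abs, ← Nat.cast_natAbs]
        have := natAbs_le_supNorm x i
        gcongr
    _ = d * (supNorm x : ℝ) ^ 2 := by simp
    _ ≤ (d * supNorm x) ^ 2 := by
        rw [mul_pow]
        have : (1 : ℝ) ≤ d := by exact_mod_cast hd
        gcongr
        nlinarith

lemma card_valMinAbs_le (r : ℕ) :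
    (Finset.univ.filter fun x : ZMod (2 * L + 1) => |x.valMinAbs| ≤ (r : ℤ)).card ≤ 2 * r + 1 := by
  have : (Finset.Icc (-(r : ℤ)) r).card = 2 * r + 1 := by simp; omega
  rw [← this]
  refine Finset.card_le_card_of_injOn (fun x => x.valMinAbs) (fun x hx => ?_)
    (fun x _ y _ h => ZMod.injective_valMinAbs h)
  simpa [abs_le] using hx

lemma card_valMinAbs {r : ℕ} (h : r ≤ L) :
    (Finset.univ.filter fun x : ZMod (2 * L + 1) => |x.valMinAbs| ≤ (r : ℤ)).card = 2 * r + 1 := by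
  refine le_antisymm (card_valMinAbs_le r) ?_
  have : (Finset.Icc (-(r : ℤ)) r).card = 2 * r + 1 := by simp; omega
  rw [← this]
  have key : ∀ y : ℤ, -(r : ℤ) ≤ y → y ≤ r → ((y : ZMod (2 * L + 1))).valMinAbs = y := by
    intro y h1 h2
    refine (ZMod.valMinAbs_spec _ _).2 ⟨rfl, ?_, ?_⟩ <;> push_cast <;> omega
  refine Finset.card_le_card_of_injOn (fun y : ℤ => (y : ZMod (2 * L + 1))) (fun y hy => ?_) ?_
  · simp only [Finset.coe_Icc, mem_Icc] at hy
    simp only [Finset.coe_filter, Finset.mem_univ, true_and, mem_ofPred_eq, key y hy.1 hy.2]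
    exact abs_le.2 hy
  · intro y hy z hz hyz
    simp only [Finset.coe_Icc, mem_Icc] at hy hz
    have := congrArg ZMod.valMinAbs hyz
    simpa [key y hy.1 hy.2, key z hz.1 hz.2] using this

lemma box_eq_piFinset (r : ℕ) : box d L r = Fintype.piFinset fun _ : Fin d =>
    Finset.univ.filter fun x : ZMod (2 * L + 1) => |x.valMinAbs| ≤ (r : ℤ) := by
  ext x; simp [box]

lemma card_box_le (r : ℕ) : (box d L r).card ≤ (2 * r + 1) ^ d := by
  rw [box_eq_piFinset, Fintype.card_piFinset]
  simpa using Nat.pow_le_pow_left (card_valMinAbs_le (L := L) r) d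

lemma card_box {r : ℕ} (h : r ≤ L) : (box d L r).card = (2 * r + 1) ^ d := by
  rw [box_eq_piFinset, Fintype.card_piFinset]
  simp [card_valMinAbs h]

lemma zero_mem_box (r : ℕ) : (0 : Torus d L) ∈ box d L r := by simp [mem_box, supNorm_zero]

lemma card_box_pos (r : ℕ) : 0 < (box d L r).card := Finset.card_pos.2 ⟨0, zero_mem_box r⟩

lemma box_zero : box d L 0 = {0} := by
  ext x
  rw [mem_box, Finset.mem_singleton, Nat.le_zero]
  refine ⟨fun h => ?_, fun h => by rw [h, supNorm_zero]⟩
  ext i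
  have := natAbs_le_supNorm x i
  rw [h, Nat.le_zero, Int.natAbs_eq_zero, ZMod.valMinAbs_eq_zero] at this
  exact this

/-! ### The incident edges -/

/-- The sum of `g` over the edges incident to `x`. -/
def starSum {M : Type*} [AddCommMonoid M] (g : Edge d L → M) (x : Torus d L) : M :=
  ∑ i, (g (x, i) + g (x - Pi.single i 1, i))

lemma sum_shift {M : Type*} [AddCommMonoid M] (g : Torus d L → M) (i : Fin d) :
    ∑ x, g (shift x i) = ∑ x, g x :=
  Fintype.sum_equiv (Equiv.addRight (Pi.single i 1)) _ _ fun _ => rfl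

lemma shift_sub (x : Torus d L) (i : Fin d) : shift (x - Pi.single i 1) i = x := by
  simp [shift]

/-- Double counting of pairs (vertex, incident edge). The incoming half is reindexed by the
translation `shift`, so no lower bound on `L` is needed. -/
lemma sum_mul_starSum {M : Type*} [CommSemiring M] (f : Torus d L → M) (g : Edge d L → M) :
    ∑ x, f x * starSum g x = ∑ e : Edge d L, (f e.1 + f (shift e.1 e.2)) * g e := by
  simp only [starSum, Finset.mul_sum, mul_add, add_mul, Finset.sum_add_distrib,
    Fintype.sum_prod_type]
  congr 1
  rw [Finset.sum_comm, Finset.sum_comm (s := Finset.univ (α := Torus d L))]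
  refine Finset.sum_congr rfl fun i _ => ?_
  refine (sum_shift (fun x => f x * g (x - Pi.single i 1, i)) i).symm.trans ?_
  simp [shift]

lemma isEndpoint_fst (e : Edge d L) : IsEndpoint e.1 e := Or.inl rfl
lemma isEndpoint_shift (e : Edge d L) : IsEndpoint (shift e.1 e.2) e := Or.inr rfl

open Classical in
/-- For `L ≥ 1` the edges incident to `x` are listed exactly once by `starSum`. -/
lemma sum_isEndpoint_eq_starSum {M : Type*} [AddCommMonoid M] (hL : 1 ≤ L)
    (g : Edge d L → M) (x : Torus d L) :
    ∑ e : Edge d L with IsEndpoint x e, g e = starSum g x := by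
  -- There are no loops, since `1 ≠ 0` modulo `2 * L + 1 > 1`. This keeps the outgoing and the
  -- incoming edges at `x` disjoint.
  have hne : ∀ (y : Torus d L) i, shift y i ≠ y := by
    intro y i h
    have h2 : (Pi.single i 1 : Torus d L) = 0 := by simpa [shift] using h
    have h1 := congrFun h2 i
    simp only [Pi.single_eq_same, Pi.zero_apply] at h1
    have : Fact (1 < 2 * L + 1) := ⟨by omega⟩
    exact one_ne_zero h1
  let i1 : Fin d ↪ Edge d L := ⟨fun i => (x, i), fun i j h => (Prod.ext_iff.1 h).2⟩
  let i2 : Fin d ↪ Edge d L :=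
    ⟨fun i => (x - Pi.single i 1, i), fun i j h => (Prod.ext_iff.1 h).2⟩
  have e1 : ∑ e ∈ Finset.univ.map i1, g e = ∑ i, g (x, i) := Finset.sum_map _ _ _
  have e2 : ∑ e ∈ Finset.univ.map i2, g e = ∑ i, g (x - Pi.single i 1, i) :=
    Finset.sum_map _ _ _
  rw [starSum, Finset.sum_add_distrib, ← e1, ← e2, ← Finset.sum_union]
  · refine Finset.sum_congr ?_ fun _ _ => rfl
    ext ⟨y, i⟩
    rw [Finset.mem_filter]
    simp only [Finset.mem_univ, true_and, Finset.mem_union, Finset.mem_map, IsEndpoint]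
    constructor
    · rintro (h | h)
      · exact Or.inl ⟨i, Prod.ext h rfl⟩
      · exact Or.inr ⟨i, Prod.ext (by simp [i2, h, shift]) rfl⟩
    · rintro (⟨j, h⟩ | ⟨j, h⟩)
      · exact Or.inl (congrArg Prod.fst h)
      · have h1 : x - Pi.single j 1 = y := congrArg Prod.fst h
        have h2 : j = i := congrArg Prod.snd h
        exact Or.inr (by rw [← h1, ← h2, shift_sub])
  · rw [Finset.disjoint_left]
    rintro e h1 h2
    simp only [Finset.mem_map, Finset.mem_univ, true_and] at h1 h2
    obtain ⟨j, rfl⟩ := h1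
    obtain ⟨j', h⟩ := h2
    have h3 : x - Pi.single j' 1 = x := congrArg Prod.fst h
    refine hne (x - Pi.single j' 1) j' ?_
    rw [shift_sub]; exact h3.symm

end Geometry

end GradPhi

namespace GradPhi

/-! ### Box averages and their variation with the radius -/

section Averages

variable {d L : ℕ}

/-- The average of `f` over the box of radius `n` centred at `x`. -/
noncomputable def boxAvg (n : ℕ) (f : Torus d L → ℝ) (x : Torus d L) : ℝ :=
  ((box d L n).card : ℝ)⁻¹ * ∑ y ∈ box d L n, f (x + y)

open Classical in
/-- The sum of the absolute increments of `f` over the edges of `U` starting at `y`. -/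
noncomputable def gradIn (U : Finset (Torus d L)) (f : Torus d L → ℝ) (y : Torus d L) : ℝ :=
  ∑ i, if y ∈ U ∧ shift y i ∈ U then |f (shift y i) - f y| else 0

lemma gradIn_nonneg (U : Finset (Torus d L)) (f : Torus d L → ℝ) (y : Torus d L) :
    0 ≤ gradIn U f y :=
  Finset.sum_nonneg fun i _ => by split_ifs <;> positivity

lemma abs_sub_le_gradIn {U : Finset (Torus d L)} (f : Torus d L → ℝ) {y : Torus d L} {i : Fin d}
    (h1 : y ∈ U) (h2 : shift y i ∈ U) : |f (shift y i) - f y| ≤ gradIn U f y := by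
  classical
  refine le_trans (le_of_eq ?_) (Finset.single_le_sum (f := fun i =>
    if y ∈ U ∧ shift y i ∈ U then |f (shift y i) - f y| else 0) (fun i _ => ?_)
    (Finset.mem_univ i))
  · simp [h1, h2]
  · split_ifs <;> positivity

lemma sum_box_translate_le {g : Torus d L → ℝ} (hg : ∀ x, 0 ≤ g x) (x : Torus d L) {z : Torus d L}
    {l n : ℕ} (hz : supNorm z ≤ n) :
    ∑ y ∈ box d L l, g (x + y + z) ≤ ∑ y ∈ box d L (l + n), g (x + y) := by
  have : ∑ y ∈ box d L l, g (x + y + z)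
      = ∑ y ∈ (box d L l).map (Equiv.addRight z).toEmbedding, g (x + y) := by
    simp [Finset.sum_map, add_assoc]
  rw [this]
  refine Finset.sum_le_sum_of_subset_of_nonneg ?_ fun _ _ _ => hg _
  intro y hy
  simp only [Finset.mem_map, Equiv.coe_toEmbedding, Equiv.coe_addRight] at hy
  obtain ⟨u, hu, rfl⟩ := hy
  rw [mem_box] at hu ⊢
  exact (supNorm_add_le _ _).trans (add_le_add hu hz)

/-- One step of a shortest path from `z` to the origin: a nonzero coordinate moves by one towards
zero. The ℓ¹ length drops by one and the supremum norm does not grow, so the path never leaves the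
box of its starting point. -/
lemma exists_step {z : Torus d L} (hz : z ≠ 0) :
    ∃ (z' : Torus d L) (i : Fin d), (z = shift z' i ∨ z' = shift z i) ∧ supNorm z' ≤ supNorm z ∧
      ∑ j, (z' j).valMinAbs.natAbs + 1 = ∑ j, (z j).valMinAbs.natAbs := by
  obtain ⟨i, hi⟩ : ∃ i, z i ≠ 0 := by
    by_contra! h
    exact hz (funext h)
  obtain ⟨ε, hε, hm⟩ : ∃ ε : ℤ, (ε = 1 ∨ ε = -1) ∧
      ((z i).valMinAbs - ε).natAbs + 1 = (z i).valMinAbs.natAbs := by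
    have h0 : (z i).valMinAbs ≠ 0 := fun h => hi ((ZMod.valMinAbs_eq_zero _).1 h)
    rcases lt_or_gt_of_ne h0 with h | h
    · exact ⟨-1, Or.inr rfl, by omega⟩
    · exact ⟨1, Or.inl rfl, by omega⟩
  -- A move towards zero cannot leave the range of representatives, so there is no wrap-around.
  have hval : (z i - (ε : ZMod (2 * L + 1))).valMinAbs = (z i).valMinAbs - ε := by
    have hr := ZMod.valMinAbs_mem_Ioc (z i)
    simp only [mem_Ioc] at hr
    refine (ZMod.valMinAbs_spec _ _).2 ⟨by push_cast [ZMod.coe_valMinAbs]; rfl, ?_, ?_⟩ <;>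
      push_cast at * <;> omega
  refine ⟨Function.update z i (z i - ε), i, ?_, ?_, ?_⟩
  · rcases hε with rfl | rfl
    · left
      ext j
      by_cases hj : j = i
      · subst hj; simp [shift]
      · simp [shift, hj]
    · right
      ext j
      by_cases hj : j = i
      · subst hj; simp [shift]
      · simp [shift, hj]
  · refine supNorm_le_iff.2 fun j => ?_
    by_cases hj : j = i
    · subst hj
      simp only [Function.update_self, hval]
      have := natAbs_le_supNorm z j
      omega
    · simpa [hj] using natAbs_le_supNorm z j
  · rw [← Finset.add_sum_erase _ _ (Finset.mem_univ i),
      ← Finset.add_sum_erase (a := i) _ (fun j => (z j).valMinAbs.natAbs) (Finset.mem_univ i)]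
    have : ∑ j ∈ Finset.univ.erase i, ((Function.update z i (z i - ε)) j).valMinAbs.natAbs
        = ∑ j ∈ Finset.univ.erase i, (z j).valMinAbs.natAbs := by
      refine Finset.sum_congr rfl fun j hj => ?_
      rw [Function.update_of_ne (Finset.ne_of_mem_erase hj)]
    rw [this]
    simp only [Function.update_self, hval]
    omega

/-- A translation by `z` telescopes into as many unit steps as the ℓ¹ length of `z`. Each step costs
at most one sum of increments over the enlarged box, because the path supplied by `exists_step`
stays within distance `n`. -/
lemma sum_abs_translate_le_aux {U : Finset (Torus d L)} (f : Torus d L → ℝ) {x : Torus d L}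
    {l n : ℕ} (hU : ∀ y ∈ box d L (l + n), x + y ∈ U) (N : ℕ) :
    ∀ z : Torus d L, supNorm z ≤ n → ∑ i, (z i).valMinAbs.natAbs ≤ N →
      ∑ y ∈ box d L l, |f (x + y) - f (x + y + z)|
        ≤ N * ∑ y ∈ box d L (l + n), gradIn U f (x + y) := by
  have hS : 0 ≤ ∑ y ∈ box d L (l + n), gradIn U f (x + y) :=
    Finset.sum_nonneg fun _ _ => gradIn_nonneg _ _ _
  induction N with
  | zero =>
    intro z _ h
    have : z = 0 := by
      ext i
      have := Finset.single_le_sum (f := fun i => (z i).valMinAbs.natAbs)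
        (fun i _ => Nat.zero_le _) (Finset.mem_univ i)
      have h0 : (z i).valMinAbs.natAbs = 0 := by omega
      simpa using h0
    simp [this]
  | succ N ih =>
    intro z hz h
    by_cases hz0 : z = 0
    · simp only [hz0, add_zero, sub_self, abs_zero, Finset.sum_const_zero]
      positivity
    obtain ⟨z', i, hs, hz', hsum⟩ := exists_step hz0
    have h1 := ih z' (hz'.trans hz) (by omega)
    have hin : ∀ w : Torus d L, supNorm w ≤ n → ∀ y ∈ box d L l, x + y + w ∈ U := by
      intro w hw y hy
      rw [add_assoc]
      refine hU _ (mem_box.2 ((supNorm_add_le _ _).trans (add_le_add (mem_box.1 hy) hw)))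
    have h2 : ∑ y ∈ box d L l, |f (x + y + z') - f (x + y + z)|
        ≤ ∑ y ∈ box d L (l + n), gradIn U f (x + y) := by
      rcases hs with rfl | rfl
      · refine le_trans (Finset.sum_le_sum fun y hy => ?_)
          (sum_box_translate_le (gradIn_nonneg U f) x (hz'.trans hz))
        have e : x + y + shift z' i = shift (x + y + z') i := by simp [shift, add_assoc]
        have := hin _ hz y hy
        rw [e] at this ⊢
        rw [abs_sub_comm]
        exact abs_sub_le_gradIn f (hin _ (hz'.trans hz) y hy) this
      · refine le_trans (Finset.sum_le_sum fun y hy => ?_)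
          (sum_box_translate_le (gradIn_nonneg U f) x hz)
        have e : x + y + shift z i = shift (x + y + z) i := by simp [shift, add_assoc]
        have := hin _ (hz'.trans hz) y hy
        rw [e] at this ⊢
        exact abs_sub_le_gradIn f (hin _ hz y hy) this
    calc ∑ y ∈ box d L l, |f (x + y) - f (x + y + z)|
        ≤ ∑ y ∈ box d L l, (|f (x + y) - f (x + y + z')| + |f (x + y + z') - f (x + y + z)|) :=
          Finset.sum_le_sum fun y _ => abs_sub_le _ _ _
      _ ≤ N * ∑ y ∈ box d L (l + n), gradIn U f (x + y)
          + ∑ y ∈ box d L (l + n), gradIn U f (x + y) := by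
          rw [Finset.sum_add_distrib]; exact add_le_add h1 h2
      _ = _ := by push_cast; ring

lemma sum_abs_translate_le {U : Finset (Torus d L)} (f : Torus d L → ℝ) {x z : Torus d L}
    {l n : ℕ} (hU : ∀ y ∈ box d L (l + n), x + y ∈ U) (hz : supNorm z ≤ n) :
    ∑ y ∈ box d L l, |f (x + y) - f (x + y + z)|
      ≤ (d * n : ℝ) * ∑ y ∈ box d L (l + n), gradIn U f (x + y) := by
  have := sum_abs_translate_le_aux f hU (d * n) z hz (by
    calc ∑ i, (z i).valMinAbs.natAbs ≤ ∑ _i : Fin d, n :=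
          Finset.sum_le_sum fun i _ => (natAbs_le_supNorm z i).trans hz
      _ = d * n := by simp)
  exact_mod_cast this

/-- Both averages are compared with the double average of `f (x + y + z)` over `y` in the small box
and `z` in the large one. Each comparison is a mean of translation differences. The small
cardinality in the bound is harmless when the two radii are comparable. -/
lemma abs_boxAvg_sub_le {U : Finset (Torus d L)} (f : Torus d L → ℝ) {x : Torus d L}
    {l n : ℕ} (hln : l ≤ n) (hU : ∀ y ∈ box d L (l + n), x + y ∈ U) :
    |boxAvg l f x - boxAvg n f x|
      ≤ 2 * d * n * ((box d L l).card : ℝ)⁻¹ * ∑ y ∈ box d L (l + n), gradIn U f (x + y) := by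
  set a : ℝ := ((box d L l).card : ℝ) with ha
  set b : ℝ := ((box d L n).card : ℝ) with hb
  set S := ∑ y ∈ box d L (l + n), gradIn U f (x + y) with hSd
  have hS : 0 ≤ S := Finset.sum_nonneg fun _ _ => gradIn_nonneg _ _ _
  have ha0 : 0 < a := by rw [ha]; exact_mod_cast card_box_pos l
  have hb0 : 0 < b := by rw [hb]; exact_mod_cast card_box_pos n
  have hab : a ≤ b := by
    rw [ha, hb]
    exact_mod_cast Finset.card_le_card fun y hy => mem_box.2 ((mem_box.1 hy).trans hln)
  have h1 : ∑ z ∈ box d L n, ∑ y ∈ box d L l, |f (x + y) - f (x + y + z)| ≤ b * (d * n * S) := by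
    rw [hb, ← nsmul_eq_mul]
    exact Finset.sum_le_card_nsmul _ _ _ fun z hz => sum_abs_translate_le f hU (mem_box.1 hz)
  have h2 : ∑ y ∈ box d L l, ∑ z ∈ box d L n, |f (x + z) - f (x + z + y)| ≤ a * (d * n * S) := by
    rw [ha, ← nsmul_eq_mul]
    refine Finset.sum_le_card_nsmul _ _ _ fun y hy => ?_
    have hU' : ∀ y ∈ box d L (n + l), x + y ∈ U := by rwa [add_comm n l]
    refine (sum_abs_translate_le f hU' (mem_box.1 hy)).trans ?_
    rw [add_comm n l]
    have : (l : ℝ) ≤ n := by exact_mod_cast hln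
    gcongr
  have e : boxAvg l f x - boxAvg n f x = (a * b)⁻¹ *
      (∑ z ∈ box d L n, ∑ y ∈ box d L l, (f (x + y) - f (x + y + z))
        - ∑ y ∈ box d L l, ∑ z ∈ box d L n, (f (x + z) - f (x + z + y))) := by
    have e1 : ∑ y ∈ box d L l, ∑ z ∈ box d L n, f (x + z + y)
        = ∑ z ∈ box d L n, ∑ y ∈ box d L l, f (x + y + z) := by
      rw [Finset.sum_comm]
      exact Finset.sum_congr rfl fun z _ => Finset.sum_congr rfl fun y _ => by
        rw [add_assoc, add_assoc, add_comm y z]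
    simp only [Finset.sum_sub_distrib, e1, Finset.sum_const, nsmul_eq_mul, ← ha, ← hb]
    simp only [boxAvg, ← ha, ← hb]
    field_simp
    ring
  rw [e, abs_mul, abs_of_pos (inv_pos.2 (mul_pos ha0 hb0))]
  have h3 : |∑ z ∈ box d L n, ∑ y ∈ box d L l, (f (x + y) - f (x + y + z))
        - ∑ y ∈ box d L l, ∑ z ∈ box d L n, (f (x + z) - f (x + z + y))|
      ≤ b * (d * n * S) + a * (d * n * S) := by
    refine (abs_sub _ _).trans (add_le_add (le_trans ?_ h1) (le_trans ?_ h2))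
    · exact (Finset.abs_sum_le_sum_abs _ _).trans
        (Finset.sum_le_sum fun _ _ => Finset.abs_sum_le_sum_abs _ _)
    · exact (Finset.abs_sum_le_sum_abs _ _).trans
        (Finset.sum_le_sum fun _ _ => Finset.abs_sum_le_sum_abs _ _)
  have h4 : b * (d * n * S) + a * (d * n * S) ≤ b * (2 * d * n * S) := by
    have : 0 ≤ (d : ℝ) * n * S := by positivity
    nlinarith
  calc (a * b)⁻¹ * _ ≤ (a * b)⁻¹ * (b * (2 * d * n * S)) := by
        gcongr; exact h3.trans h4
    _ = 2 * d * n * a⁻¹ * S := by field_simp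

end Averages

end GradPhi

namespace GradPhi

/-! ### A local Sobolev inequality, by telescoping over dyadic radii -/

section Sobolev

variable {d L : ℕ}

lemma boxAvg_zero (f : Torus d L → ℝ) (x : Torus d L) : boxAvg 0 f x = f x := by
  simp [boxAvg, box_zero]

lemma boxAvg_nonneg {f : Torus d L → ℝ} (hf : ∀ x, 0 ≤ f x) (n : ℕ) (x : Torus d L) :
    0 ≤ boxAvg n f x :=
  mul_nonneg (by positivity) (Finset.sum_nonneg fun _ _ => hf _)

lemma abs_boxAvg_le (f : Torus d L → ℝ) (n : ℕ) (x : Torus d L) :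
    |boxAvg n f x| ≤ boxAvg n (fun y => |f y|) x := by
  rw [boxAvg, abs_mul, abs_of_nonneg (by positivity : (0 : ℝ) ≤ ((box d L n).card : ℝ)⁻¹)]
  exact mul_le_mul_of_nonneg_left (Finset.abs_sum_le_sum_abs _ _) (by positivity)

lemma boxAvg_eq_zero {f : Torus d L → ℝ} (hf : ∑ x, f x = 0) (x : Torus d L) :
    boxAvg L f x = 0 := by
  rw [boxAvg, box_eq_univ le_rfl, Fintype.sum_equiv (Equiv.addLeft x) (fun y => f (x + y)) f
    (fun _ => rfl), hf, mul_zero]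

lemma sum_boxAvg (f : Torus d L → ℝ) (n : ℕ) : ∑ x, boxAvg n f x = ∑ x, f x := by
  have hc : ((box d L n).card : ℝ) ≠ 0 := by exact_mod_cast (card_box_pos n).ne'
  simp only [boxAvg, ← Finset.mul_sum]
  rw [Finset.sum_comm]
  have : ∀ y ∈ box d L n, ∑ x, f (x + y) = ∑ x, f x := fun y _ =>
    Fintype.sum_equiv (Equiv.addRight y) (fun x => f (x + y)) f (fun _ => rfl)
  rw [Finset.sum_congr rfl this, Finset.sum_const, nsmul_eq_mul, ← mul_assoc,
    inv_mul_cancel₀ hc, one_mul]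

lemma boxAvg_rpow_le {q : ℝ} (hq : 1 ≤ q) {f : Torus d L → ℝ} (hf : ∀ x, 0 ≤ f x) (n : ℕ)
    (x : Torus d L) : boxAvg n f x ^ q ≤ boxAvg n (fun y => f y ^ q) x := by
  have hc : ((box d L n).card : ℝ) ≠ 0 := by exact_mod_cast (card_box_pos n).ne'
  have := Real.rpow_arith_mean_le_arith_mean_rpow (box d L n)
    (fun _ => ((box d L n).card : ℝ)⁻¹) (fun y => f (x + y)) (fun _ _ => by positivity)
    (by simp [hc]) (fun _ _ => hf _) hq
  simpa [boxAvg, Finset.mul_sum] using this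

/-- Averaging over boxes is bounded from `ℓ^q` to `ℓ^s`. -/
lemma lpNorm_boxAvg_le {q s : ℝ} (hq : 1 ≤ q) (hqs : q ≤ s) {f : Torus d L → ℝ}
    (hf : ∀ x, 0 ≤ f x) (n : ℕ) :
    (∑ x, boxAvg n f x ^ s) ^ (1 / s)
      ≤ ((box d L n).card : ℝ) ^ (-(1 / q - 1 / s)) * (∑ x, f x ^ q) ^ (1 / q) := by
  set c : ℝ := ((box d L n).card : ℝ) with hcd
  set T := ∑ x, f x ^ q with hT
  have hc : 0 < c := by rw [hcd]; exact_mod_cast card_box_pos n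
  have hq0 : 0 < q := by linarith
  have hs0 : 0 < s := by linarith
  have hT0 : 0 ≤ T := Finset.sum_nonneg fun x _ => Real.rpow_nonneg (hf x) _
  have hG0 : ∀ x, 0 ≤ boxAvg n (fun y => f y ^ q) x :=
    boxAvg_nonneg (fun x => Real.rpow_nonneg (hf x) _) n
  have hsq : 0 ≤ s / q - 1 := by rw [sub_nonneg, le_div_iff₀ hq0]; linarith
  -- By Jensen the q-th power of the average is at most the average of `f ^ q`, which is at most
  -- `c⁻¹ * T` uniformly. All but one of the `s / q` powers are spent on this uniform bound; the
  -- last one is summed over `x`.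
  have key : ∀ x, boxAvg n f x ^ s
      ≤ (c⁻¹ * T) ^ (s / q - 1) * boxAvg n (fun y => f y ^ q) x := by
    intro x
    have h0 := boxAvg_nonneg hf n x
    have hle : boxAvg n (fun y => f y ^ q) x ≤ c⁻¹ * T := by
      rw [boxAvg, ← hcd]
      gcongr
      rw [hT, ← Fintype.sum_equiv (Equiv.addLeft x) (fun y => f (x + y) ^ q) (fun y => f y ^ q)
        (fun _ => rfl)]
      exact Finset.sum_le_sum_of_subset_of_nonneg (Finset.subset_univ _)
        fun y _ _ => Real.rpow_nonneg (hf _) _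
    calc boxAvg n f x ^ s = (boxAvg n f x ^ q) ^ (s / q) := by
          rw [← Real.rpow_mul h0]; congr 1; field_simp
      _ ≤ (boxAvg n (fun y => f y ^ q) x) ^ (s / q - 1 + 1) := by
          rw [sub_add_cancel]
          exact Real.rpow_le_rpow (Real.rpow_nonneg h0 _) (boxAvg_rpow_le hq hf n x)
            (by positivity)
      _ = (boxAvg n (fun y => f y ^ q) x) ^ (s / q - 1) * boxAvg n (fun y => f y ^ q) x :=
          Real.rpow_add_one' (hG0 x) (by rw [sub_add_cancel]; positivity)
      _ ≤ _ := mul_le_mul_of_nonneg_right (Real.rpow_le_rpow (hG0 x) hle hsq) (hG0 x)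
  have h1 : ∑ x, boxAvg n f x ^ s ≤ (c⁻¹ * T) ^ (s / q - 1) * T := by
    refine (Finset.sum_le_sum fun x _ => key x).trans (le_of_eq ?_)
    rw [← Finset.mul_sum, sum_boxAvg]
  calc (∑ x, boxAvg n f x ^ s) ^ (1 / s) ≤ ((c⁻¹ * T) ^ (s / q - 1) * T) ^ (1 / s) :=
        Real.rpow_le_rpow (Finset.sum_nonneg fun x _ =>
          Real.rpow_nonneg (boxAvg_nonneg hf n x) _) h1 (by positivity)
    _ = c ^ (-(1 / q - 1 / s)) * T ^ (1 / q) := by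
        rcases hT0.eq_or_lt with h | h
        · rw [← h, mul_zero, Real.zero_rpow (by positivity), Real.zero_rpow (by positivity),
            mul_zero]
        · rw [Real.mul_rpow (by positivity) hT0, Real.mul_rpow (by positivity) hT0,
            Real.mul_rpow (by positivity) (by positivity), ← Real.rpow_mul (by positivity),
            ← Real.rpow_mul (by positivity), mul_assoc, ← Real.rpow_add h, ← Real.rpow_neg_one,
            ← Real.rpow_mul hc.le]
          congr 2 <;> field_simp
          ring

/-- The constant in the local Sobolev inequality. -/
noncomputable def sobolevConst (d : ℕ) (η : ℝ) : ℝ := 2 * d * 3 ^ d / (1 - (1 / 2) ^ η)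

lemma one_sub_half_rpow_pos {η : ℝ} (hη : 0 < η) : (0 : ℝ) < 1 - (1 / 2) ^ η :=
  sub_pos.2 (Real.rpow_lt_one (by norm_num) (by norm_num) hη)

lemma sobolevConst_nonneg (d : ℕ) {η : ℝ} (hη : 0 < η) : 0 ≤ sobolevConst d η :=
  div_nonneg (by positivity) (one_sub_half_rpow_pos hη).le

/-- One dyadic scale: passing from radius `n / 2` to `n` costs a factor `n` times a box average of
the gradient, and averaging at scale `n` from ℓ^q to ℓ^s gains `n ^ (-d (1/q - 1/s))`. -/
lemma lpNorm_boxAvg_sub_boxAvg_le {q s : ℝ} (hq : 1 ≤ q) (hqs : q ≤ s)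
    {n : ℕ} (hn : 1 ≤ n) (hnL : n ≤ L) {S U : Finset (Torus d L)}
    (hU : ∀ x ∈ S, ∀ y ∈ box d L (2 * n), x + y ∈ U) (f : Torus d L → ℝ) :
    (∑ x ∈ S, |boxAvg (n / 2) f x - boxAvg n f x| ^ s) ^ (1 / s)
      ≤ 2 * d * 3 ^ d * (n : ℝ) ^ (1 - d * (1 / q - 1 / s))
        * (∑ y, gradIn U f y ^ q) ^ (1 / q) := by
  set l := n / 2 with hl
  have hs0 : 0 < s := by linarith
  have hn0 : (0 : ℝ) < n := by exact_mod_cast hn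
  have hg := gradIn_nonneg U f
  have hT : 0 ≤ (∑ y, gradIn U f y ^ q) ^ (1 / q) :=
    Real.rpow_nonneg (Finset.sum_nonneg fun y _ => Real.rpow_nonneg (hg y) _) _
  have hk : 0 ≤ 1 / q - 1 / s := sub_nonneg.2 (one_div_le_one_div_of_le (by linarith) hqs)
  have hca : (0 : ℝ) < (box d L l).card := by exact_mod_cast card_box_pos l
  have hcb : (0 : ℝ) < (box d L (l + n)).card := by exact_mod_cast card_box_pos (l + n)
  -- With `l = n / 2` rounded down, `n ≤ 2 * l + 1`, hence `2 * (l + n) + 1 ≤ 3 * (2 * l + 1)`.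
  have hratio : ((box d L (l + n)).card : ℝ) ≤ 3 ^ d * (box d L l).card := by
    have h1 := card_box_le (d := d) (L := L) (l + n)
    have h2 : (2 * (l + n) + 1) ^ d ≤ (3 * (2 * l + 1)) ^ d :=
      Nat.pow_le_pow_left (by omega) d
    rw [card_box (by omega : l ≤ L)]
    rw [mul_pow] at h2
    exact_mod_cast h1.trans h2
  have hlow : (n : ℝ) ^ (d : ℝ) ≤ (box d L (l + n)).card := by
    rw [Real.rpow_natCast]
    have h1 : (box d L n).card ≤ (box d L (l + n)).card :=
      Finset.card_le_card fun y hy => mem_box.2 ((mem_box.1 hy).trans (by omega))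
    rw [card_box hnL] at h1
    have h2 : n ^ d ≤ (2 * n + 1) ^ d := Nat.pow_le_pow_left (by omega) d
    exact_mod_cast h2.trans h1
  have hpt : ∀ x ∈ S, |boxAvg l f x - boxAvg n f x|
      ≤ (2 * d * 3 ^ d * n) * boxAvg (l + n) (gradIn U f) x := by
    intro x hx
    have h1 := abs_boxAvg_sub_le (U := U) f (x := x) (l := l) (n := n) (by omega)
      fun y hy => hU x hx y (mem_box.2 ((mem_box.1 hy).trans (by omega)))
    refine h1.trans ?_
    have hsum : ∑ y ∈ box d L (l + n), gradIn U f (x + y)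
        = (box d L (l + n)).card * boxAvg (l + n) (gradIn U f) x := by
      rw [boxAvg, ← mul_assoc, mul_inv_cancel₀ hcb.ne', one_mul]
    rw [hsum]
    have h3 : ((box d L l).card : ℝ)⁻¹ * (box d L (l + n)).card ≤ 3 ^ d := by
      rw [inv_mul_le_iff₀ hca]; linarith
    calc _ = 2 * d * n * (((box d L l).card : ℝ)⁻¹ * (box d L (l + n)).card)
          * boxAvg (l + n) (gradIn U f) x := by ring
      _ ≤ 2 * d * n * 3 ^ d * boxAvg (l + n) (gradIn U f) x := by
          have := boxAvg_nonneg hg (l + n) x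
          gcongr
      _ = _ := by ring
  have hM : (0 : ℝ) ≤ 2 * d * 3 ^ d * n := by positivity
  calc (∑ x ∈ S, |boxAvg l f x - boxAvg n f x| ^ s) ^ (1 / s)
      ≤ (∑ x, ((2 * d * 3 ^ d * n) * boxAvg (l + n) (gradIn U f) x) ^ s) ^ (1 / s) := by
        refine Real.rpow_le_rpow (Finset.sum_nonneg fun x _ => by positivity) ?_ (by positivity)
        refine (Finset.sum_le_sum fun x hx => Real.rpow_le_rpow (abs_nonneg _) (hpt x hx)
          hs0.le).trans ?_
        exact Finset.sum_le_sum_of_subset_of_nonneg (Finset.subset_univ _) fun x _ _ =>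
          Real.rpow_nonneg (mul_nonneg hM (boxAvg_nonneg hg _ _)) _
    _ = (2 * d * 3 ^ d * n) * (∑ x, boxAvg (l + n) (gradIn U f) x ^ s) ^ (1 / s) := by
        simp_rw [Real.mul_rpow hM (boxAvg_nonneg hg _ _)]
        rw [← Finset.mul_sum, Real.mul_rpow (by positivity) (Finset.sum_nonneg fun x _ =>
          Real.rpow_nonneg (boxAvg_nonneg hg _ _) _), ← Real.rpow_mul hM, mul_one_div_cancel hs0.ne',
          Real.rpow_one]
    _ ≤ (2 * d * 3 ^ d * n) * (((box d L (l + n)).card : ℝ) ^ (-(1 / q - 1 / s))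
          * (∑ y, gradIn U f y ^ q) ^ (1 / q)) := by
        gcongr
        exact lpNorm_boxAvg_le hq hqs hg _
    _ ≤ (2 * d * 3 ^ d * n) * (((n : ℝ) ^ (d : ℝ)) ^ (-(1 / q - 1 / s))
          * (∑ y, gradIn U f y ^ q) ^ (1 / q)) := by
        have : ((box d L (l + n)).card : ℝ) ^ (-(1 / q - 1 / s))
            ≤ ((n : ℝ) ^ (d : ℝ)) ^ (-(1 / q - 1 / s)) :=
          Real.rpow_le_rpow_of_nonpos (by positivity) hlow (by linarith)
        gcongr
    _ = _ := by
        rw [← Real.rpow_mul hn0.le, sub_eq_add_neg 1, Real.rpow_add hn0, Real.rpow_one]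
        rw [mul_neg]; ring

/-- A local Sobolev inequality: the distance in `ℓ^s` between a function and its averages over
boxes of radius `n` is controlled by its gradient in `ℓ^q`. -/
theorem lpNorm_sub_boxAvg_le {q s : ℝ} (hq : 1 ≤ q) (hqs : q ≤ s)
    (hη : 0 < 1 - d * (1 / q - 1 / s)) (n : ℕ) (hnL : n ≤ L) {S U : Finset (Torus d L)}
    (hU : ∀ x ∈ S, ∀ y ∈ box d L (2 * n), x + y ∈ U) (f : Torus d L → ℝ) :
    (∑ x ∈ S, |f x - boxAvg n f x| ^ s) ^ (1 / s)
      ≤ sobolevConst d (1 - d * (1 / q - 1 / s)) * (n : ℝ) ^ (1 - d * (1 / q - 1 / s))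
        * (∑ y, gradIn U f y ^ q) ^ (1 / q) := by
  set η := 1 - d * (1 / q - 1 / s) with hηd
  have hs0 : 0 < s := by linarith
  have hT : 0 ≤ (∑ y, gradIn U f y ^ q) ^ (1 / q) :=
    Real.rpow_nonneg (Finset.sum_nonneg fun y _ => Real.rpow_nonneg (gradIn_nonneg _ _ y) _) _
  have hC := sobolevConst_nonneg d hη
  -- Telescoping over the radii n, n/2, n/4, …; at radius 0 the average is the function itself. The
  -- positive exponent makes the costs of the scales a geometric series dominated by the largest
  -- one.
  induction n using Nat.strong_induction_on with
  | _ n ih =>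
    rcases Nat.eq_zero_or_pos n with rfl | hn
    · simp only [boxAvg_zero, sub_self, abs_zero]
      rw [Finset.sum_congr rfl fun _ _ => Real.zero_rpow hs0.ne', Finset.sum_const_zero,
        Real.zero_rpow (by positivity)]
      positivity
    · have h1 := ih (n / 2) (by omega) (by omega) fun x hx y hy =>
        hU x hx y (mem_box.2 ((mem_box.1 hy).trans (by omega)))
      have h2 := lpNorm_boxAvg_sub_boxAvg_le hq hqs hn hnL hU f
      rw [← hηd] at h2
      have h3 := Real.Lp_add_le S (fun x => f x - boxAvg (n / 2) f x)
        (fun x => boxAvg (n / 2) f x - boxAvg n f x) (hq.trans hqs)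
      simp only [sub_add_sub_cancel] at h3
      have h4 : ((n / 2 : ℕ) : ℝ) ^ η ≤ (1 / 2) ^ η * (n : ℝ) ^ η := by
        rw [← Real.mul_rpow (by norm_num) (by positivity)]
        refine Real.rpow_le_rpow (by positivity) ?_ hη.le
        have := Nat.cast_div_le (m := n) (n := 2) (α := ℝ)
        push_cast at this
        linarith
      -- The constant is the sum of the geometric series, so the induction reproduces it exactly.
      have h5 : sobolevConst d η * (1 - (1 / 2) ^ η) = 2 * d * 3 ^ d :=
        div_mul_cancel₀ _ (one_sub_half_rpow_pos hη).ne'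
      calc _ ≤ _ := h3
        _ ≤ sobolevConst d η * ((1 / 2) ^ η * (n : ℝ) ^ η) * (∑ y, gradIn U f y ^ q) ^ (1 / q)
            + 2 * d * 3 ^ d * (n : ℝ) ^ η * (∑ y, gradIn U f y ^ q) ^ (1 / q) := by
            refine add_le_add (h1.trans ?_) h2
            gcongr
        _ = _ := by rw [← h5]; ring

/-- Passage from the gradient to a weighted gradient by Hölder's inequality. -/
lemma lpNorm_gradIn_le {q τ : ℝ} (hq : 1 ≤ q) (hτ : 0 < τ) (hqτ : 1 / q = 1 / 2 + 1 / τ)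
    {U : Finset (Torus d L)} {B : Finset (Edge d L)} (hUB : edgesIn U ⊆ B)
    {w : Edge d L → ℝ} (hw : ∀ e ∈ edgesIn U, 0 < w e) (f : Torus d L → ℝ) :
    (∑ y, gradIn U f y ^ q) ^ (1 / q)
      ≤ d * (∑ e ∈ B, |(w e)⁻¹| ^ τ) ^ (1 / τ)
        * (∑ e ∈ edgesIn U, w e ^ 2 * (f (shift e.1 e.2) - f e.1) ^ 2) ^ (1 / 2 : ℝ) := by
  classical
  have hq0 : 0 < q := by linarith
  have h1 : ∀ y, gradIn U f y ^ q ≤ (d : ℝ) ^ q *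
      ∑ i, if y ∈ U ∧ shift y i ∈ U then |f (shift y i) - f y| ^ q else 0 := by
    intro y
    have := Real.rpow_sum_le_const_mul_sum_rpow Finset.univ
      (fun i => if y ∈ U ∧ shift y i ∈ U then |f (shift y i) - f y| else 0) hq
    have e : ∀ i, |if y ∈ U ∧ shift y i ∈ U then |f (shift y i) - f y| else 0|
        = if y ∈ U ∧ shift y i ∈ U then |f (shift y i) - f y| else 0 := fun i => by
      split_ifs <;> simp
    have e' : ∀ i, (if y ∈ U ∧ shift y i ∈ U then |f (shift y i) - f y| else 0) ^ q
        = if y ∈ U ∧ shift y i ∈ U then |f (shift y i) - f y| ^ q else 0 := fun i => by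
      split_ifs
      · rfl
      · exact Real.zero_rpow hq0.ne'
    simp only [e, e', Finset.card_univ, Fintype.card_fin] at this
    refine this.trans ?_
    rcases Nat.eq_zero_or_pos d with rfl | hd
    · simp
    have hd1 : (1 : ℝ) ≤ d := by exact_mod_cast hd
    refine mul_le_mul_of_nonneg_right (Real.rpow_le_rpow_of_exponent_le hd1 (by linarith)) ?_
    exact Finset.sum_nonneg fun i _ => by split_ifs <;> positivity
  have h2 : ∑ y, gradIn U f y ^ q ≤ (d : ℝ) ^ q *
      ∑ e ∈ edgesIn U, |f (shift e.1 e.2) - f e.1| ^ q := by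
    refine (Finset.sum_le_sum fun y _ => h1 y).trans (le_of_eq ?_)
    rw [← Finset.mul_sum, edgesIn, Finset.sum_filter, Fintype.sum_prod_type]
  have h3 := Real.Lr_rpow_le_Lp_mul_Lq_of_nonneg (p := τ) (q := 2) (r := q) (edgesIn U)
    (f := fun e => |(w e)⁻¹|) (g := fun e => w e * |f (shift e.1 e.2) - f e.1|)
    ⟨by rw [← one_div, ← one_div, ← one_div, hqτ]; ring, hτ, by norm_num⟩
    (fun e _ => abs_nonneg _)
    (fun e he => mul_nonneg (hw e he).le (abs_nonneg _))
  have h4 : ∑ e ∈ edgesIn U, (|(w e)⁻¹| * (w e * |f (shift e.1 e.2) - f e.1|)) ^ q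
      = ∑ e ∈ edgesIn U, |f (shift e.1 e.2) - f e.1| ^ q := by
    refine Finset.sum_congr rfl fun e he => ?_
    have := hw e he
    rw [abs_of_pos (inv_pos.2 this), ← mul_assoc, inv_mul_cancel₀ this.ne', one_mul]
  have h5 : ∑ e ∈ edgesIn U, (w e * |f (shift e.1 e.2) - f e.1|) ^ (2 : ℝ)
      = ∑ e ∈ edgesIn U, w e ^ 2 * (f (shift e.1 e.2) - f e.1) ^ 2 := by
    refine Finset.sum_congr rfl fun e _ => ?_
    rw [show (2 : ℝ) = ((2 : ℕ) : ℝ) by norm_num, Real.rpow_natCast, mul_pow, sq_abs]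
  rw [h4, h5] at h3
  set X := ∑ e ∈ edgesIn U, w e ^ 2 * (f (shift e.1 e.2) - f e.1) ^ 2 with hX
  have hX0 : 0 ≤ X := Finset.sum_nonneg fun e _ => by positivity
  have hB0 : 0 ≤ ∑ e ∈ edgesIn U, |(w e)⁻¹| ^ τ := Finset.sum_nonneg fun e _ => by positivity
  have hB : ∑ e ∈ edgesIn U, |(w e)⁻¹| ^ τ ≤ ∑ e ∈ B, |(w e)⁻¹| ^ τ :=
    Finset.sum_le_sum_of_subset_of_nonneg hUB fun e _ _ => by positivity
  calc (∑ y, gradIn U f y ^ q) ^ (1 / q)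
      ≤ ((d : ℝ) ^ q * ((∑ e ∈ edgesIn U, |(w e)⁻¹| ^ τ) ^ (q / τ) * X ^ (q / 2))) ^ (1 / q) := by
        refine Real.rpow_le_rpow (Finset.sum_nonneg fun y _ =>
          Real.rpow_nonneg (gradIn_nonneg _ _ _) _) (h2.trans ?_) (by positivity)
        gcongr
    _ = d * (∑ e ∈ edgesIn U, |(w e)⁻¹| ^ τ) ^ (1 / τ) * X ^ (1 / 2 : ℝ) := by
        rw [Real.mul_rpow (by positivity) (by positivity),
          Real.mul_rpow (by positivity) (by positivity), ← Real.rpow_mul (by positivity),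
          ← Real.rpow_mul hB0, ← Real.rpow_mul hX0, mul_one_div_cancel hq0.ne', Real.rpow_one,
          ← mul_assoc, show q / τ * (1 / q) = 1 / τ by field_simp,
          show q / 2 * (1 / q) = 1 / 2 by field_simp]
    _ ≤ _ := by gcongr

end Sobolev

end GradPhi

namespace GradPhi

/-! ### Moment interpolation and weighted inequalities on boxes -/

section Nash

variable {d L : ℕ}

/-- The weight `|x|_* = |x| + 1`, with the supremum norm. -/
noncomputable def starNorm (x : Torus d L) : ℝ := supNorm x + 1

lemma one_le_starNorm (x : Torus d L) : 1 ≤ starNorm x := by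
  unfold starNorm; linarith [(Nat.cast_nonneg (supNorm x) : (0 : ℝ) ≤ _)]

lemma starNorm_pos (x : Torus d L) : 0 < starNorm x := one_pos.trans_le (one_le_starNorm x)

lemma one_sub_two_rpow_pos {p : ℝ} (hp : (d : ℝ) < p) : (0 : ℝ) < 1 - 2 ^ ((d : ℝ) - p) :=
  sub_pos.2 (Real.rpow_lt_one_of_one_lt_of_neg (by norm_num) (by linarith))

/-- Recursion by doubling the radius. The annulus between `r` and `2 * r` has at most `(5 * r) ^ d`
points of weight at most `r ^ (-p)`, and the constant sums the geometric series of ratio `2 ^ (d -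
p)`. The recursion stops because nothing lies beyond radius `L`. -/
lemma sum_starNorm_rpow_le {p : ℝ} (hp : (d : ℝ) < p) (r : ℕ) (hr : 1 ≤ r) :
    ∑ x : Torus d L with r ≤ supNorm x, starNorm x ^ (-p)
      ≤ 5 ^ d / (1 - 2 ^ ((d : ℝ) - p)) * (r : ℝ) ^ ((d : ℝ) - p) := by
  have hpos := one_sub_two_rpow_pos hp
  have hp0 : 0 ≤ p := (Nat.cast_nonneg d).trans hp.le
  have hr0 : (0 : ℝ) < r := by exact_mod_cast hr
  set C : ℝ := 5 ^ d / (1 - 2 ^ ((d : ℝ) - p)) with hC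
  by_cases h : L < r
  · rw [Finset.filter_false_of_mem fun x _ => by have := supNorm_le x; omega, Finset.sum_empty]
    positivity
  · have ih := sum_starNorm_rpow_le hp (2 * r) (by omega)
    have hsplit : (Finset.univ.filter fun x : Torus d L => r ≤ supNorm x)
        ⊆ (Finset.univ.filter fun x : Torus d L => r ≤ supNorm x ∧ supNorm x ≤ 2 * r)
          ∪ Finset.univ.filter fun x : Torus d L => 2 * r ≤ supNorm x := by
      intro x
      simp only [Finset.mem_filter, Finset.mem_univ, true_and, Finset.mem_union]
      omega
    have h0 : ∀ x : Torus d L, 0 ≤ starNorm x ^ (-p) := fun x =>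
      Real.rpow_nonneg (starNorm_pos x).le _
    have h1 : ∑ x : Torus d L with r ≤ supNorm x ∧ supNorm x ≤ 2 * r, starNorm x ^ (-p)
        ≤ 5 ^ d * (r : ℝ) ^ ((d : ℝ) - p) := by
      calc _ ≤ ∑ _x : Torus d L with r ≤ supNorm _x ∧ supNorm _x ≤ 2 * r, (r : ℝ) ^ (-p) := by
            refine Finset.sum_le_sum fun x hx => ?_
            simp only [Finset.mem_filter, Finset.mem_univ, true_and] at hx
            refine Real.rpow_le_rpow_of_nonpos hr0 ?_ (by linarith)
            have : (r : ℝ) ≤ supNorm x := by exact_mod_cast hx.1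
            unfold starNorm; linarith
        _ = (Finset.univ.filter fun x : Torus d L => r ≤ supNorm x ∧ supNorm x ≤ 2 * r).card
            * (r : ℝ) ^ (-p) := by rw [Finset.sum_const, nsmul_eq_mul]
        _ ≤ (5 * r : ℝ) ^ d * (r : ℝ) ^ (-p) := by
            have h2 : (Finset.univ.filter fun x : Torus d L =>
                r ≤ supNorm x ∧ supNorm x ≤ 2 * r).card ≤ (5 * r) ^ d := by
              refine le_trans (Finset.card_le_card fun x hx => ?_)
                ((card_box_le (d := d) (L := L) (2 * r)).trans (Nat.pow_le_pow_left (by omega) d))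
              simp only [Finset.mem_filter, Finset.mem_univ, true_and] at hx
              exact mem_box.2 hx.2
            have h3 : ((Finset.univ.filter fun x : Torus d L =>
                r ≤ supNorm x ∧ supNorm x ≤ 2 * r).card : ℝ) ≤ (5 * r : ℝ) ^ d := by
              exact_mod_cast h2
            gcongr
        _ = _ := by
            rw [mul_pow, mul_assoc, ← Real.rpow_natCast (r : ℝ), ← Real.rpow_add hr0]
            rfl
    have h2 : C * ((2 * r : ℕ) : ℝ) ^ ((d : ℝ) - p)
        = C * 2 ^ ((d : ℝ) - p) * (r : ℝ) ^ ((d : ℝ) - p) := by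
      push_cast
      rw [Real.mul_rpow (by norm_num) hr0.le]; ring
    have h3 : C * (1 - 2 ^ ((d : ℝ) - p)) = 5 ^ d := div_mul_cancel₀ _ hpos.ne'
    calc _ ≤ _ := Finset.sum_le_sum_of_subset_of_nonneg hsplit fun x _ _ => h0 x
      _ ≤ _ := le_of_le_of_eq (le_add_of_nonneg_right (Finset.sum_nonneg fun x _ => h0 x))
          Finset.sum_union_inter
      _ ≤ 5 ^ d * (r : ℝ) ^ ((d : ℝ) - p) + C * 2 ^ ((d : ℝ) - p) * (r : ℝ) ^ ((d : ℝ) - p) :=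
          add_le_add h1 (ih.trans h2.le)
      _ = _ := by rw [← h3]; ring
termination_by L + 1 - r

/-- Interpolation of the `ℓ^1` norm between the `ℓ^2` norm and a weighted `ℓ^2` norm. -/
lemma exists_sq_sum_abs_le (d : ℕ) {p : ℝ} (hp : (d : ℝ) < p) : ∃ C : ℝ, 0 < C ∧
    ∀ (L : ℕ) (f : Torus d L → ℝ), 0 < ∑ x, f x ^ 2 →
      (∑ x, |f x|) ^ 2 ≤ C * ((∑ x, f x ^ 2) *
        ((∑ x, starNorm x ^ p * f x ^ 2) / ∑ x, f x ^ 2) ^ ((d : ℝ) / p)) := by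
  have hpos := one_sub_two_rpow_pos hp
  have hd0 : (0 : ℝ) ≤ d := Nat.cast_nonneg d
  have hp0 : 0 < p := hd0.trans_lt hp
  set C0 : ℝ := 5 ^ d / (1 - 2 ^ ((d : ℝ) - p)) with hC0
  have hC0' : 0 < C0 := by positivity
  refine ⟨2 * (3 ^ d + C0 * (1 / 2) ^ ((d : ℝ) - p)), by positivity, fun L f hE => ?_⟩
  set E := ∑ x, f x ^ 2 with hEd
  set N := ∑ x, starNorm x ^ p * f x ^ 2 with hNd
  have hEN : E ≤ N := Finset.sum_le_sum fun x _ =>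
    le_mul_of_one_le_left (sq_nonneg _) (Real.one_le_rpow (one_le_starNorm x) hp0.le)
  -- This radius balances the two regions. Cauchy–Schwarz gives `ρ ^ d * E` inside and `ρ ^ (d - p)
  -- * N` outside, and the two coincide since `N = ρ ^ p * E`.
  set ρ := (N / E) ^ (1 / p) with hρ
  have hρ1 : 1 ≤ ρ := Real.one_le_rpow ((one_le_div hE).2 hEN) (by positivity)
  have hρp : ρ ^ p = N / E := by
    rw [hρ, ← Real.rpow_mul (div_nonneg (hE.le.trans hEN) hE.le), one_div_mul_cancel hp0.ne',
      Real.rpow_one]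
  have hρd : ρ ^ (d : ℝ) = (N / E) ^ ((d : ℝ) / p) := by
    rw [hρ, ← Real.rpow_mul (div_nonneg (hE.le.trans hEN) hE.le)]
    congr 1; ring
  set r := ⌊ρ⌋₊ with hr
  have hr1 : 1 ≤ r := Nat.one_le_floor_iff _ |>.2 hρ1
  have hrρ : (r : ℝ) ≤ ρ := Nat.floor_le (by linarith)
  have hρr : ρ < r + 1 := Nat.lt_floor_add_one ρ
  have hr1' : (1 : ℝ) ≤ r := by exact_mod_cast hr1
  have hsplit : ∑ x, |f x| = ∑ x with r ≤ supNorm x, |f x| + ∑ x with ¬ r ≤ supNorm x, |f x| :=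
    (Finset.sum_filter_add_sum_filter_not _ _ _).symm
  have h1 : (∑ x with ¬ r ≤ supNorm x, |f x|) ^ 2 ≤ 3 ^ d * ρ ^ (d : ℝ) * E := by
    have h := sq_sum_le_card_mul_sum_sq (s := Finset.univ.filter fun x : Torus d L =>
      ¬ r ≤ supNorm x) (f := fun x => |f x|)
    have hc : ((Finset.univ.filter fun x : Torus d L => ¬ r ≤ supNorm x).card : ℝ)
        ≤ 3 ^ d * ρ ^ (d : ℝ) := by
      have h2 : (Finset.univ.filter fun x : Torus d L => ¬ r ≤ supNorm x).card ≤ (3 * r) ^ d := by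
        refine le_trans (Finset.card_le_card fun x hx => ?_)
          ((card_box_le (d := d) (L := L) r).trans (Nat.pow_le_pow_left (by omega) d))
        simp only [Finset.mem_filter, Finset.mem_univ, true_and] at hx
        exact mem_box.2 (by omega)
      calc _ ≤ ((3 * r : ℕ) : ℝ) ^ d := by exact_mod_cast h2
        _ = 3 ^ d * (r : ℝ) ^ d := by push_cast; rw [mul_pow]
        _ ≤ _ := by rw [Real.rpow_natCast]; gcongr
    have hs : ∑ x : Torus d L with ¬ r ≤ supNorm x, |f x| ^ 2 ≤ E := by
      simp only [sq_abs]
      exact Finset.sum_le_sum_of_subset_of_nonneg (Finset.subset_univ _) fun _ _ _ => sq_nonneg _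
    refine h.trans (mul_le_mul hc hs (Finset.sum_nonneg fun _ _ => by positivity) (by positivity))
  have h2 : (∑ x with r ≤ supNorm x, |f x|) ^ 2
      ≤ C0 * (1 / 2) ^ ((d : ℝ) - p) * ρ ^ (d : ℝ) * E := by
    have h := Finset.sum_mul_sq_le_sq_mul_sq (Finset.univ.filter fun x : Torus d L =>
      r ≤ supNorm x) (fun x => starNorm x ^ (-p / 2)) (fun x => starNorm x ^ (p / 2) * |f x|)
    have e1 : ∀ x : Torus d L, starNorm x ^ (-p / 2) * (starNorm x ^ (p / 2) * |f x|) = |f x| := by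
      intro x
      rw [← mul_assoc, ← Real.rpow_add (starNorm_pos x), show -p / 2 + p / 2 = 0 by ring,
        Real.rpow_zero, one_mul]
    have e2 : ∀ x : Torus d L, (starNorm x ^ (-p / 2)) ^ 2 = starNorm x ^ (-p) := by
      intro x
      rw [← Real.rpow_natCast, ← Real.rpow_mul (starNorm_pos x).le]
      congr 1; push_cast; ring
    have e3 : ∀ x : Torus d L, (starNorm x ^ (p / 2) * |f x|) ^ 2 = starNorm x ^ p * f x ^ 2 := by
      intro x
      rw [mul_pow, sq_abs, ← Real.rpow_natCast, ← Real.rpow_mul (starNorm_pos x).le]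
      congr 2; push_cast; ring
    simp only [e1, e2, e3] at h
    have h3 := sum_starNorm_rpow_le (L := L) hp r hr1
    have h4 : ∑ x : Torus d L with r ≤ supNorm x, starNorm x ^ p * f x ^ 2 ≤ N :=
      Finset.sum_le_sum_of_subset_of_nonneg (Finset.subset_univ _) fun x _ _ =>
        mul_nonneg (Real.rpow_nonneg (starNorm_pos x).le _) (sq_nonneg _)
    have h5 : (r : ℝ) ^ ((d : ℝ) - p) ≤ (1 / 2) ^ ((d : ℝ) - p) * ρ ^ ((d : ℝ) - p) := by
      rw [← Real.mul_rpow (by norm_num) (by linarith)]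
      exact Real.rpow_le_rpow_of_nonpos (by positivity) (by linarith) (by linarith)
    have h6 : ρ ^ ((d : ℝ) - p) * N = ρ ^ (d : ℝ) * E := by
      have : N = ρ ^ p * E := by rw [hρp, div_mul_cancel₀ _ hE.ne']
      rw [this, ← mul_assoc, ← Real.rpow_add (by linarith), sub_add_cancel]
    have hN0 : 0 ≤ N := hE.le.trans hEN
    calc _ ≤ _ := h
      _ ≤ (C0 * ((1 / 2) ^ ((d : ℝ) - p) * ρ ^ ((d : ℝ) - p))) * N := by
          refine mul_le_mul (h3.trans ?_) h4 (Finset.sum_nonneg fun x _ =>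
            mul_nonneg (Real.rpow_nonneg (starNorm_pos x).le _) (sq_nonneg _)) (by positivity)
          gcongr
      _ = C0 * (1 / 2) ^ ((d : ℝ) - p) * (ρ ^ ((d : ℝ) - p) * N) := by ring
      _ = _ := by rw [h6]; ring
  rw [hsplit, ← hρd]
  calc _ ≤ 2 * ((∑ x with r ≤ supNorm x, |f x|) ^ 2 + (∑ x with ¬ r ≤ supNorm x, |f x|) ^ 2) :=
        add_sq_le
    _ ≤ 2 * (C0 * (1 / 2) ^ ((d : ℝ) - p) * ρ ^ (d : ℝ) * E + 3 ^ d * ρ ^ (d : ℝ) * E) := by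
        gcongr
    _ = _ := by ring

lemma sum_sq_le_of_lpNorm_le {S : Finset (Torus d L)} {g : Torus d L → ℝ} {Y : ℝ}
    (h : (∑ x ∈ S, |g x| ^ (2 : ℝ)) ^ (1 / 2 : ℝ) ≤ Y) : ∑ x ∈ S, g x ^ 2 ≤ Y ^ 2 := by
  have e : ∑ x ∈ S, |g x| ^ (2 : ℝ) = ∑ x ∈ S, g x ^ 2 := Finset.sum_congr rfl fun x _ => by
    rw [show (2 : ℝ) = ((2 : ℕ) : ℝ) by norm_num, Real.rpow_natCast, sq_abs]
  rw [e] at h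
  have h0 : 0 ≤ ∑ x ∈ S, g x ^ 2 := Finset.sum_nonneg fun x _ => sq_nonneg _
  rw [← Real.sqrt_eq_rpow] at h
  exact (Real.sqrt_le_left ((Real.sqrt_nonneg _).trans h)).1 h

/-- The hypothesis that `w⁻¹` has normalized `L^q` norms at most `m` on all boxes. -/
structure InvNormLE (q : ℝ) (w : Edge d L → ℝ) (m : ℝ) : Prop where
  pos : ∀ e, 0 < w e
  le : ∀ r, 1 ≤ r → r ≤ L →
    (((box d L r).card : ℝ)⁻¹ * ∑ e ∈ edgesIn (box d L r), |(w e)⁻¹| ^ q) ^ (1 / q) ≤ m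

lemma InvNormLE.lpNorm_le {q : ℝ} (hq : 0 < q) {w : Edge d L → ℝ} {m : ℝ} (h : InvNormLE q w m)
    {r : ℕ} (hr : 1 ≤ r) (hrL : r ≤ L) :
    (∑ e ∈ edgesIn (box d L r), |(w e)⁻¹| ^ q) ^ (1 / q)
      ≤ 3 ^ ((d : ℝ) / q) * (r : ℝ) ^ ((d : ℝ) / q) * m := by
  have hc : (0 : ℝ) < (box d L r).card := by exact_mod_cast card_box_pos r
  have hS : 0 ≤ ∑ e ∈ edgesIn (box d L r), |(w e)⁻¹| ^ q :=
    Finset.sum_nonneg fun _ _ => by positivity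
  have h1 := h.le r hr hrL
  have hcr : ((box d L r).card : ℝ) ≤ (3 * r : ℝ) ^ (d : ℝ) := by
    rw [Real.rpow_natCast]
    exact_mod_cast (card_box_le (d := d) (L := L) r).trans (Nat.pow_le_pow_left (by omega) d)
  calc (∑ e ∈ edgesIn (box d L r), |(w e)⁻¹| ^ q) ^ (1 / q)
      = ((box d L r).card : ℝ) ^ (1 / q) *
        (((box d L r).card : ℝ)⁻¹ * ∑ e ∈ edgesIn (box d L r), |(w e)⁻¹| ^ q) ^ (1 / q) := by
        rw [← Real.mul_rpow hc.le (by positivity), ← mul_assoc, mul_inv_cancel₀ hc.ne', one_mul]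
    _ ≤ ((3 * r : ℝ) ^ (d : ℝ)) ^ (1 / q) * m := by gcongr
    _ = _ := by
        rw [← Real.rpow_mul (by positivity), Real.mul_rpow (by norm_num) (by positivity),
          mul_one_div]

/-- The weighted Dirichlet energy. -/
noncomputable def energyW (w : Edge d L → ℝ) (f : Torus d L → ℝ) : ℝ :=
  ∑ e : Edge d L, w e ^ 2 * (f (shift e.1 e.2) - f e.1) ^ 2

lemma energyW_nonneg (w : Edge d L → ℝ) (f : Torus d L → ℝ) : 0 ≤ energyW w f :=
  Finset.sum_nonneg fun _ _ => by positivity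

/-- The local Sobolev inequality with target exponent 2 and source exponent `2 * q / (q + 2)`,
followed by Hölder against the inverse weight. Two scales enter: the averaging radius `n`, and the
observation radius `R`, at which the inverse weight is measured. This produces the two different
powers. -/
lemma exists_sum_sub_boxAvg_sq_le (d : ℕ) (hd : 1 ≤ d) {q : ℝ} (hq : (d : ℝ) < q) (hq2 : 2 ≤ q) :
    ∃ C : ℝ, 0 < C ∧ ∀ (L : ℕ) (w : Edge d L → ℝ) (m : ℝ), InvNormLE q w m →
      ∀ (R n : ℕ), 1 ≤ R → R ≤ L → n ≤ R → ∀ f : Torus d L → ℝ,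
        ∑ x ∈ box d L R, (f x - boxAvg n f x) ^ 2
          ≤ C * ((n : ℝ) ^ (2 - 2 * (d / q)) * (R : ℝ) ^ (2 * (d / q)) * (m ^ 2 * energyW w f)) := by
  have hd0 : (0 : ℝ) < d := by exact_mod_cast hd
  have hq0 : 0 < q := by linarith
  set b := (d : ℝ) / q with hb
  have hb1 : b < 1 := (div_lt_one hq0).2 hq
  set q' := 2 * q / (q + 2) with hq'
  have hq'inv : 1 / q' = 1 / 2 + 1 / q := by rw [hq']; field_simp
  have hq'1 : 1 ≤ q' := by rw [hq', le_div_iff₀ (by linarith)]; linarith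
  have hq'2 : q' ≤ 2 := by rw [hq', div_le_iff₀ (by linarith)]; linarith
  have hη : 1 - (d : ℝ) * (1 / q' - 1 / 2) = 1 - b := by rw [hq'inv, hb]; ring
  have hη0 : 0 < 1 - (d : ℝ) * (1 / q' - 1 / 2) := by rw [hη]; linarith
  have hC := sobolevConst_nonneg d hη0
  rw [hη] at hC
  set K := sobolevConst d (1 - b) with hK
  refine ⟨(K * d * 3 ^ b * 3 ^ b) ^ 2 + 1, by positivity, fun L w m hm R n hR hRL hn f => ?_⟩
  set r := min (3 * R) L with hr
  have hr1 : 1 ≤ r := by omega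
  have hrL : r ≤ L := min_le_right _ _
  have hm0 : 0 ≤ m := le_trans (by positivity) (hm.le r hr1 hrL)
  have hX := energyW_nonneg w f
  have hU : ∀ x ∈ box d L R, ∀ y ∈ box d L (2 * n), x + y ∈ box d L r := by
    intro x hx y hy
    rw [mem_box] at *
    have h1 := supNorm_add_le x y
    have h2 := supNorm_le (x + y)
    omega
  have h1 := lpNorm_sub_boxAvg_le hq'1 hq'2 hη0 n (hn.trans hRL) hU f
  rw [hη] at h1
  have h2 := lpNorm_gradIn_le hq'1 hq0 hq'inv (Finset.Subset.refl (edgesIn (box d L r)))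
    (fun e _ => hm.pos e) f
  have h3 := hm.lpNorm_le hq0 hr1 hrL
  have h4 : (∑ e ∈ edgesIn (box d L r), w e ^ 2 * (f (shift e.1 e.2) - f e.1) ^ 2) ^ (1 / 2 : ℝ)
      ≤ energyW w f ^ (1 / 2 : ℝ) := by
    refine Real.rpow_le_rpow (Finset.sum_nonneg fun _ _ => by positivity) ?_ (by norm_num)
    exact Finset.sum_le_sum_of_subset_of_nonneg (Finset.subset_univ _) fun _ _ _ => by positivity
  have h5 : (r : ℝ) ^ b ≤ 3 ^ b * (R : ℝ) ^ b := by
    rw [← Real.mul_rpow (by norm_num) (by positivity)]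
    refine Real.rpow_le_rpow (by positivity) ?_ (by positivity)
    exact_mod_cast min_le_left _ _
  have h6 := sum_sq_le_of_lpNorm_le h1
  set Xh := energyW w f ^ (1 / 2 : ℝ) with hXh
  have hXsq : Xh ^ 2 = energyW w f := by
    rw [hXh, ← Real.sqrt_eq_rpow, Real.sq_sqrt hX]
  have hXh0 : 0 ≤ Xh := Real.rpow_nonneg hX _
  have hY : K * (n : ℝ) ^ (1 - b) * (∑ y, gradIn (box d L r) f y ^ q') ^ (1 / q')
      ≤ K * (n : ℝ) ^ (1 - b) * (d * (3 ^ b * (3 ^ b * (R : ℝ) ^ b) * m) * Xh) := by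
    gcongr
    refine h2.trans ?_
    gcongr
    refine h3.trans ?_
    gcongr
  refine h6.trans ((pow_le_pow_left₀ (mul_nonneg (by positivity) (Real.rpow_nonneg
    (Finset.sum_nonneg fun y _ => Real.rpow_nonneg (gradIn_nonneg _ _ _) _) _)) hY 2).trans ?_)
  have e1 : ((n : ℝ) ^ (1 - b)) ^ 2 = (n : ℝ) ^ (2 - 2 * b) := by
    rw [← Real.rpow_natCast, ← Real.rpow_mul (by positivity)]; congr 1; push_cast; ring
  have e2 : ((R : ℝ) ^ b) ^ 2 = (R : ℝ) ^ (2 * b) := by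
    rw [← Real.rpow_natCast, ← Real.rpow_mul (by positivity)]; congr 1; push_cast; ring
  calc _ = (K * d * 3 ^ b * 3 ^ b) ^ 2 * (((n : ℝ) ^ (1 - b)) ^ 2 * ((R : ℝ) ^ b) ^ 2
        * (m ^ 2 * Xh ^ 2)) := by ring
    _ = (K * d * 3 ^ b * 3 ^ b) ^ 2 * ((n : ℝ) ^ (2 - 2 * b) * (R : ℝ) ^ (2 * b)
        * (m ^ 2 * energyW w f)) := by rw [e1, e2, hXsq]
    _ ≤ _ := by
        refine mul_le_mul_of_nonneg_right (by linarith) ?_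
        positivity

/-- Poincaré inequality on the torus. -/
lemma exists_poincare (d : ℕ) (hd : 1 ≤ d) {q : ℝ} (hq : (d : ℝ) < q) (hq2 : 2 ≤ q) :
    ∃ C : ℝ, 0 < C ∧ ∀ (L : ℕ) (_ : 1 ≤ L) (w : Edge d L → ℝ) (m : ℝ), InvNormLE q w m →
      ∀ f : Torus d L → ℝ, ∑ x, f x = 0 →
        ∑ x, f x ^ 2 ≤ C * ((L : ℝ) ^ 2 * (m ^ 2 * energyW w f)) := by
  obtain ⟨C, hC, h⟩ := exists_sum_sub_boxAvg_sq_le d hd hq hq2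
  refine ⟨C, hC, fun L hL w m hm f hf => ?_⟩
  -- At radius `L` the box is the whole torus, so the box average is the mean, which vanishes.
  have h1 := h L w m hm L L hL le_rfl le_rfl f
  rw [box_eq_univ le_rfl] at h1
  simp only [boxAvg_eq_zero hf, sub_zero] at h1
  have hL0 : (0 : ℝ) < L := by exact_mod_cast hL
  rwa [← Real.rpow_add hL0, sub_add_cancel, show (2 : ℝ) = ((2 : ℕ) : ℝ) by norm_num,
    Real.rpow_natCast] at h1

/-- Splitting into fluctuation and average: the fluctuation is paid for by the energy, and the box
average by the ℓ¹ norm through the ℓ¹ to ℓ² bound for averages. -/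
lemma exists_sum_box_sq_le (d : ℕ) (hd : 1 ≤ d) {q : ℝ} (hq : (d : ℝ) < q) (hq2 : 2 ≤ q) :
    ∃ C : ℝ, 0 < C ∧ ∀ (L : ℕ) (w : Edge d L → ℝ) (m : ℝ), InvNormLE q w m →
      ∀ (R n : ℕ), 1 ≤ R → R ≤ L → n ≤ R → ∀ f : Torus d L → ℝ,
        ∑ x ∈ box d L R, f x ^ 2
          ≤ C * ((n : ℝ) ^ (2 - 2 * (d / q)) * (R : ℝ) ^ (2 * (d / q)) * (m ^ 2 * energyW w f))
            + C * ((∑ x, |f x|) ^ 2 / ((n : ℝ) + 1) ^ d) := by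
  obtain ⟨C, hC, h⟩ := exists_sum_sub_boxAvg_sq_le d hd hq hq2
  refine ⟨2 * C + 2, by positivity, fun L w m hm R n hR hRL hn f => ?_⟩
  have h1 := h L w m hm R n hR hRL hn f
  have hX := energyW_nonneg w f
  have h2 : ∑ x ∈ box d L R, boxAvg n f x ^ 2 ≤ (∑ x, |f x|) ^ 2 / ((n : ℝ) + 1) ^ d := by
    have h3 := lpNorm_boxAvg_le (q := 1) (s := 2) le_rfl (by norm_num)
      (fun x => abs_nonneg (f x)) n
    have hc : ((n : ℝ) + 1) ^ d ≤ (box d L n).card := by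
      rw [card_box (hn.trans hRL)]; push_cast
      have : (0 : ℝ) ≤ n := by positivity
      gcongr; linarith
    have hc0 : (0 : ℝ) < (box d L n).card := lt_of_lt_of_le (by positivity) hc
    have h4 : (∑ x, |boxAvg n (fun y => |f y|) x| ^ (2 : ℝ)) ^ (1 / 2 : ℝ)
        ≤ ((box d L n).card : ℝ) ^ (-(1 / 1 - 1 / 2) : ℝ) * (∑ x, |f x| ^ (1 : ℝ)) ^ (1 / 1 : ℝ) := by
      simpa only [abs_of_nonneg (boxAvg_nonneg (fun x => abs_nonneg (f x)) n _)] using h3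
    have h5 := sum_sq_le_of_lpNorm_le h4
    simp only [Real.rpow_one, div_one] at h5
    rw [mul_pow, ← Real.rpow_natCast (_ ^ _) 2, ← Real.rpow_mul hc0.le,
      show (-(1 - 1 / 2 : ℝ)) * ((2 : ℕ) : ℝ) = -1 by norm_num, Real.rpow_neg_one,
      inv_mul_eq_div] at h5
    calc _ ≤ ∑ x, boxAvg n (fun y => |f y|) x ^ 2 := by
          refine (Finset.sum_le_sum fun x _ => ?_).trans
            (Finset.sum_le_sum_of_subset_of_nonneg (Finset.subset_univ _) fun _ _ _ => sq_nonneg _)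
          rw [← sq_abs]
          exact pow_le_pow_left₀ (abs_nonneg _) (abs_boxAvg_le f n x) 2
      _ ≤ _ := h5
      _ ≤ _ := by gcongr
  have hF : 0 ≤ (∑ x, |f x|) ^ 2 / ((n : ℝ) + 1) ^ d := by positivity
  have hZ : 0 ≤ (n : ℝ) ^ (2 - 2 * (d / q)) * (R : ℝ) ^ (2 * (d / q)) * (m ^ 2 * energyW w f) := by
    positivity
  calc ∑ x ∈ box d L R, f x ^ 2
      ≤ ∑ x ∈ box d L R, (2 * (f x - boxAvg n f x) ^ 2 + 2 * boxAvg n f x ^ 2) := by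
        refine Finset.sum_le_sum fun x _ => ?_
        nlinarith [sq_nonneg (f x - boxAvg n f x - boxAvg n f x)]
    _ = 2 * ∑ x ∈ box d L R, (f x - boxAvg n f x) ^ 2 + 2 * ∑ x ∈ box d L R, boxAvg n f x ^ 2 := by
        rw [Finset.sum_add_distrib, Finset.mul_sum, Finset.mul_sum]
    _ ≤ _ := by nlinarith

end Nash

end GradPhi

namespace GradPhi

/-! ### The anchored Nash inequality -/

section Nash

variable {d L : ℕ}

set_option maxHeartbeats 1000000 in
/-- Anchored Nash inequality, up to the case where the function is spread over the torus. -/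
lemma exists_nash_dichotomy (d : ℕ) (hd : 1 ≤ d) {p q : ℝ} (hp : (d : ℝ) < p) (hq : (d : ℝ) < q)
    (hq2 : 2 ≤ q) : ∃ C : ℝ, 0 < C ∧ ∀ (L : ℕ) (_ : 1 ≤ L) (w : Edge d L → ℝ) (m : ℝ),
      InvNormLE q w m → ∀ f : Torus d L → ℝ, 0 < ∑ x, f x ^ 2 →
        ∑ x, f x ^ 2 ≤ C * ((∑ x, |f x|) ^ 2 / (2 * L + 1) ^ d) ∨
        ∑ x, f x ^ 2 ≤ C * ((m ^ 2 * energyW w f) *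
          (((∑ x, |f x|) ^ 2 / ∑ x, f x ^ 2) ^ ((2 - 2 * (d / q)) / d) *
          ((∑ x, starNorm x ^ p * f x ^ 2) / ∑ x, f x ^ 2) ^ (2 * (d / q) / p))) := by
  have hd0 : (0 : ℝ) < d := by exact_mod_cast hd
  have hp0 : 0 < p := hd0.trans hp
  have hp1 : 1 ≤ p := le_trans (by exact_mod_cast hd) hp.le
  have hq0 : 0 < q := by linarith
  obtain ⟨C1, hC1, h1⟩ := exists_sum_box_sq_le d hd hq hq2
  obtain ⟨C3, hC3, h3⟩ := exists_sq_sum_abs_le d hp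
  set b := (d : ℝ) / q with hb
  have hb0 : 0 < b := by positivity
  have hb1 : b < 1 := (div_lt_one hq0).2 hq
  set K1 : ℝ := (4 * C1) ^ (1 / (d : ℝ)) with hK1
  set K2 : ℝ := max 4 ((4 * C1 * C3) ^ (1 / (d : ℝ))) with hK2
  have hK24 : 4 ≤ K2 := le_max_left _ _
  set C5 : ℝ := 2 * C1 * (K1 ^ (2 - 2 * b) * K2 ^ (2 * b)) with hC5
  have hC50 : 0 < C5 := by positivity
  refine ⟨4 * C1 * 3 ^ d + C5, by positivity, fun L hL w m hm f hE => ?_⟩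
  set E := ∑ x, f x ^ 2 with hEd
  set F := ∑ x, |f x| with hFd
  set N := ∑ x, starNorm x ^ p * f x ^ 2 with hNd
  have hF0 : 0 ≤ F := Finset.sum_nonneg fun _ _ => abs_nonneg _
  have hEN : E ≤ N := Finset.sum_le_sum fun x _ =>
    le_mul_of_one_le_left (sq_nonneg _) (Real.one_le_rpow (one_le_starNorm x) hp0.le)
  have hN0 : 0 < N := hE.trans_le hEN
  have hZ : 0 ≤ m ^ 2 * energyW w f := mul_nonneg (sq_nonneg _) (energyW_nonneg _ _)
  have hL0 : (1 : ℝ) ≤ L := by exact_mod_cast hL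
  -- The first alternative covers the case in which the averaging scale needed below could exceed
  -- the torus.
  by_cases hcase : E ≤ 4 * C1 * 3 ^ d * (F ^ 2 / (2 * L + 1) ^ d)
  · left
    refine hcase.trans (mul_le_mul_of_nonneg_right (by linarith) (by positivity))
  right
  push Not at hcase
  have hFpos : 0 < F := by
    rcases hF0.eq_or_lt with h | h
    · exfalso
      have : ∀ x, f x = 0 := by
        intro x
        have := (Finset.sum_eq_zero_iff_of_nonneg fun x _ => abs_nonneg (f x)).1 h.symm x
          (Finset.mem_univ x)
        simpa using this
      simp [hEd, this] at hE
    · exact h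
  have hFE : 0 < F ^ 2 / E := by positivity
  have hNE : 1 ≤ N / E := (one_le_div hE).2 hEN
  -- `ρ` is the averaging scale, with `ρ ^ d = 4 * C1 * (F ^ 2 / E)`, so that the ℓ¹ term is at most
  -- `E / 4`. `R0` is the anchoring scale, with `R0 ^ p ≥ 4 * (N / E)`, so that at most `E / 4` of
  -- the energy lies outside the box. Half of the energy is left for the gradient term.
  set ρ : ℝ := K1 * (F ^ 2 / E) ^ (1 / (d : ℝ)) with hρ
  set R0 : ℝ := K2 * (N / E) ^ (1 / p) with hR0
  have hρ0 : 0 < ρ := by positivity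
  have hR04 : 4 ≤ R0 := by
    have : 1 ≤ (N / E) ^ (1 / p) := Real.one_le_rpow hNE (by positivity)
    nlinarith
  have hroot : ∀ y : ℝ, 0 ≤ y → (y ^ (1 / (d : ℝ))) ^ d = y := fun y hy => by
    rw [← Real.rpow_natCast, ← Real.rpow_mul hy, one_div_mul_cancel hd0.ne', Real.rpow_one]
  have hρd : ρ ^ d = 4 * C1 * (F ^ 2 / E) := by
    rw [hρ, mul_pow, hroot _ hFE.le, hK1, hroot _ (by positivity)]
  have hρL : ρ ≤ L := by
    have h : ρ ^ d ≤ (L : ℝ) ^ d := by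
      rw [hρd]
      have h4 : 4 * C1 * 3 ^ d * F ^ 2 < E * (2 * L + 1) ^ d := by
        rw [← mul_div_assoc, div_lt_iff₀ (by positivity)] at hcase
        exact hcase
      have h5 : (2 * L + 1 : ℝ) ^ d ≤ 3 ^ d * (L : ℝ) ^ d := by
        rw [← mul_pow]; gcongr; linarith
      rw [← mul_div_assoc, div_le_iff₀ hE]
      have h6 : 3 ^ d * (4 * C1 * F ^ 2) ≤ 3 ^ d * ((L : ℝ) ^ d * E) := by nlinarith
      exact le_of_mul_le_mul_left h6 (by positivity)
    exact le_of_pow_le_pow_left₀ (by omega) (by positivity) h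
  -- The averaging scale must not exceed the observation scale. This follows from the interpolation
  -- of the ℓ¹ norm and explains the second entry of the maximum `K2`.
  have hρR : ρ ≤ R0 := by
    have h4 := h3 L f hE
    rw [← hEd, ← hFd, ← hNd] at h4
    have h5 : ρ ^ d ≤ R0 ^ d := by
      have e1 : ((N / E) ^ (1 / p)) ^ d = (N / E) ^ ((d : ℝ) / p) := by
        rw [← Real.rpow_natCast, ← Real.rpow_mul (by positivity)]; congr 1; field_simp
      have h6 : 4 * C1 * C3 ≤ K2 ^ d := by
        rw [← hroot (4 * C1 * C3) (by positivity)]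
        exact pow_le_pow_left₀ (by positivity) (le_max_right _ _) d
      rw [hρd, hR0, mul_pow, e1]
      calc 4 * C1 * (F ^ 2 / E) ≤ 4 * C1 * (C3 * (N / E) ^ ((d : ℝ) / p)) := by
            gcongr
            rw [div_le_iff₀ hE]; linarith
        _ = 4 * C1 * C3 * (N / E) ^ ((d : ℝ) / p) := by ring
        _ ≤ _ := by gcongr
    exact le_of_pow_le_pow_left₀ (by omega) (by positivity) h5
  set n := ⌊ρ⌋₊ with hn
  set R := min ⌊R0⌋₊ L with hR
  have hnρ : (n : ℝ) ≤ ρ := Nat.floor_le hρ0.le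
  have hR1 : 1 ≤ R := le_min (Nat.one_le_floor_iff _ |>.2 (by linarith)) hL
  have hnR : n ≤ R := le_min (Nat.floor_le_floor hρR) (Nat.floor_le_of_le hρL)
  have hRR0 : (R : ℝ) ≤ R0 :=
    le_trans (by exact_mod_cast min_le_left _ _) (Nat.floor_le (by linarith))
  have hbox := h1 L w m hm R n hR1 (min_le_right _ _) hnR f
  have hsecond : C1 * (F ^ 2 / ((n : ℝ) + 1) ^ d) ≤ E / 4 := by
    have h4 : ρ ^ d ≤ ((n : ℝ) + 1) ^ d :=
      pow_le_pow_left₀ hρ0.le (Nat.lt_floor_add_one ρ).le d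
    rw [hρd, ← mul_div_assoc, div_le_iff₀ hE] at h4
    rw [← mul_div_assoc, div_le_iff₀ (by positivity)]
    linarith
  have hout : ∑ x with ¬ x ∈ box d L R, f x ^ 2 ≤ E / 4 := by
    by_cases hRL : L ≤ ⌊R0⌋₊
    · have : R = L := min_eq_right hRL
      rw [this, box_eq_univ le_rfl, Finset.filter_false_of_mem (by simp), Finset.sum_empty]
      positivity
    · have hReq : R = ⌊R0⌋₊ := min_eq_left (by omega)
      have hR0p : R0 ^ p = K2 ^ p * (N / E) := by
        rw [hR0, Real.mul_rpow (by positivity) (by positivity), ← Real.rpow_mul (by positivity),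
          one_div_mul_cancel hp0.ne', Real.rpow_one]
      have hK2p : 4 ≤ K2 ^ p := by
        calc (4 : ℝ) ≤ K2 := hK24
          _ = K2 ^ (1 : ℝ) := (Real.rpow_one _).symm
          _ ≤ K2 ^ p := Real.rpow_le_rpow_of_exponent_le (by linarith) hp1
      have h4 : R0 ^ p * ∑ x with ¬ x ∈ box d L R, f x ^ 2 ≤ N := by
        rw [Finset.mul_sum]
        refine le_trans (Finset.sum_le_sum fun x hx => ?_)
          (Finset.sum_le_sum_of_subset_of_nonneg (Finset.subset_univ _) fun x _ _ =>
            mul_nonneg (Real.rpow_nonneg (starNorm_pos x).le _) (sq_nonneg _))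
        simp only [Finset.mem_filter, Finset.mem_univ, true_and, mem_box] at hx
        refine mul_le_mul_of_nonneg_right (Real.rpow_le_rpow (by linarith) ?_ hp0.le) (sq_nonneg _)
        have h5 : (R : ℝ) < supNorm x := by exact_mod_cast not_le.1 hx
        have h6 := Nat.lt_floor_add_one R0
        rw [← hReq] at h6
        unfold starNorm; linarith
      have h7 : 4 * (N / E) ≤ R0 ^ p := by rw [hR0p]; gcongr
      have h0 : 0 ≤ ∑ x with ¬ x ∈ box d L R, f x ^ 2 := Finset.sum_nonneg fun _ _ => sq_nonneg _
      have h8 : 4 * (N / E) * ∑ x with ¬ x ∈ box d L R, f x ^ 2 ≤ N :=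
        (mul_le_mul_of_nonneg_right h7 h0).trans h4
      have h9 : N * (4 * ∑ x with ¬ x ∈ box d L R, f x ^ 2) ≤ N * E := by
        have : 4 * (N / E) * (∑ x with ¬ x ∈ box d L R, f x ^ 2)
          = N * (4 * ∑ x with ¬ x ∈ box d L R, f x ^ 2) / E := by ring
        rw [this, div_le_iff₀ hE] at h8
        exact h8
      have := le_of_mul_le_mul_left h9 hN0
      linarith
  have hsplit : E = ∑ x ∈ box d L R, f x ^ 2 + ∑ x with ¬ x ∈ box d L R, f x ^ 2 := by
    rw [hEd, ← Finset.sum_filter_add_sum_filter_not Finset.univ (fun x => x ∈ box d L R)]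
    congr 2; ext x; simp
  have hmain : E ≤ 2 * C1 * ((n : ℝ) ^ (2 - 2 * b) * (R : ℝ) ^ (2 * b) * (m ^ 2 * energyW w f)) := by
    linarith
  have e1 : ρ ^ (2 - 2 * b) = K1 ^ (2 - 2 * b) * (F ^ 2 / E) ^ ((2 - 2 * b) / d) := by
    rw [hρ, Real.mul_rpow (by positivity) (by positivity), ← Real.rpow_mul hFE.le]
    congr 2; ring
  have e2 : R0 ^ (2 * b) = K2 ^ (2 * b) * (N / E) ^ (2 * b / p) := by
    rw [hR0, Real.mul_rpow (by positivity) (by positivity), ← Real.rpow_mul (by positivity)]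
    congr 2; ring
  have i1 : (n : ℝ) ^ (2 - 2 * b) ≤ ρ ^ (2 - 2 * b) :=
    Real.rpow_le_rpow (by positivity) hnρ (by linarith)
  have i2 : (R : ℝ) ^ (2 * b) ≤ R0 ^ (2 * b) :=
    Real.rpow_le_rpow (by positivity) hRR0 (by positivity)
  calc E ≤ _ := hmain
    _ ≤ 2 * C1 * (ρ ^ (2 - 2 * b) * R0 ^ (2 * b) * (m ^ 2 * energyW w f)) := by gcongr
    _ = C5 * ((m ^ 2 * energyW w f) *
        ((F ^ 2 / E) ^ ((2 - 2 * b) / d) * (N / E) ^ (2 * b / p))) := by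
        rw [e1, e2, hC5]; ring
    _ ≤ _ := by
        refine mul_le_mul_of_nonneg_right (by linarith [show 0 < 4 * C1 * 3 ^ d by positivity]) ?_
        positivity

/-- The relations between the exponents of the anchored Nash inequality. -/
structure NashExponents (d : ℕ) (p q α β γ : ℝ) : Prop where
  pos_α : 0 < α
  pos_β : 0 < β
  pos_γ : 0 < γ
  add_eq : α + β + γ = 1
  β_eq : β = α * ((2 - 2 * (d / q)) / d)
  γ_eq : γ = α * (2 * (d / q) / p)

/-- Homogeneity of the Nash inequality under a change of length scale. It is the identity that makes
the powers of `L`, and later the powers of time, match. -/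
lemma NashExponents.two_mul {p q α β γ : ℝ} (hd : 1 ≤ d) (hp : 0 < p)
    (h : NashExponents d p q α β γ) : 2 * α = d * β + p * γ := by
  have hd0 : (0 : ℝ) < d := by exact_mod_cast hd
  rw [h.β_eq, h.γ_eq]; field_simp; ring

/-- After raising to the power `α`, the factors `1 / E` on the right carry the powers `β` and `γ`.
Multiplication by `E ^ β * E ^ γ` restores `E ^ (α + β + γ) = E` on the left. -/
lemma nash_of_dichotomy {p q α β γ : ℝ} (h : NashExponents d p q α β γ) {E F2 N Z C : ℝ}
    (hE : 0 < E) (hF : 0 ≤ F2) (hN : 0 ≤ N) (hZ : 0 ≤ Z) (hC : 0 < C)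
    (hle : E ≤ C * (Z * ((F2 / E) ^ ((2 - 2 * (d / q)) / d) * (N / E) ^ (2 * (d / q) / p)))) :
    E ≤ C ^ α * (Z ^ α * F2 ^ β * N ^ γ) := by
  have h1 := Real.rpow_le_rpow hE.le hle h.pos_α.le
  rw [Real.mul_rpow hC.le (by positivity), Real.mul_rpow hZ (by positivity),
    Real.mul_rpow (by positivity) (by positivity), ← Real.rpow_mul (by positivity),
    ← Real.rpow_mul (by positivity), mul_comm _ α, mul_comm _ α, ← h.β_eq, ← h.γ_eq,
    Real.div_rpow hF hE.le, Real.div_rpow hN hE.le] at h1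
  have hEβ : 0 < E ^ β := by positivity
  have hEγ : 0 < E ^ γ := by positivity
  calc E = E ^ (α + β + γ) := by rw [h.add_eq, Real.rpow_one]
    _ = E ^ α * (E ^ β * E ^ γ) := by rw [Real.rpow_add hE, Real.rpow_add hE, mul_assoc]
    _ ≤ (C ^ α * (Z ^ α * (F2 ^ β / E ^ β * (N ^ γ / E ^ γ)))) * (E ^ β * E ^ γ) := by gcongr
    _ = _ := by field_simp

/-- Anchored Nash inequality on the torus. -/
theorem exists_nash (d : ℕ) (hd : 1 ≤ d) {p q α β γ : ℝ} (hp : (d : ℝ) < p) (hq : (d : ℝ) < q)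
    (hq2 : 2 ≤ q) (hexp : NashExponents d p q α β γ) :
    ∃ C : ℝ, 0 < C ∧ ∀ (L : ℕ) (_ : 1 ≤ L) (w : Edge d L → ℝ) (m : ℝ),
      InvNormLE q w m → ∀ f : Torus d L → ℝ,
        ∑ x, f x ^ 2 ≤ C * ((∑ x, |f x|) ^ 2 / (2 * L + 1) ^ d) +
          C * ((m ^ 2 * energyW w f) ^ α * ((∑ x, |f x|) ^ 2) ^ β *
            (∑ x, starNorm x ^ p * f x ^ 2) ^ γ) := by
  obtain ⟨C, hC, h⟩ := exists_nash_dichotomy d hd hp hq hq2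
  refine ⟨C + C ^ α, by positivity, fun L hL w m hm f => ?_⟩
  have hN : 0 ≤ ∑ x, starNorm x ^ p * f x ^ 2 := Finset.sum_nonneg fun x _ =>
    mul_nonneg (Real.rpow_nonneg (starNorm_pos x).le _) (sq_nonneg _)
  have hZ : 0 ≤ m ^ 2 * energyW w f := mul_nonneg (sq_nonneg _) (energyW_nonneg _ _)
  have hE0 : 0 ≤ ∑ x, f x ^ 2 := Finset.sum_nonneg fun _ _ => sq_nonneg _
  have hA : 0 ≤ (∑ x, |f x|) ^ 2 / (2 * L + 1) ^ d := by positivity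
  have hB : 0 ≤ (m ^ 2 * energyW w f) ^ α * ((∑ x, |f x|) ^ 2) ^ β *
            (∑ x, starNorm x ^ p * f x ^ 2) ^ γ := by positivity
  have hCα : 0 < C ^ α := by positivity
  rcases hE0.eq_or_lt with hE | hE
  · rw [← hE]; positivity
  rcases h L hL w m hm f hE with h1 | h1
  · refine h1.trans ?_
    nlinarith [mul_nonneg hCα.le hA, mul_nonneg (add_pos hC hCα).le hB]
  · refine (nash_of_dichotomy hexp hE (by positivity) hN hZ hC h1).trans ?_
    nlinarith [mul_nonneg hC.le hB, mul_nonneg (add_pos hC hCα).le hA]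

/-- Nash inequality on the torus for functions of mean zero. -/
theorem exists_nash_of_sum_eq_zero (d : ℕ) (hd : 1 ≤ d) {p q α β γ : ℝ} (hp : (d : ℝ) < p)
    (hq : (d : ℝ) < q) (hq2 : 2 ≤ q) (hexp : NashExponents d p q α β γ) :
    ∃ C : ℝ, 0 < C ∧ ∀ (L : ℕ) (_ : 1 ≤ L) (w : Edge d L → ℝ) (m : ℝ),
      InvNormLE q w m → ∀ f : Torus d L → ℝ, ∑ x, f x = 0 →
        ∑ x, f x ^ 2 ≤ C * ((m ^ 2 * energyW w f) ^ α * ((∑ x, |f x|) ^ 2) ^ β *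
            ((L : ℝ) ^ p * ∑ x, f x ^ 2) ^ γ) := by
  obtain ⟨C, hC, h⟩ := exists_nash_dichotomy d hd hp hq hq2
  obtain ⟨C', hC', h'⟩ := exists_poincare d hd hq hq2
  have hd0 : (0 : ℝ) < d := by exact_mod_cast hd
  have hp0 : 0 < p := hd0.trans hp
  have hα := hexp.pos_α
  have hβ := hexp.pos_β
  have hγ := hexp.pos_γ
  refine ⟨C ^ α * (2 ^ p) ^ γ + C' ^ α * C ^ β, by positivity, fun L hL w m hm f hf => ?_⟩
  have hL0 : (1 : ℝ) ≤ L := by exact_mod_cast hL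
  have hZ : 0 ≤ m ^ 2 * energyW w f := mul_nonneg (sq_nonneg _) (energyW_nonneg _ _)
  have hE0 : 0 ≤ ∑ x, f x ^ 2 := Finset.sum_nonneg fun _ _ => sq_nonneg _
  have hN : ∑ x, starNorm x ^ p * f x ^ 2 ≤ 2 ^ p * ((L : ℝ) ^ p * ∑ x, f x ^ 2) := by
    rw [← mul_assoc, ← Real.mul_rpow (by norm_num) (by linarith), Finset.mul_sum]
    refine Finset.sum_le_sum fun x _ => mul_le_mul_of_nonneg_right ?_ (sq_nonneg _)
    refine Real.rpow_le_rpow (starNorm_pos x).le ?_ hp0.le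
    have : (supNorm x : ℝ) ≤ L := by exact_mod_cast supNorm_le x
    unfold starNorm; linarith
  have hN0 : 0 ≤ ∑ x, starNorm x ^ p * f x ^ 2 := Finset.sum_nonneg fun x _ =>
    mul_nonneg (Real.rpow_nonneg (starNorm_pos x).le _) (sq_nonneg _)
  have hP := h' L hL w m hm f hf
  set Z := m ^ 2 * energyW w f with hZd
  set F2 := (∑ x, |f x|) ^ 2 with hF2
  have hF20 : 0 ≤ F2 := by positivity
  rcases hE0.eq_or_lt with hE | hE
  · rw [← hE]; positivity
  have h1 := h L hL w m hm f hE
  set E := ∑ x, f x ^ 2 with hEd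
  have hB : 0 ≤ Z ^ α * F2 ^ β * ((L : ℝ) ^ p * E) ^ γ := by positivity
  rcases h1 with h1 | h1
  -- When the function is spread over the torus, write `E = E ^ α * E ^ β * E ^ γ`. The first factor
  -- is bounded by Poincaré, the second by the dichotomy, the third is kept; by homogeneity `L ^ (2
  -- * α - d * β)` equals `L ^ (p * γ)`.
  · have h2 : E ≤ C * (F2 * (L : ℝ) ^ (-(d : ℝ))) := by
      refine h1.trans ?_
      rw [Real.rpow_neg (by positivity), Real.rpow_natCast, ← div_eq_mul_inv]
      gcongr
      linarith
    have h3 : E ^ α ≤ C' ^ α * ((L : ℝ) ^ (2 * α) * Z ^ α) := by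
      refine (Real.rpow_le_rpow hE.le hP hα.le).trans (le_of_eq ?_)
      rw [Real.mul_rpow hC'.le (by positivity), Real.mul_rpow (by positivity) hZ,
        ← Real.rpow_natCast (L : ℝ), ← Real.rpow_mul (by positivity)]
      rfl
    have h4 : E ^ β ≤ C ^ β * (F2 ^ β * (L : ℝ) ^ (-(d * β))) := by
      refine (Real.rpow_le_rpow hE.le h2 hβ.le).trans (le_of_eq ?_)
      rw [Real.mul_rpow hC.le (by positivity), Real.mul_rpow hF20 (by positivity),
        ← Real.rpow_mul (by positivity), neg_mul]
    have h5 : (L : ℝ) ^ (2 * α) * (L : ℝ) ^ (-(d * β)) = ((L : ℝ) ^ p) ^ γ := by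
      rw [← Real.rpow_add (by linarith), ← Real.rpow_mul (by positivity),
        hexp.two_mul hd hp0]
      congr 1; ring
    calc E = E ^ (α + β + γ) := by rw [hexp.add_eq, Real.rpow_one]
      _ = E ^ α * E ^ β * E ^ γ := by rw [Real.rpow_add hE, Real.rpow_add hE]
      _ ≤ (C' ^ α * ((L : ℝ) ^ (2 * α) * Z ^ α)) * (C ^ β * (F2 ^ β * (L : ℝ) ^ (-(d * β))))
          * E ^ γ := by gcongr
      _ = C' ^ α * C ^ β * (Z ^ α * F2 ^ β * (((L : ℝ) ^ (2 * α) * (L : ℝ) ^ (-(d * β)))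
          * E ^ γ)) := by ring
      _ = C' ^ α * C ^ β * (Z ^ α * F2 ^ β * ((L : ℝ) ^ p * E) ^ γ) := by
          rw [h5, ← Real.mul_rpow (by positivity) hE.le]
      _ ≤ _ := mul_le_mul_of_nonneg_right
          (by linarith [show 0 < C ^ α * ((2 : ℝ) ^ p) ^ γ by positivity]) hB
  · have h2 := nash_of_dichotomy hexp hE hF20 hN0 hZ hC h1
    calc E ≤ _ := h2
      _ ≤ C ^ α * (Z ^ α * F2 ^ β * (2 ^ p * ((L : ℝ) ^ p * E)) ^ γ) := by gcongr
      _ = C ^ α * (2 ^ p) ^ γ * (Z ^ α * F2 ^ β * ((L : ℝ) ^ p * E) ^ γ) := by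
          have h3 : 0 ≤ (L : ℝ) ^ p * E := mul_nonneg (by positivity) hE.le
          rw [Real.mul_rpow (x := 2 ^ p) (by positivity) h3]; ring
      _ ≤ _ := mul_le_mul_of_nonneg_right
          (by linarith [show 0 < C' ^ α * C ^ β by positivity]) hB

end Nash

end GradPhi

namespace GradPhi

/-! ### A Sobolev inequality weighted by the environment, at one scale -/

section WeightedSobolev

variable {d L : ℕ}

/-- The relations between the exponents used in the weighted Sobolev inequality. -/
structure SobolevExponents (d : ℕ) (q s σ τ η ζ : ℝ) : Prop where
  one_le_q : 1 ≤ q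
  q_le_s : q ≤ s
  two_le_s : 2 < s
  pos_τ : 0 < τ
  σ_eq : 2 / σ + 2 / s = 1
  τ_eq : 1 / q = 1 / 2 + 1 / τ
  η_eq : η = 1 - d * (1 / q - 1 / s)
  ζ_eq : ζ = d * (1 / 2 - 1 / s)
  pos_η : 0 < η

lemma SobolevExponents.two_lt_σ {q s σ τ η ζ : ℝ} (h : SobolevExponents d q s σ τ η ζ) :
    2 < σ := by
  have h1 := h.two_le_s
  have h2 : 0 < 2 / s := by positivity
  have h3 : 2 / s < 1 := (div_lt_one (by linarith)).2 h1
  have h4 : 0 < 2 / σ := by linarith [h.σ_eq]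
  have h5 : 0 < σ := by
    by_contra hc
    exact absurd h4 (not_lt.2 (div_nonpos_of_nonneg_of_nonpos (by norm_num) (not_lt.1 hc)))
  have h6 : 2 / σ < 1 := by linarith [h.σ_eq]
  exact (div_lt_one h5).1 h6

lemma add_rpow_le_two_rpow_mul {t x y : ℝ} (ht : 1 ≤ t) (hx : 0 ≤ x) (hy : 0 ≤ y) :
    (x + y) ^ t ≤ 2 ^ (t - 1) * (x ^ t + y ^ t) := by
  lift x to ℝ≥0 using hx
  lift y to ℝ≥0 using hy
  exact_mod_cast NNReal.rpow_add_le_mul_rpow_add_rpow x y ht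

lemma starSum_rpow_le {t : ℝ} (ht : 1 ≤ t) {a : Edge d L → ℝ} (ha : ∀ e, 0 ≤ a e) (x : Torus d L) :
    starSum a x ^ t ≤ (d : ℝ) ^ (t - 1) * 2 ^ (t - 1) * starSum (fun e => a e ^ t) x := by
  have h1 := Real.rpow_sum_le_const_mul_sum_rpow Finset.univ
    (fun i => a (x, i) + a (x - Pi.single i 1, i)) ht
  simp only [abs_of_nonneg (add_nonneg (ha _) (ha _)), Finset.card_univ, Fintype.card_fin] at h1
  refine h1.trans ?_
  rw [mul_assoc]
  refine mul_le_mul_of_nonneg_left ?_ (by positivity)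
  rw [starSum, Finset.mul_sum]
  exact Finset.sum_le_sum fun i _ => add_rpow_le_two_rpow_mul ht (ha _) (ha _)

lemma starSum_nonneg {a : Edge d L → ℝ} (ha : ∀ e, 0 ≤ a e) (x : Torus d L) : 0 ≤ starSum a x :=
  Finset.sum_nonneg fun _ _ => add_nonneg (ha _) (ha _)

/-- Every edge meeting `S` lies in the box, either because `S` keeps distance one from the
complement or because the box is the torus; each edge is counted at most twice. -/
lemma sum_starSum_le {g : Edge d L → ℝ} (hg : ∀ e, 0 ≤ g e) {S : Finset (Torus d L)} {r : ℕ}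
    (hS : ∀ x ∈ S, supNorm x + 1 ≤ r ∨ L ≤ r) :
    ∑ x ∈ S, starSum g x ≤ 2 * ∑ e ∈ edgesIn (box d L r), g e := by
  classical
  have h1 : ∑ x ∈ S, starSum g x = ∑ x, (if x ∈ S then (1 : ℝ) else 0) * starSum g x := by
    simp [Finset.sum_ite_mem]
  rw [h1, sum_mul_starSum, Finset.mul_sum, edgesIn, Finset.sum_filter]
  refine Finset.sum_le_sum fun e _ => ?_
  have hmem : ∀ x ∈ S, ∀ y, supNorm y ≤ supNorm x + 1 → y ∈ box d L r := by
    intro x hx y hy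
    rcases hS x hx with h | h
    · exact mem_box.2 (hy.trans h)
    · exact mem_box.2 ((supNorm_le y).trans h)
  by_cases h : e.1 ∈ box d L r ∧ shift e.1 e.2 ∈ box d L r
  · rw [if_pos h]
    refine mul_le_mul_of_nonneg_right ?_ (hg e)
    split_ifs <;> norm_num
  · have h2 : e.1 ∉ S := fun hx =>
      h ⟨hmem _ hx _ (by omega), hmem _ hx _ (supNorm_shift_le _ _)⟩
    have h3 : shift e.1 e.2 ∉ S := fun hx =>
      h ⟨hmem _ hx _ (supNorm_le_shift _ _), hmem _ hx _ (by omega)⟩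
    simp [h2, h3, h]

lemma boxAvg_congr {U : Finset (Torus d L)} {f g : Torus d L → ℝ} {n : ℕ} {x : Torus d L}
    (hU : ∀ y ∈ box d L n, x + y ∈ U) (h : ∀ y ∈ U, f y = g y) : boxAvg n f x = boxAvg n g x := by
  unfold boxAvg
  rw [Finset.sum_congr rfl fun y hy => h _ (hU y hy)]

set_option maxHeartbeats 1000000 in
/-- Weighted Sobolev inequality on a set `S` at distance of order `R` from the origin. -/
lemma exists_sum_starSum_mul_sq_le (d : ℕ) {q s σ τ η ζ : ℝ}
    (h : SobolevExponents d q s σ τ η ζ) : ∃ C : ℝ, 0 < C ∧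
      ∀ (L : ℕ) (a w : Edge d L → ℝ) (_ : ∀ e, 0 ≤ a e) (r R n : ℕ) (_ : r ≤ 3 * R) (_ : 1 ≤ R)
        (_ : n ≤ L) (_ : r ≤ L) (M : ℝ) (S U : Finset (Torus d L))
        (_ : ∀ x ∈ S, supNorm x + 1 ≤ r ∨ L ≤ r)
        (_ : U ⊆ box d L r)
        (_ : ∀ x ∈ S, ∀ y ∈ box d L (2 * n), x + y ∈ U)
        (_ : ∀ e ∈ edgesIn (box d L r), 0 < w e)
        (_ : ((((box d L r).card : ℝ)⁻¹ * ∑ e ∈ edgesIn (box d L r), √(a e) ^ σ) ^ (1 / σ)) ^ 2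
          * (1 + ((((box d L r).card : ℝ)⁻¹ *
            ∑ e ∈ edgesIn (box d L r), |(w e)⁻¹| ^ τ) ^ (1 / τ)) ^ 2) ≤ M)
        (v : Torus d L → ℝ),
        ∑ x ∈ S, starSum a x * v x ^ 2 ≤ C * (M * ((R : ℝ) ^ (2 - 2 * η) * (n : ℝ) ^ (2 * η) *
            ∑ e ∈ edgesIn U, w e ^ 2 * (v (shift e.1 e.2) - v e.1) ^ 2
          + (R : ℝ) ^ (2 * ζ) * ((n : ℝ) + 1) ^ (-(2 * ζ)) * ∑ x ∈ U, v x ^ 2)) := by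
  have hq1 := h.one_le_q
  have hqs := h.q_le_s
  have hs2 := h.two_le_s
  have hσ2 := h.two_lt_σ
  have hτ := h.pos_τ
  have hη := h.pos_η
  have hη' : 0 < 1 - (d : ℝ) * (1 / q - 1 / s) := h.η_eq ▸ hη
  have hs0 : 0 < s := by linarith
  have hσ0 : 0 < σ := by linarith
  -- Bookkeeping of volumes: undoing the normalization of the norms of `√a` and of the inverse
  -- weight costs `R ^ (2 * ζ)` and `R ^ (2 * (d / τ))`, whose product is `R ^ (2 - 2 * η)`.
  have hζσ : 2 * ζ = d * (2 / σ) := by rw [h.ζ_eq]; linear_combination (d : ℝ) * h.σ_eq.symm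
  have hsum : ζ + d / τ + η = 1 := by rw [h.ζ_eq, h.η_eq, h.τ_eq]; ring
  have hK0 := sobolevConst_nonneg d hη
  set K := sobolevConst d η with hK
  set c1 : ℝ := ((d : ℝ) ^ (σ / 2 - 1) * 2 ^ (σ / 2 - 1) * 2) ^ (2 / σ) * (9 ^ d : ℝ) ^ (2 / σ)
    with hc1
  set c2 : ℝ := 2 * (K * d * (9 ^ d : ℝ) ^ (1 / τ)) ^ 2 + 2 with hc2
  have hc10 : 0 ≤ c1 := by positivity
  have hc20 : 0 < c2 := by positivity
  refine ⟨c1 * c2 + 1, by positivity, ?_⟩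
  intro L a w ha r R n hr hR hnL hrL M S U hS hUr hU hw hM v
  set A := (((box d L r).card : ℝ)⁻¹ * ∑ e ∈ edgesIn (box d L r), √(a e) ^ σ) ^ (1 / σ) with hA
  set W := (((box d L r).card : ℝ)⁻¹ * ∑ e ∈ edgesIn (box d L r), |(w e)⁻¹| ^ τ) ^ (1 / τ) with hW
  set X := ∑ e ∈ edgesIn U, w e ^ 2 * (v (shift e.1 e.2) - v e.1) ^ 2 with hX
  set Y := ∑ x ∈ U, v x ^ 2 with hY
  have hX0 : 0 ≤ X := Finset.sum_nonneg fun _ _ => by positivity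
  have hY0 : 0 ≤ Y := Finset.sum_nonneg fun _ _ => by positivity
  have hA0 : 0 ≤ A := by positivity
  have hW0 : 0 ≤ W := by positivity
  have hR0 : (1 : ℝ) ≤ R := by exact_mod_cast hR
  have hc : (0 : ℝ) < (box d L r).card := by exact_mod_cast card_box_pos r
  have hcr : ((box d L r).card : ℝ) ≤ 9 ^ d * (R : ℝ) ^ (d : ℝ) := by
    rw [Real.rpow_natCast, ← mul_pow]
    exact_mod_cast (card_box_le (d := d) (L := L) r).trans (Nat.pow_le_pow_left (by omega) d)
  have hEU : edgesIn U ⊆ edgesIn (box d L r) := by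
    intro e he
    simp only [edgesIn, Finset.mem_filter, Finset.mem_univ, true_and] at he ⊢
    exact ⟨hUr he.1, hUr he.2⟩
  -- the factor containing `a`
  have hfa : (∑ x ∈ S, starSum a x ^ (σ / 2)) ^ (1 / (σ / 2)) ≤ c1 * ((R : ℝ) ^ (2 * ζ) * A ^ 2) := by
    have h1 : ∑ x ∈ S, starSum a x ^ (σ / 2) ≤ (d : ℝ) ^ (σ / 2 - 1) * 2 ^ (σ / 2 - 1) *
        (2 * ∑ e ∈ edgesIn (box d L r), √(a e) ^ σ) := by
      calc _ ≤ ∑ x ∈ S, (d : ℝ) ^ (σ / 2 - 1) * 2 ^ (σ / 2 - 1) *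
            starSum (fun e => a e ^ (σ / 2)) x :=
            Finset.sum_le_sum fun x _ => starSum_rpow_le (by linarith) ha x
        _ ≤ _ := by
            rw [← Finset.mul_sum]
            refine mul_le_mul_of_nonneg_left ?_ (by positivity)
            refine (sum_starSum_le (fun e => Real.rpow_nonneg (ha e) _) hS).trans (le_of_eq ?_)
            congr 1
            refine Finset.sum_congr rfl fun e _ => ?_
            rw [Real.sqrt_eq_rpow, ← Real.rpow_mul (ha e)]
            congr 1; ring
    have hT : 0 ≤ ∑ e ∈ edgesIn (box d L r), √(a e) ^ σ :=
      Finset.sum_nonneg fun _ _ => by positivity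
    have h2 : A ^ 2 = (((box d L r).card : ℝ)⁻¹ *
        ∑ e ∈ edgesIn (box d L r), √(a e) ^ σ) ^ (2 / σ) := by
      rw [hA, ← Real.rpow_natCast, ← Real.rpow_mul (by positivity)]
      congr 1; push_cast; ring
    have h3 : (∑ e ∈ edgesIn (box d L r), √(a e) ^ σ) ^ (2 / σ)
        = ((box d L r).card : ℝ) ^ (2 / σ) * A ^ 2 := by
      rw [h2, ← Real.mul_rpow hc.le (by positivity), ← mul_assoc, mul_inv_cancel₀ hc.ne', one_mul]
    have h4 : ((R : ℝ) ^ (d : ℝ)) ^ (2 / σ) = (R : ℝ) ^ (2 * ζ) := by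
      rw [← Real.rpow_mul (by positivity), hζσ]
    rw [show 1 / (σ / 2) = 2 / σ by field_simp]
    calc _ ≤ ((d : ℝ) ^ (σ / 2 - 1) * 2 ^ (σ / 2 - 1) *
        (2 * ∑ e ∈ edgesIn (box d L r), √(a e) ^ σ)) ^ (2 / σ) :=
          Real.rpow_le_rpow (Finset.sum_nonneg fun x _ =>
            Real.rpow_nonneg (starSum_nonneg ha x) _) h1 (by positivity)
      _ = ((d : ℝ) ^ (σ / 2 - 1) * 2 ^ (σ / 2 - 1) * 2) ^ (2 / σ) *
          (((box d L r).card : ℝ) ^ (2 / σ) * A ^ 2) := by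
          rw [← h3, ← Real.mul_rpow (by positivity) hT, mul_assoc]; congr 1; ring
      _ ≤ ((d : ℝ) ^ (σ / 2 - 1) * 2 ^ (σ / 2 - 1) * 2) ^ (2 / σ) *
          ((9 ^ d * (R : ℝ) ^ (d : ℝ)) ^ (2 / σ) * A ^ 2) := by gcongr
      _ = _ := by
          rw [Real.mul_rpow (x := 9 ^ d) (y := (R : ℝ) ^ (d : ℝ)) (by positivity) (by positivity),
            h4, hc1]
          ring
  -- the factor containing `v`
  have hfv : (∑ x ∈ S, |v x| ^ s) ^ (1 / s) ≤
      K * (n : ℝ) ^ η * (d * ((9 ^ d : ℝ) ^ (1 / τ) * (R : ℝ) ^ (d / τ) * W) * X ^ (1 / 2 : ℝ))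
        + ((n : ℝ) + 1) ^ (-ζ) * Y ^ (1 / 2 : ℝ) := by
    have h1 := Real.Lp_add_le S (fun x => v x - boxAvg n v x) (fun x => boxAvg n v x) (p := s)
      (by linarith)
    simp only [sub_add_cancel] at h1
    refine h1.trans (add_le_add ?_ ?_)
    · have h2 := lpNorm_sub_boxAvg_le hq1 hqs hη' n hnL hU v
      rw [← h.η_eq] at h2
      refine h2.trans ?_
      have h3 := lpNorm_gradIn_le hq1 hτ h.τ_eq hEU (fun e he => hw e (hEU he)) v
      have h4 : (∑ e ∈ edgesIn (box d L r), |(w e)⁻¹| ^ τ) ^ (1 / τ)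
          ≤ (9 ^ d : ℝ) ^ (1 / τ) * (R : ℝ) ^ (d / τ) * W := by
        calc _ = ((box d L r).card : ℝ) ^ (1 / τ) * W := by
              rw [hW, ← Real.mul_rpow hc.le (by positivity), ← mul_assoc, mul_inv_cancel₀ hc.ne',
                one_mul]
          _ ≤ (9 ^ d * (R : ℝ) ^ (d : ℝ)) ^ (1 / τ) * W := by gcongr
          _ = _ := by
              rw [Real.mul_rpow (by positivity) (by positivity), ← Real.rpow_mul (by positivity),
                mul_one_div]
      gcongr
      exact h3.trans (by gcongr)
    · classical
      -- Cutting off outside `U` does not change the averages at points of `S`, and makes the global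
      -- averaging bound see only the ℓ² norm on `U`.
      set v' : Torus d L → ℝ := fun x => if x ∈ U then v x else 0 with hv'
      have h2 : ∀ x ∈ S, boxAvg n v x = boxAvg n v' x := fun x hx =>
        boxAvg_congr (fun y hy => hU x hx y (mem_box.2 ((mem_box.1 hy).trans (by omega))))
          fun y hy => by simp [hv', hy]
      have h3 := lpNorm_boxAvg_le (q := 2) (s := s) (by norm_num) hs2.le
        (fun x => abs_nonneg (v' x)) n
      have h4 : ∑ x, |v' x| ^ (2 : ℝ) = Y := by
        have : ∀ x, |v' x| ^ (2 : ℝ) = if x ∈ U then v x ^ 2 else 0 := by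
          intro x
          rw [show (2 : ℝ) = ((2 : ℕ) : ℝ) by norm_num, Real.rpow_natCast, sq_abs, hv']
          dsimp only
          split_ifs <;> simp
        simp [this, Finset.sum_ite_mem, hY]
      have h5 : ((box d L n).card : ℝ) ^ (-(1 / 2 - 1 / s)) ≤ ((n : ℝ) + 1) ^ (-ζ) := by
        have h6 : ((n : ℝ) + 1) ^ (d : ℝ) ≤ (box d L n).card := by
          rw [card_box hnL, Real.rpow_natCast]; push_cast
          have : (0 : ℝ) ≤ n := by positivity
          gcongr; linarith
        have h7 : 0 ≤ 1 / 2 - 1 / s := sub_nonneg.2 (one_div_le_one_div_of_le (by norm_num) hs2.le)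
        refine (Real.rpow_le_rpow_of_nonpos (by positivity) h6 (by linarith)).trans (le_of_eq ?_)
        rw [← Real.rpow_mul (by positivity), h.ζ_eq]
        congr 1; ring
      rw [h4] at h3
      refine le_trans ?_ (h3.trans (by gcongr))
      refine Real.rpow_le_rpow (Finset.sum_nonneg fun _ _ => by positivity) ?_ (by positivity)
      refine (Finset.sum_le_sum fun x hx => ?_).trans
        (Finset.sum_le_sum_of_subset_of_nonneg (Finset.subset_univ S) fun x _ _ =>
          Real.rpow_nonneg (boxAvg_nonneg (fun x => abs_nonneg (v' x)) _ _) _)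
      rw [h2 x hx]
      exact Real.rpow_le_rpow (abs_nonneg _) (abs_boxAvg_le _ _ _) hs0.le
  -- combination by Hölder's inequality
  have hhol := Real.inner_le_Lp_mul_Lq_of_nonneg S (p := σ / 2) (q := s / 2)
    (f := fun x => starSum a x) (g := fun x => v x ^ 2)
    (Real.holderConjugate_iff.2 ⟨by linarith, by rw [inv_div, inv_div]; exact h.σ_eq⟩)
    (fun x _ => starSum_nonneg ha x) (fun x _ => sq_nonneg _)
  have hv2 : (∑ x ∈ S, (v x ^ 2) ^ (s / 2)) ^ (1 / (s / 2))
      = ((∑ x ∈ S, |v x| ^ s) ^ (1 / s)) ^ 2 := by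
    have : ∀ x, (v x ^ 2) ^ (s / 2) = |v x| ^ s := by
      intro x
      rw [← sq_abs, ← Real.rpow_natCast, ← Real.rpow_mul (abs_nonneg _)]
      congr 1; push_cast; ring
    simp only [this]
    rw [← Real.rpow_natCast, ← Real.rpow_mul (Finset.sum_nonneg fun _ _ => by positivity)]
    congr 1; push_cast; field_simp
  rw [hv2] at hhol
  have hn1 : (0 : ℝ) < (n : ℝ) + 1 := by positivity
  have hXs : (X ^ (1 / 2 : ℝ)) ^ 2 = X := by rw [← Real.sqrt_eq_rpow, Real.sq_sqrt hX0]
  have hYs : (Y ^ (1 / 2 : ℝ)) ^ 2 = Y := by rw [← Real.sqrt_eq_rpow, Real.sq_sqrt hY0]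
  have e1 : ((n : ℝ) ^ η) ^ 2 = (n : ℝ) ^ (2 * η) := by
    rw [← Real.rpow_natCast, ← Real.rpow_mul (by positivity)]; congr 1; push_cast; ring
  have e2 : ((R : ℝ) ^ (d / τ)) ^ 2 = (R : ℝ) ^ (2 * (d / τ)) := by
    rw [← Real.rpow_natCast, ← Real.rpow_mul (by positivity)]; congr 1; push_cast; ring
  have e3 : (((n : ℝ) + 1) ^ (-ζ)) ^ 2 = ((n : ℝ) + 1) ^ (-(2 * ζ)) := by
    rw [← Real.rpow_natCast, ← Real.rpow_mul hn1.le]; congr 1; push_cast; ring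
  have e4 : (R : ℝ) ^ (2 * ζ) * (R : ℝ) ^ (2 * (d / τ)) = (R : ℝ) ^ (2 - 2 * η) := by
    rw [← Real.rpow_add (by linarith)]; congr 1; linarith
  have hv3 : ((∑ x ∈ S, |v x| ^ s) ^ (1 / s)) ^ 2 ≤
      c2 * (W ^ 2 * ((n : ℝ) ^ (2 * η) * (R : ℝ) ^ (2 * (d / τ)) * X)
        + ((n : ℝ) + 1) ^ (-(2 * ζ)) * Y) := by
    refine (pow_le_pow_left₀ (by positivity) hfv 2).trans (add_sq_le.trans ?_)
    have e5 : (K * (n : ℝ) ^ η * (d * ((9 ^ d : ℝ) ^ (1 / τ) * (R : ℝ) ^ (d / τ) * W)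
        * X ^ (1 / 2 : ℝ))) ^ 2
        = (K * d * (9 ^ d : ℝ) ^ (1 / τ)) ^ 2 * (W ^ 2 * (((n : ℝ) ^ η) ^ 2 *
          ((R : ℝ) ^ (d / τ)) ^ 2 * (X ^ (1 / 2 : ℝ)) ^ 2)) := by ring
    have e6 : (((n : ℝ) + 1) ^ (-ζ) * Y ^ (1 / 2 : ℝ)) ^ 2
        = (((n : ℝ) + 1) ^ (-ζ)) ^ 2 * (Y ^ (1 / 2 : ℝ)) ^ 2 := mul_pow _ _ _
    rw [e5, e6, e1, e2, e3, hXs, hYs]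
    have i1 : 0 ≤ W ^ 2 * ((n : ℝ) ^ (2 * η) * (R : ℝ) ^ (2 * (d / τ)) * X) := by positivity
    have i2 : 0 ≤ ((n : ℝ) + 1) ^ (-(2 * ζ)) * Y := by positivity
    have i3 : ∀ u y z : ℝ, 0 ≤ u → 0 ≤ y → 0 ≤ z → 2 * (u * y + z) ≤ (2 * u + 2) * (y + z) := by
      intro u y z hu hy hz
      linarith [mul_nonneg hu hz, (by ring : (2 * u + 2) * (y + z)
        = 2 * (u * y) + 2 * (u * z) + 2 * y + 2 * z)]
    exact i3 _ _ _ (sq_nonneg _) i1 i2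
  have hM1 : A ^ 2 * W ^ 2 ≤ M := by nlinarith [sq_nonneg A]
  have hM2 : A ^ 2 ≤ M := by nlinarith [mul_nonneg (sq_nonneg A) (sq_nonneg W)]
  have hM0 : 0 ≤ M := (sq_nonneg A).trans hM2
  have i1 : 0 ≤ (R : ℝ) ^ (2 - 2 * η) * (n : ℝ) ^ (2 * η) * X := by positivity
  have i2 : 0 ≤ (R : ℝ) ^ (2 * ζ) * ((n : ℝ) + 1) ^ (-(2 * ζ)) * Y := by positivity
  calc _ ≤ _ := hhol
    _ ≤ (c1 * ((R : ℝ) ^ (2 * ζ) * A ^ 2)) *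
        (c2 * (W ^ 2 * ((n : ℝ) ^ (2 * η) * (R : ℝ) ^ (2 * (d / τ)) * X)
        + ((n : ℝ) + 1) ^ (-(2 * ζ)) * Y)) :=
        mul_le_mul hfa hv3 (by positivity) (by positivity)
    _ = c1 * c2 * (A ^ 2 * W ^ 2 * (((R : ℝ) ^ (2 * ζ) * (R : ℝ) ^ (2 * (d / τ))) *
          (n : ℝ) ^ (2 * η) * X) +
          A ^ 2 * ((R : ℝ) ^ (2 * ζ) * ((n : ℝ) + 1) ^ (-(2 * ζ)) * Y)) := by ring
    _ ≤ c1 * c2 * (M * ((R : ℝ) ^ (2 - 2 * η) * (n : ℝ) ^ (2 * η) * X) +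
          M * ((R : ℝ) ^ (2 * ζ) * ((n : ℝ) + 1) ^ (-(2 * ζ)) * Y)) := by
        rw [e4]; gcongr
    _ ≤ _ := by
        rw [← mul_add]
        refine mul_le_mul_of_nonneg_right (by linarith) (by positivity)

end WeightedSobolev

end GradPhi

namespace GradPhi

/-! ### Summation of the weighted Sobolev inequality over dyadic shells -/

section WeightedSobolev

variable {d L : ℕ}

/-- The dyadic shell `2^k ≤ |x| + 1 < 2^{k+1}`. -/
def shell (d L k : ℕ) : Finset (Torus d L) :=
  Finset.univ.filter fun x => Nat.log 2 (supNorm x + 1) = k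

/-- A neighbourhood of the dyadic shell. -/
def fatShell (d L k : ℕ) : Finset (Torus d L) :=
  Finset.univ.filter fun x => 2 ^ k ≤ 2 * (supNorm x + 1) ∧ supNorm x + 1 ≤ 3 * 2 ^ k

lemma mem_shell {k : ℕ} {x : Torus d L} :
    x ∈ shell d L k ↔ 2 ^ k ≤ supNorm x + 1 ∧ supNorm x + 1 < 2 ^ (k + 1) := by
  rw [shell, Finset.mem_filter, Nat.log_eq_iff (Or.inr ⟨by norm_num, by omega⟩)]
  simp

/-- Bounded overlap: `k` differs by at most one from the binary logarithm of `|x| + 1`, so each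
point lies in at most three fat shells. -/
lemma sum_fatShell_le {ι : Type*} (s : Finset ι) (x : ι → Torus d L) {g : ι → ℝ}
    (hg : ∀ i ∈ s, 0 ≤ g i) (n : ℕ) :
    ∑ k ∈ Finset.range n, ∑ i ∈ s with x i ∈ fatShell d L k, g i ≤ 3 * ∑ i ∈ s, g i := by
  simp only [Finset.sum_filter]
  rw [Finset.sum_comm, Finset.mul_sum]
  refine Finset.sum_le_sum fun i hi => ?_
  rw [← Finset.sum_filter, Finset.sum_const, nsmul_eq_mul]
  refine mul_le_mul_of_nonneg_right ?_ (hg i hi)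
  have h : ((Finset.range n).filter fun k => x i ∈ fatShell d L k)
      ⊆ Finset.Icc (Nat.log 2 (supNorm (x i) + 1) - 1) (Nat.log 2 (supNorm (x i) + 1) + 1) := by
    intro k hk
    simp only [Finset.mem_filter, fatShell, Finset.mem_univ, true_and] at hk
    obtain ⟨-, h1, h2⟩ := hk
    set N := supNorm (x i) + 1 with hN
    have h3 : 2 ^ Nat.log 2 N ≤ N := Nat.pow_log_le_self 2 (by omega)
    have h4 : N < 2 ^ (Nat.log 2 N + 1) := Nat.lt_pow_succ_log_self (by norm_num) _
    have h5 : Nat.log 2 N < k + 2 := by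
      refine (Nat.pow_lt_pow_iff_right (a := 2) (by norm_num)).1 ?_
      have : 2 ^ (k + 2) = 4 * 2 ^ k := by ring
      have := Nat.pos_of_ne_zero (pow_ne_zero k (two_ne_zero : (2 : ℕ) ≠ 0))
      omega
    have h6 : k < Nat.log 2 N + 2 := by
      refine (Nat.pow_lt_pow_iff_right (a := 2) (by norm_num)).1 ?_
      have : 2 ^ (Nat.log 2 N + 2) = 2 * 2 ^ (Nat.log 2 N + 1) := by ring
      omega
    rw [Finset.mem_Icc]; omega
  have h2 := Finset.card_le_card h
  rw [Nat.card_Icc] at h2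
  have h3 : ((Finset.range n).filter fun k => x i ∈ fatShell d L k).card ≤ 3 := by omega
  exact_mod_cast h3

/-- The hypothesis that the products of the norms of `√a` and `w⁻¹` over all boxes are at
most `M`. -/
structure ProdNormLE (σ τ : ℝ) (a w : Edge d L → ℝ) (M : ℝ) : Prop where
  nonneg : ∀ e, 0 ≤ a e
  pos : ∀ e, 0 < w e
  one_le : 1 ≤ M
  le : ∀ r, r ≤ L →
    ((((box d L r).card : ℝ)⁻¹ * ∑ e ∈ edgesIn (box d L r), √(a e) ^ σ) ^ (1 / σ)) ^ 2
      * (1 + ((((box d L r).card : ℝ)⁻¹ *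
        ∑ e ∈ edgesIn (box d L r), |(w e)⁻¹| ^ τ) ^ (1 / τ)) ^ 2) ≤ M

/-- The averaging radius is a small fraction of the shell radius. A smaller fraction reduces the
gradient term and enlarges the term without gradient; optimizing produces the power `1 + ζ / η` of
`M`. -/
lemma exists_sum_shell_le (d : ℕ) {q s σ τ η ζ : ℝ} (h : SobolevExponents d q s σ τ η ζ) :
    ∃ C : ℝ, 0 < C ∧ ∀ ε : ℝ, 0 < ε → ε ≤ 1 → ∀ (L : ℕ) (_ : 1 ≤ L) (a w : Edge d L → ℝ) (M : ℝ),
      ProdNormLE σ τ a w M → ∀ (k : ℕ) (v : Torus d L → ℝ),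
        ∑ x ∈ shell d L k, starSum a x * v x ^ 2 ≤ C * (ε * (((2 ^ k : ℕ) : ℝ) ^ (2 : ℝ) *
            ∑ e ∈ edgesIn (fatShell d L k), w e ^ 2 * (v (shift e.1 e.2) - v e.1) ^ 2)
          + 4 ^ (2 * ζ) * ε⁻¹ ^ (ζ / η) * (M ^ (1 + ζ / η) * ∑ x ∈ fatShell d L k, v x ^ 2)) := by
  obtain ⟨C, hC, hmain⟩ := exists_sum_starSum_mul_sq_le d h
  have hη := h.pos_η
  have hζ : 0 ≤ ζ := by
    rw [h.ζ_eq]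
    refine mul_nonneg (Nat.cast_nonneg _) (sub_nonneg.2 ?_)
    exact one_div_le_one_div_of_le (by norm_num) h.two_le_s.le
  refine ⟨C, hC, fun ε hε hε1 L hL a w M hM k v => ?_⟩
  set R := 2 ^ k with hR
  have hR1 : 1 ≤ R := Nat.one_le_two_pow
  have hR1' : (1 : ℝ) ≤ R := by exact_mod_cast hR1
  have hM1 := hM.one_le
  have hX0 : 0 ≤ ∑ e ∈ edgesIn (fatShell d L k), w e ^ 2 * (v (shift e.1 e.2) - v e.1) ^ 2 :=
    Finset.sum_nonneg fun _ _ => by positivity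
  have hY0 : 0 ≤ ∑ x ∈ fatShell d L k, v x ^ 2 := Finset.sum_nonneg fun _ _ => by positivity
  -- A nonempty shell forces `2 ^ k ≤ L + 1`, which keeps the averaging radius below `L`.
  rcases (shell d L k).eq_empty_or_nonempty with hS | ⟨x0, hx0⟩
  · rw [hS, Finset.sum_empty]; positivity
  have hRL : R ≤ L + 1 := (mem_shell.1 hx0).1.trans (by have := supNorm_le x0; omega)
  -- The power makes `M * κ ^ (2 * η) ≤ ε`. The division by 4 keeps the `2 * n`-neighbourhood of the
  -- shell inside the fat shell.
  set κ : ℝ := (ε / M) ^ (1 / (2 * η)) / 4 with hκ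
  have hεM : ε / M ≤ 1 := (div_le_one (by linarith)).2 (by linarith)
  have hεM0 : 0 < ε / M := by positivity
  have hκ0 : 0 < κ := by positivity
  have hκ4 : κ ≤ 1 / 4 := by
    rw [hκ]
    have : (ε / M) ^ (1 / (2 * η)) ≤ 1 := Real.rpow_le_one hεM0.le hεM (by positivity)
    linarith
  set n := ⌊κ * R⌋₊ with hn
  have hnκ : (n : ℝ) ≤ κ * R := Nat.floor_le (by positivity)
  have hnκ' : κ * R ≤ (n : ℝ) + 1 := (Nat.lt_floor_add_one _).le
  have hnR : 4 * n ≤ R := by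
    have : (4 * n : ℝ) ≤ R := by nlinarith
    exact_mod_cast this
  have hmem : ∀ x ∈ shell d L k, ∀ y ∈ box d L (2 * n), x + y ∈ fatShell d L k := by
    intro x hx y hy
    have h1 := mem_shell.1 hx
    rw [pow_succ] at h1
    have h2 := mem_box.1 hy
    have h3 := supNorm_add_le x y
    have h4 := supNorm_le_add x y
    simp only [fatShell, Finset.mem_filter, Finset.mem_univ, true_and]
    omega
  have hfat : fatShell d L k ⊆ box d L (min (3 * R) L) := by
    intro x hx
    simp only [fatShell, Finset.mem_filter, Finset.mem_univ, true_and] at hx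
    rw [mem_box]
    exact le_min (by omega) (supNorm_le x)
  have hb := hmain L a w hM.nonneg (min (3 * R) L) R n (min_le_left _ _) hR1 (by omega)
    (min_le_right _ _) M (shell d L k) (fatShell d L k)
    (fun x hx => by have := mem_shell.1 hx; rw [pow_succ] at this; omega) hfat hmem
    (fun e _ => hM.pos e) (hM.le _ (min_le_right _ _)) v
  refine hb.trans (mul_le_mul_of_nonneg_left ?_ hC.le)
  set X := ∑ e ∈ edgesIn (fatShell d L k), w e ^ 2 * (v (shift e.1 e.2) - v e.1) ^ 2
  set Y := ∑ x ∈ fatShell d L k, v x ^ 2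
  have hM0 : 0 < M := by linarith
  have e1 : M * ((R : ℝ) ^ (2 - 2 * η) * (n : ℝ) ^ (2 * η)) ≤ ε * (R : ℝ) ^ (2 : ℝ) := by
    have h1 : (n : ℝ) ^ (2 * η) ≤ κ ^ (2 * η) * (R : ℝ) ^ (2 * η) := by
      rw [← Real.mul_rpow hκ0.le (by positivity)]
      exact Real.rpow_le_rpow (by positivity) hnκ (by positivity)
    have h2 : κ ^ (2 * η) ≤ ε / M := by
      rw [hκ, Real.div_rpow (by positivity) (by norm_num), ← Real.rpow_mul hεM0.le,
        one_div_mul_cancel (by positivity), Real.rpow_one]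
      exact div_le_self hεM0.le (Real.one_le_rpow (by norm_num) (by positivity))
    calc _ ≤ M * ((R : ℝ) ^ (2 - 2 * η) * ((ε / M) * (R : ℝ) ^ (2 * η))) := by
          gcongr
          exact h1.trans (by gcongr)
      _ = (M * (ε / M)) * ((R : ℝ) ^ (2 - 2 * η) * (R : ℝ) ^ (2 * η)) := by ring
      _ = _ := by
          rw [mul_div_cancel₀ _ hM0.ne', ← Real.rpow_add (by linarith), sub_add_cancel]
  have e2 : M * ((R : ℝ) ^ (2 * ζ) * ((n : ℝ) + 1) ^ (-(2 * ζ)))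
      ≤ 4 ^ (2 * ζ) * ε⁻¹ ^ (ζ / η) * M ^ (1 + ζ / η) := by
    have h1 : ((n : ℝ) + 1) ^ (-(2 * ζ)) ≤ κ ^ (-(2 * ζ)) * (R : ℝ) ^ (-(2 * ζ)) := by
      rw [← Real.mul_rpow hκ0.le (by positivity)]
      exact Real.rpow_le_rpow_of_nonpos (by positivity) hnκ' (by linarith)
    have h2 : κ ^ (-(2 * ζ)) = 4 ^ (2 * ζ) * ε⁻¹ ^ (ζ / η) * M ^ (ζ / η) := by
      rw [hκ, Real.div_rpow (by positivity) (by norm_num), ← Real.rpow_mul hεM0.le,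
        Real.rpow_neg (by norm_num : (0 : ℝ) ≤ 4), div_inv_eq_mul,
        show 1 / (2 * η) * -(2 * ζ) = -(ζ / η) by field_simp, Real.rpow_neg hεM0.le,
        ← Real.inv_rpow hεM0.le, inv_div, div_eq_mul_inv, Real.mul_rpow hM0.le (by positivity)]
      ring
    have h3 : (R : ℝ) ^ (2 * ζ) * (R : ℝ) ^ (-(2 * ζ)) = 1 := by
      rw [← Real.rpow_add (by linarith), add_neg_cancel, Real.rpow_zero]
    calc _ ≤ M * ((R : ℝ) ^ (2 * ζ) * (κ ^ (-(2 * ζ)) * (R : ℝ) ^ (-(2 * ζ)))) := by gcongr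
      _ = M * (κ ^ (-(2 * ζ)) * ((R : ℝ) ^ (2 * ζ) * (R : ℝ) ^ (-(2 * ζ)))) := by ring
      _ = _ := by
          rw [h3, h2, Real.rpow_add hM0, Real.rpow_one]; ring
  calc _ = M * ((R : ℝ) ^ (2 - 2 * η) * (n : ℝ) ^ (2 * η)) * X
        + M * ((R : ℝ) ^ (2 * ζ) * ((n : ℝ) + 1) ^ (-(2 * ζ))) * Y := by ring
    _ ≤ ε * (R : ℝ) ^ (2 : ℝ) * X + 4 ^ (2 * ζ) * ε⁻¹ ^ (ζ / η) * M ^ (1 + ζ / η) * Y := by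
        gcongr
    _ = _ := by ring

/-- Weighted Sobolev inequality: the quantity driving the growth of the moments is controlled by
a small multiple of the weighted energy and a lower-order term. -/
theorem exists_sum_starSum_mul_rpow_mul_sq_le (d : ℕ) {p q s σ τ η ζ : ℝ} (hp : 2 ≤ p)
    (h : SobolevExponents d q s σ τ η ζ) {ε : ℝ} (hε : 0 < ε) :
    ∃ C : ℝ, 0 < C ∧ ∀ (L : ℕ) (_ : 1 ≤ L) (a w : Edge d L → ℝ) (M : ℝ),
      ProdNormLE σ τ a w M → ∀ v : Torus d L → ℝ,
        ∑ x, starSum a x * (starNorm x ^ (p - 2) * v x ^ 2) ≤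
          ε * ∑ e : Edge d L, starNorm e.1 ^ p * (w e ^ 2 * (v (shift e.1 e.2) - v e.1) ^ 2)
          + C * (M ^ (1 + ζ / η) * ∑ x, starNorm x ^ (p - 2) * v x ^ 2) := by
  obtain ⟨C0, hC0, hshell⟩ := exists_sum_shell_le d h
  set K : ℝ := C0 * (2 ^ (p - 2) * 2 ^ p * 3) with hK
  have hK0 : 0 < K := by positivity
  -- `K` collects the comparison of `starNorm` with `2 ^ k` on a shell and the threefold overlap of
  -- the fat shells.
  set ε' := min 1 (ε / K) with hε'
  have hε'0 : 0 < ε' := lt_min one_pos (by positivity)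
  have hε'K : K * ε' ≤ ε := by
    have : ε' ≤ ε / K := min_le_right _ _
    rwa [le_div_iff₀ hK0, mul_comm] at this
  set c1 : ℝ := 4 ^ (2 * ζ) * ε'⁻¹ ^ (ζ / η) with hc1
  have hc10 : 0 < c1 := by positivity
  refine ⟨C0 * (2 ^ (p - 2) * 2 ^ (p - 2) * 3) * c1, by positivity, fun L hL a w M hM v => ?_⟩
  have hM1 := hM.one_le
  have hwt : ∀ (t : ℝ) (x : Torus d L), 0 ≤ starNorm x ^ t := fun t x =>
    Real.rpow_nonneg (starNorm_pos x).le _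
  have hsum : ∑ x, starSum a x * (starNorm x ^ (p - 2) * v x ^ 2)
      = ∑ k ∈ Finset.range (L + 1), ∑ x ∈ shell d L k,
          starSum a x * (starNorm x ^ (p - 2) * v x ^ 2) := by
    refine (Finset.sum_fiberwise_of_maps_to (fun x _ => ?_) _).symm
    rw [Finset.mem_range]
    have h1 : Nat.log 2 (supNorm x + 1) < supNorm x + 1 := Nat.log_lt_self 2 (by omega)
    have := supNorm_le x
    omega
  have hk : ∀ k, ∑ x ∈ shell d L k, starSum a x * (starNorm x ^ (p - 2) * v x ^ 2) ≤
      C0 * (2 ^ (p - 2) * 2 ^ p) * ε' * ∑ e : Edge d L with e.1 ∈ fatShell d L k,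
        starNorm e.1 ^ p * (w e ^ 2 * (v (shift e.1 e.2) - v e.1) ^ 2)
      + C0 * (2 ^ (p - 2) * 2 ^ (p - 2)) * c1 * M ^ (1 + ζ / η) *
        ∑ x with x ∈ fatShell d L k, starNorm x ^ (p - 2) * v x ^ 2 := by
    intro k
    have h1 := hshell ε' hε'0 (min_le_left _ _) L hL a w M hM k v
    set R : ℝ := ((2 ^ k : ℕ) : ℝ) with hR
    have hR0 : 0 < R := by rw [hR]; positivity
    set X := ∑ e ∈ edgesIn (fatShell d L k), w e ^ 2 * (v (shift e.1 e.2) - v e.1) ^ 2 with hX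
    set Y := ∑ x ∈ fatShell d L k, v x ^ 2 with hY
    have hfat : ∀ x ∈ fatShell d L k, R ≤ 2 * starNorm x := by
      intro x hx
      simp only [fatShell, Finset.mem_filter, Finset.mem_univ, true_and] at hx
      rw [hR]; unfold starNorm; exact_mod_cast hx.1
    have hfat' : ∀ (t : ℝ), 0 ≤ t → ∀ x ∈ fatShell d L k, R ^ t ≤ 2 ^ t * starNorm x ^ t := by
      intro t ht x hx
      rw [← Real.mul_rpow (by norm_num) (starNorm_pos x).le]
      exact Real.rpow_le_rpow hR0.le (hfat x hx) ht
    have hXle : R ^ p * X ≤ 2 ^ p * ∑ e : Edge d L with e.1 ∈ fatShell d L k,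
        starNorm e.1 ^ p * (w e ^ 2 * (v (shift e.1 e.2) - v e.1) ^ 2) := by
      rw [hX, Finset.mul_sum, Finset.mul_sum]
      refine le_trans (Finset.sum_le_sum fun e he => ?_)
        (Finset.sum_le_sum_of_subset_of_nonneg (fun e he => ?_) fun e _ _ =>
          mul_nonneg (by positivity) (mul_nonneg (hwt _ _) (by positivity)))
      · simp only [edgesIn, Finset.mem_filter, Finset.mem_univ, true_and] at he
        rw [← mul_assoc (2 ^ p)]
        exact mul_le_mul_of_nonneg_right (hfat' p (by linarith) _ he.1)
          (mul_nonneg (sq_nonneg _) (sq_nonneg _))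
      · simp only [edgesIn, Finset.mem_filter, Finset.mem_univ, true_and] at he ⊢
        exact he.1
    have hYle : R ^ (p - 2) * Y ≤ 2 ^ (p - 2) *
        ∑ x with x ∈ fatShell d L k, starNorm x ^ (p - 2) * v x ^ 2 := by
      rw [hY, Finset.mul_sum, Finset.mul_sum,
        show (Finset.univ.filter fun x => x ∈ fatShell d L k) = fatShell d L k by ext; simp]
      refine Finset.sum_le_sum fun x hx => ?_
      rw [← mul_assoc]
      exact mul_le_mul_of_nonneg_right (hfat' (p - 2) (by linarith) _ hx) (by positivity)
    have hleft : ∑ x ∈ shell d L k, starSum a x * (starNorm x ^ (p - 2) * v x ^ 2)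
        ≤ 2 ^ (p - 2) * R ^ (p - 2) * ∑ x ∈ shell d L k, starSum a x * v x ^ 2 := by
      rw [Finset.mul_sum]
      refine Finset.sum_le_sum fun x hx => ?_
      have h2 : starNorm x ^ (p - 2) ≤ 2 ^ (p - 2) * R ^ (p - 2) := by
        rw [← Real.mul_rpow (by norm_num) hR0.le]
        refine Real.rpow_le_rpow (starNorm_pos x).le ?_ (by linarith)
        have h3 := (mem_shell.1 hx).2
        rw [pow_succ] at h3
        rw [hR]; unfold starNorm
        have : ((supNorm x + 1 : ℕ) : ℝ) ≤ ((2 ^ k * 2 : ℕ) : ℝ) := by exact_mod_cast h3.le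
        push_cast at this ⊢; linarith
      have h4 := starSum_nonneg hM.nonneg x
      calc _ = starNorm x ^ (p - 2) * (starSum a x * v x ^ 2) := by ring
        _ ≤ _ := mul_le_mul_of_nonneg_right h2 (mul_nonneg h4 (sq_nonneg _))
    have hRp : R ^ (p - 2) * R ^ (2 : ℝ) = R ^ p := by
      rw [← Real.rpow_add hR0, sub_add_cancel]
    calc _ ≤ _ := hleft
      _ ≤ 2 ^ (p - 2) * R ^ (p - 2) * (C0 * (ε' * (R ^ (2 : ℝ) * X) +
          c1 * (M ^ (1 + ζ / η) * Y))) := by gcongr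
      _ = C0 * 2 ^ (p - 2) * ε' * ((R ^ (p - 2) * R ^ (2 : ℝ)) * X)
          + C0 * 2 ^ (p - 2) * c1 * M ^ (1 + ζ / η) * (R ^ (p - 2) * Y) := by ring
      _ ≤ C0 * 2 ^ (p - 2) * ε' * (2 ^ p * ∑ e : Edge d L with e.1 ∈ fatShell d L k,
        starNorm e.1 ^ p * (w e ^ 2 * (v (shift e.1 e.2) - v e.1) ^ 2))
          + C0 * 2 ^ (p - 2) * c1 * M ^ (1 + ζ / η) * (2 ^ (p - 2) *
        ∑ x with x ∈ fatShell d L k, starNorm x ^ (p - 2) * v x ^ 2) := by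
          rw [hRp]; gcongr
      _ = _ := by ring
  rw [hsum]
  refine (Finset.sum_le_sum fun k _ => hk k).trans ?_
  rw [Finset.sum_add_distrib, ← Finset.mul_sum, ← Finset.mul_sum]
  have hT1 := sum_fatShell_le Finset.univ (fun e : Edge d L => e.1)
    (g := fun e => starNorm e.1 ^ p * (w e ^ 2 * (v (shift e.1 e.2) - v e.1) ^ 2))
    (fun e _ => mul_nonneg (hwt _ _) (by positivity)) (L + 1)
  have hT2 := sum_fatShell_le Finset.univ (fun x : Torus d L => x)
    (g := fun x => starNorm x ^ (p - 2) * v x ^ 2)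
    (fun e _ => mul_nonneg (hwt _ _) (by positivity)) (L + 1)
  have hT0 : 0 ≤ ∑ e : Edge d L, starNorm e.1 ^ p *
      (w e ^ 2 * (v (shift e.1 e.2) - v e.1) ^ 2) :=
    Finset.sum_nonneg fun e _ => mul_nonneg (hwt _ _) (by positivity)
  refine add_le_add ?_ ?_
  · refine (mul_le_mul_of_nonneg_left hT1 (by positivity)).trans ?_
    calc _ = K * ε' * ∑ e : Edge d L, starNorm e.1 ^ p *
          (w e ^ 2 * (v (shift e.1 e.2) - v e.1) ^ 2) := by rw [hK]; ring
      _ ≤ _ := mul_le_mul_of_nonneg_right hε'K hT0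
  · refine (mul_le_mul_of_nonneg_left hT2 (by positivity)).trans (le_of_eq ?_)
    ring

end WeightedSobolev

end GradPhi

namespace GradPhi

/-! ### The averaging kernel and averages over future times -/

section Kernels

variable {p δ : ℝ}

lemma measurable_kSmall (p δ : ℝ) : Measurable (kSmall p δ) := by
  unfold kSmall; fun_prop

lemma kSmall_nonneg (hδ : 0 < δ) {t : ℝ} (ht : 0 ≤ t) : 0 ≤ kSmall p δ t := by
  unfold kSmall; positivity

lemma measurable_kBig (p δ : ℝ) : Measurable (kBig p δ) := by
  refine (measurable_kSmall p δ).add ?_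
  have h1 : ∀ t : ℝ, ∫ s in Ioi t, s * kSmall p δ s
      = ∫ s, ({q : ℝ × ℝ | q.1 < q.2}.indicator (fun q => q.2 * kSmall p δ q.2)) (t, s) := by
    intro t
    rw [← integral_indicator measurableSet_Ioi]
    rfl
  simp only [h1]
  refine StronglyMeasurable.measurable (StronglyMeasurable.integral_prod_right ?_)
  refine Measurable.stronglyMeasurable (Measurable.indicator ?_
    (measurableSet_lt measurable_fst measurable_snd))
  exact measurable_snd.mul ((measurable_kSmall p δ).comp measurable_snd)

lemma mul_kSmall_nonneg (hδ : 0 < δ) {t s : ℝ} (ht : 0 ≤ t) (hs : s ∈ Ioi t) :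
    0 ≤ s * kSmall p δ s :=
  mul_nonneg (ht.trans (le_of_lt hs)) (kSmall_nonneg hδ (ht.trans (le_of_lt hs)))

lemma mul_kSmall_le (hδ : 0 < δ) {s : ℝ} (hs : 0 ≤ s) :
    s * kSmall p δ s ≤ δ * (s + 1) ^ (-(p + 2)) := by
  have h1 : (0 : ℝ) < 1 + s := by linarith
  unfold kSmall
  rw [mul_div_assoc', div_le_iff₀ (by positivity), add_comm s 1, mul_assoc,
    ← Real.rpow_add h1, show -(p + 2) + (p + 3) = 1 by ring, Real.rpow_one]
  nlinarith

lemma integrableOn_add_one_rpow {t r : ℝ} (ht : 0 ≤ t) (hr : r < -1) :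
    IntegrableOn (fun s : ℝ => (s + 1) ^ r) (Ioi t) :=
  integrableOn_add_rpow_Ioi_of_lt hr (by linarith)

lemma integral_add_one_rpow {t r : ℝ} (ht : 0 ≤ t) (hr : r < -1) :
    ∫ s in Ioi t, (s + 1) ^ r = -(t + 1) ^ (r + 1) / (r + 1) := by
  have h := integral_Ioi_rpow_of_lt hr (c := t + 1) (by linarith)
  rw [← h]
  have := (measurePreserving_add_right volume (1 : ℝ)).setIntegral_preimage_emb
    (MeasurableEquiv.addRight (1 : ℝ)).measurableEmbedding (fun s => s ^ r) (Ioi (t + 1))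
  simpa using this

lemma integrableOn_mul_kSmall (hp : 2 < p) (hδ : 0 < δ) {t : ℝ} (ht : 0 ≤ t) :
    IntegrableOn (fun s => s * kSmall p δ s) (Ioi t) := by
  refine Integrable.mono' ((integrableOn_add_one_rpow (r := -(p + 2)) ht
    (by linarith)).const_mul δ) ?_ ?_
  · exact (measurable_id.mul (measurable_kSmall p δ)).aestronglyMeasurable
  · refine (ae_restrict_iff' measurableSet_Ioi).2 (Eventually.of_forall fun s hs => ?_)
    rw [Real.norm_of_nonneg (mul_kSmall_nonneg hδ ht hs)]
    exact mul_kSmall_le hδ (ht.trans (le_of_lt hs))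

lemma kSmall_le_kBig (hδ : 0 < δ) {t : ℝ} (ht : 0 ≤ t) : kSmall p δ t ≤ kBig p δ t :=
  le_add_of_nonneg_right (setIntegral_nonneg measurableSet_Ioi fun _ hs =>
    mul_kSmall_nonneg hδ ht hs)

lemma kBig_nonneg (hδ : 0 < δ) {t : ℝ} (ht : 0 ≤ t) : 0 ≤ kBig p δ t :=
  (kSmall_nonneg hδ ht).trans (kSmall_le_kBig hδ ht)

/-- Integrating `s * kSmall p δ s` costs two powers of time, so `kBig` decays like `(t + 1) ^ (-(p +
1))`. This still integrates a moment growing like `(t + 1) ^ (p - 1)`. -/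
lemma kBig_le (hp : 2 < p) (hδ : 0 < δ) {t : ℝ} (ht : 0 ≤ t) :
    kBig p δ t ≤ 2 * δ * (t + 1) ^ (-(p + 1)) := by
  have h1 : (1 : ℝ) ≤ t + 1 := by linarith
  have h2 : kSmall p δ t ≤ δ * (t + 1) ^ (-(p + 1)) := by
    unfold kSmall
    rw [div_eq_mul_inv, ← Real.rpow_neg (by linarith), add_comm 1 t]
    refine mul_le_mul_of_nonneg_left ?_ hδ.le
    exact Real.rpow_le_rpow_of_exponent_le h1 (by linarith)
  have h3 : ∫ s in Ioi t, s * kSmall p δ s ≤ δ * (t + 1) ^ (-(p + 1)) := by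
    calc ∫ s in Ioi t, s * kSmall p δ s ≤ ∫ s in Ioi t, δ * (s + 1) ^ (-(p + 2)) :=
          setIntegral_mono_on (integrableOn_mul_kSmall hp hδ ht)
            ((integrableOn_add_one_rpow ht (by linarith)).const_mul δ) measurableSet_Ioi
            fun s hs => mul_kSmall_le hδ (ht.trans (le_of_lt hs))
      _ = δ * ((t + 1) ^ (-(p + 1)) / (p + 1)) := by
          rw [integral_const_mul, integral_add_one_rpow ht (by linarith),
            show -(p + 2) + 1 = -(p + 1) by ring, neg_div_neg_eq]
      _ ≤ _ := by
          refine mul_le_mul_of_nonneg_left ?_ hδ.le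
          exact div_le_self (by positivity) (by linarith)
  unfold kBig; linarith

lemma le_kBig (hp : 2 < p) (hδ : 0 < δ) {t : ℝ} (ht : 0 ≤ t) (ht1 : t ≤ 1) :
    δ / 2 ^ (p + 3) ≤ kBig p δ t := by
  refine le_trans ?_ (kSmall_le_kBig hδ ht)
  unfold kSmall
  gcongr
  linarith

lemma lintegral_mul_kSmall_le (hp : 2 < p) (hδ : 0 < δ) {t : ℝ} (ht : 0 ≤ t) :
    ∫⁻ s in Ioi t, ENNReal.ofReal (s * kSmall p δ s) ≤ ENNReal.ofReal (kBig p δ t) := by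
  rw [← ofReal_integral_eq_lintegral_ofReal (integrableOn_mul_kSmall hp hδ ht)
    ((ae_restrict_iff' measurableSet_Ioi).2 (Eventually.of_forall fun s hs =>
      mul_kSmall_nonneg hδ ht hs))]
  exact ENNReal.ofReal_le_ofReal (le_add_of_nonneg_left (kSmall_nonneg hδ ht))

lemma integrableOn_kBig (hp : 2 < p) (hδ : 0 < δ) {t : ℝ} (ht : 0 ≤ t) :
    IntegrableOn (kBig p δ) (Ioi t) := by
  refine Integrable.mono' ((integrableOn_add_one_rpow (r := -(p + 1)) ht
    (by linarith)).const_mul (2 * δ)) (measurable_kBig p δ).aestronglyMeasurable ?_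
  refine (ae_restrict_iff' measurableSet_Ioi).2 (Eventually.of_forall fun s hs => ?_)
  have hs0 : 0 ≤ s := ht.trans (le_of_lt hs)
  rw [Real.norm_of_nonneg (kBig_nonneg hδ hs0)]
  exact kBig_le hp hδ hs0

lemma KernelSmall.lintegral_le (h : KernelSmall p δ) (hp : 2 < p) (hδ : 0 < δ) :
    ∫⁻ s in Ioi (0 : ℝ), ENNReal.ofReal (kBig p δ s) ≤ 1 := by
  rw [← ofReal_integral_eq_lintegral_ofReal (integrableOn_kBig hp hδ le_rfl)
    ((ae_restrict_iff' measurableSet_Ioi).2 (Eventually.of_forall fun s hs =>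
      kBig_nonneg hδ (le_of_lt hs)))]
  exact ENNReal.ofReal_le_one.2 h.integral_le

lemma KernelSmall.conv_lintegral_le (h : KernelSmall p δ) (hp : 2 < p) (hδ : 0 < δ) {t s' : ℝ}
    (hts : t ≤ s') :
    ∫⁻ s in Ioo t s', ENNReal.ofReal (kBig p δ (s - t)) * ENNReal.ofReal (kBig p δ (s' - s))
      ≤ ENNReal.ofReal (kBig p δ (s' - t)) := by
  have hbd : ∀ r : ℝ, 0 ≤ r → kBig p δ r ≤ 2 * δ := fun r hr =>
    (kBig_le hp hδ hr).trans (mul_le_of_le_one_right (by positivity)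
      (Real.rpow_le_one_of_one_le_of_nonpos (by linarith) (by linarith)))
  have hcongr : ∫⁻ s in Ioo t s', ENNReal.ofReal (kBig p δ (s - t))
        * ENNReal.ofReal (kBig p δ (s' - s))
      = ∫⁻ s in Ioo t s', ENNReal.ofReal (kBig p δ (s - t) * kBig p δ (s' - s)) := by
    refine setLIntegral_congr_fun measurableSet_Ioo fun s hs => ?_
    rw [ENNReal.ofReal_mul (kBig_nonneg hδ (by linarith [hs.1]))]
  have hm : Measurable fun s => kBig p δ (s - t) * kBig p δ (s' - s) :=
    ((measurable_kBig p δ).comp (measurable_id.sub_const t)).mul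
      ((measurable_kBig p δ).comp (measurable_id.const_sub s'))
  have hint : IntegrableOn (fun s => kBig p δ (s - t) * kBig p δ (s' - s)) (Ioo t s') := by
    refine Measure.integrableOn_of_bounded (M := 2 * δ * (2 * δ)) (by simp)
      hm.aestronglyMeasurable ?_
    refine (ae_restrict_iff' measurableSet_Ioo).2 (Eventually.of_forall fun s hs => ?_)
    have h1 : 0 ≤ s - t := by linarith [hs.1]
    have h2 : 0 ≤ s' - s := by linarith [hs.2]
    rw [Real.norm_of_nonneg (mul_nonneg (kBig_nonneg hδ h1) (kBig_nonneg hδ h2))]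
    exact mul_le_mul (hbd _ h1) (hbd _ h2) (kBig_nonneg hδ h2) (by positivity)
  rw [hcongr, ← ofReal_integral_eq_lintegral_ofReal hint
    ((ae_restrict_iff' measurableSet_Ioo).2 (Eventually.of_forall fun s hs =>
      mul_nonneg (kBig_nonneg hδ (by linarith [hs.1])) (kBig_nonneg hδ (by linarith [hs.2]))))]
  refine ENNReal.ofReal_le_ofReal ?_
  -- The convolution hypothesis requires a positive left endpoint, so the interval is translated to
  -- start at 1.
  have h1 := h.conv_le 1 (1 + (s' - t)) one_pos (by linarith)
  have h2 := intervalIntegral.integral_comp_sub_right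
    (fun s => kBig p δ (s - 1) * kBig p δ (1 + (s' - t) - s)) (t - 1) (a := t) (b := s')
  rw [show t - (t - 1) = 1 by ring, show s' - (t - 1) = 1 + (s' - t) by ring] at h2
  rw [← h2, intervalIntegral.integral_of_le hts, integral_Ioc_eq_integral_Ioo] at h1
  have e1 : ∀ s : ℝ, s - (t - 1) - 1 = s - t := fun s => by ring
  have e2 : ∀ s : ℝ, 1 + (s' - t) - (s - (t - 1)) = s' - s := fun s => by ring
  have e3 : 1 + (s' - t) - 1 = s' - t := by ring
  simp only [e1, e2, e3] at h1
  exact h1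

/-- Averages over future times with the kernel `K`. -/
noncomputable def avgK (p δ : ℝ) (g : ℝ → ℝ≥0∞) (t : ℝ) : ℝ≥0∞ :=
  ∫⁻ s in Ioi t, ENNReal.ofReal (kBig p δ (s - t)) * g s

lemma avgK_eq_shift (p δ : ℝ) (g : ℝ → ℝ≥0∞) (t : ℝ) :
    avgK p δ g t = ∫⁻ r in Ioi (0 : ℝ), ENNReal.ofReal (kBig p δ r) * g (t + r) := by
  have := (measurePreserving_add_left volume t).setLIntegral_comp_preimage_emb
    (MeasurableEquiv.addLeft t).measurableEmbedding
    (fun s => ENNReal.ofReal (kBig p δ (s - t)) * g s) (Ioi t)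
  simp only [preimage_const_add_Ioi, sub_self, add_sub_cancel_left] at this
  rw [avgK, ← this]

lemma avgK_mono {g g' : ℝ → ℝ≥0∞} {t : ℝ} (h : ∀ s, t < s → g s ≤ g' s) :
    avgK p δ g t ≤ avgK p δ g' t :=
  setLIntegral_mono' measurableSet_Ioi fun s hs => mul_le_mul_right (h s hs) _

lemma avgK_const_mul {g : ℝ → ℝ≥0∞} {t : ℝ} {c : ℝ≥0∞} (hc : c ≠ ⊤) :
    avgK p δ (fun s => c * g s) t = c * avgK p δ g t := by
  rw [avgK, avgK, ← lintegral_const_mul' _ _ hc]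
  simp only [mul_left_comm]

lemma avgK_const_le (h : KernelSmall p δ) (hp : 2 < p) (hδ : 0 < δ) (c : ℝ≥0∞) (t : ℝ) :
    avgK p δ (fun _ => c) t ≤ c := by
  rw [avgK_eq_shift]
  calc _ = (∫⁻ r in Ioi (0 : ℝ), ENNReal.ofReal (kBig p δ r)) * c :=
        lintegral_mul_const _ (measurable_kBig p δ).ennreal_ofReal
    _ ≤ 1 * c := mul_le_mul_left (h.lintegral_le hp hδ) _
    _ = c := one_mul c

lemma measurable_kernel_comp_sub (p δ t : ℝ) :
    Measurable fun s => ENNReal.ofReal (kBig p δ (s - t)) :=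
  ((measurable_kBig p δ).comp (measurable_id.sub_const t)).ennreal_ofReal

lemma avgK_add {g g' : ℝ → ℝ≥0∞} {t : ℝ} (hg : Measurable g) :
    avgK p δ (fun s => g s + g' s) t = avgK p δ g t + avgK p δ g' t := by
  simp only [avgK, mul_add]
  exact lintegral_add_left ((measurable_kernel_comp_sub p δ t).mul hg) _

lemma avgK_finset_sum {ι : Type*} (S : Finset ι) {g : ι → ℝ → ℝ≥0∞} {t : ℝ}
    (hg : ∀ i, Measurable (g i)) :
    avgK p δ (fun s => ∑ i ∈ S, g i s) t = ∑ i ∈ S, avgK p δ (g i) t := by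
  simp only [avgK, Finset.mul_sum]
  exact lintegral_finsetSum _ fun i _ => (measurable_kernel_comp_sub p δ t).mul (hg i)

lemma measurable_avgK {g : ℝ → ℝ≥0∞} (hg : Measurable g) : Measurable (avgK p δ g) := by
  have : avgK p δ g = fun t => ∫⁻ r in Ioi (0 : ℝ), ENNReal.ofReal (kBig p δ r) * g (t + r) :=
    funext (avgK_eq_shift p δ g)
  rw [this]
  refine Measurable.lintegral_prod_right' (f := fun q : ℝ × ℝ =>
    ENNReal.ofReal (kBig p δ q.2) * g (q.1 + q.2)) ?_
  exact ((measurable_kBig p δ).comp measurable_snd).ennreal_ofReal.mul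
    (hg.comp (measurable_fst.add measurable_snd))

/-- The semigroup-like property of the kernel. -/
lemma avgK_avgK_le (h : KernelSmall p δ) (hp : 2 < p) (hδ : 0 < δ) {g : ℝ → ℝ≥0∞}
    (hg : Measurable g) (t : ℝ) : avgK p δ (avgK p δ g) t ≤ avgK p δ g t := by
  -- Tonelli on the region `t < s < s'`; for fixed `s'` the integral in `s` is the convolution of
  -- the kernel with itself.
  set F : ℝ → ℝ → ℝ≥0∞ := fun s s' => {q : ℝ × ℝ | q.1 < q.2}.indicator (fun q =>
    ENNReal.ofReal (kBig p δ (q.1 - t)) * (ENNReal.ofReal (kBig p δ (q.2 - q.1)) * g q.2))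
    (s, s') with hF
  have hFm : Measurable (Function.uncurry F) := by
    refine Measurable.indicator ?_ (measurableSet_lt measurable_fst measurable_snd)
    refine Measurable.mul ?_ (Measurable.mul ?_ (hg.comp measurable_snd))
    · exact ((measurable_kBig p δ).comp (measurable_fst.sub_const t)).ennreal_ofReal
    · exact ((measurable_kBig p δ).comp (measurable_snd.sub measurable_fst)).ennreal_ofReal
  have h1 : avgK p δ (avgK p δ g) t = ∫⁻ s in Ioi t, ∫⁻ s' in Ioi t, F s s' := by
    refine setLIntegral_congr_fun measurableSet_Ioi fun s hs => ?_
    rw [avgK, ← lintegral_const_mul' _ _ ENNReal.ofReal_ne_top]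
    have : ∀ s', F s s' = (Ioi s).indicator (fun s' => ENNReal.ofReal (kBig p δ (s - t)) *
        (ENNReal.ofReal (kBig p δ (s' - s)) * g s')) s' := fun s' => rfl
    simp only [this]
    rw [setLIntegral_indicator measurableSet_Ioi,
      inter_eq_self_of_subset_left (Ioi_subset_Ioi (le_of_lt hs))]
  rw [h1, lintegral_lintegral_swap hFm.aemeasurable]
  refine setLIntegral_mono' measurableSet_Ioi fun s' hs' => ?_
  have h2 : ∀ s, F s s' = (Iio s').indicator (fun s => ENNReal.ofReal (kBig p δ (s - t)) *
      ENNReal.ofReal (kBig p δ (s' - s)) * g s') s := fun s => by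
    simp only [hF, indicator, mem_ofPred_eq, mem_Iio, mul_assoc]
  simp only [h2]
  rw [setLIntegral_indicator measurableSet_Iio, inter_comm, Ioi_inter_Iio,
    lintegral_mul_const]
  · exact mul_le_mul_left (h.conv_lintegral_le hp hδ (le_of_lt hs')) _
  · exact (measurable_kernel_comp_sub p δ t).mul
      ((measurable_kBig p δ).comp (measurable_id.const_sub s')).ennreal_ofReal

/-- Averages of time integrals. -/
lemma avgK_setLIntegral {g : ℝ → ℝ≥0∞} (hg : Measurable g) (t1 t2 : ℝ) :
    ∫⁻ r in Ioi (0 : ℝ), ENNReal.ofReal (kBig p δ r) * ∫⁻ s in Ioc t1 t2, g (s + r)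
      = ∫⁻ s in Ioc t1 t2, avgK p δ g s := by
  simp only [avgK_eq_shift]
  rw [lintegral_lintegral_swap]
  · refine setLIntegral_congr_fun measurableSet_Ioi fun r _ => ?_
    rw [lintegral_const_mul' _ _ ENNReal.ofReal_ne_top]
  · refine Measurable.aemeasurable ?_
    exact ((measurable_kBig p δ).comp measurable_snd).ennreal_ofReal.mul
      (hg.comp (measurable_fst.add measurable_snd))

end Kernels

end GradPhi

namespace GradPhi

/-! ### The generator, solutions, and increments at two times -/

section Flow

variable {d L : ℕ}

/-- The increment of a function along an edge. -/
abbrev edgeDiff (f : Torus d L → ℝ) (e : Edge d L) : ℝ := f (shift e.1 e.2) - f e.1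

/-- The generator `∇ · a ∇`. -/
noncomputable def flow (a : Edge d L → ℝ) (f : Torus d L → ℝ) (x : Torus d L) : ℝ :=
  starSum (fun e => a e * edgeDiff f e * ((if e.1 = x then 1 else 0)
    - (if shift e.1 e.2 = x then 1 else 0))) x

lemma flow_eq (hL : 1 ≤ L) (a : Edge d L → ℝ) (f : Torus d L → ℝ) (x : Torus d L) :
    flow a f x = ∑ e : Edge d L, a e * edgeDiff f e * ((if e.1 = x then 1 else 0)
    - (if shift e.1 e.2 = x then 1 else 0)) := by
  classical
  rw [flow, ← sum_isEndpoint_eq_starSum hL, Finset.sum_filter]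
  refine Finset.sum_congr rfl fun e _ => ?_
  split_ifs with h1 h2 h3 h4 h5 h6 <;> simp_all [IsEndpoint]

lemma sum_mul_flow (hL : 1 ≤ L) (a : Edge d L → ℝ) (f g : Torus d L → ℝ) :
    ∑ x, g x * flow a f x = -∑ e, a e * edgeDiff f e * edgeDiff g e := by
  simp only [flow_eq hL, Finset.mul_sum]
  rw [Finset.sum_comm, ← Finset.sum_neg_distrib]
  refine Finset.sum_congr rfl fun e _ => ?_
  have : ∀ x, g x * (a e * edgeDiff f e * ((if e.1 = x then 1 else 0)
      - (if shift e.1 e.2 = x then 1 else 0))) = a e * edgeDiff f e *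
      ((if e.1 = x then g x else 0) - (if shift e.1 e.2 = x then g x else 0)) := by
    intro x; split_ifs <;> ring
  simp only [this, ← Finset.mul_sum, Finset.sum_sub_distrib, Finset.sum_ite_eq,
    Finset.mem_univ, if_true]
  ring

lemma sum_mul_divergence (o : Edge d L → Bool) (g : Torus d L → ℝ) (h : Edge d L → ℝ) :
    ∑ x, g x * divergence o h x = ∑ e, h e * (g (edgeSrc o e) - g (edgeTgt o e)) := by
  classical
  simp only [divergence, mul_sub, Finset.mul_sum, Finset.sum_sub_distrib]
  congr 1
  · rw [← Finset.sum_fiberwise Finset.univ (edgeSrc o)]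
    refine Finset.sum_congr rfl fun x _ => Finset.sum_congr (by congr) fun e he => ?_
    rw [(Finset.mem_filter.1 he).2]; ring
  · rw [← Finset.sum_fiberwise Finset.univ (edgeTgt o)]
    refine Finset.sum_congr rfl fun x _ => Finset.sum_congr (by congr) fun e he => ?_
    rw [(Finset.mem_filter.1 he).2]; ring

/-- Gradient and divergence both change sign with the orientation, so their composition does not
depend on it. The equality is read off by pairing with an arbitrary function and specializing to an
indicator. -/
lemma divergence_eq_flow (hL : 1 ≤ L) (o : Edge d L → Bool) (a : Edge d L → ℝ)
    (f : Torus d L → ℝ) (x : Torus d L) :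
    divergence o (fun e => a e * grad o f e) x = flow a f x := by
  classical
  have h : ∀ g : Torus d L → ℝ, ∑ x, g x * divergence o (fun e => a e * grad o f e) x
      = ∑ x, g x * flow a f x := by
    intro g
    rw [sum_mul_divergence, sum_mul_flow hL, ← Finset.sum_neg_distrib]
    refine Finset.sum_congr rfl fun e _ => ?_
    unfold grad edgeSrc edgeTgt edgeDiff
    split_ifs <;> ring
  simpa using h (fun y => if x = y then 1 else 0)

lemma starSum_mono {g h : Edge d L → ℝ} (hgh : ∀ e, g e ≤ h e) (x : Torus d L) :
    starSum g x ≤ starSum h x :=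
  Finset.sum_le_sum fun _ _ => add_le_add (hgh _) (hgh _)

lemma abs_starSum_le (g : Edge d L → ℝ) (x : Torus d L) :
    |starSum g x| ≤ starSum (fun e => |g e|) x :=
  (Finset.abs_sum_le_sum_abs _ _).trans (Finset.sum_le_sum fun _ _ => abs_add_le _ _)

lemma abs_flow_le {a : Edge d L → ℝ} (ha : ∀ e, 0 ≤ a e) (f : Torus d L → ℝ) (x : Torus d L) :
    |flow a f x| ≤ starSum (fun e => a e * |edgeDiff f e|) x := by
  refine (abs_starSum_le _ x).trans (starSum_mono (fun e => ?_) x)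
  rw [abs_mul, abs_mul, abs_of_nonneg (ha e)]
  refine mul_le_of_le_one_right (mul_nonneg (ha e) (abs_nonneg _)) ?_
  split_ifs <;> norm_num

open Classical in
lemma starSum_add_starSum_le (hL : 1 ≤ L) {g : Edge d L → ℝ} (hg : ∀ e, 0 ≤ g e)
    (e : Edge d L) : starSum g (shift e.1 e.2) + starSum g e.1
      ≤ 2 * ∑ e' : Edge d L with EdgesMeet e e', g e' := by
  have h : ∀ x, IsEndpoint x e → starSum g x ≤ ∑ e' : Edge d L with EdgesMeet e e', g e' := by
    intro x hx
    rw [← sum_isEndpoint_eq_starSum hL]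
    refine Finset.sum_le_sum_of_subset_of_nonneg (fun e' he' => ?_) fun e' _ _ => hg e'
    simp only [Finset.mem_filter, Finset.mem_univ, true_and] at he' ⊢
    exact ⟨x, hx, he'⟩
  linarith [h _ (isEndpoint_shift e), h _ (isEndpoint_fst e)]

open Classical in
lemma sum_edgesMeet_le (hL : 1 ≤ L) {g : Edge d L → ℝ} (hg : ∀ e, 0 ≤ g e)
    (e : Edge d L) : ∑ e' : Edge d L with EdgesMeet e e', g e'
      ≤ starSum g (shift e.1 e.2) + starSum g e.1 := by
  rw [← sum_isEndpoint_eq_starSum hL, ← sum_isEndpoint_eq_starSum hL, Finset.sum_filter,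
    Finset.sum_filter, Finset.sum_filter, ← Finset.sum_add_distrib]
  refine Finset.sum_le_sum fun e' _ => ?_
  have h0 := hg e'
  by_cases h : EdgesMeet e e'
  · rw [if_pos h]
    obtain ⟨x, hx, hx'⟩ := h
    rcases hx with rfl | rfl
    · rw [if_pos hx']; split_ifs <;> linarith
    · rw [if_pos hx']; split_ifs <;> linarith
  · rw [if_neg h]; split_ifs <;> linarith

/-- A nonnegative environment which is continuous in time. -/
structure IsEnv (a : ℝ → Edge d L → ℝ) : Prop where
  cont : ∀ e, Continuous fun t => a t e
  nonneg : ∀ t e, 0 ≤ a t e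

/-- Solutions of `∂_t v = ∇ · a ∇ v` for `t > 0`, extended to continuous functions of `t ∈ ℝ`. -/
structure IsSol (a : ℝ → Edge d L → ℝ) (v : ℝ → Torus d L → ℝ) : Prop where
  cont : ∀ x, Continuous fun t => v t x
  deriv : ∀ t, 0 < t → ∀ x, HasDerivAt (fun t => v t x) (flow (a t) (v t) x) t

lemma IsSol.cont_edgeDiff {a : ℝ → Edge d L → ℝ} {v : ℝ → Torus d L → ℝ} (hv : IsSol a v)
    (e : Edge d L) : Continuous fun t => edgeDiff (v t) e :=
  (hv.cont _).sub (hv.cont _)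

/-- Cauchy--Schwarz for time integrals of sums over edges. -/
lemma sq_intervalIntegral_sum_le {ι : Type*} (S : Finset ι) {a g : ι → ℝ → ℝ} {t s : ℝ} (hts : t < s)
    (hS : S.Nonempty) (ha : ∀ e, Continuous (a e)) (ha0 : ∀ e t, 0 ≤ a e t)
    (hg : ∀ e, Continuous (g e)) :
    (∫ r in t..s, ∑ e ∈ S, a e r * |g e r|) ^ 2
      ≤ (∑ e ∈ S, ∫ r in t..s, max (a e r) 1) * ∫ r in t..s, ∑ e ∈ S, a e r * g e r ^ 2 := by
  set Q := ∫ r in t..s, ∑ e ∈ S, a e r * |g e r| with hQ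
  set R := ∑ e ∈ S, ∫ r in t..s, max (a e r) 1 with hR
  set W := ∫ r in t..s, ∑ e ∈ S, a e r * g e r ^ 2 with hW
  have hR0 : 0 < R := by
    refine Finset.sum_pos (fun e _ => ?_) hS
    refine intervalIntegral.intervalIntegral_pos_of_pos ?_ (fun r => ?_) hts
    · exact ((ha e).max continuous_const).intervalIntegrable _ _
    · exact lt_max_of_lt_right one_pos
  have hRR : R = ∫ r in t..s, ∑ e ∈ S, max (a e r) 1 :=
    (intervalIntegral.integral_finsetSum fun e _ =>
      ((ha e).max continuous_const).intervalIntegrable _ _).symm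
  -- Cauchy–Schwarz from a nonnegative quadratic in `l`, taken at its minimum `Q / R`. Replacing `a`
  -- by `max a 1` in `R` keeps the divisor positive.
  have key : ∀ l : ℝ, 0 ≤ W - 2 * l * Q + l ^ 2 * R := by
    intro l
    have c1 : Continuous fun r => ∑ e ∈ S, a e r * g e r ^ 2 := by fun_prop
    have c2 : Continuous fun r => 2 * l * ∑ e ∈ S, a e r * |g e r| := by fun_prop
    have c3 : Continuous fun r => l ^ 2 * ∑ e ∈ S, max (a e r) 1 := by fun_prop
    have : W - 2 * l * Q + l ^ 2 * R = ∫ r in t..s, (((∑ e ∈ S, a e r * g e r ^ 2)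
        - 2 * l * (∑ e ∈ S, a e r * |g e r|)) + l ^ 2 * ∑ e ∈ S, max (a e r) 1) := by
      rw [intervalIntegral.integral_add (Continuous.intervalIntegrable (by exact c1.sub c2) _ _)
        (c3.intervalIntegrable _ _), intervalIntegral.integral_sub (c1.intervalIntegrable _ _)
        (c2.intervalIntegrable _ _), intervalIntegral.integral_const_mul,
        intervalIntegral.integral_const_mul, hRR]
    rw [this]
    refine intervalIntegral.integral_nonneg hts.le fun r _ => ?_
    rw [Finset.mul_sum, Finset.mul_sum, ← Finset.sum_sub_distrib, ← Finset.sum_add_distrib]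
    refine Finset.sum_nonneg fun e _ => ?_
    have h1 := mul_nonneg (ha0 e r) (sq_nonneg (|g e r| - l))
    have h2 := mul_le_mul_of_nonneg_left (le_max_left (a e r) 1) (sq_nonneg l)
    have h3 := sq_abs (g e r)
    rw [← h3]; nlinarith [h1, h2]
  have h := key (Q / R)
  have e1 : W - 2 * (Q / R) * Q + (Q / R) ^ 2 * R = W - Q ^ 2 / R := by field_simp; ring
  rw [e1, sub_nonneg, div_le_iff₀ hR0] at h
  linarith

open Classical in
/-- Increments of a solution along an edge, at two different times. -/
lemma IsSol.sq_edgeDiff_le (hL : 1 ≤ L) {a : ℝ → Edge d L → ℝ} {v : ℝ → Torus d L → ℝ}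
    (ha : IsEnv a) (hv : IsSol a v) {t s : ℝ} (ht : 0 ≤ t) (hts : t < s) (e : Edge d L) :
    edgeDiff (v t) e ^ 2 ≤ 2 * edgeDiff (v s) e ^ 2
      + 8 * ((∑ e' : Edge d L with EdgesMeet e e', ∫ s' in t..s, max (a s' e') 1) *
        ∫ r in t..s, ∑ e' : Edge d L with EdgesMeet e e', a r e' * edgeDiff (v r) e' ^ 2) := by
  have hcs := sq_intervalIntegral_sum_le (Finset.univ.filter (EdgesMeet e))
    (a := fun e r => a r e) (g := fun e r => edgeDiff (v r) e) hts
    ⟨e, by simp only [Finset.mem_filter, Finset.mem_univ, true_and]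
           exact ⟨e.1, isEndpoint_fst e, isEndpoint_fst e⟩⟩
    ha.cont (fun e t => ha.nonneg t e) hv.cont_edgeDiff
  set Q := ∫ r in t..s, ∑ e' : Edge d L with EdgesMeet e e', a r e' * |edgeDiff (v r) e'| with hQ
  have cQ : Continuous fun r => ∑ e' : Edge d L with EdgesMeet e e', a r e' * |edgeDiff (v r) e'| :=
    continuous_finsetSum _ fun e' _ => (ha.cont e').mul (hv.cont_edgeDiff e').abs
  -- The time derivative of the increment is the difference of the generator at the two endpoints,
  -- so only edges meeting `e` contribute.
  have h1 : |edgeDiff (v s) e - edgeDiff (v t) e| ≤ 2 * Q := by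
    have hder : ∀ r ∈ Ioo t s, HasDerivAt (fun r => edgeDiff (v r) e)
        (flow (a r) (v r) (shift e.1 e.2) - flow (a r) (v r) e.1) r := fun r hr =>
      (hv.deriv r (ht.trans_lt hr.1) _).sub (hv.deriv r (ht.trans_lt hr.1) _)
    rw [← intervalIntegral.integral_const_mul]
    refine norm_sub_le_integral_of_norm_deriv_le_of_le hts.le
      (hv.cont_edgeDiff e).continuousOn (fun r hr => (hder r hr).differentiableAt.differentiableWithinAt)
      (Eventually.of_forall fun r hr => ?_) ((cQ.const_mul 2).intervalIntegrable _ _)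
    rw [(hder r hr).deriv]
    refine (norm_sub_le _ _).trans ((add_le_add (abs_flow_le (ha.nonneg r) _ _)
      (abs_flow_le (ha.nonneg r) _ _)).trans ?_)
    exact starSum_add_starSum_le hL (fun e' => mul_nonneg (ha.nonneg r e') (abs_nonneg _)) e
  have h2 : |edgeDiff (v t) e| ≤ |edgeDiff (v s) e| + 2 * Q := by
    have := abs_sub_abs_le_abs_sub (edgeDiff (v t) e) (edgeDiff (v s) e)
    rw [abs_sub_comm (edgeDiff (v t) e)] at this
    linarith
  have h3 : |edgeDiff (v t) e| ^ 2 ≤ (|edgeDiff (v s) e| + 2 * Q) ^ 2 := by gcongr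
  rw [sq_abs] at h3
  have h4 := sq_abs (edgeDiff (v s) e)
  nlinarith [sq_nonneg (|edgeDiff (v s) e| - 2 * Q)]

end Flow

/-! ### Gradients controlled by future dissipation -/

section Moderation

variable {d L : ℕ} {p δ : ℝ}

-- Only an inequality is needed, and it dispenses with integrability: a Bochner integral that does
-- not converge is zero.
open Classical in
lemma ofReal_modEnv_sq_mul_le (p : ℝ) (hδ : 0 < δ) (a : ℝ → Edge d L → ℝ) (ha : IsEnv a) (t : ℝ)
    (e : Edge d L) : ENNReal.ofReal (modEnv p δ a t e ^ 2) ≤ ∫⁻ s in Ioi t, ENNReal.ofReal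
      (kSmall p δ (s - t) * (min (a s e) 1 / ((s - t)⁻¹ *
        ∑ e' : Edge d L with EdgesMeet e e', ∫ s' in t..s, max (a s' e') 1))) := by
  have hnn : ∀ s ∈ Ioi t, 0 ≤ kSmall p δ (s - t) * (min (a s e) 1 / ((s - t)⁻¹ *
        ∑ e' : Edge d L with EdgesMeet e e', ∫ s' in t..s, max (a s' e') 1)) := by
    intro s hs
    have hs' : 0 < s - t := sub_pos.2 hs
    refine mul_nonneg (kSmall_nonneg hδ hs'.le) (div_nonneg (le_min (ha.nonneg _ _) zero_le_one)
      (mul_nonneg (inv_nonneg.2 hs'.le) (Finset.sum_nonneg fun e' _ => ?_)))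
    exact intervalIntegral.integral_nonneg (le_of_lt hs) fun r _ => zero_le_one.trans (le_max_right _ _)
  rw [modEnv, Real.sq_sqrt (setIntegral_nonneg measurableSet_Ioi hnn)]
  by_cases hi : IntegrableOn (fun s => kSmall p δ (s - t) * (min (a s e) 1 / ((s - t)⁻¹ *
        ∑ e' : Edge d L with EdgesMeet e e', ∫ s' in t..s, max (a s' e') 1))) (Ioi t)
  · rw [ofReal_integral_eq_lintegral_ofReal hi
      ((ae_restrict_iff' measurableSet_Ioi).2 (Eventually.of_forall hnn))]
  · rw [integral_undef hi]; simp

/-- Exchanging the integrals leaves, in front of the value at time `r`, the tail integral of `s *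
kSmall p δ s` beyond `r - t`. This tail is the second term in the definition of `kBig`. -/
lemma lintegral_mul_lintegral_le_avgK (hp : 2 < p) (hδ : 0 < δ) {g : ℝ → ℝ≥0∞}
    (hg : Measurable g) (t : ℝ) :
    ∫⁻ s in Ioi t, ENNReal.ofReal ((s - t) * kSmall p δ (s - t)) * ∫⁻ r in Ioo t s, g r
      ≤ avgK p δ g t := by
  set F : ℝ → ℝ → ℝ≥0∞ := fun s r => {q : ℝ × ℝ | q.2 < q.1}.indicator (fun q =>
    ENNReal.ofReal ((q.1 - t) * kSmall p δ (q.1 - t)) * g q.2) (s, r) with hF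
  have hm : Measurable fun s => ENNReal.ofReal ((s - t) * kSmall p δ (s - t)) :=
    ((measurable_id.sub_const t).mul
      ((measurable_kSmall p δ).comp (measurable_id.sub_const t))).ennreal_ofReal
  have hFm : Measurable (Function.uncurry F) :=
    Measurable.indicator ((hm.comp measurable_fst).mul (hg.comp measurable_snd))
      (measurableSet_lt measurable_snd measurable_fst)
  have h1 : ∫⁻ s in Ioi t, ENNReal.ofReal ((s - t) * kSmall p δ (s - t)) * ∫⁻ r in Ioo t s, g r
      = ∫⁻ s in Ioi t, ∫⁻ r in Ioi t, F s r := by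
    refine setLIntegral_congr_fun measurableSet_Ioi fun s hs => ?_
    rw [← lintegral_const_mul' _ _ ENNReal.ofReal_ne_top]
    have : ∀ r, F s r = (Iio s).indicator (fun r => ENNReal.ofReal ((s - t) * kSmall p δ (s - t))
      * g r) r := fun r => rfl
    simp only [this]
    rw [setLIntegral_indicator measurableSet_Iio, inter_comm, Ioi_inter_Iio]
  rw [h1, lintegral_lintegral_swap hFm.aemeasurable]
  refine setLIntegral_mono' measurableSet_Ioi fun r hr => ?_
  have h2 : ∀ s, F s r = (Ioi r).indicator (fun s => ENNReal.ofReal ((s - t) * kSmall p δ (s - t))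
      * g r) s := fun s => rfl
  simp only [h2]
  rw [setLIntegral_indicator measurableSet_Ioi,
    inter_eq_self_of_subset_left (Ioi_subset_Ioi (le_of_lt hr)), lintegral_mul_const _ hm]
  refine mul_le_mul_left ?_ _
  refine le_trans (le_of_eq ?_) (lintegral_mul_kSmall_le hp hδ (sub_nonneg.2 (le_of_lt hr)))
  have := (measurePreserving_sub_right volume t).setLIntegral_comp_preimage_emb
    (MeasurableEquiv.subRight t).measurableEmbedding
    (fun s => ENNReal.ofReal (s * kSmall p δ s)) (Ioi (r - t))
  rw [← this]
  simp

/-- Moderation: gradients of solutions are controlled by the dissipation at later times. -/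
lemma IsSol.moderation (hL : 1 ≤ L) (hp : 2 < p) (hδ : 0 < δ) {a : ℝ → Edge d L → ℝ}
    {v : ℝ → Torus d L → ℝ}
    (ha : IsEnv a) (hv : IsSol a v) {t : ℝ} (ht : 0 ≤ t) (e : Edge d L) :
    ENNReal.ofReal (modEnv p δ a t e ^ 2 * edgeDiff (v t) e ^ 2)
      ≤ 10 * avgK p δ (fun s => ENNReal.ofReal
        (starSum (fun e' => a s e' * edgeDiff (v s) e' ^ 2) (shift e.1 e.2)
          + starSum (fun e' => a s e' * edgeDiff (v s) e' ^ 2) e.1)) t := by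
  classical
  set Y : ℝ → ℝ := fun s => ∑ e' : Edge d L with EdgesMeet e e', a s e' * edgeDiff (v s) e' ^ 2
    with hY
  have hY0 : ∀ s, 0 ≤ Y s := fun s =>
    Finset.sum_nonneg fun e' _ => mul_nonneg (ha.nonneg s e') (sq_nonneg _)
  have hYc : Continuous Y :=
    continuous_finsetSum _ fun e' _ => (ha.cont e').mul ((hv.cont_edgeDiff e').pow 2)
  have hYm : Measurable fun s => ENNReal.ofReal (Y s) := hYc.measurable.ennreal_ofReal
  have hee : e ∈ Finset.univ.filter (EdgesMeet e) := by
    simp only [Finset.mem_filter, Finset.mem_univ, true_and]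
    exact ⟨e.1, isEndpoint_fst e, isEndpoint_fst e⟩
  have hkm : Measurable fun s => kSmall p δ (s - t) :=
    (measurable_kSmall p δ).comp (measurable_id.sub_const t)
  have hYle : avgK p δ (fun s => ENNReal.ofReal (Y s)) t ≤ avgK p δ (fun s => ENNReal.ofReal
        (starSum (fun e' => a s e' * edgeDiff (v s) e' ^ 2) (shift e.1 e.2)
          + starSum (fun e' => a s e' * edgeDiff (v s) e' ^ 2) e.1)) t :=
    avgK_mono fun s _ => ENNReal.ofReal_le_ofReal
      (sum_edgesMeet_le hL (fun e' => mul_nonneg (ha.nonneg s e') (sq_nonneg _)) e)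
  refine le_trans ?_ (mul_le_mul_right hYle 10)
  rw [ENNReal.ofReal_mul (sq_nonneg _)]
  refine (mul_le_mul_left (ofReal_modEnv_sq_mul_le p hδ a ha t e) _).trans ?_
  rw [← lintegral_mul_const' _ _ ENNReal.ofReal_ne_top]
  -- The comparison of increments is multiplied by the integrand of `modEnv ^ 2`. In the first term
  -- `min a 1 ≤ a` produces dissipation at time `s`. In the second the denominator cancels the
  -- factor from Cauchy–Schwarz and leaves the weight `s - t`.
  calc _ ≤ ∫⁻ s in Ioi t, (2 * (ENNReal.ofReal (kBig p δ (s - t)) * ENNReal.ofReal (Y s))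
        + 8 * (ENNReal.ofReal ((s - t) * kSmall p δ (s - t))
          * ∫⁻ r in Ioo t s, ENNReal.ofReal (Y r))) := by
        refine setLIntegral_mono' measurableSet_Ioi fun s hs => ?_
        have hs' : 0 < s - t := sub_pos.2 hs
        have hk := kSmall_nonneg (p := p) hδ hs'.le
        set A1 := ∑ e' : Edge d L with EdgesMeet e e', ∫ s' in t..s, max (a s' e') 1 with hA1
        have hint0 : ∀ e', 0 ≤ ∫ s' in t..s, max (a s' e') 1 := fun e' =>
          intervalIntegral.integral_nonneg (le_of_lt hs) fun r _ =>
            zero_le_one.trans (le_max_right _ _)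
        -- The edge `e` meets itself and `max a 1 ≥ 1`, so its own term is already at least `s - t`.
        have hA : s - t ≤ A1 := by
          refine le_trans ?_ (Finset.single_le_sum (fun e' _ => hint0 e') hee)
          have h := intervalIntegral.integral_mono_on (μ := volume) (le_of_lt hs)
            (f := fun _ => (1 : ℝ)) (g := fun s' => max (a s' e) 1)
            (by simp) (((ha.cont e).max continuous_const).intervalIntegrable _ _)
            fun r _ => le_max_right _ _
          simpa using h
        have hA0 : 0 < A1 := hs'.trans_le hA
        have hsq := hv.sq_edgeDiff_le hL ha ht hs e
        set W := ∫ r in t..s, ∑ e' : Edge d L with EdgesMeet e e',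
          a r e' * edgeDiff (v r) e' ^ 2 with hW
        have hWe : ∫⁻ r in Ioo t s, ENNReal.ofReal (Y r) = ENNReal.ofReal W := by
          rw [hW, intervalIntegral.integral_of_le (le_of_lt hs), restrict_Ioo_eq_restrict_Ioc,
            ofReal_integral_eq_lintegral_ofReal]
          · exact (hYc.intervalIntegrable t s).1
          · exact Eventually.of_forall hY0
        have hW0 : 0 ≤ W := intervalIntegral.integral_nonneg (le_of_lt hs) fun r _ => hY0 r
        have hm0 : 0 ≤ min (a s e) 1 := le_min (ha.nonneg _ _) zero_le_one
        have hYe : a s e * edgeDiff (v s) e ^ 2 ≤ Y s :=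
          Finset.single_le_sum (f := fun e' => a s e' * edgeDiff (v s) e' ^ 2)
            (fun e' _ => mul_nonneg (ha.nonneg s e') (sq_nonneg _)) hee
        have hfrac : min (a s e) 1 / ((s - t)⁻¹ * A1) = min (a s e) 1 * ((s - t) / A1) := by
          field_simp
        have hreal : kSmall p δ (s - t) * (min (a s e) 1 / ((s - t)⁻¹ * A1))
            * edgeDiff (v t) e ^ 2 ≤ 2 * (kBig p δ (s - t) * Y s)
              + 8 * ((s - t) * kSmall p δ (s - t) * W) := by
          have hk2 := kSmall_le_kBig (p := p) hδ hs'.le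
          have hr0 : 0 ≤ (s - t) / A1 := by positivity
          have hr1 : (s - t) / A1 ≤ 1 := (div_le_one hA0).2 hA
          rw [hfrac]
          calc _ ≤ kSmall p δ (s - t) * (min (a s e) 1 * ((s - t) / A1))
                * (2 * edgeDiff (v s) e ^ 2 + 8 * (A1 * W)) := by gcongr
            _ = 2 * (kSmall p δ (s - t) * ((min (a s e) 1 * edgeDiff (v s) e ^ 2)
                  * ((s - t) / A1)))
                + 8 * ((s - t) * kSmall p δ (s - t) * W * min (a s e) 1) := by
                field_simp
            _ ≤ 2 * (kBig p δ (s - t) * (Y s * 1))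
                + 8 * ((s - t) * kSmall p δ (s - t) * W * 1) := by
                have h1 : min (a s e) 1 * edgeDiff (v s) e ^ 2 ≤ Y s :=
                  (mul_le_mul_of_nonneg_right (min_le_left _ _) (sq_nonneg _)).trans hYe
                have h2 : min (a s e) 1 ≤ 1 := min_le_right _ _
                have h3 := hY0 s
                have hkB := kBig_nonneg (p := p) hδ hs'.le
                have h4 : 0 ≤ min (a s e) 1 * edgeDiff (v s) e ^ 2 := by positivity
                gcongr
            _ = _ := by ring
        rw [hWe, ← ENNReal.ofReal_mul' (sq_nonneg _),
          ← ENNReal.ofReal_mul (mul_nonneg hs'.le hk),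
          ← ENNReal.ofReal_mul (kBig_nonneg hδ hs'.le)]
        refine (ENNReal.ofReal_le_ofReal hreal).trans ?_
        rw [ENNReal.ofReal_add (mul_nonneg zero_le_two (mul_nonneg (kBig_nonneg hδ hs'.le)
          (hY0 s))) (by positivity), ENNReal.ofReal_mul zero_le_two,
          ENNReal.ofReal_mul (by norm_num : (0 : ℝ) ≤ 8)]
        simp
    _ = 2 * avgK p δ (fun s => ENNReal.ofReal (Y s)) t
        + 8 * ∫⁻ s in Ioi t, ENNReal.ofReal ((s - t) * kSmall p δ (s - t))
          * ∫⁻ r in Ioo t s, ENNReal.ofReal (Y r) := by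
        have hmeas : Measurable fun s => 2 * (ENNReal.ofReal (kBig p δ (s - t))
            * ENNReal.ofReal (Y s)) :=
          ((measurable_kernel_comp_sub p δ t).mul hYm).const_mul 2
        rw [lintegral_add_left hmeas,
          lintegral_const_mul' _ _ (by norm_num), lintegral_const_mul' _ _ (by norm_num)]
        rfl
    _ ≤ 2 * avgK p δ (fun s => ENNReal.ofReal (Y s)) t
        + 8 * avgK p δ (fun s => ENNReal.ofReal (Y s)) t :=
        add_le_add_right (mul_le_mul_right
          (lintegral_mul_lintegral_le_avgK hp hδ hYm t) 8) _
    _ = _ := by rw [← add_mul]; norm_num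

/-- Weighted sums of moderated gradients are controlled by averages of weighted dissipations. -/
lemma IsSol.moderation_sum (hL : 1 ≤ L) (hp : 2 < p) (hδ : 0 < δ) {a : ℝ → Edge d L → ℝ}
    {v : ℝ → Torus d L → ℝ} (ha : IsEnv a) (hv : IsSol a v) {t : ℝ} (ht : 0 ≤ t)
    {m : Torus d L → ℝ} {c : ℝ} (hm : ∀ x, 0 ≤ m x) (hc : 0 ≤ c)
    (hms : ∀ x i, m (shift x i) ≤ c * m x) (hms' : ∀ x i, m x ≤ c * m (shift x i)) :
    ENNReal.ofReal (∑ e, m e.1 * (modEnv p δ a t e ^ 2 * edgeDiff (v t) e ^ 2))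
      ≤ ENNReal.ofReal (20 * d * (1 + c) ^ 2) * avgK p δ (fun s => ENNReal.ofReal
        (∑ e, m e.1 * (a s e * edgeDiff (v s) e ^ 2))) t := by
  set h : ℝ → Edge d L → ℝ := fun s e => a s e * edgeDiff (v s) e ^ 2 with hh
  have h0 : ∀ s e, 0 ≤ h s e := fun s e => mul_nonneg (ha.nonneg s e) (sq_nonneg _)
  have hS0 : ∀ s x, 0 ≤ starSum (h s) x := fun s x => starSum_nonneg (h0 s) x
  have hcont : ∀ x, Continuous fun s => starSum (h s) x := fun x =>
    continuous_finsetSum _ fun i _ =>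
      ((ha.cont _).mul ((hv.cont_edgeDiff _).pow 2)).add
        ((ha.cont _).mul ((hv.cont_edgeDiff _).pow 2))
  -- Each edge has boundedly many neighbouring edges, and the weight `m` changes by at most the
  -- factor `c` between neighbouring vertices.
  have hstat : ∀ s, ∑ e : Edge d L, m e.1 * (starSum (h s) (shift e.1 e.2) + starSum (h s) e.1)
      ≤ 2 * d * (1 + c) ^ 2 * ∑ e, m e.1 * h s e := by
    intro s
    have h1 : ∑ e : Edge d L, m (shift e.1 e.2) * starSum (h s) (shift e.1 e.2)
        = ∑ e : Edge d L, m e.1 * starSum (h s) e.1 := by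
      rw [Fintype.sum_prod_type_right, Fintype.sum_prod_type_right]
      exact Finset.sum_congr rfl fun i _ => sum_shift (fun x => m x * starSum (h s) x) i
    have h2 : ∑ e : Edge d L, m e.1 * starSum (h s) e.1 = d * ∑ x, m x * starSum (h s) x := by
      rw [Fintype.sum_prod_type_right]
      simp
    have h3 : ∑ x, m x * starSum (h s) x ≤ (1 + c) * ∑ e, m e.1 * h s e := by
      rw [sum_mul_starSum, Finset.mul_sum]
      refine Finset.sum_le_sum fun e _ => ?_
      have := mul_le_mul_of_nonneg_right (hms e.1 e.2) (h0 s e)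
      nlinarith
    calc _ ≤ ∑ e : Edge d L, (c * (m (shift e.1 e.2) * starSum (h s) (shift e.1 e.2))
          + m e.1 * starSum (h s) e.1) := by
          refine Finset.sum_le_sum fun e _ => ?_
          have := mul_le_mul_of_nonneg_right (hms' e.1 e.2) (hS0 s (shift e.1 e.2))
          linarith
      _ = (1 + c) * (d * ∑ x, m x * starSum (h s) x) := by
          rw [Finset.sum_add_distrib, ← Finset.mul_sum, h1, h2]; ring
      _ ≤ (1 + c) * (d * ((1 + c) * ∑ e, m e.1 * h s e)) := by gcongr
      _ ≤ _ := by
          have : 0 ≤ (1 + c) ^ 2 * d * ∑ e, m e.1 * h s e :=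
            mul_nonneg (by positivity) (Finset.sum_nonneg fun e _ => mul_nonneg (hm _) (h0 s e))
          linarith
  rw [ENNReal.ofReal_sum_of_nonneg fun e _ => mul_nonneg (hm _) (mul_nonneg (sq_nonneg _)
    (sq_nonneg _))]
  calc _ ≤ ∑ e : Edge d L, 10 * avgK p δ (fun s => ENNReal.ofReal
        (m e.1 * (starSum (h s) (shift e.1 e.2) + starSum (h s) e.1))) t := by
        refine Finset.sum_le_sum fun e _ => ?_
        simp only [ENNReal.ofReal_mul (hm _)]
        rw [avgK_const_mul ENNReal.ofReal_ne_top, ← mul_assoc, mul_comm 10, mul_assoc]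
        exact mul_le_mul_right (hv.moderation hL hp hδ ha ht e) _
    _ = 10 * avgK p δ (fun s => ENNReal.ofReal
        (∑ e : Edge d L, m e.1 * (starSum (h s) (shift e.1 e.2) + starSum (h s) e.1))) t := by
        have hmeas : ∀ e : Edge d L, Measurable fun s => ENNReal.ofReal
            (m e.1 * (starSum (h s) (shift e.1 e.2) + starSum (h s) e.1)) := fun e =>
          (((hcont _).add (hcont _)).const_mul _).measurable.ennreal_ofReal
        rw [← Finset.mul_sum, ← avgK_finset_sum _ hmeas]
        congr 2
        funext s
        rw [ENNReal.ofReal_sum_of_nonneg fun e _ => mul_nonneg (hm _) (add_nonneg (hS0 _ _)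
          (hS0 _ _))]
    _ ≤ 10 * avgK p δ (fun s => ENNReal.ofReal (2 * d * (1 + c) ^ 2) *
          ENNReal.ofReal (∑ e, m e.1 * h s e)) t := by
        refine mul_le_mul_right (avgK_mono fun s _ => ?_) _
        rw [← ENNReal.ofReal_mul (by positivity)]
        exact ENNReal.ofReal_le_ofReal (hstat s)
    _ = _ := by
        rw [avgK_const_mul ENNReal.ofReal_ne_top, ← mul_assoc,
          show (10 : ℝ≥0∞) = ENNReal.ofReal 10 by norm_num, ← ENNReal.ofReal_mul (by norm_num)]
        congr 2
        ring

end Moderation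

end GradPhi

namespace GradPhi

/-! ### From functionals with values in `[0, ∞]` to real norm bounds -/

section Bridge

variable {d L : ℕ} {p p' δ : ℝ}

lemma normAvg_ofReal {q : ℝ} (hq : 0 < q) {U : Finset (Torus d L)} (hU : 0 < U.card)
    {u : Edge d L → ℝ} (hu : ∀ e, 0 ≤ u e) :
    normAvg q U (fun e => ENNReal.ofReal (u e))
      = ENNReal.ofReal (((U.card : ℝ)⁻¹ * ∑ e ∈ edgesIn U, u e ^ q) ^ (1 / q)) := by
  have hU' : (0 : ℝ) < U.card := by exact_mod_cast hU
  have hs : 0 ≤ ∑ e ∈ edgesIn U, u e ^ q :=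
    Finset.sum_nonneg fun e _ => Real.rpow_nonneg (hu e) q
  rw [normAvg, ← ENNReal.ofReal_rpow_of_nonneg (by positivity) (by positivity),
    ENNReal.ofReal_mul (by positivity), ENNReal.ofReal_inv_of_pos hU', ENNReal.ofReal_natCast,
    ENNReal.ofReal_sum_of_nonneg fun e _ => Real.rpow_nonneg (hu e) q]
  simp only [ENNReal.ofReal_rpow_of_nonneg (hu _) hq.le]

lemma edgesIn_univ : edgesIn (Finset.univ : Finset (Torus d L)) = Finset.univ := by
  simp [edgesIn]

/-- A single edge where the moderated environment vanishes makes the norm of its inverse over the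
whole torus infinite. -/
lemma pos_of_normAvg_wInv_ne_top {q : ℝ} (hq : 0 < q) {a : ℝ → Edge d L → ℝ} {t : ℝ}
    (h : normAvg q Finset.univ (wInv p δ a t) ≠ ⊤) (e : Edge d L) : 0 < modEnv p δ a t e := by
  by_contra hw
  refine h ?_
  have hw0 : wInv p δ a t e = ⊤ := by
    rw [wInv, wE, ENNReal.ofReal_of_nonpos (not_lt.1 hw), ENNReal.inv_zero]
  have hs : ∑ e ∈ edgesIn (Finset.univ : Finset (Torus d L)), wInv p δ a t e ^ q = ⊤ := by
    rw [edgesIn_univ, ENNReal.sum_eq_top]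
    exact ⟨e, Finset.mem_univ _, by rw [hw0, ENNReal.top_rpow_of_pos hq]⟩
  rw [normAvg, hs, ENNReal.mul_top (ENNReal.inv_ne_zero.2 (ENNReal.natCast_ne_top _)), ENNReal.top_rpow_of_pos (by positivity)]

lemma wInv_eq_ofReal {a : ℝ → Edge d L → ℝ} {t : ℝ} (h : ∀ e, 0 < modEnv p δ a t e) :
    wInv p δ a t = fun e => ENNReal.ofReal |(modEnv p δ a t e)⁻¹| := by
  funext e
  rw [wInv, wE, abs_of_nonneg (inv_nonneg.2 (h e).le), ENNReal.ofReal_inv_of_pos (h e)]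

lemma normAvg_sq_le_calMp' {a : ℝ → Edge d L → ℝ} {t : ℝ} {r : ℕ} (h1 : 1 ≤ r) (hr : r ≤ L) :
    normAvg p' (box d L r) (wInv p δ a t) ^ 2 ≤ calMp' p p' δ a t := by
  rw [calMp']
  refine le_trans ?_ le_add_self
  refine (le_iSup₂_of_le (f := fun r _ => normAvg p' (box d L r) (wInv p δ a t) ^ 2) r
    (Finset.mem_Icc.2 ⟨h1, hr⟩) le_rfl).trans ?_
  exact le_mul_of_one_le_left (by positivity) (one_le_pow₀ le_self_add)

lemma sq_ne_top {x : ℝ≥0∞} (h : x ^ 2 ≠ ⊤) : x ≠ ⊤ := by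
  rintro rfl; simp at h

/-- Finiteness of `𝓜_{p'}` gives norm bounds for the inverse of the moderated environment. -/
lemma invNormLE_of_calMp'_ne_top (hL : 1 ≤ L) (hp' : 0 < p') {a : ℝ → Edge d L → ℝ} {t : ℝ}
    (h : calMp' p p' δ a t ≠ ⊤) :
    InvNormLE p' (modEnv p δ a t) √(calMp' p p' δ a t).toReal := by
  have hpos : ∀ e, 0 < modEnv p δ a t e := by
    refine pos_of_normAvg_wInv_ne_top hp' (sq_ne_top (ne_top_of_le_ne_top h ?_))
    have := normAvg_sq_le_calMp' (p := p) (p' := p') (δ := δ) (a := a) (t := t) hL le_rfl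
    rwa [box_eq_univ le_rfl] at this
  refine ⟨hpos, fun r h1 hr => Real.le_sqrt_of_sq_le ?_⟩
  have h2 := normAvg_sq_le_calMp' (p := p) (p' := p') (δ := δ) (a := a) (t := t) h1 hr
  rw [wInv_eq_ofReal hpos, normAvg_ofReal hp' (card_box_pos r) fun e => abs_nonneg _,
    ← ENNReal.ofReal_pow (by positivity)] at h2
  exact (ENNReal.ofReal_le_iff_le_toReal h).1 h2

lemma one_le_calM0 {a : ℝ → Edge d L → ℝ} {t : ℝ} : 1 ≤ calM0 p δ a t := le_self_add

/-- Finiteness of `𝓜_0` gives norm bounds, unless the environment vanishes. -/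
lemma prodNormLE_of_calM0_ne_top (hσ : 0 < sigmaD d) (hτ : 0 < tauD' d)
    {a : ℝ → Edge d L → ℝ} {t : ℝ} (ha : ∀ e, 0 ≤ a t e) (h : calM0 p δ a t ≠ ⊤) :
    (∀ e, a t e = 0) ∨
      ProdNormLE (sigmaD d) (tauD' d) (a t) (modEnv p δ a t) (calM0 p δ a t).toReal := by
  have hle : ∀ r ≤ L, normAvg (sigmaD d) (box d L r) (fun e => ENNReal.ofReal √(a t e)) ^ 2
      * (1 + normAvg (tauD' d) (box d L r) (wInv p δ a t) ^ 2) ≤ calM0 p δ a t := by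
    intro r hr
    rw [calM0]
    refine le_trans ?_ le_add_self
    exact le_iSup₂_of_le (f := fun r _ =>
      normAvg (sigmaD d) (box d L r) (fun e => ENNReal.ofReal √(a t e)) ^ 2
      * (1 + normAvg (tauD' d) (box d L r) (wInv p δ a t) ^ 2)) r
      (Finset.mem_Icc.2 ⟨Nat.zero_le r, hr⟩) le_rfl
  -- If `a` vanishes identically, the convention `0 * ∞ = 0` lets `calM0` be finite without any
  -- information on `modEnv`. Otherwise the factor with `√a` at radius `L` is positive and an
  -- infinite inverse norm is excluded.
  by_cases hz : ∀ e, a t e = 0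
  · exact Or.inl hz
  refine Or.inr ?_
  push Not at hz
  obtain ⟨e, he⟩ := hz
  have hpos : ∀ e, 0 < modEnv p δ a t e := by
    refine pos_of_normAvg_wInv_ne_top hτ fun htop => ?_
    have h1 := hle L le_rfl
    rw [box_eq_univ le_rfl, htop] at h1
    refine h (top_le_iff.1 (le_trans (le_of_eq ?_) h1))
    rw [ENNReal.top_pow two_ne_zero, add_top, ENNReal.mul_top]
    refine pow_ne_zero 2 ?_
    rw [normAvg, Ne, ENNReal.rpow_eq_zero_iff]
    push Not
    refine ⟨fun h0 => absurd h0 (mul_ne_zero (ENNReal.inv_ne_zero.2 (ENNReal.natCast_ne_top _)) ?_), fun _ => by positivity⟩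
    rw [edgesIn_univ, Ne, Finset.sum_eq_zero_iff]
    push Not
    refine ⟨e, Finset.mem_univ _, ?_⟩
    have : 0 < √(a t e) := Real.sqrt_pos.2 ((ha e).lt_of_ne' he)
    rw [ENNReal.ofReal_rpow_of_pos this]
    simp only [ne_eq, ENNReal.ofReal_eq_zero, not_le]
    positivity
  refine ⟨ha, hpos, ?_, fun r hr => ?_⟩
  · exact (ENNReal.ofReal_le_iff_le_toReal h).1 (by simpa using one_le_calM0)
  · have h2 := hle r hr
    rw [wInv_eq_ofReal hpos, normAvg_ofReal hτ (card_box_pos r) fun e => abs_nonneg _,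
      normAvg_ofReal hσ (card_box_pos r) fun e => Real.sqrt_nonneg _,
      ← ENNReal.ofReal_pow (by positivity), ← ENNReal.ofReal_pow (by positivity),
      ← ENNReal.ofReal_one, ← ENNReal.ofReal_add zero_le_one (by positivity),
      ← ENNReal.ofReal_mul (by positivity)] at h2
    exact (ENNReal.ofReal_le_iff_le_toReal h).1 h2

end Bridge

/-! ### Measurability in time of the functionals -/

section Measurability

variable {d L : ℕ} {p p' δ : ℝ} {a : ℝ → Edge d L → ℝ}

lemma IsEnv.measurable_modEnv (ha : IsEnv a) (p δ : ℝ) (e : Edge d L) :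
    Measurable fun t => modEnv p δ a t e := by
  classical
  have hprim : ∀ e', Continuous fun q : ℝ × ℝ => ∫ s' in q.1..q.2, max (a s' e') 1 := by
    intro e'
    have hc : Continuous fun s' => max (a s' e') 1 := (ha.cont e').max continuous_const
    have h1 : Continuous fun t => ∫ s' in (0 : ℝ)..t, max (a s' e') 1 :=
      intervalIntegral.continuous_primitive (fun _ _ => hc.intervalIntegrable _ _) 0
    have h2 : (fun q : ℝ × ℝ => ∫ s' in q.1..q.2, max (a s' e') 1)
        = fun q => (∫ s' in (0 : ℝ)..q.2, max (a s' e') 1) - ∫ s' in (0 : ℝ)..q.1, max (a s' e') 1 :=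
      funext fun q => (intervalIntegral.integral_interval_sub_left
        (hc.intervalIntegrable _ _) (hc.intervalIntegrable _ _)).symm
    rw [h2]
    exact (h1.comp continuous_snd).sub (h1.comp continuous_fst)
  refine Measurable.sqrt ?_
  set f : ℝ × ℝ → ℝ := fun q => kSmall p δ (q.2 - q.1) * (min (a q.2 e) 1 /
      ((q.2 - q.1)⁻¹ * ∑ e' : Edge d L with EdgesMeet e e', ∫ s' in q.1..q.2, max (a s' e') 1))
    with hf
  have hfm : Measurable f := by
    refine Measurable.mul ((measurable_kSmall p δ).comp (measurable_snd.sub measurable_fst))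
      (Measurable.div ?_ (Measurable.mul (measurable_snd.sub measurable_fst).inv ?_))
    · exact (((ha.cont e).measurable.comp measurable_snd).min measurable_const)
    · exact Finset.measurable_fun_sum _ fun e' _ => (hprim e').measurable
  have h1 : ∀ t : ℝ, ∫ s in Ioi t, f (t, s)
      = ∫ s, ({q : ℝ × ℝ | q.1 < q.2}.indicator f) (t, s) := by
    intro t
    rw [← integral_indicator measurableSet_Ioi]
    rfl
  have h2 : Measurable fun t => ∫ s in Ioi t, f (t, s) := by
    simp only [h1]
    refine StronglyMeasurable.measurable (StronglyMeasurable.integral_prod_right ?_)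
    exact (Measurable.indicator hfm (measurableSet_lt measurable_fst
      measurable_snd)).stronglyMeasurable
  exact h2

lemma IsEnv.measurable_wE (ha : IsEnv a) (p δ : ℝ) (e : Edge d L) :
    Measurable fun t => wE p δ a t e := (ha.measurable_modEnv p δ e).ennreal_ofReal

lemma IsEnv.measurable_wInv (ha : IsEnv a) (p δ : ℝ) (e : Edge d L) :
    Measurable fun t => wInv p δ a t e := (ha.measurable_wE p δ e).inv

lemma measurable_normAvg {u : ℝ → Edge d L → ℝ≥0∞} (hu : ∀ e, Measurable fun t => u t e) (q : ℝ)
    (U : Finset (Torus d L)) : Measurable fun t => normAvg q U (u t) := by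
  unfold normAvg
  have h : Measurable fun t => ∑ e ∈ edgesIn U, u t e ^ q :=
    Finset.measurable_fun_sum _ fun e _ => (hu e).pow_const q
  exact (h.const_mul _).pow_const _

lemma IsEnv.measurable_calMp' (ha : IsEnv a) (p p' δ : ℝ) : Measurable (calMp' p p' δ a) := by
  have h : Measurable fun t => normAvg (sigmaD d) Finset.univ (wE p δ a t)
      * normAvg (tauD d) Finset.univ (wInv p δ a t) :=
    (measurable_normAvg (ha.measurable_wE p δ) _ _).mul
      (measurable_normAvg (ha.measurable_wInv p δ) _ _)
  have h1 : Measurable fun t => ⨆ r ∈ Finset.Icc 1 L,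
      normAvg p' (box d L r) (wInv p δ a t) ^ 2 :=
    Measurable.iSup fun r => Measurable.iSup fun _ =>
      (measurable_normAvg (ha.measurable_wInv p δ) _ _).pow_const 2
  exact (((h.const_add 1).pow_const 2).mul h1).const_add 1

lemma IsEnv.measurable_calM0 (ha : IsEnv a) (p δ : ℝ) : Measurable (calM0 p δ a) := by
  have h : ∀ r, Measurable fun t =>
      normAvg (sigmaD d) (box d L r) (fun e => ENNReal.ofReal √(a t e)) ^ 2
      * (1 + normAvg (tauD' d) (box d L r) (wInv p δ a t) ^ 2) := fun r =>
    ((measurable_normAvg (fun e => (ha.cont e).measurable.sqrt.ennreal_ofReal) _ _).pow_const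
      2).mul (((measurable_normAvg (ha.measurable_wInv p δ) _ _).pow_const 2).const_add 1)
  exact Measurable.const_add (Measurable.iSup fun r => Measurable.iSup fun _ => h r) 1

end Measurability

/-! ### Hölder's inequality for kernel averages -/

section Holder

variable {d L : ℕ} {p p' δ : ℝ} {a : ℝ → Edge d L → ℝ}

/-- Hölder's inequality with three exponents. -/
lemma lintegral_mul_mul_rpow_le {μ : Measure ℝ} {α β γ : ℝ} (hα : 0 < α) (hβ : 0 < β)
    (hγ : 0 < γ) (h1 : α + β + γ = 1) {f g h : ℝ → ℝ≥0∞} (hf : AEMeasurable f μ)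
    (hg : AEMeasurable g μ) (hh : AEMeasurable h μ) :
    ∫⁻ s, f s ^ β * g s ^ α * h s ^ γ ∂μ
      ≤ (∫⁻ s, f s ∂μ) ^ β * (∫⁻ s, g s ∂μ) ^ α * (∫⁻ s, h s ∂μ) ^ γ := by
  have := ENNReal.lintegral_prod_norm_pow_le (μ := μ) (Finset.univ : Finset (Fin 3))
    (f := ![f, g, h]) (p := ![β, α, γ]) ?_ ?_ ?_
  · simpa [Fin.prod_univ_three] using this
  · intro i _; fin_cases i <;> assumption
  · simp [Fin.sum_univ_three]; linarith
  · intro i _; fin_cases i <;> simp <;> linarith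

/-- Averages of products controlled with `𝓜_3`. -/
lemma avgK_le_calM3_mul (hK : KernelSmall p δ) (hp : 2 < p) (hδ : 0 < δ) (ha : IsEnv a)
    (hα : 0 < alphaE d p p') (hβ : 0 < betaE d p p') (hγ : 0 < gammaE d p p')
    (h1 : alphaE d p p' + betaE d p p' + gammaE d p p' = 1)
    {G X H : ℝ → ℝ≥0∞} (hX : Measurable X) (hH : Measurable H) {c0 c1 : ℝ≥0∞}
    (hc1 : c1 ≠ ⊤) {t : ℝ} (hfin : calM3 p p' δ a t ≠ ⊤)
    (hG : ∀ s, t < s → calMp' p p' δ a s ≠ ⊤ →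
      G s ≤ c0 + c1 * (calMp' p p' δ a s ^ alphaE d p p' * X s ^ alphaE d p p'
        * H s ^ gammaE d p p')) :
    avgK p δ G t ≤ c0 + c1 * (calM3 p p' δ a t * avgK p δ X t ^ alphaE d p p'
      * avgK p δ H t ^ gammaE d p p') := by
  set α := alphaE d p p' with hα'
  set β := betaE d p p' with hβ'
  set γ := gammaE d p p' with hγ'
  have hMm := ha.measurable_calMp' p p' δ
  set N : ℝ → ℝ≥0∞ := fun s => calMp' p p' δ a s ^ (α / β) with hN
  have hNm : Measurable N := hMm.pow_const _
  have hkm := measurable_kernel_comp_sub p δ t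
  have hNfin : avgK p δ N t ≠ ⊤ := by
    intro htop
    refine hfin ?_
    rw [calM3]
    change 1 + (avgK p δ N t) ^ β = ⊤
    rw [htop, ENNReal.top_rpow_of_pos hβ, add_top]
  -- The kernel is positive, so finiteness of `calM3` at time `t` makes `calMp'` finite at almost
  -- every later time; the pointwise hypothesis is required only there.
  have hae : ∀ᵐ s ∂(volume.restrict (Ioi t)), calMp' p p' δ a s ≠ ⊤ := by
    have h2 := ae_lt_top (hkm.mul hNm) hNfin
    filter_upwards [h2, ae_restrict_mem measurableSet_Ioi] with s hs hst htop
    have hpos : 0 < kSmall p δ (s - t) := by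
      have : 0 < s - t := sub_pos.2 hst
      unfold kSmall; positivity
    refine hs.ne ?_
    simp only [Pi.mul_apply, hN, htop]
    rw [ENNReal.top_rpow_of_pos (by positivity), ENNReal.mul_top]
    exact (ENNReal.ofReal_pos.2 (hpos.trans_le (kSmall_le_kBig hδ
      (sub_nonneg.2 (le_of_lt hst))))).ne'
  calc avgK p δ G t ≤ ∫⁻ s in Ioi t, (ENNReal.ofReal (kBig p δ (s - t)) * c0
        + c1 * ((ENNReal.ofReal (kBig p δ (s - t)) * N s) ^ β
          * (ENNReal.ofReal (kBig p δ (s - t)) * X s) ^ α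
          * (ENNReal.ofReal (kBig p δ (s - t)) * H s) ^ γ)) := by
        refine lintegral_mono_ae ?_
        filter_upwards [hae, ae_restrict_mem measurableSet_Ioi] with s hs hst
        refine (mul_le_mul_right (hG s hst hs) _).trans (le_of_eq ?_)
        rw [mul_add]
        congr 1
        rw [ENNReal.mul_rpow_of_nonneg _ _ hβ.le, ENNReal.mul_rpow_of_nonneg _ _ hα.le,
          ENNReal.mul_rpow_of_nonneg _ _ hγ.le, hN]
        simp only
        rw [← ENNReal.rpow_mul, div_mul_cancel₀ _ hβ.ne']
        set k := ENNReal.ofReal (kBig p δ (s - t)) with hk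
        -- The kernel is shared among the three factors in proportion to their Hölder exponents.
        have e1 : k = k ^ β * k ^ α * k ^ γ := by
          rw [← ENNReal.rpow_add_of_nonneg _ _ hβ.le hα.le,
            ← ENNReal.rpow_add_of_nonneg _ _ (by positivity) hγ.le,
            show β + α + γ = 1 by linarith, ENNReal.rpow_one]
        nth_rewrite 1 [e1]
        ring
    _ = avgK p δ (fun _ => c0) t + c1 * ∫⁻ s in Ioi t,
          ((ENNReal.ofReal (kBig p δ (s - t)) * N s) ^ β
          * (ENNReal.ofReal (kBig p δ (s - t)) * X s) ^ α
          * (ENNReal.ofReal (kBig p δ (s - t)) * H s) ^ γ) := by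
        rw [lintegral_add_left (hkm.mul_const c0), lintegral_const_mul' _ _ hc1]
        rfl
    _ ≤ c0 + c1 * (avgK p δ N t ^ β * avgK p δ X t ^ α * avgK p δ H t ^ γ) := by
        refine add_le_add (avgK_const_le hK hp hδ c0 t) (mul_le_mul_right ?_ _)
        exact lintegral_mul_mul_rpow_le hα hβ hγ h1 (hkm.mul hNm).aemeasurable
          (hkm.mul hX).aemeasurable (hkm.mul hH).aemeasurable
    _ ≤ _ := by
        gcongr
        rw [calM3]
        exact le_add_self

end Holder

end GradPhi

namespace GradPhi

/-! ### The exponents of the statement satisfy the relations used -/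

section Exponents

variable {d : ℕ} {p p' : ℝ}

/-- For any value of the interpolation parameter the three exponents sum to one and satisfy the
homogeneity relation. The value `thetaC` fixes the one remaining degree of freedom, so that the
split between averaging and anchoring corresponds to integrability `p'` of the inverse weight. -/
lemma nashExponents (hd : 2 ≤ d) (hp : (d : ℝ) < p) (hp' : (d : ℝ) < p') :
    NashExponents d p p' (alphaE d p p') (betaE d p p') (gammaE d p p') := by
  have hd2 : (2 : ℝ) ≤ d := by exact_mod_cast hd
  have hd0 : (0 : ℝ) < d := by linarith
  have hp0 : (0 : ℝ) < p := by linarith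
  have hp'0 : (0 : ℝ) < p' := by linarith
  have hr : (0 : ℝ) < p' / d - 1 := sub_pos.2 ((one_lt_div hd0).2 hp')
  set x := (d * p + 2 * p) / (d * p + 2 * d) * (p' / d - 1) with hx
  have hx0 : 0 < x := by positivity
  have hθ : thetaC d p p' = 1 / (1 + x) := rfl
  have hθ0 : 0 < thetaC d p p' := by rw [hθ]; positivity
  have hθ1 : thetaC d p p' < 1 := by rw [hθ, div_lt_one (by positivity)]; linarith
  have hθ' : 1 - thetaC d p p' = x / (1 + x) := by rw [hθ]; field_simp; ring
  refine ⟨?_, ?_, ?_, ?_, ?_, ?_⟩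
  · unfold alphaE
    have : 0 < 1 - thetaC d p p' := by linarith
    positivity
  · unfold betaE
    have : 0 < 1 - thetaC d p p' := by linarith
    positivity
  · unfold gammaE
    positivity
  · unfold alphaE betaE gammaE
    field_simp
    ring
  · unfold alphaE betaE
    rw [hθ', hθ, hx]
    have h1 : p' - d ≠ 0 := by linarith
    field_simp
    ring
  · unfold alphaE gammaE
    rw [hθ', hθ, hx]
    field_simp
    ring

lemma one_sub_alphaE_sub_gammaE (h : NashExponents d p p' (alphaE d p p') (betaE d p p')
    (gammaE d p p')) : 1 - alphaE d p p' - gammaE d p p' = betaE d p p' := by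
  linarith [h.add_eq]

lemma inv_kappaD (hd : 2 ≤ d) : (kappaD d)⁻¹ = ((d : ℝ) ^ 2 - 2) / (d * (2 * d + 2)) := by
  have hd2 : (2 : ℝ) ≤ d := by exact_mod_cast hd
  have h2 : (0 : ℝ) < d ^ 2 - 2 := by nlinarith
  have h3 : (d : ℝ) - lambdaD d = (d ^ 2 - 2) / (d + 2) := by
    unfold lambdaD; field_simp; ring
  unfold kappaD
  rw [h3, lambdaD]
  field_simp

lemma two_lt_kappaD (hd : 2 ≤ d) : 2 < kappaD d := by
  have hd2 : (2 : ℝ) ≤ d := by exact_mod_cast hd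
  have h2 : (0 : ℝ) < d ^ 2 - 2 := by nlinarith
  have h := inv_kappaD hd
  rw [← inv_inv (kappaD d), h, inv_div, lt_div_iff₀ h2]
  nlinarith

/-- `kappaD` is the Sobolev conjugate of `lambdaD`. Using the slightly larger source exponent
`lambdaD'` leaves the positive margin `d * (1 / lambdaD - 1 / lambdaD')`, which is the exponent
required to be positive. -/
lemma sobolevExponents (hd : 2 ≤ d) : SobolevExponents d (lambdaD' d) (kappaD d) (sigmaD d)
    (tauD' d) (1 - d * (1 / lambdaD' d - 1 / kappaD d)) (d * (1 / 2 - 1 / kappaD d)) := by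
  have hd2 : (2 : ℝ) ≤ d := by exact_mod_cast hd
  have hk := two_lt_kappaD hd
  have hl1 : 1 ≤ lambdaD' d := by
    unfold lambdaD'; rw [le_div_iff₀ (by linarith)]; linarith
  have hl2 : lambdaD' d < 2 := by
    unfold lambdaD'; rw [div_lt_iff₀ (by linarith)]; linarith
  refine ⟨hl1, (hl2.trans hk).le, hk, ?_, ?_, ?_, rfl, rfl, ?_⟩
  · unfold tauD'
    have : 0 < 2 - lambdaD' d := by linarith
    positivity
  · unfold sigmaD
    have : kappaD d - 2 ≠ 0 := by linarith
    field_simp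
    ring
  · unfold tauD'
    have : 2 - lambdaD' d ≠ 0 := by linarith
    field_simp
    ring
  · rw [one_div (kappaD d), inv_kappaD hd, lambdaD', one_div_div]
    have : 1 - (d : ℝ) * ((d + 2) / (2 * d + 3) - (d ^ 2 - 2) / (d * (2 * d + 2)))
        = d * (d + 2) / ((2 * d + 3) * (2 * d + 2)) := by field_simp; ring
    rw [this]; positivity

/-- The power `1 + ζ / η` of the weighted Sobolev inequality, expressed as the power of `calM0` in
the moment estimate. -/
lemma one_add_div_eq (hd : 2 ≤ d) : 1 + (d * (1 / 2 - 1 / kappaD d))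
    / (1 - d * (1 / lambdaD' d - 1 / kappaD d)) = 1 / (1 - thetaD d) := by
  have hd2 : (2 : ℝ) ≤ d := by exact_mod_cast hd
  rw [one_div (kappaD d), inv_kappaD hd, lambdaD', one_div_div]
  have h1 : 1 - (d : ℝ) * ((d + 2) / (2 * d + 3) - (d ^ 2 - 2) / (d * (2 * d + 2)))
        = d * (d + 2) / ((2 * d + 3) * (2 * d + 2)) := by field_simp; ring
  have h2 : (d : ℝ) * (1 / 2 - (d ^ 2 - 2) / (d * (2 * d + 2))) = (d + 2) / (2 * d + 2) := by
    field_simp; ring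
  have h3 : 1 - thetaD d = d / (3 * d + 3) := by unfold thetaD; field_simp; ring
  rw [h1, h2, h3]
  field_simp
  ring

lemma sigmaD_pos (hd : 2 ≤ d) : 0 < sigmaD d := by linarith [(sobolevExponents hd).two_lt_σ]

lemma thetaD_lt_one (hd : 2 ≤ d) : thetaD d < 1 := by
  have hd2 : (2 : ℝ) ≤ d := by exact_mod_cast hd
  have h3 : 1 - thetaD d = d / (3 * d + 3) := by unfold thetaD; field_simp; ring
  have : (0 : ℝ) < d / (3 * d + 3) := by positivity
  linarith

end Exponents

/-! ### Conservation of mass, energy identity and positivity -/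

section Evolution

variable {d L : ℕ} {a : ℝ → Edge d L → ℝ} {v : ℝ → Torus d L → ℝ}

/-- Evolution of nonlinear weighted sums along a solution. -/
lemma IsSol.sum_comp_eq (hL : 1 ≤ L) (ha : IsEnv a) (hv : IsSol a v) {F F' : ℝ → ℝ}
    (hF : ∀ r, HasDerivAt F (F' r) r) (hF' : Continuous F') (m : Torus d L → ℝ) {t1 t2 : ℝ}
    (h0 : 0 ≤ t1) (h12 : t1 ≤ t2) :
    ∑ x, m x * F (v t2 x) = ∑ x, m x * F (v t1 x)
      - ∫ t in t1..t2, ∑ e, a t e * edgeDiff (v t) e * edgeDiff (fun x => m x * F' (v t x)) e := by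
  have hFc : Continuous F := continuous_iff_continuousAt.2 fun r => (hF r).continuousAt
  have hder : ∀ t ∈ Ioo t1 t2, HasDerivAt (fun t => ∑ x, m x * F (v t x))
      (-∑ e, a t e * edgeDiff (v t) e * edgeDiff (fun x => m x * F' (v t x)) e) t := by
    intro t ht
    rw [← sum_mul_flow hL]
    have := HasDerivAt.fun_sum (u := Finset.univ) fun x (_ : x ∈ Finset.univ) =>
      ((hF (v t x)).comp t (hv.deriv t (h0.trans_lt ht.1) x)).const_mul (m x)
    simpa only [Function.comp_def, mul_assoc] using this
  have hc : Continuous fun t => ∑ e, a t e * edgeDiff (v t) e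
      * edgeDiff (fun x => m x * F' (v t x)) e := by
    refine continuous_finsetSum _ fun e _ => ((ha.cont e).mul (hv.cont_edgeDiff e)).mul ?_
    exact ((hF'.comp (hv.cont _)).const_mul _).sub ((hF'.comp (hv.cont _)).const_mul _)
  have := intervalIntegral.integral_eq_sub_of_hasDerivAt_of_le h12
    (f := fun t => ∑ x, m x * F (v t x))
    (continuous_finsetSum _ fun x _ => (hFc.comp (hv.cont x)).const_mul _).continuousOn hder
    (hc.neg.intervalIntegrable _ _)
  rw [intervalIntegral.integral_neg] at this
  linarith

lemma IsSol.sum_eq (hL : 1 ≤ L) (ha : IsEnv a) (hv : IsSol a v) {t : ℝ} (ht : 0 ≤ t) :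
    ∑ x, v t x = ∑ x, v 0 x := by
  have := hv.sum_comp_eq hL ha (F := id) (F' := fun _ => 1) (fun r => hasDerivAt_id r)
    continuous_const (fun _ => 1) le_rfl ht
  simpa using this

/-- The energy identity. -/
lemma IsSol.energy_eq (hL : 1 ≤ L) (ha : IsEnv a) (hv : IsSol a v) {t1 t2 : ℝ} (h0 : 0 ≤ t1)
    (h12 : t1 ≤ t2) : ∑ x, v t2 x ^ 2 + 2 * ∫ t in t1..t2, ∑ e, a t e * edgeDiff (v t) e ^ 2
      = ∑ x, v t1 x ^ 2 := by
  have := hv.sum_comp_eq hL ha (F := fun r => r ^ 2) (F' := fun r => 2 * r)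
    (fun r => by simpa using hasDerivAt_pow 2 r) (by fun_prop) (fun _ => 1) h0 h12
  simp only [one_mul] at this
  rw [this, ← intervalIntegral.integral_const_mul, sub_add_eq_add_sub, add_sub_assoc, add_eq_left,
    sub_eq_zero]
  refine intervalIntegral.integral_congr fun t _ => ?_
  rw [Finset.mul_sum]
  exact Finset.sum_congr rfl fun e _ => by unfold edgeDiff; ring

lemma hasDerivAt_min_zero_sq (r : ℝ) : HasDerivAt (fun r : ℝ => min r 0 ^ 2) (2 * min r 0) r := by
  rcases lt_trichotomy r 0 with h | h | h
  · rw [min_eq_left h.le]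
    have := hasDerivAt_pow 2 r
    simp only [Nat.cast_ofNat, Nat.add_one_sub_one, pow_one] at this
    refine this.congr_of_eventuallyEq ?_
    filter_upwards [Iio_mem_nhds h] with s hs
    rw [min_eq_left (le_of_lt hs)]
  · subst h
    rw [min_self, mul_zero, hasDerivAt_iff_isLittleO_nhds_zero]
    refine Asymptotics.IsBigO.trans_isLittleO (g := fun h : ℝ => h ^ 2) ?_ ?_
    · refine Asymptotics.IsBigO.of_bound 1 (Eventually.of_forall fun h => ?_)
      simp only [zero_add, min_self, smul_zero, sub_zero, one_mul]
      norm_num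
      rcases le_total h 0 with h1 | h1
      · rw [min_eq_left h1]
      · rw [min_eq_right h1]; simp; positivity
    · simpa using Asymptotics.isLittleO_pow_id (𝕜 := ℝ) (n := 2) (by norm_num)
  · rw [min_eq_right h.le, mul_zero]
    refine (hasDerivAt_const r (0 : ℝ)).congr_of_eventuallyEq ?_
    filter_upwards [Ioi_mem_nhds h] with s hs
    rw [min_eq_right (le_of_lt hs)]; simp

/-- The sum of the squared negative parts starts at zero and cannot increase: its dissipation pairs
increments of `v` with increments of `min v 0`, which have the same sign. The squared negative part
is C¹, as the evolution identity requires. -/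
lemma IsSol.nonneg (hL : 1 ≤ L) (ha : IsEnv a) (hv : IsSol a v) (h0 : ∀ x, 0 ≤ v 0 x) {t : ℝ}
    (ht : 0 ≤ t) (x : Torus d L) : 0 ≤ v t x := by
  have h := hv.sum_comp_eq hL ha hasDerivAt_min_zero_sq (by fun_prop) (fun _ => 1) le_rfl ht
  have h1 : ∑ x, (1 : ℝ) * min (v 0 x) 0 ^ 2 = 0 :=
    Finset.sum_eq_zero fun x _ => by rw [min_eq_right (h0 x)]; simp
  have h2 : 0 ≤ ∫ s in (0 : ℝ)..t, ∑ e, a s e * edgeDiff (v s) e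
      * edgeDiff (fun x => 1 * (2 * min (v s x) 0)) e := by
    refine intervalIntegral.integral_nonneg ht fun s _ => Finset.sum_nonneg fun e _ => ?_
    rw [mul_assoc]
    refine mul_nonneg (ha.nonneg s e) ?_
    unfold edgeDiff
    rcases le_total (v s (shift e.1 e.2)) (v s e.1) with h3 | h3
    · refine mul_nonneg_of_nonpos_of_nonpos (by linarith) ?_
      have := min_le_min_right 0 h3
      linarith
    · refine mul_nonneg (by linarith) ?_
      have := min_le_min_right 0 h3
      linarith
  rw [h1] at h
  have h3 : ∑ x, (1 : ℝ) * min (v t x) 0 ^ 2 = 0 :=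
    le_antisymm (by linarith) (Finset.sum_nonneg fun x _ => by positivity)
  rw [Finset.sum_eq_zero_iff_of_nonneg fun x _ => by positivity] at h3
  have h4 := h3 x (Finset.mem_univ x)
  simp only [one_mul, ne_eq, OfNat.ofNat_ne_zero, not_false_eq_true, pow_eq_zero_iff] at h4
  exact min_eq_right_iff.1 h4

lemma IsSol.add_const (hv : IsSol a v) (c : ℝ) : IsSol a fun t x => v t x + c := by
  refine ⟨fun x => (hv.cont x).add continuous_const, fun t ht x => ?_⟩
  have h : flow (a t) (fun x => v t x + c) x = flow (a t) (v t) x := by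
    simp only [flow, edgeDiff, add_sub_add_right_eq_sub]
  rw [h]
  exact (hv.deriv t ht x).add_const c

end Evolution

/-! ### Dissipation of weighted energies -/

section Weighted

variable {d L : ℕ}

lemma starNorm_shift_le (x : Torus d L) (i : Fin d) : starNorm (shift x i) ≤ 2 * starNorm x := by
  have h : ((supNorm (shift x i) : ℕ) : ℝ) ≤ supNorm x + 1 := by exact_mod_cast supNorm_shift_le x i
  have := Nat.cast_nonneg (α := ℝ) (supNorm x)
  unfold starNorm; linarith

lemma starNorm_le_shift (x : Torus d L) (i : Fin d) : starNorm x ≤ 2 * starNorm (shift x i) := by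
  have h : (supNorm x : ℝ) ≤ supNorm (shift x i) + 1 := by exact_mod_cast supNorm_le_shift x i
  have := Nat.cast_nonneg (α := ℝ) (supNorm (shift x i))
  unfold starNorm; linarith

lemma abs_rpow_sub_rpow_le {p x y : ℝ} (hp : 1 ≤ p) (hx : 1 ≤ x) (hy : 1 ≤ y) (hxy : |y - x| ≤ 1)
    (h2 : y ≤ 2 * x) : |y ^ p - x ^ p| ≤ p * 2 ^ (p - 1) * x ^ (p - 1) := by
  have h := (convex_Icc 1 (2 * x)).norm_image_sub_le_of_norm_hasDerivWithin_le
    (f := fun r : ℝ => r ^ p) (f' := fun r => p * r ^ (p - 1)) (C := p * (2 * x) ^ (p - 1))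
    (x := x) (y := y) (fun r hr => (Real.hasDerivAt_rpow_const
      (Or.inr hp)).hasDerivWithinAt) (fun r hr => ?_) ⟨hx, by linarith⟩ ⟨hy, h2⟩
  · rw [Real.norm_eq_abs, Real.norm_eq_abs] at h
    refine h.trans ((mul_le_of_le_one_right (by positivity) hxy).trans (le_of_eq ?_))
    rw [Real.mul_rpow (by norm_num) (by linarith), mul_assoc]
  · have : 0 ≤ r := zero_le_one.trans hr.1
    rw [Real.norm_of_nonneg (by positivity)]
    exact mul_le_mul_of_nonneg_left (Real.rpow_le_rpow this hr.2 (by linarith)) (by linarith)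

/-- Here `P` and `Q` are the weights at the two endpoints of an edge. The increment of the product
splits into a dissipation and a cross term containing `Q - P`. Completing the square absorbs the
cross term into part of the dissipation, at a cost of order `(Q - P) ^ 2 / P`. -/
lemma neg_mul_sub_le {P Q U K : ℝ} (hP0 : 0 < P) (hQ0 : 0 < Q)
    (hsq : (Q - P) ^ 2 ≤ K ^ 2 * (P * U)) (f g : ℝ) :
    -((g - f) * (Q * (2 * g) - P * (2 * f))) ≤ -(1 / 2 * (P * (g - f) ^ 2))
      + K ^ 2 * (U * (f ^ 2 + g ^ 2)) := by
  have e1 : (g - f) * (Q * (2 * g) - P * (2 * f))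
      = (P + Q) * (g - f) ^ 2 + (Q - P) * ((g - f) * (g + f)) := by ring
  have h3 : (Q - P) ^ 2 * (g + f) ^ 2 ≤ (K ^ 2 * (P * U)) * (2 * (f ^ 2 + g ^ 2)) := by
    refine mul_le_mul hsq ?_ (sq_nonneg _) ((sq_nonneg _).trans hsq)
    nlinarith [sq_nonneg (g - f)]
  have h6 : 0 ≤ Q * (g - f) ^ 2 := by positivity
  have h2 := sq_nonneg (P * (g - f) + (Q - P) * (g + f))
  have h7 : 0 ≤ P * (P * (g - f) ^ 2 + 2 * ((Q - P) * ((g - f) * (g + f)))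
      + 2 * (K ^ 2 * (U * (f ^ 2 + g ^ 2)))) := by nlinarith
  have h8 := nonneg_of_mul_nonneg_right h7 hP0
  rw [e1]
  linarith

/-- The dissipation of the weighted energy, up to lower order terms. -/
lemma exists_weighted_dissipation_le (d : ℕ) {p : ℝ} (hp : 2 ≤ p) : ∃ C : ℝ, 0 < C ∧
    ∀ (L : ℕ) (a : Edge d L → ℝ), (∀ e, 0 ≤ a e) → ∀ v : Torus d L → ℝ,
      -∑ e, a e * edgeDiff v e * edgeDiff (fun x => starNorm x ^ p * (2 * v x)) e
        ≤ -(1 / 2 * ∑ e : Edge d L, starNorm e.1 ^ p * (a e * edgeDiff v e ^ 2))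
          + C * ∑ x, starSum a x * (starNorm x ^ (p - 2) * v x ^ 2) := by
  set K : ℝ := p * 2 ^ (p - 1) with hK
  have hK0 : 0 < K := by positivity
  refine ⟨K ^ 2 * 2 ^ (p - 2), by positivity, fun L a ha v => ?_⟩
  have h1 : ∑ x, starSum a x * (starNorm x ^ (p - 2) * v x ^ 2) = ∑ e : Edge d L,
      (starNorm e.1 ^ (p - 2) * v e.1 ^ 2 + starNorm (shift e.1 e.2) ^ (p - 2)
        * v (shift e.1 e.2) ^ 2) * a e := by
    rw [← sum_mul_starSum (fun x => starNorm x ^ (p - 2) * v x ^ 2)]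
    exact Finset.sum_congr rfl fun x _ => mul_comm _ _
  rw [h1, Finset.mul_sum, Finset.mul_sum, ← Finset.sum_neg_distrib, ← Finset.sum_neg_distrib,
    ← Finset.sum_add_distrib]
  refine Finset.sum_le_sum fun e _ => ?_
  obtain ⟨x, i⟩ := e
  simp only [edgeDiff]
  set y := shift x i with hy
  set X := starNorm x with hX
  set Y := starNorm y with hY
  have hX1 : 1 ≤ X := one_le_starNorm x
  have hY1 : 1 ≤ Y := one_le_starNorm y
  have hX0 : 0 < X := by linarith
  have hXY : |Y - X| ≤ 1 := by
    have h1 : (supNorm y : ℝ) ≤ supNorm x + 1 := by exact_mod_cast supNorm_shift_le x i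
    have h2 : (supNorm x : ℝ) ≤ supNorm y + 1 := by exact_mod_cast supNorm_le_shift x i
    rw [abs_le, hX, hY, starNorm, starNorm]
    constructor <;> linarith
  have hdm := abs_rpow_sub_rpow_le (p := p) (by linarith) hX1 hY1 hXY (starNorm_shift_le x i)
  rw [← hK] at hdm
  have hXp : X ^ (p - 2) ≤ 2 ^ (p - 2) * Y ^ (p - 2) := by
    rw [← Real.mul_rpow (by norm_num) (by linarith)]
    exact Real.rpow_le_rpow hX0.le (starNorm_le_shift x i) (by linarith)
  have hone : (1 : ℝ) ≤ 2 ^ (p - 2) := Real.one_le_rpow (by norm_num) (by linarith)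
  -- The squared increment of the weight `X ^ p`, divided by the weight, is of order `X ^ (p - 2)`;
  -- this is the weight of the error term.
  have hsplit : X ^ p * X ^ (p - 2) = (X ^ (p - 1)) ^ 2 := by
    rw [← Real.rpow_add hX0, ← Real.rpow_natCast, ← Real.rpow_mul hX0.le]
    congr 1; push_cast; ring
  set P := X ^ p with hP
  set Q := Y ^ p with hQ
  set U := X ^ (p - 2) with hU
  set W := Y ^ (p - 2) with hW
  have hP0 : 0 < P := Real.rpow_pos_of_pos hX0 _
  have hQ0 : 0 < Q := Real.rpow_pos_of_pos (by linarith) _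
  have hU0 : 0 < U := Real.rpow_pos_of_pos hX0 _
  have hW0 : 0 < W := Real.rpow_pos_of_pos (by linarith) _
  have hsq : (Q - P) ^ 2 ≤ K ^ 2 * (P * U) := by
    rw [hsplit, ← mul_pow, ← sq_abs]
    exact pow_le_pow_left₀ (abs_nonneg _) hdm 2
  set f := v x with hf
  set g := v y with hg
  have key := neg_mul_sub_le hP0 hQ0 hsq f g
  have key2 : K ^ 2 * (U * (f ^ 2 + g ^ 2)) ≤ K ^ 2 * 2 ^ (p - 2) * (U * f ^ 2 + W * g ^ 2) := by
    have h2 : U * f ^ 2 ≤ 2 ^ (p - 2) * (U * f ^ 2) := le_mul_of_one_le_left (by positivity) hone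
    have h3 : U * g ^ 2 ≤ 2 ^ (p - 2) * (W * g ^ 2) := by
      rw [← mul_assoc]; exact mul_le_mul_of_nonneg_right hXp (sq_nonneg _)
    have h4 : U * (f ^ 2 + g ^ 2) ≤ 2 ^ (p - 2) * (U * f ^ 2 + W * g ^ 2) := by linarith
    calc _ ≤ K ^ 2 * (2 ^ (p - 2) * (U * f ^ 2 + W * g ^ 2)) := by gcongr
      _ = _ := by ring
  have := mul_le_mul_of_nonneg_left (key.trans (add_le_add_right key2 _)) (ha (x, i))
  linarith

/-- Interpolation between the weighted and unweighted energies. -/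
lemma sum_starNorm_rpow_mul_sq_le {p κ : ℝ} (hκ : 0 < κ) (hκ1 : κ < 1) (v : Torus d L → ℝ) :
    ∑ x, starNorm x ^ (p * κ) * v x ^ 2
      ≤ (∑ x, starNorm x ^ p * v x ^ 2) ^ κ * (∑ x, v x ^ 2) ^ (1 - κ) := by
  have hconj : (1 / κ).HolderConjugate (1 / (1 - κ)) := by
    rw [Real.holderConjugate_iff]
    refine ⟨(one_lt_div hκ).2 hκ1, ?_⟩
    simp
  have h := Real.inner_le_Lp_mul_Lq_of_nonneg Finset.univ hconj
    (f := fun x : Torus d L => (starNorm x ^ p * v x ^ 2) ^ κ) (g := fun x => (v x ^ 2) ^ (1 - κ))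
    (fun x _ => Real.rpow_nonneg (mul_nonneg (Real.rpow_nonneg (starNorm_pos x).le _)
      (sq_nonneg _)) _) (fun x _ => by positivity)
  have e1 : ∀ x : Torus d L, (starNorm x ^ p * v x ^ 2) ^ κ * (v x ^ 2) ^ (1 - κ)
      = starNorm x ^ (p * κ) * v x ^ 2 := by
    intro x
    rw [Real.mul_rpow (Real.rpow_nonneg (starNorm_pos x).le _) (sq_nonneg _),
      ← Real.rpow_mul (starNorm_pos x).le, mul_assoc,
      ← Real.rpow_add_of_nonneg (sq_nonneg _) hκ.le (by linarith), add_sub_cancel, Real.rpow_one]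
  have e2 : ∀ x : Torus d L, ((starNorm x ^ p * v x ^ 2) ^ κ) ^ (1 / κ)
      = starNorm x ^ p * v x ^ 2 := by
    intro x
    rw [← Real.rpow_mul (mul_nonneg (Real.rpow_nonneg (starNorm_pos x).le _) (sq_nonneg _)),
      mul_one_div_cancel hκ.ne', Real.rpow_one]
  have e3 : ∀ x : Torus d L, ((v x ^ 2) ^ (1 - κ)) ^ (1 / (1 - κ)) = v x ^ 2 := by
    intro x
    rw [← Real.rpow_mul (sq_nonneg _), mul_one_div_cancel (by linarith), Real.rpow_one]
  simp only [e1, e2, e3, one_div_one_div] at h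
  exact h

end Weighted

end GradPhi

namespace GradPhi

/-! ### Inequalities inherited by kernel averages -/

section Averages

variable {p δ : ℝ}

/-- Integrated inequalities are inherited by averages. -/
lemma avgK_add_setLIntegral_le {F G f g : ℝ → ℝ≥0∞} (hF : Measurable F) (hf : Measurable f)
    (hG : Measurable G) (hg : Measurable g) {t1 t2 : ℝ}
    (h : ∀ r, 0 < r → F (t2 + r) + ∫⁻ s in Ioc t1 t2, f (s + r)
      ≤ G (t1 + r) + ∫⁻ s in Ioc t1 t2, g (s + r)) :
    avgK p δ F t2 + ∫⁻ s in Ioc t1 t2, avgK p δ f s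
      ≤ avgK p δ G t1 + ∫⁻ s in Ioc t1 t2, avgK p δ g s := by
  have hk := (measurable_kBig p δ).ennreal_ofReal
  have hF' : Measurable fun r => ENNReal.ofReal (kBig p δ r) * F (t2 + r) :=
    hk.mul (hF.comp (measurable_const_add t2))
  have hG' : Measurable fun r => ENNReal.ofReal (kBig p δ r) * G (t1 + r) :=
    hk.mul (hG.comp (measurable_const_add t1))
  rw [avgK_eq_shift p δ F, avgK_eq_shift p δ G, ← avgK_setLIntegral hf, ← avgK_setLIntegral hg,
    ← lintegral_add_left hF', ← lintegral_add_left hG']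
  refine setLIntegral_mono' measurableSet_Ioi fun r hr => ?_
  rw [← mul_add, ← mul_add]
  exact mul_le_mul_right (h r hr) _

/-- The kernel is bounded below on unit times. For a decreasing energy this makes its average at
time `t` dominate a fixed fraction of its value at time `t + 1`. -/
lemma mul_le_avgK (hp : 2 < p) (hδ : 0 < δ) {g : ℝ → ℝ≥0∞} {t : ℝ} {c : ℝ≥0∞}
    (h : ∀ s ∈ Ioc t (t + 1), c ≤ g s) :
    ENNReal.ofReal (δ / 2 ^ (p + 3)) * c ≤ avgK p δ g t := by
  calc _ = ∫⁻ _ in Ioc t (t + 1), ENNReal.ofReal (δ / 2 ^ (p + 3)) * c := by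
        simp
    _ ≤ ∫⁻ s in Ioc t (t + 1), ENNReal.ofReal (kBig p δ (s - t)) * g s :=
        setLIntegral_mono' measurableSet_Ioc fun s hs => mul_le_mul'
          (ENNReal.ofReal_le_ofReal (le_kBig hp hδ (by linarith [hs.1]) (by linarith [hs.2])))
          (h s hs)
    _ ≤ _ := lintegral_mono_set Ioc_subset_Ioi_self

lemma avgK_le_of_le (hK : KernelSmall p δ) (hp : 2 < p) (hδ : 0 < δ) {g : ℝ → ℝ≥0∞} {t : ℝ}
    {c : ℝ≥0∞} (h : ∀ s, t < s → g s ≤ c) : avgK p δ g t ≤ c :=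
  (avgK_mono h).trans (avgK_const_le hK hp hδ c t)

end Averages

/-! ### Averaged energy, dissipation and moderated gradients -/

section Energy

variable {d L : ℕ} {p δ : ℝ} {a : ℝ → Edge d L → ℝ} {v : ℝ → Torus d L → ℝ}

/-- The energy `∑ v²`. -/
noncomputable def nrg (v : ℝ → Torus d L → ℝ) (t : ℝ) : ℝ := ∑ x, v t x ^ 2

/-- The dissipation `∑ a (∇v)²`. -/
noncomputable def dsp (a : ℝ → Edge d L → ℝ) (v : ℝ → Torus d L → ℝ) (t : ℝ) : ℝ :=
  ∑ e, a t e * edgeDiff (v t) e ^ 2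

/-- The energy, with values in `[0, ∞]`. -/
noncomputable def eNrg (v : ℝ → Torus d L → ℝ) (t : ℝ) : ℝ≥0∞ := ENNReal.ofReal (nrg v t)

/-- The dissipation, with values in `[0, ∞]`. -/
noncomputable def eDsp (a : ℝ → Edge d L → ℝ) (v : ℝ → Torus d L → ℝ) (t : ℝ) : ℝ≥0∞ :=
  ENNReal.ofReal (dsp a v t)

lemma nrg_nonneg (v : ℝ → Torus d L → ℝ) (t : ℝ) : 0 ≤ nrg v t :=
  Finset.sum_nonneg fun _ _ => sq_nonneg _

lemma dsp_nonneg (ha : IsEnv a) (v : ℝ → Torus d L → ℝ) (t : ℝ) : 0 ≤ dsp a v t :=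
  Finset.sum_nonneg fun e _ => mul_nonneg (ha.nonneg t e) (sq_nonneg _)

lemma IsSol.continuous_nrg (hv : IsSol a v) : Continuous (nrg v) :=
  continuous_finsetSum _ fun x _ => (hv.cont x).pow 2

lemma IsSol.continuous_dsp (ha : IsEnv a) (hv : IsSol a v) : Continuous (dsp a v) :=
  continuous_finsetSum _ fun e _ => (ha.cont e).mul ((hv.cont_edgeDiff e).pow 2)

lemma IsSol.measurable_eNrg (hv : IsSol a v) : Measurable (eNrg v) :=
  hv.continuous_nrg.measurable.ennreal_ofReal

lemma IsSol.measurable_eDsp (ha : IsEnv a) (hv : IsSol a v) : Measurable (eDsp a v) :=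
  (hv.continuous_dsp ha).measurable.ennreal_ofReal

lemma IsSol.nrg_antitone (hL : 1 ≤ L) (ha : IsEnv a) (hv : IsSol a v) {t1 t2 : ℝ} (h0 : 0 ≤ t1)
    (h12 : t1 ≤ t2) : nrg v t2 ≤ nrg v t1 := by
  have h := hv.energy_eq hL ha h0 h12
  have h2 : 0 ≤ ∫ t in t1..t2, ∑ e, a t e * edgeDiff (v t) e ^ 2 :=
    intervalIntegral.integral_nonneg h12 fun t _ => dsp_nonneg ha v t
  unfold nrg; linarith

lemma ofReal_intervalIntegral_comp_add {f : ℝ → ℝ} (hf : Continuous f) (h0 : ∀ s, 0 ≤ f s)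
    {t1 t2 : ℝ} (h12 : t1 ≤ t2) (r : ℝ) :
    ENNReal.ofReal (∫ s in (t1 + r)..(t2 + r), f s)
      = ∫⁻ s in Ioc t1 t2, ENNReal.ofReal (f (s + r)) := by
  rw [← intervalIntegral.integral_comp_add_right, intervalIntegral.integral_of_le h12,
    ofReal_integral_eq_lintegral_ofReal]
  · exact ((hf.comp (continuous_add_const r)).intervalIntegrable t1 t2).1
  · exact Eventually.of_forall fun s => h0 _

/-- The energy inequality for averaged energies. -/
lemma IsSol.avgK_eNrg_add_le (hL : 1 ≤ L) (ha : IsEnv a) (hv : IsSol a v) {t1 t2 : ℝ}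
    (h0 : 0 ≤ t1) (h12 : t1 ≤ t2) :
    avgK p δ (eNrg v) t2 + ∫⁻ s in Ioc t1 t2, avgK p δ (fun s => 2 * eDsp a v s) s
      ≤ avgK p δ (eNrg v) t1 := by
  have h := avgK_add_setLIntegral_le (p := p) (δ := δ) hv.measurable_eNrg
    ((hv.measurable_eDsp ha).const_mul 2) hv.measurable_eNrg measurable_zero (t1 := t1) (t2 := t2) ?_
  · have hz : ∀ s, avgK p δ (0 : ℝ → ℝ≥0∞) s = 0 := fun s => by simp [avgK]
    simpa only [hz, lintegral_zero, add_zero] using h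
  · intro r hr
    have he := hv.energy_eq hL ha (t1 := t1 + r) (t2 := t2 + r) (by linarith) (by linarith)
    have hi := ofReal_intervalIntegral_comp_add (hv.continuous_dsp ha) (dsp_nonneg ha v) h12 r
    simp only [eDsp, Pi.zero_apply, lintegral_zero, add_zero]
    rw [lintegral_const_mul' _ _ (by norm_num), ← hi, eNrg, eNrg, nrg, nrg, ← he,
      ENNReal.ofReal_add (Finset.sum_nonneg fun _ _ => sq_nonneg _), ENNReal.ofReal_mul zero_le_two]
    · simp [dsp]
    · exact mul_nonneg zero_le_two (intervalIntegral.integral_nonneg (by linarith)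
        fun t _ => dsp_nonneg ha v t)

lemma IsSol.avgK_eNrg_le (hK : KernelSmall p δ) (hp : 2 < p) (hδ : 0 < δ) (hL : 1 ≤ L)
    (ha : IsEnv a) (hv : IsSol a v) {t : ℝ} (ht : 0 ≤ t) : avgK p δ (eNrg v) t ≤ eNrg v t :=
  avgK_le_of_le hK hp hδ fun _ hs =>
    ENNReal.ofReal_le_ofReal (hv.nrg_antitone hL ha ht hs.le)

lemma IsSol.eNrg_add_one_le (hp : 2 < p) (hδ : 0 < δ) (hL : 1 ≤ L)
    (ha : IsEnv a) (hv : IsSol a v) {t : ℝ} (ht : 0 ≤ t) :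
    ENNReal.ofReal (δ / 2 ^ (p + 3)) * eNrg v (t + 1) ≤ avgK p δ (eNrg v) t :=
  mul_le_avgK hp hδ fun _ hs =>
    ENNReal.ofReal_le_ofReal (hv.nrg_antitone hL ha (ht.trans hs.1.le) hs.2)

/-- The moderated gradients of solutions. -/
noncomputable def eMod (p δ : ℝ) (a : ℝ → Edge d L → ℝ) (v : ℝ → Torus d L → ℝ) (t : ℝ) : ℝ≥0∞ :=
  ENNReal.ofReal (energyW (modEnv p δ a t) (v t))

lemma IsSol.measurable_eMod (ha : IsEnv a) (hv : IsSol a v) : Measurable (eMod p δ a v) := by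
  refine Measurable.ennreal_ofReal (Finset.measurable_fun_sum _ fun e _ => ?_)
  exact ((ha.measurable_modEnv p δ e).pow_const 2).mul ((hv.cont_edgeDiff e).pow 2).measurable

/-- Moderation at each time gives one average of the dissipation. Averaging again gives two, and K *
K ≤ K reduces them to one. -/
lemma IsSol.avgK_eMod_le (hK : KernelSmall p δ) (hp : 2 < p) (hδ : 0 < δ) (hL : 1 ≤ L)
    (ha : IsEnv a) (hv : IsSol a v) {t : ℝ} (ht : 0 ≤ t) :
    avgK p δ (eMod p δ a v) t ≤ ENNReal.ofReal (80 * d) * avgK p δ (eDsp a v) t := by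
  have h : ∀ s, t < s → eMod p δ a v s ≤ ENNReal.ofReal (80 * d) * avgK p δ (eDsp a v) s := by
    intro s hs
    have := hv.moderation_sum hL hp hδ ha (ht.trans hs.le) (m := fun _ => 1) (c := 1)
      (fun _ => zero_le_one) zero_le_one (by simp) (by simp)
    simp only [one_mul, show (20 : ℝ) * d * (1 + 1) ^ 2 = 80 * d by ring] at this
    exact this
  refine (avgK_mono h).trans ?_
  rw [avgK_const_mul ENNReal.ofReal_ne_top]
  exact mul_le_mul_right (avgK_avgK_le hK hp hδ (hv.measurable_eDsp ha) t) _

end Energy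

/-! ### Solving sublinear inequalities -/

section Absorb

/-- Sublinear inequalities can be solved. -/
lemma le_of_le_add_mul_rpow {S Y G : ℝ≥0∞} {κ : ℝ} (hκ : 0 < κ) (hκ1 : κ < 1) (hS : S ≠ ⊤)
    (h : S ≤ Y + G * S ^ (1 - κ)) : S ≤ 2 * Y + (2 * G) ^ (1 / κ) := by
  rcases le_or_gt S (2 * Y) with h1 | h1
  · exact h1.trans le_self_add
  refine le_trans ?_ le_add_self
  have hS0 : S ≠ 0 := (bot_le.trans_lt h1).ne'
  -- Otherwise both terms on the right would be less than `S / 2`. Finiteness of `S` then permits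
  -- division by `S ^ (1 - κ)`.
  have h2 : S ≤ 2 * G * S ^ (1 - κ) := by
    by_contra hcon
    push Not at hcon
    have h3 : 2 * Y + 2 * (G * S ^ (1 - κ)) < S + S := by
      rw [← mul_assoc]
      exact ENNReal.add_lt_add h1 hcon
    rw [← mul_add, ← two_mul] at h3
    exact absurd (mul_le_mul_right h 2) (not_le.2 h3)
  have h4 : S ^ κ ≤ 2 * G := by
    have e1 : S = S ^ κ * S ^ (1 - κ) := by
      rw [← ENNReal.rpow_add _ _ hS0 hS, add_sub_cancel, ENNReal.rpow_one]
    nth_rewrite 1 [e1] at h2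
    exact (ENNReal.mul_le_mul_iff_left (by simp [hS0, hS])
      (ENNReal.rpow_ne_top_of_nonneg (by linarith) hS)).1 h2
  calc S = (S ^ κ) ^ (1 / κ) := by
        rw [← ENNReal.rpow_mul, mul_one_div_cancel hκ.ne', ENNReal.rpow_one]
    _ ≤ _ := ENNReal.rpow_le_rpow h4 (by positivity)

end Absorb

end GradPhi

namespace GradPhi

/-! ### Spatial moments and the evolution of weighted energies -/

section Moments

variable {d L : ℕ} {p δ : ℝ} {a : ℝ → Edge d L → ℝ} {v : ℝ → Torus d L → ℝ}

/-- The solution started from the indicator function of the origin. -/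
structure IsHeat (a : ℝ → Edge d L → ℝ) (v : ℝ → Torus d L → ℝ) : Prop extends IsSol a v where
  init : ∀ x, v 0 x = if x = 0 then 1 else 0

lemma IsHeat.nonneg (hL : 1 ≤ L) (ha : IsEnv a) (hv : IsHeat a v) {t : ℝ} (ht : 0 ≤ t)
    (x : Torus d L) : 0 ≤ v t x :=
  hv.toIsSol.nonneg hL ha (fun x => by rw [hv.init]; split_ifs <;> norm_num) ht x

lemma IsHeat.sum_eq (hL : 1 ≤ L) (ha : IsEnv a) (hv : IsHeat a v) {t : ℝ} (ht : 0 ≤ t) :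
    ∑ x, v t x = 1 := by
  rw [hv.toIsSol.sum_eq hL ha ht]
  simp [hv.init]

lemma IsHeat.nrg_le_one (hL : 1 ≤ L) (ha : IsEnv a) (hv : IsHeat a v) {t : ℝ} (ht : 0 ≤ t) :
    nrg v t ≤ 1 := by
  refine (hv.toIsSol.nrg_antitone hL ha le_rfl ht).trans (le_of_eq ?_)
  simp [nrg, hv.init]

lemma IsHeat.nrg_pos (hL : 1 ≤ L) (ha : IsEnv a) (hv : IsHeat a v) {t : ℝ} (ht : 0 ≤ t) :
    0 < nrg v t := by
  refine (nrg_nonneg v t).lt_of_ne' fun h => ?_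
  have h1 := hv.sum_eq hL ha ht
  rw [nrg, Finset.sum_eq_zero_iff_of_nonneg fun _ _ => sq_nonneg _] at h
  have : ∑ x, v t x = 0 := Finset.sum_eq_zero fun x hx => by simpa using h x hx
  linarith

/-- Weighted energies `∑ |x|_*^q v²`. -/
noncomputable def eMom (q : ℝ) (v : ℝ → Torus d L → ℝ) (t : ℝ) : ℝ≥0∞ :=
  ENNReal.ofReal (∑ x, starNorm x ^ q * v t x ^ 2)

/-- The error term in the evolution of weighted energies. -/
noncomputable def eErr (p : ℝ) (a : ℝ → Edge d L → ℝ) (v : ℝ → Torus d L → ℝ) (t : ℝ) : ℝ≥0∞ :=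
  ENNReal.ofReal (∑ x, starSum (a t) x * (starNorm x ^ (p - 2) * v t x ^ 2))

/-- The weighted dissipation. -/
noncomputable def eDspW (p : ℝ) (a : ℝ → Edge d L → ℝ) (v : ℝ → Torus d L → ℝ) (t : ℝ) : ℝ≥0∞ :=
  ENNReal.ofReal (∑ e : Edge d L, starNorm e.1 ^ p * (a t e * edgeDiff (v t) e ^ 2))

/-- The weighted moderated gradients. -/
noncomputable def eModW (p δ : ℝ) (a : ℝ → Edge d L → ℝ) (v : ℝ → Torus d L → ℝ) (t : ℝ) : ℝ≥0∞ :=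
  ENNReal.ofReal (∑ e : Edge d L, starNorm e.1 ^ p * (modEnv p δ a t e ^ 2 * edgeDiff (v t) e ^ 2))

lemma starNorm_rpow_nonneg (x : Torus d L) (q : ℝ) : 0 ≤ starNorm x ^ q :=
  Real.rpow_nonneg (starNorm_pos x).le q

lemma IsSol.continuous_mom (hv : IsSol a v) (q : ℝ) :
    Continuous fun t => ∑ x, starNorm x ^ q * v t x ^ 2 :=
  continuous_finsetSum _ fun x _ => ((hv.cont x).pow 2).const_mul _

lemma IsSol.continuous_dspW (ha : IsEnv a) (hv : IsSol a v) (q : ℝ) :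
    Continuous fun t => ∑ e : Edge d L, starNorm e.1 ^ q * (a t e * edgeDiff (v t) e ^ 2) :=
  continuous_finsetSum _ fun e _ => ((ha.cont e).mul ((hv.cont_edgeDiff e).pow 2)).const_mul _

lemma IsEnv.continuous_starSum (ha : IsEnv a) (x : Torus d L) :
    Continuous fun t => starSum (a t) x :=
  continuous_finsetSum _ fun _ _ => (ha.cont _).add (ha.cont _)

lemma IsSol.continuous_err (ha : IsEnv a) (hv : IsSol a v) (q : ℝ) :
    Continuous fun t => ∑ x, starSum (a t) x * (starNorm x ^ q * v t x ^ 2) :=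
  continuous_finsetSum _ fun x _ =>
    (ha.continuous_starSum x).mul (((hv.cont x).pow 2).const_mul _)

lemma dspW_nonneg (ha : IsEnv a) (v : ℝ → Torus d L → ℝ) (q t : ℝ) :
    0 ≤ ∑ e : Edge d L, starNorm e.1 ^ q * (a t e * edgeDiff (v t) e ^ 2) :=
  Finset.sum_nonneg fun e _ =>
    mul_nonneg (starNorm_rpow_nonneg _ _) (mul_nonneg (ha.nonneg t e) (sq_nonneg _))

lemma mom_nonneg (v : ℝ → Torus d L → ℝ) (q t : ℝ) : 0 ≤ ∑ x, starNorm x ^ q * v t x ^ 2 :=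
  Finset.sum_nonneg fun _ _ => mul_nonneg (starNorm_rpow_nonneg _ _) (sq_nonneg _)

lemma err_nonneg (ha : IsEnv a) (v : ℝ → Torus d L → ℝ) (q t : ℝ) :
    0 ≤ ∑ x, starSum (a t) x * (starNorm x ^ q * v t x ^ 2) :=
  Finset.sum_nonneg fun x _ => mul_nonneg (starSum_nonneg (ha.nonneg t) x)
    (mul_nonneg (starNorm_rpow_nonneg _ _) (sq_nonneg _))

lemma IsSol.measurable_eMom (hv : IsSol a v) (q : ℝ) : Measurable (eMom q v) :=
  (hv.continuous_mom q).measurable.ennreal_ofReal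

lemma IsSol.measurable_eDspW (ha : IsEnv a) (hv : IsSol a v) (q : ℝ) : Measurable (eDspW q a v) :=
  (hv.continuous_dspW ha q).measurable.ennreal_ofReal

lemma IsSol.measurable_eErr (ha : IsEnv a) (hv : IsSol a v) (q : ℝ) : Measurable (eErr q a v) :=
  (hv.continuous_err ha (q - 2)).measurable.ennreal_ofReal

/-- Evolution of weighted energies. -/
lemma exists_eMom_add_le (d : ℕ) {p : ℝ} (hp : 2 ≤ p) : ∃ C : ℝ, 0 < C ∧
    ∀ (L : ℕ) (_ : 1 ≤ L) (a : ℝ → Edge d L → ℝ) (v : ℝ → Torus d L → ℝ), IsEnv a → IsSol a v →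
    ∀ t1 t2 r : ℝ, 0 ≤ t1 → t1 ≤ t2 → 0 ≤ r →
      eMom p v (t2 + r) + ∫⁻ s in Ioc t1 t2, ENNReal.ofReal (1 / 2) * eDspW p a v (s + r)
        ≤ eMom p v (t1 + r) + ∫⁻ s in Ioc t1 t2, ENNReal.ofReal C * eErr p a v (s + r) := by
  obtain ⟨C, hC, h⟩ := exists_weighted_dissipation_le d hp
  refine ⟨C, hC, fun L hL a v ha hv t1 t2 r h0 h12 hr => ?_⟩
  have he := hv.sum_comp_eq hL ha (F := fun r => r ^ 2) (F' := fun r => 2 * r)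
    (fun r => by simpa using hasDerivAt_pow 2 r) (by fun_prop) (fun x => starNorm x ^ p)
    (t1 := t1 + r) (t2 := t2 + r) (by linarith) (by linarith)
  have c1 := hv.continuous_dspW ha p
  have c2 := hv.continuous_err ha (p - 2)
  have c3 : Continuous fun t => ∑ e, a t e * edgeDiff (v t) e
      * edgeDiff (fun x => starNorm x ^ p * (2 * v t x)) e := by
    refine continuous_finsetSum _ fun e _ => ((ha.cont e).mul (hv.cont_edgeDiff e)).mul ?_
    exact (((hv.cont _).const_mul 2).const_mul _).sub (((hv.cont _).const_mul 2).const_mul _)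
  have h12' : t1 + r ≤ t2 + r := by linarith
  have hm := intervalIntegral.integral_mono_on h12' (c3.neg.intervalIntegrable (μ := volume) _ _)
    (Continuous.intervalIntegrable (by exact ((c1.const_mul (1 / 2)).neg.add (c2.const_mul C))) _ _)
    (fun t _ => h L (a t) (ha.nonneg t) (v t))
  simp only [Pi.neg_apply] at hm
  rw [intervalIntegral.integral_add (Continuous.intervalIntegrable (by exact
      (c1.const_mul (1 / 2)).neg) _ _) (Continuous.intervalIntegrable (by exact
      (c2.const_mul C)) _ _), intervalIntegral.integral_neg, intervalIntegral.integral_neg,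
    intervalIntegral.integral_const_mul, intervalIntegral.integral_const_mul] at hm
  simp only [eDspW, eErr]
  rw [lintegral_const_mul' _ _ ENNReal.ofReal_ne_top, lintegral_const_mul' _ _ ENNReal.ofReal_ne_top,
    ← ofReal_intervalIntegral_comp_add c1 (dspW_nonneg ha v p) h12,
    ← ofReal_intervalIntegral_comp_add c2 (err_nonneg ha v _) h12, eMom, eMom,
    ← ENNReal.ofReal_mul (by norm_num), ← ENNReal.ofReal_mul hC.le,
    ← ENNReal.ofReal_add (mom_nonneg v _ _), ← ENNReal.ofReal_add (mom_nonneg v _ _)]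
  · refine ENNReal.ofReal_le_ofReal ?_
    linarith
  · exact mul_nonneg hC.le (intervalIntegral.integral_nonneg h12' fun t _ => err_nonneg ha v _ t)
  · exact mul_nonneg (by norm_num)
      (intervalIntegral.integral_nonneg h12' fun t _ => dspW_nonneg ha v p t)

lemma eMom_le {κ : ℝ} (hκ : 0 < κ) (hκ1 : κ < 1) (v : ℝ → Torus d L → ℝ) (t : ℝ) :
    eMom (p * κ) v t ≤ eMom p v t ^ κ * eNrg v t ^ (1 - κ) := by
  rw [eMom, eMom, eNrg, ENNReal.ofReal_rpow_of_nonneg (mom_nonneg v p t) hκ.le,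
    ENNReal.ofReal_rpow_of_nonneg (nrg_nonneg v t) (by linarith),
    ← ENNReal.ofReal_mul (Real.rpow_nonneg (mom_nonneg v p t) _)]
  exact ENNReal.ofReal_le_ofReal (sum_starNorm_rpow_mul_sq_le hκ hκ1 (v t))

lemma one_le_calM2 {t : ℝ} : 1 ≤ calM2 p a t := le_self_add

/-- With `κ = (p - 2) / (p - 1)` one has `p * κ = κ + (p - 2)`. The growth `|x|_* ^ κ` allowed by
`calM2` thus raises the weight `p - 2` exactly to a weight that interpolates between the moment of
order `p` and the energy. -/
lemma eErr_le_calM2 (hd : 1 ≤ d) (hp : 2 < p) (hL : 1 ≤ L) (ha : IsEnv a) (v : ℝ → Torus d L → ℝ)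
    (t : ℝ) : eErr p a v t ≤ ENNReal.ofReal (d ^ ((p - 2) / (p - 1))) * calM2 p a t
      * (eMom p v t ^ ((p - 2) / (p - 1)) * eNrg v t ^ (1 - (p - 2) / (p - 1))) := by
  set κ := (p - 2) / (p - 1) with hκ
  have hκ0 : 0 < κ := div_pos (by linarith) (by linarith)
  have hκ1 : κ < 1 := (div_lt_one (by linarith)).2 (by linarith)
  have hd1 : (1 : ℝ) ≤ d := by exact_mod_cast hd
  have hpκ : p * κ = κ + (p - 2) := by
    rw [hκ]
    have : p - 1 ≠ 0 := by linarith
    field_simp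
    ring
  refine le_trans ?_ (mul_le_mul_right (eMom_le hκ0 hκ1 v t) _)
  rw [hpκ, eErr, eMom, ENNReal.ofReal_sum_of_nonneg fun x _ => mul_nonneg
    (starSum_nonneg (ha.nonneg t) x) (mul_nonneg (starNorm_rpow_nonneg _ _) (sq_nonneg _)),
    ENNReal.ofReal_sum_of_nonneg fun x _ => mul_nonneg (starNorm_rpow_nonneg _ _) (sq_nonneg _),
    Finset.mul_sum]
  refine Finset.sum_le_sum fun x _ => ?_
  have h1 : ENNReal.ofReal (starSum (a t) x / (torusNorm x + 1) ^ κ) ≤ calM2 p a t := by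
    classical
    rw [calM2, ← sum_isEndpoint_eq_starSum hL]
    refine le_trans ?_ le_add_self
    exact le_iSup (fun x : Torus d L => ENNReal.ofReal
      ((∑ e : Edge d L with IsEndpoint x e, a t e) / (torusNorm x + 1) ^ ((p - 2) / (p - 1)))) x
  have ht0 : 0 ≤ torusNorm x := Real.sqrt_nonneg _
  have h2 : (torusNorm x + 1) ^ κ ≤ d ^ κ * starNorm x ^ κ := by
    rw [← Real.mul_rpow (by linarith) (starNorm_pos x).le]
    refine Real.rpow_le_rpow (by linarith) ?_ hκ0.le
    have := torusNorm_le x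
    unfold starNorm
    linarith
  have h3 : starSum (a t) x * (starNorm x ^ (p - 2) * v t x ^ 2)
      ≤ d ^ κ * (starSum (a t) x / (torusNorm x + 1) ^ κ)
        * (starNorm x ^ (κ + (p - 2)) * v t x ^ 2) := by
    have hs := starSum_nonneg (ha.nonneg t) x
    have hpos : 0 < (torusNorm x + 1) ^ κ := by positivity
    rw [Real.rpow_add (starNorm_pos x)]
    calc _ = (torusNorm x + 1) ^ κ * ((starSum (a t) x / (torusNorm x + 1) ^ κ)
          * (starNorm x ^ (p - 2) * v t x ^ 2)) := by field_simp
      _ ≤ (d ^ κ * starNorm x ^ κ) * ((starSum (a t) x / (torusNorm x + 1) ^ κ)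
          * (starNorm x ^ (p - 2) * v t x ^ 2)) := by
          refine mul_le_mul_of_nonneg_right h2 ?_
          exact mul_nonneg (div_nonneg hs hpos.le) (mul_nonneg (starNorm_rpow_nonneg _ _)
            (sq_nonneg _))
      _ = _ := by ring
  refine (ENNReal.ofReal_le_ofReal h3).trans ?_
  rw [ENNReal.ofReal_mul (mul_nonneg (by positivity) (div_nonneg (starSum_nonneg (ha.nonneg t) x)
    (by positivity))), ENNReal.ofReal_mul (by positivity)]
  gcongr

lemma eMom_le_card (hL : 1 ≤ L) (hp : 0 ≤ p) (ha : IsEnv a) (hv : IsHeat a v) {t : ℝ}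
    (ht : 0 ≤ t) : eMom p v t ≤ ENNReal.ofReal ((L + 1) ^ p) := by
  refine ENNReal.ofReal_le_ofReal ?_
  calc ∑ x, starNorm x ^ p * v t x ^ 2 ≤ ∑ x, ((L : ℝ) + 1) ^ p * v t x ^ 2 := by
        refine Finset.sum_le_sum fun x _ => mul_le_mul_of_nonneg_right ?_ (sq_nonneg _)
        refine Real.rpow_le_rpow (starNorm_pos x).le ?_ hp
        have : (supNorm x : ℝ) ≤ L := by exact_mod_cast supNorm_le x
        unfold starNorm; linarith
    _ = ((L : ℝ) + 1) ^ p * nrg v t := by rw [nrg, Finset.mul_sum]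
    _ ≤ _ := mul_le_of_le_one_right (by positivity) (hv.nrg_le_one hL ha ht)

lemma eNrg_le_one (hL : 1 ≤ L) (ha : IsEnv a) (hv : IsHeat a v) {t : ℝ} (ht : 0 ≤ t) :
    eNrg v t ≤ 1 := ENNReal.ofReal_le_one.2 (hv.nrg_le_one hL ha ht)

lemma setLIntegral_eq_mul_timeAvg (f : ℝ → ℝ≥0∞) {t : ℝ} (ht : 0 < t) :
    ∫⁻ s in Ioc 0 t, f s = ENNReal.ofReal t * timeAvg f t := by
  rw [timeAvg, ← mul_assoc, ENNReal.mul_inv_cancel (by simpa using ht) ENNReal.ofReal_ne_top,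
    one_mul]

/-- The supremum runs over times at least one, so the interval is enlarged to length `1 + t` to
include short times. -/
lemma setLIntegral_le_mul_iSup (f : ℝ → ℝ≥0∞) {t : ℝ} (ht : 0 ≤ t) :
    ∫⁻ s in Ioc 0 t, f s ≤ ENNReal.ofReal (1 + t) * ⨆ t ∈ Ici (1 : ℝ), timeAvg f t := by
  calc _ ≤ ∫⁻ s in Ioc 0 (1 + t), f s := lintegral_mono_set (Ioc_subset_Ioc_right (by linarith))
    _ = _ := setLIntegral_eq_mul_timeAvg f (by linarith)
    _ ≤ _ := by
        gcongr
        exact le_iSup₂ (f := fun t (_ : t ∈ Ici (1 : ℝ)) => timeAvg f t) (1 + t)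
          (by simpa using ht)

lemma one_le_iSup_timeAvg {f : ℝ → ℝ≥0∞} (hf : ∀ s, 1 ≤ f s) :
    1 ≤ ⨆ t ∈ Ici (1 : ℝ), timeAvg f t := by
  refine le_iSup₂_of_le (1 : ℝ) (by simp) ?_
  have := setLIntegral_mono' (μ := volume) (measurableSet_Ioc (a := (0 : ℝ)) (b := 1))
    (f := fun _ => 1) fun s _ => hf s
  rw [timeAvg]
  simpa using this

lemma one_le_scrM2 (hp : 1 < p) : 1 ≤ scrM2 p a :=
  ENNReal.one_le_rpow (one_le_iSup_timeAvg fun _ => one_le_calM2) (by linarith)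

end Moments

end GradPhi

namespace GradPhi

/-! ### A crude moment bound, giving the initial averaged moment -/

section InitialMoment

variable {d L : ℕ} {p δ : ℝ} {a : ℝ → Edge d L → ℝ} {v : ℝ → Torus d L → ℝ}

lemma eMom_zero (hv : IsHeat a v) : eMom p v 0 = 1 := by
  have : ∑ x, starNorm x ^ p * v 0 x ^ 2 = 1 := by
    rw [Finset.sum_eq_single (0 : Torus d L)]
    · simp [hv.init, starNorm, supNorm_zero]
    · intro x _ hx; simp [hv.init, hx]
    · simp
  rw [eMom, this, ENNReal.ofReal_one]

/-- Growth of the weighted energy. -/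
lemma exists_eMom_le (d : ℕ) (hd : 1 ≤ d) {p : ℝ} (hp : 2 < p) : ∃ C : ℝ, 0 < C ∧
    ∀ (L : ℕ) (_ : 1 ≤ L) (a : ℝ → Edge d L → ℝ) (v : ℝ → Torus d L → ℝ), IsEnv a → IsHeat a v →
    ∀ s : ℝ, 0 ≤ s → eMom p v s ≤ ENNReal.ofReal (C * (s + 1) ^ (p - 1)) * scrM2 p a := by
  obtain ⟨C, hC, h⟩ := exists_eMom_add_le d hp.le
  set κ := (p - 2) / (p - 1) with hκ
  have hp1 : p - 1 ≠ 0 := by linarith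
  have hκ0 : 0 < κ := div_pos (by linarith) (by linarith)
  have hκ1 : κ < 1 := (div_lt_one (by linarith)).2 (by linarith)
  have hκ' : 1 / (1 - κ) = p - 1 := by rw [hκ]; field_simp; ring
  have hd0 : (0 : ℝ) < d := by exact_mod_cast hd
  set B : ℝ := C * d ^ κ with hB
  have hB0 : 0 < B := by positivity
  clear_value B
  refine ⟨2 + (2 * B) ^ (p - 1), by positivity, fun L hL a v ha hv s hs => ?_⟩
  -- The supremum is finite because the torus is, so the sublinear inequality with power `κ` can be
  -- solved. The resulting power `1 / (1 - κ) = p - 1` is the one in `scrM2`.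
  set S : ℝ≥0∞ := ⨆ r ∈ Icc 0 s, eMom p v r with hS
  have hSfin : S ≠ ⊤ := ne_top_of_le_ne_top ENNReal.ofReal_ne_top
    (iSup₂_le fun r hr => eMom_le_card hL (by linarith : (0 : ℝ) ≤ p) ha hv hr.1)
  have hSle : ∀ r ∈ Icc 0 s, eMom p v r ≤ S := fun r hr =>
    le_iSup₂ (f := fun r (_ : r ∈ Icc 0 s) => eMom p v r) r hr
  have hle : S ≤ 1 + (ENNReal.ofReal B * ∫⁻ q in Ioc 0 s, calM2 p a q) * S ^ (1 - (1 - κ)) := by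
    refine iSup₂_le fun r hr => ?_
    have h1 := h L hL a v ha hv.toIsSol 0 r 0 le_rfl hr.1 le_rfl
    simp only [add_zero] at h1
    rw [eMom_zero hv] at h1
    refine (le_self_add.trans h1).trans (add_le_add_right ?_ _)
    calc _ ≤ ∫⁻ q in Ioc 0 r, (ENNReal.ofReal B * S ^ κ) * calM2 p a q := by
          refine setLIntegral_mono' measurableSet_Ioc fun q hq => ?_
          have h2 := eErr_le_calM2 hd hp hL ha v q
          have h3 : eNrg v q ^ (1 - κ) ≤ 1 :=
            ENNReal.rpow_le_one (eNrg_le_one hL ha hv hq.1.le) (by linarith)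
          have h4 : eMom p v q ^ κ ≤ S ^ κ :=
            ENNReal.rpow_le_rpow (hSle q ⟨hq.1.le, hq.2.trans hr.2⟩) hκ0.le
          calc _ ≤ ENNReal.ofReal C * (ENNReal.ofReal (d ^ κ) * calM2 p a q * (S ^ κ * 1)) := by
                refine mul_le_mul_right (h2.trans ?_) _
                gcongr
            _ = _ := by rw [hB, ENNReal.ofReal_mul hC.le]; ring
      _ = (ENNReal.ofReal B * S ^ κ) * ∫⁻ q in Ioc 0 r, calM2 p a q :=
          lintegral_const_mul' _ _ (ENNReal.mul_ne_top ENNReal.ofReal_ne_top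
            (ENNReal.rpow_ne_top_of_nonneg hκ0.le hSfin))
      _ ≤ (ENNReal.ofReal B * S ^ κ) * ∫⁻ q in Ioc 0 s, calM2 p a q :=
          mul_le_mul_right (lintegral_mono_set (Ioc_subset_Ioc_right hr.2)) _
      _ = _ := by rw [sub_sub_cancel]; ring
  have hfin := le_of_le_add_mul_rpow (by linarith) (by linarith) hSfin hle
  rw [hκ'] at hfin
  refine (hSle s ⟨hs, le_rfl⟩).trans (hfin.trans ?_)
  have h5 : ∫⁻ q in Ioc 0 s, calM2 p a q
      ≤ ENNReal.ofReal (1 + s) * ⨆ t ∈ Ici (1 : ℝ), timeAvg (fun s => calM2 p a s) t :=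
    setLIntegral_le_mul_iSup _ hs
  have h6 : (2 * (ENNReal.ofReal B * ∫⁻ q in Ioc 0 s, calM2 p a q)) ^ (p - 1)
      ≤ ENNReal.ofReal ((2 * B) ^ (p - 1) * (s + 1) ^ (p - 1)) * scrM2 p a := by
    calc _ ≤ (ENNReal.ofReal (2 * B * (s + 1))
          * ⨆ t ∈ Ici (1 : ℝ), timeAvg (fun s => calM2 p a s) t) ^ (p - 1) := by
          refine ENNReal.rpow_le_rpow ?_ (by linarith)
          rw [ENNReal.ofReal_mul (by positivity), ENNReal.ofReal_mul zero_le_two, add_comm s 1,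
            ENNReal.ofReal_ofNat, mul_assoc, mul_assoc]
          gcongr
      _ = _ := by
          rw [ENNReal.mul_rpow_of_nonneg _ _ (by linarith), scrM2,
            ENNReal.ofReal_rpow_of_nonneg (by positivity) (by linarith),
            Real.mul_rpow (by positivity) (by positivity)]
  have h7 : (2 : ℝ≥0∞) * 1 ≤ ENNReal.ofReal (2 * (s + 1) ^ (p - 1)) * scrM2 p a := by
    refine mul_le_mul' ?_ (one_le_scrM2 (by linarith))
    rw [← ENNReal.ofReal_ofNat]
    refine ENNReal.ofReal_le_ofReal ?_
    have : (1 : ℝ) ≤ (s + 1) ^ (p - 1) := Real.one_le_rpow (by linarith) (by linarith)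
    linarith
  refine (add_le_add h7 h6).trans (le_of_eq ?_)
  rw [← add_mul, ← ENNReal.ofReal_add (by positivity) (by positivity), ← add_mul]

/-- The crude growth `(s + 1) ^ (p - 1)` against the kernel decay `(s + 1) ^ (-(p + 1))` leaves an
integrable `(s + 1) ^ (-2)`. This is where `scrM2` enters the argument: it controls the initial
value of the averaged moment. -/
lemma exists_avgK_eMom_zero_le (d : ℕ) (hd : 1 ≤ d) {p δ : ℝ} (hp : 2 < p) (hδ : 0 < δ) :
    ∃ C : ℝ, 0 < C ∧ ∀ (L : ℕ) (_ : 1 ≤ L) (a : ℝ → Edge d L → ℝ) (v : ℝ → Torus d L → ℝ),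
      IsEnv a → IsHeat a v → avgK p δ (eMom p v) 0 ≤ ENNReal.ofReal C * scrM2 p a := by
  obtain ⟨C, hC, h⟩ := exists_eMom_le d hd hp
  refine ⟨2 * δ * C, by positivity, fun L hL a v ha hv => ?_⟩
  calc avgK p δ (eMom p v) 0
      ≤ ∫⁻ s in Ioi (0 : ℝ), ENNReal.ofReal (2 * δ * C * (s + 1) ^ (-2 : ℝ)) * scrM2 p a := by
        refine setLIntegral_mono' measurableSet_Ioi fun s hs => ?_
        have hs0 : (0 : ℝ) ≤ s := le_of_lt hs
        have hk := kBig_le hp hδ hs0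
        rw [sub_zero]
        refine (mul_le_mul_right (h L hL a v ha hv s hs0) _).trans ?_
        rw [← mul_assoc, ← ENNReal.ofReal_mul (kBig_nonneg hδ hs0)]
        refine mul_le_mul_left (ENNReal.ofReal_le_ofReal ?_) _
        calc _ ≤ 2 * δ * (s + 1) ^ (-(p + 1)) * (C * (s + 1) ^ (p - 1)) := by gcongr
          _ = 2 * δ * C * ((s + 1) ^ (-(p + 1)) * (s + 1) ^ (p - 1)) := by ring
          _ = _ := by
              rw [← Real.rpow_add (by linarith)]
              congr 2; ring
    _ = (∫⁻ s in Ioi (0 : ℝ), ENNReal.ofReal (2 * δ * C * (s + 1) ^ (-2 : ℝ))) * scrM2 p a :=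
        lintegral_mul_const _ (by fun_prop)
    _ = _ := by
        rw [← ofReal_integral_eq_lintegral_ofReal
          ((integrableOn_add_one_rpow le_rfl (by norm_num)).const_mul _)
          ((ae_restrict_iff' measurableSet_Ioi).2 (Eventually.of_forall fun s hs => ?_)),
          integral_const_mul, integral_add_one_rpow le_rfl (by norm_num)]
        · norm_num
        · have : (0 : ℝ) < s := hs
          positivity

end InitialMoment

/-! ### Growth of the averaged moment -/

section AveragedMoment

variable {d L : ℕ} {p δ : ℝ} {a : ℝ → Edge d L → ℝ} {v : ℝ → Torus d L → ℝ}

lemma IsHeat.eMom_ne_zero (hL : 1 ≤ L) (ha : IsEnv a) (hv : IsHeat a v) {q : ℝ} (hq : 0 ≤ q)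
    {t : ℝ} (ht : 0 ≤ t) : eMom q v t ≠ 0 := by
  rw [eMom, Ne, ENNReal.ofReal_eq_zero, not_le]
  refine (hv.nrg_pos hL ha ht).trans_le (Finset.sum_le_sum fun x _ => ?_)
  exact le_mul_of_one_le_left (sq_nonneg _) (Real.one_le_rpow (one_le_starNorm x) hq)

/-- The error term in the evolution of the weighted energy. -/
lemma exists_eErr_le (d : ℕ) (hd : 2 ≤ d) {p : ℝ} (δ : ℝ) (hp : 2 ≤ p) {ε : ℝ} (hε : 0 < ε) :
    ∃ C : ℝ, 0 < C ∧
    ∀ (L : ℕ) (_ : 1 ≤ L) (a : ℝ → Edge d L → ℝ) (v : ℝ → Torus d L → ℝ), IsEnv a → IsHeat a v →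
    ∀ t : ℝ, 0 ≤ t → eErr p a v t ≤ ENNReal.ofReal ε * eModW p δ a v t
      + ENNReal.ofReal C * (calM0 p δ a t ^ (1 / (1 - thetaD d)) * eMom (p - 2) v t) := by
  obtain ⟨C, hC, h⟩ := exists_sum_starSum_mul_rpow_mul_sq_le d hp (sobolevExponents hd) hε
  rw [one_add_div_eq hd] at h
  have hθ : 0 < 1 / (1 - thetaD d) := one_div_pos.2 (by linarith [thetaD_lt_one hd])
  refine ⟨C, hC, fun L hL a v ha hv t ht => ?_⟩
  -- The right side is infinite in this case, because the moment of a solution of mass one is not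
  -- zero.
  by_cases htop : calM0 p δ a t = ⊤
  · rw [htop, ENNReal.top_rpow_of_pos hθ, ENNReal.top_mul (hv.eMom_ne_zero hL ha (by linarith) ht),
      ENNReal.mul_top (by simpa using hC), add_top]
    exact le_top
  rcases prodNormLE_of_calM0_ne_top (sigmaD_pos hd) (sobolevExponents hd).pos_τ (ha.nonneg t)
    htop with h0 | h0
  · have : eErr p a v t = 0 := by simp [eErr, starSum, h0]
    rw [this]; exact bot_le
  · have h1 := h L hL (a t) _ _ h0 (v t)
    refine (ENNReal.ofReal_le_ofReal h1).trans (le_of_eq ?_)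
    have hn : 0 ≤ (calM0 p δ a t).toReal := ENNReal.toReal_nonneg
    rw [ENNReal.ofReal_add, ENNReal.ofReal_mul hε.le, ENNReal.ofReal_mul hC.le,
      ENNReal.ofReal_mul (by positivity), ← ENNReal.ofReal_rpow_of_nonneg hn hθ.le,
      ENNReal.ofReal_toReal htop]
    · rfl
    · exact mul_nonneg hε.le (Finset.sum_nonneg fun e _ =>
        mul_nonneg (starNorm_rpow_nonneg _ _) (by positivity))
    · exact mul_nonneg hC.le (mul_nonneg (by positivity) (mom_nonneg v _ t))

lemma IsSol.avgK_eModW_le (hK : KernelSmall p δ) (hp : 2 < p) (hδ : 0 < δ) (hL : 1 ≤ L)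
    (ha : IsEnv a) (hv : IsSol a v) {t : ℝ} (ht : 0 ≤ t) :
    avgK p δ (eModW p δ a v) t
      ≤ ENNReal.ofReal (20 * d * (1 + 2 ^ p) ^ 2) * avgK p δ (eDspW p a v) t := by
  have h : ∀ s, t < s → eModW p δ a v s
      ≤ ENNReal.ofReal (20 * d * (1 + 2 ^ p) ^ 2) * avgK p δ (eDspW p a v) s := by
    intro s hs
    refine hv.moderation_sum hL hp hδ ha (ht.trans hs.le) (m := fun x => starNorm x ^ p)
      (c := 2 ^ p) (fun x => starNorm_rpow_nonneg x p) (by positivity) (fun x i => ?_) fun x i => ?_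
    · rw [← Real.mul_rpow zero_le_two (starNorm_pos x).le]
      exact Real.rpow_le_rpow (starNorm_pos _).le (starNorm_shift_le x i) (by linarith)
    · rw [← Real.mul_rpow zero_le_two (starNorm_pos _).le]
      exact Real.rpow_le_rpow (starNorm_pos _).le (starNorm_le_shift x i) (by linarith)
  refine (avgK_mono h).trans ?_
  rw [avgK_const_mul ENNReal.ofReal_ne_top]
  exact mul_le_mul_right (avgK_avgK_le hK hp hδ (hv.measurable_eDspW ha p) t) _

/-- A qualitative bound: the weight is at most `(L + 1) ^ p` and the total dissipation is bounded by
the initial energy. Finiteness is what permits cancelling this term from both sides of the moment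
inequality. -/
lemma IsSol.setLIntegral_avgK_eDspW_ne_top (hK : KernelSmall p δ) (hp : 2 < p) (hδ : 0 < δ)
    (hL : 1 ≤ L) (ha : IsEnv a) (hv : IsSol a v) {t : ℝ} (ht : 0 ≤ t) :
    ∫⁻ s in Ioc 0 t, avgK p δ (eDspW p a v) s ≠ ⊤ := by
  have h1 := hv.avgK_eNrg_add_le (p := p) (δ := δ) hL ha le_rfl ht
  have h2 : ∫⁻ s in Ioc 0 t, avgK p δ (fun s => 2 * eDsp a v s) s ≠ ⊤ :=
    ne_top_of_le_ne_top (b := eNrg v 0) ENNReal.ofReal_ne_top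
      ((le_add_self.trans h1).trans (hv.avgK_eNrg_le hK hp hδ hL ha le_rfl))
  refine ne_top_of_le_ne_top (ENNReal.mul_ne_top (ENNReal.ofReal_ne_top (r := (L + 1) ^ p)) h2) ?_
  rw [← lintegral_const_mul' _ _ ENNReal.ofReal_ne_top]
  refine setLIntegral_mono' measurableSet_Ioc fun s _ => ?_
  rw [← avgK_const_mul ENNReal.ofReal_ne_top]
  refine avgK_mono fun r _ => ?_
  have h3 : eDspW p a v r ≤ ENNReal.ofReal ((L + 1) ^ p) * eDsp a v r := by
    rw [eDsp, ← ENNReal.ofReal_mul (by positivity)]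
    refine ENNReal.ofReal_le_ofReal ?_
    rw [dsp, Finset.mul_sum]
    refine Finset.sum_le_sum fun e _ => mul_le_mul_of_nonneg_right ?_
      (mul_nonneg (ha.nonneg r e) (sq_nonneg _))
    refine Real.rpow_le_rpow (starNorm_pos _).le ?_ (by linarith)
    have : (supNorm e.1 : ℝ) ≤ L := by exact_mod_cast supNorm_le e.1
    unfold starNorm; linarith
  refine h3.trans (mul_le_mul_right ?_ _)
  rw [two_mul]; exact le_self_add

/-- Hölder's inequality for the error term. -/
lemma IsHeat.avgK_err_le (hp : 2 < p) (hL : 1 ≤ L)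
    (ha : IsEnv a) (hv : IsHeat a v) {t : ℝ} (ht : 0 ≤ t) :
    avgK p δ (fun s => calM0 p δ a s ^ (1 / (1 - thetaD d)) * eMom (p - 2) v s) t
      ≤ calM1 p δ a t ^ (2 / p) * eNrg v t ^ (2 / p) * avgK p δ (eMom p v) t ^ (1 - 2 / p) := by
  have hp0 : 0 < p := by linarith
  have hκ0 : 0 < 1 - 2 / p := sub_pos.2 ((div_lt_one hp0).2 hp)
  have hκ1 : 1 - 2 / p < 1 := sub_lt_self _ (by positivity)
  have hpκ : p * (1 - 2 / p) = p - 2 := by field_simp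
  have hMm := ha.measurable_calM0 p δ
  have hkm := measurable_kernel_comp_sub p δ t
  -- The moment of order `p - 2` interpolates between order `p` and the energy. The energy
  -- decreases, so it is replaced by its value at `t` and leaves the average.
  calc _ ≤ avgK p δ (fun s => eNrg v t ^ (2 / p) *
        ((calM0 p δ a s ^ (p / (2 * (1 - thetaD d)))) ^ (2 / p) * eMom p v s ^ (1 - 2 / p))) t := by
        refine avgK_mono fun s hs => ?_
        have h1 := eMom_le (p := p) hκ0 hκ1 v s
        rw [hpκ, sub_sub_cancel] at h1
        have h2 : eNrg v s ≤ eNrg v t :=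
          ENNReal.ofReal_le_ofReal (hv.toIsSol.nrg_antitone hL ha ht hs.le)
        have h3 : (calM0 p δ a s ^ (p / (2 * (1 - thetaD d)))) ^ (2 / p)
            = calM0 p δ a s ^ (1 / (1 - thetaD d)) := by
          rw [← ENNReal.rpow_mul]
          congr 1
          rw [div_mul_div_comm, mul_comm p 2, mul_assoc, mul_comm (1 - thetaD d) p,
            mul_div_mul_left _ _ (by norm_num : (2 : ℝ) ≠ 0), mul_comm p, ← div_div,
            div_right_comm, div_self hp0.ne']
        rw [h3]
        calc _ ≤ calM0 p δ a s ^ (1 / (1 - thetaD d))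
              * (eMom p v s ^ (1 - 2 / p) * eNrg v t ^ (2 / p)) := by
              refine mul_le_mul_right (h1.trans ?_) _
              gcongr
          _ = _ := by ring
    _ = eNrg v t ^ (2 / p) * ∫⁻ s in Ioi t, ((ENNReal.ofReal (kBig p δ (s - t))
          * calM0 p δ a s ^ (p / (2 * (1 - thetaD d)))) ^ (2 / p)
          * (ENNReal.ofReal (kBig p δ (s - t)) * eMom p v s) ^ (1 - 2 / p)) := by
        rw [avgK_const_mul (c := eNrg v t ^ (2 / p))
          (ENNReal.rpow_ne_top_of_nonneg (by positivity) ENNReal.ofReal_ne_top), avgK]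
        congr 1
        refine lintegral_congr fun s => ?_
        rw [ENNReal.mul_rpow_of_nonneg _ _ (by positivity : 0 ≤ 2 / p),
          ENNReal.mul_rpow_of_nonneg _ _ hκ0.le]
        set k := ENNReal.ofReal (kBig p δ (s - t)) with hk
        have e1 : k = k ^ (2 / p) * k ^ (1 - 2 / p) := by
          rw [← ENNReal.rpow_add_of_nonneg _ _ (by positivity) hκ0.le, add_sub_cancel,
            ENNReal.rpow_one]
        nth_rewrite 1 [e1]
        ring
    _ ≤ eNrg v t ^ (2 / p) * ((∫⁻ s in Ioi t, ENNReal.ofReal (kBig p δ (s - t))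
          * calM0 p δ a s ^ (p / (2 * (1 - thetaD d)))) ^ (2 / p)
          * avgK p δ (eMom p v) t ^ (1 - 2 / p)) := by
        refine mul_le_mul_right ?_ _
        exact ENNReal.lintegral_mul_norm_pow_le (hkm.mul (hMm.pow_const _)).aemeasurable
          (hkm.mul (hv.toIsSol.measurable_eMom p)).aemeasurable (by positivity) hκ0.le (by ring)
    _ ≤ eNrg v t ^ (2 / p) * (calM1 p δ a t ^ (2 / p)
          * avgK p δ (eMom p v) t ^ (1 - 2 / p)) := by
        gcongr
        rw [calM1]
        exact le_add_self
    _ = _ := by ring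

/-- Bounds on averaged weighted energies. -/
theorem exists_avgK_eMom_le (d : ℕ) (hd : 2 ≤ d) {p δ : ℝ} (hp : 2 < p) (hδ : 0 < δ)
    (hK : KernelSmall p δ) : ∃ C : ℝ, 0 < C ∧
    ∀ (L : ℕ) (_ : 1 ≤ L) (a : ℝ → Edge d L → ℝ) (v : ℝ → Torus d L → ℝ), IsEnv a → IsHeat a v →
    ∀ t : ℝ, 0 ≤ t → avgK p δ (eMom p v) t ≤ ENNReal.ofReal C * scrM2 p a
      + (ENNReal.ofReal C * ∫⁻ s in Ioc 0 t, calM1 p δ a s ^ (2 / p) * eNrg v s ^ (2 / p))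
        ^ (p / 2) := by
  obtain ⟨C1, hC1, h1⟩ := exists_eMom_add_le d hp.le
  obtain ⟨C0, hC0, h0⟩ := exists_avgK_eMom_zero_le d (by omega) hp hδ
  have hd0 : (0 : ℝ) < d := by exact_mod_cast (by omega : 0 < d)
  set B : ℝ := 20 * d * (1 + 2 ^ p) ^ 2 with hB
  have hB0 : 0 < B := by positivity
  clear_value B
  -- `C1` multiplies the error term and `B` is the cost of moderation. This `ε` turns the moderated
  -- part of the error into exactly half of the weighted dissipation.
  obtain ⟨C2, hC2, h2⟩ := exists_eErr_le d hd δ hp.le (ε := 1 / (2 * C1 * B)) (by positivity)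
  have hp0 : 0 < p := by linarith
  refine ⟨max (2 * C0) (2 * (C1 * C2)), by positivity, fun L hL a v ha hv t ht => ?_⟩
  set S : ℝ≥0∞ := ⨆ r ∈ Icc 0 t, avgK p δ (eMom p v) r with hS
  have hSfin : S ≠ ⊤ := ne_top_of_le_ne_top ENNReal.ofReal_ne_top
    (iSup₂_le fun r hr => avgK_le_of_le hK hp hδ fun s hs =>
      eMom_le_card hL hp0.le ha hv (hr.1.trans hs.le))
  have hSle : ∀ r ∈ Icc 0 t, avgK p δ (eMom p v) r ≤ S := fun r hr =>
    le_iSup₂ (f := fun r (_ : r ∈ Icc 0 t) => avgK p δ (eMom p v) r) r hr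
  set I := ∫⁻ s in Ioc 0 t, calM1 p δ a s ^ (2 / p) * eNrg v s ^ (2 / p) with hI
  have hκ0 : 0 < 1 - 2 / p := sub_pos.2 ((div_lt_one hp0).2 hp)
  have hle : S ≤ avgK p δ (eMom p v) 0 + (ENNReal.ofReal (C1 * C2) * I) * S ^ (1 - 2 / p) := by
    refine iSup₂_le fun r hr => ?_
    have h3 := avgK_add_setLIntegral_le (p := p) (δ := δ) (hv.toIsSol.measurable_eMom p)
      ((hv.toIsSol.measurable_eDspW ha p).const_mul (ENNReal.ofReal (1 / 2)))
      (hv.toIsSol.measurable_eMom p)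
      ((hv.toIsSol.measurable_eErr ha p).const_mul (ENNReal.ofReal C1)) (t1 := 0) (t2 := r)
      (fun q hq => h1 L hL a v ha hv.toIsSol 0 r q le_rfl hr.1 hq.le)
    have h4 : ∫⁻ s in Ioc 0 r, avgK p δ (fun s => ENNReal.ofReal C1 * eErr p a v s) s
        ≤ (∫⁻ s in Ioc 0 r, avgK p δ (fun s => ENNReal.ofReal (1 / 2) * eDspW p a v s) s)
          + (ENNReal.ofReal (C1 * C2) * I) * S ^ (1 - 2 / p) := by
      calc _ ≤ ∫⁻ s in Ioc 0 r, (avgK p δ (fun s => ENNReal.ofReal (1 / 2) * eDspW p a v s) s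
            + (ENNReal.ofReal (C1 * C2) * S ^ (1 - 2 / p))
              * (calM1 p δ a s ^ (2 / p) * eNrg v s ^ (2 / p))) := by
            refine setLIntegral_mono' measurableSet_Ioc fun s hs => ?_
            have hs0 : 0 ≤ s := hs.1.le
            calc avgK p δ (fun s => ENNReal.ofReal C1 * eErr p a v s) s
                ≤ avgK p δ (fun s => ENNReal.ofReal (1 / (2 * B)) * eModW p δ a v s
                  + ENNReal.ofReal (C1 * C2) * (calM0 p δ a s ^ (1 / (1 - thetaD d))
                    * eMom (p - 2) v s)) s := by
                  refine avgK_mono fun q hq => ?_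
                  refine (mul_le_mul_right (h2 L hL a v ha hv q (hs0.trans hq.le)) _).trans
                    (le_of_eq ?_)
                  rw [mul_add, ← mul_assoc, ← mul_assoc, ← ENNReal.ofReal_mul hC1.le,
                    ← ENNReal.ofReal_mul hC1.le]
                  congr 3
                  field_simp
              _ = ENNReal.ofReal (1 / (2 * B)) * avgK p δ (eModW p δ a v) s
                  + ENNReal.ofReal (C1 * C2) * avgK p δ (fun s =>
                    calM0 p δ a s ^ (1 / (1 - thetaD d)) * eMom (p - 2) v s) s := by
                  have hmeas : Measurable fun s => ENNReal.ofReal (1 / (2 * B))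
                      * eModW p δ a v s := by
                    refine Measurable.const_mul (Measurable.ennreal_ofReal
                      (Finset.measurable_fun_sum _ fun e _ => ?_)) _
                    exact (((ha.measurable_modEnv p δ e).pow_const 2).mul
                      ((hv.toIsSol.cont_edgeDiff e).pow 2).measurable).const_mul _
                  rw [avgK_add hmeas, avgK_const_mul ENNReal.ofReal_ne_top,
                    avgK_const_mul ENNReal.ofReal_ne_top]
              _ ≤ ENNReal.ofReal (1 / (2 * B)) * (ENNReal.ofReal B * avgK p δ (eDspW p a v) s)
                  + ENNReal.ofReal (C1 * C2) * (calM1 p δ a s ^ (2 / p) * eNrg v s ^ (2 / p)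
                    * S ^ (1 - 2 / p)) := by
                  gcongr
                  · exact hB ▸ hv.toIsSol.avgK_eModW_le hK hp hδ hL ha hs0
                  · refine (hv.avgK_err_le hp hL ha hs0).trans ?_
                    gcongr
                    exact hSle s ⟨hs0, hs.2.trans hr.2⟩
              _ = _ := by
                  rw [avgK_const_mul ENNReal.ofReal_ne_top, ← mul_assoc,
                    ← ENNReal.ofReal_mul (by positivity),
                    show 1 / (2 * B) * B = 1 / 2 by field_simp]
                  ring
        _ = (∫⁻ s in Ioc 0 r, avgK p δ (fun s => ENNReal.ofReal (1 / 2) * eDspW p a v s) s)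
            + (ENNReal.ofReal (C1 * C2) * S ^ (1 - 2 / p))
              * ∫⁻ s in Ioc 0 r, calM1 p δ a s ^ (2 / p) * eNrg v s ^ (2 / p) := by
            rw [lintegral_add_left (measurable_avgK
              ((hv.toIsSol.measurable_eDspW ha p).const_mul _)), lintegral_const_mul']
            exact ENNReal.mul_ne_top ENNReal.ofReal_ne_top
              (ENNReal.rpow_ne_top_of_nonneg hκ0.le hSfin)
        _ ≤ (∫⁻ s in Ioc 0 r, avgK p δ (fun s => ENNReal.ofReal (1 / 2) * eDspW p a v s) s)
            + (ENNReal.ofReal (C1 * C2) * S ^ (1 - 2 / p)) * I := by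
            gcongr
            exact lintegral_mono_set (Ioc_subset_Ioc_right hr.2)
        _ = _ := by ring
    -- The dissipation occurs on both sides and may be cancelled only because it is finite.
    have h5 : ∫⁻ s in Ioc 0 r, avgK p δ (fun s => ENNReal.ofReal (1 / 2) * eDspW p a v s) s
        ≠ ⊤ := by
      simp only [avgK_const_mul ENNReal.ofReal_ne_top]
      rw [lintegral_const_mul' _ _ ENNReal.ofReal_ne_top]
      exact ENNReal.mul_ne_top ENNReal.ofReal_ne_top
        (hv.toIsSol.setLIntegral_avgK_eDspW_ne_top hK hp hδ hL ha hr.1)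
    have h6 := h3.trans (add_le_add_right h4 _)
    rw [add_left_comm, add_comm (avgK p δ (eMom p v) r)] at h6
    exact (ENNReal.add_le_add_iff_left h5).1 h6
  have hfin := le_of_le_add_mul_rpow (by positivity) (by linarith) hSfin hle
  rw [one_div_div] at hfin
  refine (hSle t ⟨ht, le_rfl⟩).trans (hfin.trans (add_le_add ?_ ?_))
  · calc _ ≤ 2 * (ENNReal.ofReal C0 * scrM2 p a) := by gcongr; exact h0 L hL a v ha hv
      _ = ENNReal.ofReal (2 * C0) * scrM2 p a := by
          rw [ENNReal.ofReal_mul zero_le_two, ENNReal.ofReal_ofNat, mul_assoc]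
      _ ≤ _ := by gcongr; exact le_max_left _ _
  · refine ENNReal.rpow_le_rpow ?_ (by positivity)
    rw [← mul_assoc, ← ENNReal.ofReal_ofNat 2, ← ENNReal.ofReal_mul (by norm_num)]
    gcongr
    exact le_max_right _ _

end AveragedMoment

end GradPhi

namespace GradPhi

/-! ### Lower bounds on the averaged dissipation -/

section AveragedNash

variable {d L : ℕ} {p p' δ : ℝ} {a : ℝ → Edge d L → ℝ} {v : ℝ → Torus d L → ℝ}

lemma ofReal_sq_mul_rpow {M : ℝ≥0∞} (hM : M ≠ ⊤) {X α : ℝ} (hα : 0 ≤ α) (hX : 0 ≤ X) :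
    ENNReal.ofReal ((√M.toReal ^ 2 * X) ^ α) = M ^ α * ENNReal.ofReal X ^ α := by
  rw [Real.sq_sqrt ENNReal.toReal_nonneg, ← ENNReal.ofReal_rpow_of_nonneg (by positivity) hα,
    ENNReal.ofReal_mul ENNReal.toReal_nonneg, ENNReal.ofReal_toReal hM,
    ENNReal.mul_rpow_of_nonneg _ _ hα]

/-- The reciprocal power of `𝓜_3` which enters `ℳ_3`. -/
noncomputable def invM3 (p p' δ : ℝ) (a : ℝ → Edge d L → ℝ) (t : ℝ) : ℝ≥0∞ :=
  calM3 p p' δ a t ^ (-(1 / alphaE d p p'))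

lemma one_le_calM3 {t : ℝ} : 1 ≤ calM3 p p' δ a t := le_self_add

lemma invM3_le_one (hα : 0 < alphaE d p p') (t : ℝ) : invM3 p p' δ a t ≤ 1 :=
  ENNReal.rpow_le_one_of_one_le_of_neg one_le_calM3 (by simpa using hα)

/-- Raise to the power `1 / α` and divide by the corresponding power of `calM3`. At times when
`calM3` is infinite, the left side is zero, so such times need no exclusion. -/
lemma invM3_mul_rpow_le (hα : 0 < alphaE d p p') {t : ℝ} {G A D : ℝ≥0∞}
    (h : calM3 p p' δ a t ≠ ⊤ → G ≤ A * (calM3 p p' δ a t * D ^ alphaE d p p')) :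
    invM3 p p' δ a t * G ^ (1 / alphaE d p p') ≤ A ^ (1 / alphaE d p p') * D := by
  have hα' : 0 < 1 / alphaE d p p' := one_div_pos.2 hα
  by_cases htop : calM3 p p' δ a t = ⊤
  · rw [invM3, htop, ENNReal.top_rpow_of_neg (by simpa using hα), zero_mul]
    exact bot_le
  have h1 : calM3 p p' δ a t ≠ 0 := (one_pos.trans_le one_le_calM3).ne'
  calc _ ≤ invM3 p p' δ a t * (A * (calM3 p p' δ a t * D ^ alphaE d p p')) ^ (1 / alphaE d p p') := by
        gcongr; exact h htop
    _ = (calM3 p p' δ a t ^ (-(1 / alphaE d p p')) * calM3 p p' δ a t ^ (1 / alphaE d p p'))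
          * (A ^ (1 / alphaE d p p') * (D ^ alphaE d p p') ^ (1 / alphaE d p p')) := by
        rw [invM3, ENNReal.mul_rpow_of_nonneg _ _ hα'.le, ENNReal.mul_rpow_of_nonneg _ _ hα'.le]
        ring
    _ = _ := by
        rw [← ENNReal.rpow_add _ _ h1 htop, neg_add_cancel, ENNReal.rpow_zero, one_mul,
          ← ENNReal.rpow_mul, mul_one_div_cancel hα.ne', ENNReal.rpow_one]

lemma IsSol.avgK_ne_top (hK : KernelSmall p δ) (hp : 2 < p) (hδ : 0 < δ) (hL : 1 ≤ L)
    (ha : IsEnv a) (hv : IsSol a v) {t : ℝ} (ht : 0 ≤ t) : avgK p δ (eNrg v) t ≠ ⊤ :=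
  ne_top_of_le_ne_top ENNReal.ofReal_ne_top (hv.avgK_eNrg_le hK hp hδ hL ha ht)

lemma exists_avgK_eMod_le {p δ : ℝ} (d : ℕ) (hd : 1 ≤ d) (hp : 2 < p) (hδ : 0 < δ)
    (hK : KernelSmall p δ) : ∃ D : ℝ, 0 < D ∧ ∀ (L : ℕ) (_ : 1 ≤ L) (a : ℝ → Edge d L → ℝ)
      (v : ℝ → Torus d L → ℝ), IsEnv a → IsSol a v → ∀ t : ℝ, 0 ≤ t →
      avgK p δ (eMod p δ a v) t ≤ ENNReal.ofReal D * avgK p δ (eDsp a v) t := by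
  have hd0 : (0 : ℝ) < d := by exact_mod_cast hd
  exact ⟨80 * d, by positivity, fun L hL a v ha hv t ht => hv.avgK_eMod_le hK hp hδ hL ha ht⟩

/-- Lower bound on the dissipation of the heat kernel. -/
lemma exists_invM3_mul_le (d : ℕ) (hd : 2 ≤ d) {p p' δ : ℝ} (hp : (d : ℝ) < p)
    (hp' : (d : ℝ) < p') (hδ : 0 < δ) (hK : KernelSmall p δ) : ∃ C : ℝ, 1 ≤ C ∧
    ∀ (L : ℕ) (_ : 1 ≤ L) (a : ℝ → Edge d L → ℝ) (v : ℝ → Torus d L → ℝ), IsEnv a → IsHeat a v →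
    ∀ t N : ℝ, 0 ≤ t → 0 < N → avgK p δ (eMom p v) t ≤ ENNReal.ofReal N →
      ENNReal.ofReal (C / (2 * L + 1) ^ d) ≤ avgK p δ (eNrg v) t →
      invM3 p p' δ a t * avgK p δ (eNrg v) t ^ (1 / alphaE d p p')
        ≤ ENNReal.ofReal (C * N ^ (gammaE d p p' / alphaE d p p')) * avgK p δ (eDsp a v) t := by
  have hd2 : (2 : ℝ) ≤ d := by exact_mod_cast hd
  have hexp := nashExponents hd hp hp'
  obtain ⟨C, hC, h⟩ := exists_nash d (by omega) hp hp' (by linarith) hexp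
  have hα := hexp.pos_α
  have hβ := hexp.pos_β
  have hγ := hexp.pos_γ
  have hsum := hexp.add_eq
  set α := alphaE d p p' with hαdef
  set β := betaE d p p' with hβdef
  set γ := gammaE d p p' with hγdef
  obtain ⟨D0, hD0, hmod⟩ := exists_avgK_eMod_le (p := p) (δ := δ) d (by omega) (by linarith) hδ hK
  refine ⟨max 1 (max (2 * C) ((2 * C) ^ (1 / α) * D0)), le_max_left _ _,
    fun L hL a v ha hv t N ht hN hmom hlow => ?_⟩
  set C' := max 1 (max (2 * C) ((2 * C) ^ (1 / α) * D0)) with hC'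
  have h1 : calM3 p p' δ a t ≠ ⊤ → avgK p δ (eNrg v) t
      ≤ ENNReal.ofReal (2 * C * N ^ γ * D0 ^ α)
        * (calM3 p p' δ a t * avgK p δ (eDsp a v) t ^ α) := by
    intro hfin
    have hav := avgK_le_calM3_mul hK (by linarith) hδ ha hα hβ hγ hsum
      (G := eNrg v) (hv.toIsSol.measurable_eMod (p := p) (δ := δ) ha)
      (hv.toIsSol.measurable_eMom p) (c0 := ENNReal.ofReal (C / (2 * L + 1) ^ d))
      (c1 := ENNReal.ofReal C) ENNReal.ofReal_ne_top hfin (fun s hs hM => ?_)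
    -- The energy is assumed to be at least twice the finite-volume term of the Nash inequality, so
    -- that term is absorbed at the cost of a factor 2.
    · have h2 : avgK p δ (eNrg v) t + ENNReal.ofReal (C / (2 * L + 1) ^ d) * 2
          ≤ ENNReal.ofReal C * (calM3 p p' δ a t * avgK p δ (eMod p δ a v) t ^ α
            * avgK p δ (eMom p v) t ^ γ) * 2 + ENNReal.ofReal (C / (2 * L + 1) ^ d) * 2 := by
        have hc2 : ENNReal.ofReal (C / (2 * L + 1) ^ d) * 2 ≤ avgK p δ (eNrg v) t := by
          refine le_trans ?_ hlow
          rw [← ENNReal.ofReal_ofNat 2, ← ENNReal.ofReal_mul (by positivity)]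
          refine ENNReal.ofReal_le_ofReal ?_
          rw [div_mul_eq_mul_div, mul_comm C]
          gcongr
          exact (le_max_left _ _).trans (le_max_right _ _)
        calc _ ≤ avgK p δ (eNrg v) t + avgK p δ (eNrg v) t := by gcongr
          _ = avgK p δ (eNrg v) t * 2 := (mul_two _).symm
          _ ≤ _ := mul_le_mul_left hav 2
          _ = _ := by ring
      have h3 := (ENNReal.add_le_add_iff_right (by finiteness)).1 h2
      refine h3.trans ?_
      calc _ ≤ ENNReal.ofReal C * (calM3 p p' δ a t *
            (ENNReal.ofReal D0 * avgK p δ (eDsp a v) t) ^ α * (ENNReal.ofReal N) ^ γ) * 2 := by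
            gcongr
            exact hmod L hL a v ha hv.toIsSol t ht
        _ = _ := by
            rw [ENNReal.mul_rpow_of_nonneg _ _ hα.le, ENNReal.ofReal_mul (by positivity),
              ENNReal.ofReal_mul (by positivity), ENNReal.ofReal_mul (by positivity),
              ENNReal.ofReal_rpow_of_nonneg (by positivity) hα.le,
              ENNReal.ofReal_rpow_of_nonneg hN.le hγ.le, ENNReal.ofReal_ofNat]
            ring
    · have hn := h L hL _ _ (invNormLE_of_calMp'_ne_top hL (by linarith) hM) (v s)
      have hs0 : 0 ≤ s := ht.trans hs.le
      have hone : ∑ x, |v s x| = 1 := by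
        rw [← hv.sum_eq hL ha hs0]
        exact Finset.sum_congr rfl fun x _ => abs_of_nonneg (hv.nonneg hL ha hs0 x)
      rw [hone, one_pow, Real.one_rpow, mul_one] at hn
      refine (ENNReal.ofReal_le_ofReal hn).trans (le_of_eq ?_)
      have hX := energyW_nonneg (modEnv p δ a s) (v s)
      have hm := mom_nonneg v p s
      rw [ENNReal.ofReal_add (by positivity) (by positivity), mul_one_div,
        ENNReal.ofReal_mul hC.le, ENNReal.ofReal_mul (by positivity),
        ofReal_sq_mul_rpow hM hα.le hX, ← ENNReal.ofReal_rpow_of_nonneg hm hγ.le]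
      rfl
  refine (invM3_mul_rpow_le hα h1).trans (mul_le_mul_left ?_ _)
  rw [ENNReal.ofReal_rpow_of_nonneg (by positivity) (by positivity)]
  refine ENNReal.ofReal_le_ofReal ?_
  rw [Real.mul_rpow (by positivity) (by positivity), Real.mul_rpow (by positivity) (by positivity),
    ← Real.rpow_mul (by positivity), ← Real.rpow_mul (by positivity), mul_one_div, mul_one_div_cancel hα.ne',
    Real.rpow_one, mul_right_comm]
  gcongr
  exact (le_max_right _ _).trans (le_max_right _ _)

/-- Lower bounds on the dissipation of solutions of vanishing sum. -/
lemma exists_invM3_mul_le_of_sum_eq_zero (d : ℕ) (hd : 2 ≤ d) {p p' δ : ℝ} (hp : (d : ℝ) < p)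
    (hp' : (d : ℝ) < p') (hδ : 0 < δ) (hK : KernelSmall p δ) : ∃ C : ℝ, 1 ≤ C ∧
    ∀ (L : ℕ) (_ : 1 ≤ L) (a : ℝ → Edge d L → ℝ) (u : ℝ → Torus d L → ℝ), IsEnv a → IsSol a u →
    (∀ t, 0 ≤ t → ∑ x, u t x = 0) → (∀ t, 0 ≤ t → ∑ x, |u t x| ≤ 2) → ∀ t : ℝ, 0 ≤ t →
      invM3 p p' δ a t * avgK p δ (eNrg u) t ^ (1 + betaE d p p' / alphaE d p p')
          ≤ ENNReal.ofReal (C * (L : ℝ) ^ (p * (gammaE d p p' / alphaE d p p')))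
            * avgK p δ (eDsp a u) t ∧
      invM3 p p' δ a t * eNrg u (t + 1)
          ≤ ENNReal.ofReal (C * (L : ℝ) ^ 2) * avgK p δ (eDsp a u) t := by
  have hd2 : (2 : ℝ) ≤ d := by exact_mod_cast hd
  have hexp := nashExponents hd hp hp'
  obtain ⟨C1, hC1, h1⟩ := exists_nash_of_sum_eq_zero d (by omega) hp hp' (by linarith) hexp
  obtain ⟨C2, hC2, h2⟩ := exists_poincare d (by omega) hp' (by linarith)
  have hα := hexp.pos_α
  have hβ := hexp.pos_β
  have hγ := hexp.pos_γ
  have hsum := hexp.add_eq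
  set α := alphaE d p p' with hαdef
  set β := betaE d p p' with hβdef
  set γ := gammaE d p p' with hγdef
  obtain ⟨D0, hD0, hmod⟩ := exists_avgK_eMod_le (p := p) (δ := δ) d (by omega) (by linarith) hδ hK
  set K1 : ℝ := C1 * 4 ^ β * D0 ^ α with hK1
  set c0 : ℝ := δ / 2 ^ (p + 3) with hc0
  have hc0p : 0 < c0 := by positivity
  set K2 : ℝ := c0⁻¹ * C2 ^ α * D0 ^ α with hK2
  have hK1p : 0 < K1 := by positivity
  have hK2p : 0 < K2 := by positivity
  refine ⟨max 1 (max (K1 ^ (1 / α)) (K2 ^ (1 / α))), le_max_left _ _,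
    fun L hL a u ha hu hu0 hu1 t ht => ⟨?_, ?_⟩⟩
  · have hL0 : (0 : ℝ) < L := by exact_mod_cast hL
    have hnash : calM3 p p' δ a t ≠ ⊤ → avgK p δ (eNrg u) t
        ≤ ENNReal.ofReal K1 * (calM3 p p' δ a t * avgK p δ (eDsp a u) t ^ α
          * (ENNReal.ofReal (L ^ p) * avgK p δ (eNrg u) t) ^ γ) := by
      intro hfin
      have hav := avgK_le_calM3_mul hK (by linarith) hδ ha hα hβ hγ hsum
        (G := eNrg u) (hu.measurable_eMod (p := p) (δ := δ) ha)
        (hu.measurable_eNrg.const_mul (ENNReal.ofReal (L ^ p))) (c0 := 0)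
        (c1 := ENNReal.ofReal (C1 * 4 ^ β)) ENNReal.ofReal_ne_top hfin (fun s hs hM => ?_)
      · rw [zero_add, avgK_const_mul ENNReal.ofReal_ne_top] at hav
        refine hav.trans ?_
        calc _ ≤ ENNReal.ofReal (C1 * 4 ^ β) * (calM3 p p' δ a t
              * (ENNReal.ofReal D0 * avgK p δ (eDsp a u) t) ^ α
              * (ENNReal.ofReal (L ^ p) * avgK p δ (eNrg u) t) ^ γ) := by
              gcongr
              exact hmod L hL a u ha hu t ht
          _ = _ := by
              have e : ENNReal.ofReal K1 = ENNReal.ofReal (C1 * 4 ^ β) * ENNReal.ofReal (D0 ^ α) :=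
                ENNReal.ofReal_mul (by positivity)
              rw [ENNReal.mul_rpow_of_nonneg _ _ hα.le, e,
                ENNReal.ofReal_rpow_of_nonneg (by positivity) hα.le]
              ring
      · have hs0 : 0 ≤ s := ht.trans hs.le
        have hn := h1 L hL _ _ (invNormLE_of_calMp'_ne_top hL (by linarith) hM) (u s) (hu0 s hs0)
        have hX := energyW_nonneg (modEnv p δ a s) (u s)
        have hE : 0 ≤ ∑ x, u s x ^ 2 := nrg_nonneg u s
        have habs : 0 ≤ ∑ x, |u s x| := Finset.sum_nonneg fun _ _ => abs_nonneg _
        have h4 : ((∑ x, |u s x|) ^ 2) ^ β ≤ 4 ^ β := by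
          refine Real.rpow_le_rpow (sq_nonneg _) ?_ hβ.le
          nlinarith [hu1 s hs0]
        have hn2 : ∑ x, u s x ^ 2 ≤ C1 * 4 ^ β * ((√(calMp' p p' δ a s).toReal ^ 2
            * energyW (modEnv p δ a s) (u s)) ^ α * ((L : ℝ) ^ p * ∑ x, u s x ^ 2) ^ γ) := by
          refine hn.trans ?_
          calc _ ≤ C1 * ((√(calMp' p p' δ a s).toReal ^ 2
                * energyW (modEnv p δ a s) (u s)) ^ α * 4 ^ β
                * ((L : ℝ) ^ p * ∑ x, u s x ^ 2) ^ γ) := by gcongr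
            _ = _ := by ring
        rw [zero_add]
        refine (ENNReal.ofReal_le_ofReal hn2).trans (le_of_eq ?_)
        rw [ENNReal.ofReal_mul (p := C1 * 4 ^ β) (by positivity)]
        congr 1
        rw [ENNReal.ofReal_mul (by positivity),
          ofReal_sq_mul_rpow hM hα.le hX, ← ENNReal.ofReal_rpow_of_nonneg (by positivity) hγ.le,
          ENNReal.ofReal_mul (by positivity)]
        rfl
    have hEfin := hu.avgK_ne_top hK (by linarith) hδ hL ha ht
    by_cases hE0 : avgK p δ (eNrg u) t = 0
    · rw [hE0, ENNReal.zero_rpow_of_pos (by positivity), mul_zero]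
      exact bot_le
    -- For mean zero the moment is replaced by `L ^ p` times the energy, so the energy also appears
    -- on the right. Division leaves the power `1 - γ = α + β`, which becomes `1 + β / α` once
    -- raised to `1 / α`.
    have h3 : calM3 p p' δ a t ≠ ⊤ → avgK p δ (eNrg u) t ^ (1 - γ)
        ≤ ENNReal.ofReal (K1 * (L ^ p) ^ γ)
          * (calM3 p p' δ a t * avgK p δ (eDsp a u) t ^ α) := by
      intro hfin
      have h5 := hnash hfin
      rw [ENNReal.mul_rpow_of_nonneg _ _ hγ.le] at h5
      have h6 : avgK p δ (eNrg u) t ^ (1 - γ) * avgK p δ (eNrg u) t ^ γ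
          ≤ ENNReal.ofReal (K1 * (L ^ p) ^ γ)
          * (calM3 p p' δ a t * avgK p δ (eDsp a u) t ^ α) * avgK p δ (eNrg u) t ^ γ := by
        rw [← ENNReal.rpow_add _ _ hE0 hEfin, sub_add_cancel, ENNReal.rpow_one]
        refine h5.trans (le_of_eq ?_)
        rw [ENNReal.ofReal_mul hK1p.le, ENNReal.ofReal_rpow_of_nonneg (by positivity) hγ.le]
        ring
      exact (ENNReal.mul_le_mul_iff_left (by simp [hE0, hEfin])
        (ENNReal.rpow_ne_top_of_nonneg hγ.le hEfin)).1 h6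
    have h7 := invM3_mul_rpow_le hα h3
    rw [← ENNReal.rpow_mul] at h7
    have e1 : (1 - γ) * (1 / α) = 1 + β / α := by
      rw [show 1 - γ = α + β by linarith]; field_simp
    rw [e1] at h7
    refine h7.trans (mul_le_mul_left ?_ _)
    rw [ENNReal.ofReal_rpow_of_nonneg (by positivity) (by positivity)]
    refine ENNReal.ofReal_le_ofReal ?_
    rw [Real.mul_rpow (by positivity) (by positivity), ← Real.rpow_mul (by positivity),
      ← Real.rpow_mul (by positivity), mul_one_div]
    gcongr
    exact (le_max_left _ _).trans (le_max_right _ _)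
  · have hL0 : (0 : ℝ) < L := by exact_mod_cast hL
    have h3 : calM3 p p' δ a t ≠ ⊤ → eNrg u (t + 1) ^ α
        ≤ ENNReal.ofReal (K2 * (L ^ 2) ^ α)
          * (calM3 p p' δ a t * avgK p δ (eDsp a u) t ^ α) := by
      intro hfin
      -- The Poincaré inequality is raised to the power `α` so that the same Hölder bound applies,
      -- with a constant in place of the moment.
      have hav := avgK_le_calM3_mul hK (by linarith) hδ ha hα hβ hγ hsum
        (G := fun s => eNrg u s ^ α) (hu.measurable_eMod (p := p) (δ := δ) ha)
        (H := fun _ => 1) measurable_const (c0 := 0)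
        (c1 := ENNReal.ofReal ((C2 * L ^ 2) ^ α)) ENNReal.ofReal_ne_top hfin (fun s hs hM => ?_)
      · have hlow := mul_le_avgK (p := p) (by linarith) hδ (g := fun s => eNrg u s ^ α)
          (c := eNrg u (t + 1) ^ α) (t := t)
          (fun s hs => ENNReal.rpow_le_rpow (ENNReal.ofReal_le_ofReal
            (hu.nrg_antitone hL ha (ht.trans hs.1.le) hs.2)) hα.le)
        rw [← hc0] at hlow
        have h8 : avgK p δ (fun _ => 1) t ^ γ ≤ 1 :=
          ENNReal.rpow_le_one (avgK_const_le hK (by linarith) hδ 1 t) hγ.le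
        have h9 : ENNReal.ofReal c0 * eNrg u (t + 1) ^ α ≤ ENNReal.ofReal ((C2 * L ^ 2) ^ α)
            * (calM3 p p' δ a t * (ENNReal.ofReal D0 * avgK p δ (eDsp a u) t) ^ α * 1) := by
          refine hlow.trans (hav.trans ?_)
          rw [zero_add]
          gcongr
          exact hmod L hL a u ha hu t ht
        calc eNrg u (t + 1) ^ α
            = ENNReal.ofReal c0⁻¹ * (ENNReal.ofReal c0 * eNrg u (t + 1) ^ α) := by
              rw [← mul_assoc, ← ENNReal.ofReal_mul (by positivity), inv_mul_cancel₀ hc0p.ne',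
                ENNReal.ofReal_one, one_mul]
          _ ≤ ENNReal.ofReal c0⁻¹ * (ENNReal.ofReal ((C2 * L ^ 2) ^ α)
            * (calM3 p p' δ a t * (ENNReal.ofReal D0 * avgK p δ (eDsp a u) t) ^ α * 1)) := by
              gcongr
          _ = _ := by
              rw [ENNReal.mul_rpow_of_nonneg _ _ hα.le, hK2, Real.mul_rpow hC2.le (by positivity),
                ENNReal.ofReal_mul (by positivity), ENNReal.ofReal_mul (by positivity),
                ENNReal.ofReal_mul (by positivity), ENNReal.ofReal_mul (by positivity),
                ENNReal.ofReal_rpow_of_nonneg hD0.le hα.le]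
              ring
      · have hs0 : 0 ≤ s := ht.trans hs.le
        have hn := h2 L hL _ _ (invNormLE_of_calMp'_ne_top hL (by linarith) hM) (u s) (hu0 s hs0)
        have hX := energyW_nonneg (modEnv p δ a s) (u s)
        have hn2 : nrg u s ^ α ≤ (C2 * L ^ 2) ^ α * (√(calMp' p p' δ a s).toReal ^ 2
            * energyW (modEnv p δ a s) (u s)) ^ α := by
          rw [← Real.mul_rpow (by positivity) (by positivity), mul_assoc]
          exact Real.rpow_le_rpow (nrg_nonneg u s) hn hα.le
        rw [zero_add, ENNReal.one_rpow, mul_one, eNrg,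
          ENNReal.ofReal_rpow_of_nonneg (nrg_nonneg u s) hα.le]
        refine (ENNReal.ofReal_le_ofReal hn2).trans (le_of_eq ?_)
        rw [ENNReal.ofReal_mul (by positivity), ofReal_sq_mul_rpow hM hα.le hX]
        rfl
    have h7 := invM3_mul_rpow_le hα h3
    rw [← ENNReal.rpow_mul, mul_one_div_cancel hα.ne', ENNReal.rpow_one] at h7
    refine h7.trans (mul_le_mul_left ?_ _)
    rw [ENNReal.ofReal_rpow_of_nonneg (by positivity) (by positivity)]
    refine ENNReal.ofReal_le_ofReal ?_
    rw [Real.mul_rpow (by positivity) (by positivity), ← Real.rpow_mul (by positivity),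
      mul_one_div_cancel hα.ne', Real.rpow_one]
    gcongr
    exact (le_max_right _ _).trans (le_max_right _ _)

end AveragedNash

end GradPhi

namespace GradPhi

/-! ### Discrete differential inequalities -/

section Recursions

/-- Two uses of weighted arithmetic–geometric means on `[0, 1]`: `2 ^ z ≤ 1 + z`, and `2 ^ (-ν * z)`
lies below its chord. -/
lemma mul_le_one_sub_rpow_neg {ν z : ℝ} (hν : 0 < ν) (hz0 : 0 ≤ z) (hz1 : z ≤ 1) :
    (1 - 2 ^ (-ν)) * z ≤ 1 - (1 + z) ^ (-ν) := by
  have h1 : (2 : ℝ) ^ z ≤ 1 + z := by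
    have := Real.geom_mean_le_arith_mean2_weighted (w₁ := 1 - z) (w₂ := z) (p₁ := 1) (p₂ := 2)
      (by linarith) hz0 (by norm_num) (by norm_num) (by ring)
    rw [Real.one_rpow, one_mul] at this
    linarith
  have hb : (0 : ℝ) < 2 ^ (-ν) := by positivity
  have h2 : ((2 : ℝ) ^ (-ν)) ^ z ≤ (1 - z) + z * 2 ^ (-ν) := by
    have := Real.geom_mean_le_arith_mean2_weighted (w₁ := 1 - z) (w₂ := z) (p₁ := 1)
      (p₂ := 2 ^ (-ν)) (by linarith) hz0 (by norm_num) hb.le (by ring)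
    rw [Real.one_rpow, one_mul, mul_one] at this
    exact this
  have h3 : (1 + z) ^ (-ν) ≤ ((2 : ℝ) ^ (-ν)) ^ z := by
    rw [← Real.rpow_mul (by norm_num), mul_comm, Real.rpow_mul (by norm_num)]
    exact Real.rpow_le_rpow_of_nonpos (by positivity) h1 (by linarith)
  linarith

/-- Implicit Euler scheme for `y' = - g μ y^{1+ν}`. -/
lemma le_rpow_neg_of_recursion {ν g : ℝ} (hν : 0 < ν) (hg : 0 < g) (hg1 : g ≤ 1) {y μ : ℕ → ℝ}
    (hy1 : ∀ k, y k ≤ 1) (hμ0 : ∀ k, 0 ≤ μ k) (hμ1 : ∀ k, μ k ≤ 1) {n : ℕ} (hyn : 0 < y n)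
    (h : ∀ k < n, y (k + 1) + g * μ k * y (k + 1) ^ (1 + ν) ≤ y k) :
    (1 - 2 ^ (-ν)) * g * ∑ k ∈ Finset.range n, μ k ≤ y n ^ (-ν) := by
  induction n with
  | zero => simp only [Finset.range_zero, Finset.sum_empty, mul_zero]; positivity
  | succ n ih =>
    have hstep := h n (Nat.lt_succ_self n)
    have hpos : 0 ≤ g * μ n * y (n + 1) ^ (1 + ν) :=
      mul_nonneg (mul_nonneg hg.le (hμ0 n)) (Real.rpow_nonneg hyn.le _)
    have hyn' : 0 < y n := by linarith
    have ih' := ih hyn' fun k hk => h k (hk.trans (Nat.lt_succ_self n))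
    -- In terms of `z` the recursion reads `y (n + 1) * (1 + z) ≤ y n`, so `y ^ (-ν)` grows by at
    -- least `(1 - 2 ^ (-ν)) * g * μ n` per step.
    set z := g * μ n * y (n + 1) ^ ν with hz
    have hz0 : 0 ≤ z := mul_nonneg (mul_nonneg hg.le (hμ0 n)) (Real.rpow_nonneg hyn.le _)
    have hz1 : z ≤ 1 := mul_le_one₀ (mul_le_one₀ hg1 (hμ0 n) (hμ1 n)) (Real.rpow_nonneg hyn.le _)
      (Real.rpow_le_one hyn.le (hy1 _) hν.le)
    have e1 : y (n + 1) * (1 + z) ≤ y n := by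
      rw [Real.rpow_add hyn, Real.rpow_one] at hstep
      rw [hz]; linarith
    have e2 : y n ^ (-ν) ≤ y (n + 1) ^ (-ν) * (1 + z) ^ (-ν) := by
      rw [← Real.mul_rpow hyn.le (by linarith)]
      exact Real.rpow_le_rpow_of_nonpos (by positivity) e1 (by linarith)
    have e3 := mul_le_one_sub_rpow_neg hν hz0 hz1
    have e4 : y (n + 1) ^ (-ν) * z = g * μ n := by
      rw [hz, mul_comm, mul_assoc, ← Real.rpow_add hyn, add_neg_cancel, Real.rpow_zero, mul_one]
    have hr : 0 < y (n + 1) ^ (-ν) := Real.rpow_pos_of_pos hyn _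
    have e5 := mul_le_mul_of_nonneg_left e3 hr.le
    rw [Finset.sum_range_succ]
    have e6 : y (n + 1) ^ (-ν) * ((1 - 2 ^ (-ν)) * z) = (1 - 2 ^ (-ν)) * (g * μ n) := by
      rw [← e4]; ring
    rw [e6] at e5
    linarith

lemma exp_half_le {g : ℝ} (h0 : 0 ≤ g) (h1 : g ≤ 1) : Real.exp (g / 2) ≤ 1 + g := by
  have h := Real.one_sub_le_exp_neg (g / 2)
  have h2 : 0 < 1 - g / 2 := by linarith
  have h3 : Real.exp (g / 2) * Real.exp (-(g / 2)) = 1 := by rw [← Real.exp_add]; simp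
  have h4 := Real.exp_pos (g / 2)
  have h5 : Real.exp (g / 2) * (1 - g / 2) ≤ 1 := by nlinarith
  have h6 : 1 ≤ (1 + g) * (1 - g / 2) := by nlinarith
  nlinarith

/-- Exponential decay for delayed recursions. -/
lemma mul_exp_le_of_recursion {y g : ℕ → ℝ} (hy0 : ∀ k, 0 ≤ y k) (hg0 : ∀ k, 0 ≤ g k)
    (hg1 : ∀ k, g k ≤ 1) {m n : ℕ} (hmn : m ≤ n)
    (h : ∀ k, m ≤ k → y (k + 1) + g k * y (k + 2) ≤ y k) :
    y n * y (n + 1) * Real.exp ((∑ k ∈ Finset.Ico m n, g k) / 2) ≤ y m * y (m + 1) := by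
  -- The delay is handled by the product of consecutive terms: `y (n + 1) * y (n + 2) * (1 + g n) ≤
  -- y (n + 1) * y n`.
  induction n, hmn using Nat.le_induction with
  | base => simp
  | succ n hn ih =>
    refine le_trans ?_ ih
    rw [Finset.sum_Ico_succ_top hn, add_div, Real.exp_add, mul_comm (Real.exp _), ← mul_assoc]
    refine mul_le_mul_of_nonneg_right ?_ (Real.exp_pos _).le
    have h1 := h n hn
    have h2 := exp_half_le (hg0 n) (hg1 n)
    have h3 := mul_nonneg (hy0 (n + 1)) (hy0 (n + 2))
    calc y (n + 1) * y (n + 1 + 1) * Real.exp (g n / 2)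
        ≤ y (n + 1) * y (n + 2) * (1 + g n) := mul_le_mul_of_nonneg_left h2 h3
      _ ≤ y (n + 1) * (y (n + 1) + g n * y (n + 2)) := by
          have h4 : y (n + 2) ≤ y (n + 1) := by
            have := h (n + 1) (by omega)
            have h5 := mul_nonneg (hg0 (n + 1)) (hy0 (n + 3))
            linarith [this]
          nlinarith [hy0 (n + 1)]
      _ ≤ y (n + 1) * y n := mul_le_mul_of_nonneg_left h1 (hy0 _)
      _ = _ := mul_comm _ _

end Recursions

/-! ### Time averages of `invM3` and discretization at integer times -/

section TimeAverages

variable {d L : ℕ} {p p' δ : ℝ} {a : ℝ → Edge d L → ℝ} {v : ℝ → Torus d L → ℝ}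

/-- Integrals of `invM3` over unit intervals. -/
noncomputable def stepM3 (p p' δ : ℝ) (a : ℝ → Edge d L → ℝ) (k : ℕ) : ℝ :=
  (∫⁻ s in Ioc (k : ℝ) (k + 1), invM3 p p' δ a s).toReal

lemma setLIntegral_invM3_le (hα : 0 < alphaE d p p') (s t : ℝ) :
    ∫⁻ s in Ioc s t, invM3 p p' δ a s ≤ ENNReal.ofReal (t - s) :=
  (setLIntegral_mono' measurableSet_Ioc fun s _ => invM3_le_one hα s).trans (by simp)

lemma setLIntegral_invM3_ne_top (hα : 0 < alphaE d p p') (s t : ℝ) :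
    ∫⁻ s in Ioc s t, invM3 p p' δ a s ≠ ⊤ :=
  ne_top_of_le_ne_top ENNReal.ofReal_ne_top (setLIntegral_invM3_le hα s t)

lemma stepM3_nonneg (k : ℕ) : 0 ≤ stepM3 p p' δ a k := ENNReal.toReal_nonneg

lemma stepM3_le_one (hα : 0 < alphaE d p p') (k : ℕ) : stepM3 p p' δ a k ≤ 1 := by
  refine ENNReal.toReal_le_of_le_ofReal zero_le_one ((setLIntegral_invM3_le hα _ _).trans ?_)
  simp

lemma sum_stepM3 (hα : 0 < alphaE d p p') (n : ℕ) :
    ENNReal.ofReal (∑ k ∈ Finset.range n, stepM3 p p' δ a k)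
      = ∫⁻ s in Ioc (0 : ℝ) n, invM3 p p' δ a s := by
  induction n with
  | zero => simp
  | succ n ih =>
    rw [Finset.sum_range_succ, ENNReal.ofReal_add (Finset.sum_nonneg fun k _ => stepM3_nonneg k)
      (stepM3_nonneg n), ih, stepM3, ENNReal.ofReal_toReal (setLIntegral_invM3_ne_top hα _ _),
      ← lintegral_union measurableSet_Ioc, Ioc_union_Ioc_eq_Ioc (Nat.cast_nonneg n) (by simp)]
    · push_cast; rfl
    · exact Ioc_disjoint_Ioc_of_le le_rfl

lemma one_le_scrM3 (hα : 0 < alphaE d p p') (hγ : 0 < gammaE d p p') : 1 ≤ scrM3 p p' δ a := by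
  have h : (⨅ t ∈ Ici (1 : ℝ), timeAvg (fun s => calM3 p p' δ a s ^ (-(1 / alphaE d p p'))) t)
      ≤ 1 := by
    refine (iInf₂_le (1 : ℝ) (by simp)).trans ?_
    rw [timeAvg]
    have h := setLIntegral_invM3_le (p := p) (p' := p') (δ := δ) (a := a) hα 0 1
    unfold invM3 at h
    simp only [ENNReal.ofReal_one, inv_one, one_mul]
    simpa using h
  rw [scrM3, ENNReal.rpow_neg, ENNReal.one_le_inv]
  exact ENNReal.rpow_le_one h (by positivity)

/-- Long time averages of `invM3`. -/
lemma le_sum_stepM3 (hα : 0 < alphaE d p p') (hγ : 0 < gammaE d p p')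
    (hfin : scrM3 p p' δ a ≠ ⊤) (n : ℕ) :
    n * (scrM3 p p' δ a).toReal ^ (-(gammaE d p p' / alphaE d p p'))
      ≤ ∑ k ∈ Finset.range n, stepM3 p p' δ a k := by
  rcases Nat.eq_zero_or_pos n with rfl | hn
  · simp
  set α := alphaE d p p' with hαdef
  set γ := gammaE d p p' with hγdef
  have hn1 : (1 : ℝ) ≤ n := by exact_mod_cast hn
  set I : ℝ≥0∞ := ⨅ t ∈ Ici (1 : ℝ), timeAvg (fun s => calM3 p p' δ a s ^ (-(1 / α))) t with hI
  have hS : scrM3 p p' δ a = I ^ (-(α / γ)) := rfl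
  -- The two exponents are inverse to each other, so this power of `scrM3` is the infimum of the
  -- time averages and bounds each of them from below.
  have hI2 : scrM3 p p' δ a ^ (-(γ / α)) = I := by
    rw [hS, ← ENNReal.rpow_mul, show -(α / γ) * -(γ / α) = 1 by field_simp, ENNReal.rpow_one]
  have hS1 : 1 ≤ (scrM3 p p' δ a).toReal :=
    (ENNReal.ofReal_le_iff_le_toReal hfin).1 (by simpa using one_le_scrM3 hα hγ)
  have h1 : I ≤ timeAvg (fun s => calM3 p p' δ a s ^ (-(1 / α))) n := iInf₂_le (n : ℝ) hn1
  have h2 := setLIntegral_eq_mul_timeAvg (fun s => calM3 p p' δ a s ^ (-(1 / α)))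
    (t := (n : ℝ)) (by linarith)
  have h3 := sum_stepM3 (p := p) (p' := p') (δ := δ) (a := a) hα n
  have h4 : ENNReal.ofReal (n * (scrM3 p p' δ a).toReal ^ (-(γ / α)))
      ≤ ENNReal.ofReal (∑ k ∈ Finset.range n, stepM3 p p' δ a k) := by
    rw [h3]
    refine le_trans ?_ (le_of_eq h2.symm)
    rw [ENNReal.ofReal_mul (by positivity), ← ENNReal.ofReal_rpow_of_pos (by linarith),
      ENNReal.ofReal_toReal hfin, hI2]
    exact mul_le_mul_right h1 _
  exact (ENNReal.ofReal_le_ofReal_iff (Finset.sum_nonneg fun k _ => stepM3_nonneg k)).1 h4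

/-- Averaged energies at integer times. -/
noncomputable def avgNrg (p δ : ℝ) (v : ℝ → Torus d L → ℝ) (k : ℕ) : ℝ :=
  (avgK p δ (eNrg v) k).toReal

lemma avgNrg_nonneg (v : ℝ → Torus d L → ℝ) (k : ℕ) : 0 ≤ avgNrg p δ v k := ENNReal.toReal_nonneg

lemma IsSol.ofReal_avgNrg (hK : KernelSmall p δ) (hp : 2 < p) (hδ : 0 < δ) (hL : 1 ≤ L)
    (ha : IsEnv a) (hv : IsSol a v) (k : ℕ) :
    ENNReal.ofReal (avgNrg p δ v k) = avgK p δ (eNrg v) k :=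
  ENNReal.ofReal_toReal (hv.avgK_ne_top hK hp hδ hL ha (Nat.cast_nonneg k))

lemma IsSol.avgNrg_le (hK : KernelSmall p δ) (hp : 2 < p) (hδ : 0 < δ) (hL : 1 ≤ L)
    (ha : IsEnv a) (hv : IsSol a v) (k : ℕ) : avgNrg p δ v k ≤ nrg v k :=
  ENNReal.toReal_le_of_le_ofReal (nrg_nonneg v k)
    (hv.avgK_eNrg_le hK hp hδ hL ha (Nat.cast_nonneg k))

lemma IsSol.nrg_add_one_le (hK : KernelSmall p δ) (hp : 2 < p) (hδ : 0 < δ) (hL : 1 ≤ L)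
    (ha : IsEnv a) (hv : IsSol a v) (k : ℕ) :
    nrg v (k + 1) ≤ 2 ^ (p + 3) / δ * avgNrg p δ v k := by
  have h := hv.eNrg_add_one_le hp hδ hL ha (Nat.cast_nonneg k)
  rw [← hv.ofReal_avgNrg hK hp hδ hL ha, eNrg, ← ENNReal.ofReal_mul (by positivity),
    ENNReal.ofReal_le_ofReal_iff (avgNrg_nonneg v k)] at h
  calc nrg v (k + 1) = 2 ^ (p + 3) / δ * (δ / 2 ^ (p + 3) * nrg v (k + 1)) := by field_simp
    _ ≤ _ := by gcongr

lemma IsSol.avgK_antitone (hL : 1 ≤ L)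
    (ha : IsEnv a) (hv : IsSol a v) {s t : ℝ} (hs : 0 ≤ s) (hst : s ≤ t) :
    avgK p δ (eNrg v) t ≤ avgK p δ (eNrg v) s :=
  le_self_add.trans (hv.avgK_eNrg_add_le hL ha hs hst)

/-- One step of the recursion for the averaged energies. -/
lemma IsSol.avgNrg_step (hK : KernelSmall p δ) (hp : 2 < p) (hδ : 0 < δ) (hL : 1 ≤ L)
    (ha : IsEnv a) (hv : IsSol a v) (hα : 0 < alphaE d p p') (k : ℕ) {A Q : ℝ} (hA : 0 < A)
    (hQ : 0 ≤ Q) (h : ∀ t ∈ Ioc (k : ℝ) (k + 1), invM3 p p' δ a t * ENNReal.ofReal Q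
      ≤ ENNReal.ofReal A * avgK p δ (eDsp a v) t) :
    avgNrg p δ v (k + 1) + 2 / A * stepM3 p p' δ a k * Q ≤ avgNrg p δ v k := by
  have hE := hv.avgK_eNrg_add_le (p := p) (δ := δ) hL ha (Nat.cast_nonneg k)
    (t2 := ((k + 1 : ℕ) : ℝ)) (by simp)
  have hint : ENNReal.ofReal (2 / A * stepM3 p p' δ a k * Q)
      ≤ ∫⁻ s in Ioc (k : ℝ) ((k + 1 : ℕ) : ℝ), avgK p δ (fun s => 2 * eDsp a v s) s := by
    have e1 : ENNReal.ofReal (2 / A * stepM3 p p' δ a k * Q) = ENNReal.ofReal (2 / A * Q)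
        * ∫⁻ s in Ioc (k : ℝ) (k + 1), invM3 p p' δ a s := by
      rw [mul_right_comm, ENNReal.ofReal_mul (by positivity), stepM3,
        ENNReal.ofReal_toReal (setLIntegral_invM3_ne_top hα _ _)]
    rw [e1, ← lintegral_const_mul' _ _ ENNReal.ofReal_ne_top]
    push_cast
    refine setLIntegral_mono' measurableSet_Ioc fun s hs => ?_
    rw [avgK_const_mul (by norm_num)]
    calc _ = ENNReal.ofReal (2 / A) * (invM3 p p' δ a s * ENNReal.ofReal Q) := by
          rw [ENNReal.ofReal_mul (by positivity)]; ring
      _ ≤ ENNReal.ofReal (2 / A) * (ENNReal.ofReal A * avgK p δ (eDsp a v) s) := by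
          exact mul_le_mul_right (h s hs) _
      _ = _ := by
          rw [← mul_assoc, ← ENNReal.ofReal_mul (by positivity), div_mul_cancel₀ _ hA.ne',
            ENNReal.ofReal_ofNat]
  have h2 := (add_le_add_right hint _).trans hE
  rw [← hv.ofReal_avgNrg hK hp hδ hL ha, ← hv.ofReal_avgNrg hK hp hδ hL ha,
    ← ENNReal.ofReal_add (avgNrg_nonneg v _) (mul_nonneg (mul_nonneg (by positivity)
      (stepM3_nonneg k)) hQ), ENNReal.ofReal_le_ofReal_iff (avgNrg_nonneg v k)] at h2
  exact h2

end TimeAverages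

end GradPhi

namespace GradPhi

/-! ### The moment bound under an assumed energy decay -/

section ShortTimes

/-- Induction by halving the interval. On `(t / 2, t]` the weight is at most `2 * (1 + t) ^ (-b)`.
On the first half, `1 + t / 2 ≤ 3 / 4 * (1 + t)` for `t ≥ 1` gives the ratio `ρ < 1`. The constant
`C = 2 / (1 - ρ)` solves `C * ρ + 2 = C`. -/
lemma exists_setLIntegral_mul_rpow_le {b : ℝ} (hb0 : 0 ≤ b) (hb1 : b < 1) : ∃ C : ℝ, 1 ≤ C ∧
    ∀ (f : ℝ → ℝ≥0∞) (G : ℝ), 0 ≤ G →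
    (∀ t, 0 ≤ t → ∫⁻ s in Ioc 0 t, f s ≤ ENNReal.ofReal ((1 + t) * G)) → ∀ t, 0 ≤ t →
    ∫⁻ s in Ioc 0 t, f s * ENNReal.ofReal ((1 + s) ^ (-b))
      ≤ ENNReal.ofReal (C * G * (1 + t) ^ (1 - b)) := by
  set ρ : ℝ := (3 / 4) ^ (1 - b) with hρ
  have hρ1 : ρ < 1 := Real.rpow_lt_one (by norm_num) (by norm_num) (by linarith)
  have hρ0 : 0 < ρ := by positivity
  have h1ρ : 0 < 1 - ρ := by linarith
  have hC2 : 2 ≤ 2 / (1 - ρ) := by rw [le_div_iff₀ h1ρ]; nlinarith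
  refine ⟨2 / (1 - ρ), by linarith, fun f G hG hf => ?_⟩
  have hstep : ∀ r s t : ℝ, 0 ≤ r → 0 ≤ t → (∀ x, r < x → (1 + x) ^ (-b) ≤ s) → 0 ≤ s →
      ∫⁻ x in Ioc r t, f x * ENNReal.ofReal ((1 + x) ^ (-b))
        ≤ ENNReal.ofReal (s * ((1 + t) * G)) := by
    intro r s t hr ht hs hs0
    calc _ ≤ ∫⁻ x in Ioc r t, f x * ENNReal.ofReal s :=
          setLIntegral_mono' measurableSet_Ioc fun x hx =>
            mul_le_mul_right (ENNReal.ofReal_le_ofReal (hs x hx.1)) _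
      _ = (∫⁻ x in Ioc r t, f x) * ENNReal.ofReal s := lintegral_mul_const' _ _ (by simp)
      _ ≤ ENNReal.ofReal ((1 + t) * G) * ENNReal.ofReal s := by
          refine mul_le_mul_left ((lintegral_mono_set (Ioc_subset_Ioc_left hr)).trans (hf t ht)) _
      _ = _ := by rw [mul_comm, ENNReal.ofReal_mul hs0]
  have key : ∀ (n : ℕ) (t : ℝ), 0 ≤ t → t ≤ 2 ^ n →
      ∫⁻ s in Ioc 0 t, f s * ENNReal.ofReal ((1 + s) ^ (-b))
        ≤ ENNReal.ofReal (2 / (1 - ρ) * G * (1 + t) ^ (1 - b)) := by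
    have hsmall : ∀ t : ℝ, 0 ≤ t → t ≤ 1 →
        ∫⁻ s in Ioc 0 t, f s * ENNReal.ofReal ((1 + s) ^ (-b))
          ≤ ENNReal.ofReal (2 / (1 - ρ) * G * (1 + t) ^ (1 - b)) := by
      intro t ht ht1
      refine (hstep 0 1 t le_rfl ht (fun x hx =>
        Real.rpow_le_one_of_one_le_of_nonpos (by linarith) (by linarith)) zero_le_one).trans ?_
      refine ENNReal.ofReal_le_ofReal ?_
      have h1 : (1 : ℝ) ≤ (1 + t) ^ (1 - b) := Real.one_le_rpow (by linarith) (by linarith)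
      calc 1 * ((1 + t) * G) ≤ 2 * G * 1 := by nlinarith
        _ ≤ 2 / (1 - ρ) * G * (1 + t) ^ (1 - b) := by gcongr
    intro n
    induction n with
    | zero => intro t ht ht1; exact hsmall t ht (by simpa using ht1)
    | succ n ih =>
      intro t ht htn
      rcases le_total t 1 with ht1 | ht1
      · exact hsmall t ht ht1
      rw [← Ioc_union_Ioc_eq_Ioc (show (0 : ℝ) ≤ t / 2 by linarith) (show t / 2 ≤ t by linarith),
        lintegral_union measurableSet_Ioc (Ioc_disjoint_Ioc_of_le le_rfl)]
      have h1 := ih (t / 2) (by linarith) (by rw [pow_succ] at htn; linarith)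
      have h2 := hstep (t / 2) (2 * (1 + t) ^ (-b)) t (by linarith) ht (fun x hx => by
        have e1 : (1 + x) ^ (-b) ≤ ((1 + t) / 2) ^ (-b) :=
          Real.rpow_le_rpow_of_nonpos (by linarith) (by linarith) (by linarith)
        refine e1.trans ?_
        rw [Real.div_rpow (by linarith) (by norm_num), Real.rpow_neg (by norm_num : (0 : ℝ) ≤ 2),
          div_inv_eq_mul, mul_comm]
        refine mul_le_mul_of_nonneg_right ?_ (by positivity)
        calc (2 : ℝ) ^ b ≤ 2 ^ (1 : ℝ) := Real.rpow_le_rpow_of_exponent_le (by norm_num) hb1.le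
          _ = 2 := Real.rpow_one 2) (by positivity)
      refine (add_le_add h1 h2).trans ?_
      rw [← ENNReal.ofReal_add (by positivity) (by positivity)]
      refine ENNReal.ofReal_le_ofReal ?_
      have h3 : (1 + t / 2) ^ (1 - b) ≤ ρ * (1 + t) ^ (1 - b) := by
        rw [hρ, ← Real.mul_rpow (by norm_num) (by linarith)]
        exact Real.rpow_le_rpow (by linarith) (by linarith) (by linarith)
      have h4 : (1 + t) ^ (-b) * (1 + t) = (1 + t) ^ (1 - b) := by
        rw [sub_eq_add_neg, add_comm (1 : ℝ) (-b), Real.rpow_add (by linarith), Real.rpow_one]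
      calc _ ≤ 2 / (1 - ρ) * G * (ρ * (1 + t) ^ (1 - b)) + 2 * G * (1 + t) ^ (1 - b) := by
            rw [← h4] at h3 ⊢
            have : 0 ≤ 2 / (1 - ρ) * G := by positivity
            nlinarith [mul_le_mul_of_nonneg_left h3 this]
        _ = _ := by field_simp; ring
  intro t ht
  obtain ⟨n, hn⟩ := pow_unbounded_of_one_lt t (by norm_num : (1 : ℝ) < 2)
  exact key n t ht hn.le

variable {d L : ℕ} {p p' δ : ℝ} {a : ℝ → Edge d L → ℝ} {v : ℝ → Torus d L → ℝ}

lemma one_le_scrM1 (hp : 0 < p) : 1 ≤ scrM1 p δ a :=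
  ENNReal.one_le_rpow (one_le_iSup_timeAvg fun _ =>
    ENNReal.one_le_rpow (by rw [calM1]; exact le_self_add) (by positivity)) (by positivity)

/-- The assumed decay contributes `(1 + s) ^ (-d / p)` to the integral in the moment bound, so the
integral is of order `(1 + t) ^ (1 - d / p)`. The outer power `p / 2` turns this into `(1 + T) ^ ((p
- d) / 2)` and makes the bound linear in `Λ`. -/
lemma exists_avgK_eMom_le_of_nrg_le (d : ℕ) (hd : 2 ≤ d) {p δ : ℝ} (hp : (d : ℝ) < p)
    (hδ : 0 < δ) (hK : KernelSmall p δ) : ∃ C : ℝ, 1 ≤ C ∧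
    ∀ (L : ℕ) (_ : 1 ≤ L) (a : ℝ → Edge d L → ℝ) (v : ℝ → Torus d L → ℝ), IsEnv a → IsHeat a v →
    scrM1 p δ a ≠ ⊤ → scrM2 p a ≠ ⊤ → ∀ Λ T : ℝ, 1 ≤ Λ →
    (∀ s, 0 ≤ s → s ≤ T → nrg v s ≤ Λ * (1 + s) ^ (-((d : ℝ) / 2))) → ∀ t, 0 ≤ t → t ≤ T →
    avgK p δ (eMom p v) t
      ≤ ENNReal.ofReal (C * Λ * (scrM1 p δ a + scrM2 p a).toReal * (1 + T) ^ ((p - d) / 2)) := by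
  have hd2 : (2 : ℝ) ≤ d := by exact_mod_cast hd
  have hp2 : 2 < p := by linarith
  have hp0 : 0 < p := by linarith
  obtain ⟨C1, hC1, h1⟩ := exists_avgK_eMom_le d hd hp2 hδ hK
  obtain ⟨C2, hC2, h2⟩ := exists_setLIntegral_mul_rpow_le (b := d / p) (by positivity)
    ((div_lt_one hp0).2 hp)
  refine ⟨max 1 (C1 + (C1 * C2) ^ (p / 2)), le_max_left _ _, ?_⟩
  intro L hL a v ha hv hM1 hM2 Λ T hΛ hE t ht htT
  set I := ⨆ t ∈ Ici (1 : ℝ), timeAvg (fun s => calM1 p δ a s ^ (2 / p)) t with hI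
  have hIM : scrM1 p δ a = I ^ (p / 2) := rfl
  have hIt : I ≠ ⊤ := by
    intro h
    rw [hIM, h, ENNReal.top_rpow_of_pos (by positivity)] at hM1
    exact hM1 rfl
  have hG0 : 0 ≤ I.toReal := ENNReal.toReal_nonneg
  have hint := h2 (fun s => calM1 p δ a s ^ (2 / p)) I.toReal hG0 (fun t ht => by
    refine (setLIntegral_le_mul_iSup _ ht).trans (le_of_eq ?_)
    rw [ENNReal.ofReal_mul (by linarith), ENNReal.ofReal_toReal hIt]) t ht
  have hΛ0 : 0 < Λ := by linarith
  have hint2 : ∫⁻ s in Ioc 0 t, calM1 p δ a s ^ (2 / p) * eNrg v s ^ (2 / p)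
      ≤ ENNReal.ofReal (Λ ^ (2 / p) * (C2 * I.toReal * (1 + t) ^ (1 - d / p))) := by
    rw [ENNReal.ofReal_mul (by positivity)]
    refine le_trans ?_ (mul_le_mul_right hint _)
    rw [← lintegral_const_mul' _ _ ENNReal.ofReal_ne_top]
    refine setLIntegral_mono' measurableSet_Ioc fun s hs => ?_
    have hs0 : 0 ≤ s := hs.1.le
    rw [mul_left_comm]
    refine mul_le_mul_right ?_ _
    rw [← ENNReal.ofReal_mul (by positivity), eNrg,
      ENNReal.ofReal_rpow_of_nonneg (nrg_nonneg v s) (by positivity)]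
    refine ENNReal.ofReal_le_ofReal ?_
    refine (Real.rpow_le_rpow (nrg_nonneg v s) (hE s hs0 (hs.2.trans htT)) (by positivity)).trans ?_
    rw [Real.mul_rpow hΛ0.le (by positivity), ← Real.rpow_mul (by linarith)]
    rw [show -((d : ℝ) / 2) * (2 / p) = -(d / p) by field_simp]
  refine (h1 L hL a v ha hv t ht).trans ?_
  have hS1 : (scrM1 p δ a).toReal = I.toReal ^ (p / 2) := by rw [hIM, ENNReal.toReal_rpow]
  have hT1 : (1 : ℝ) ≤ (1 + T) ^ ((p - d) / 2) := Real.one_le_rpow (by linarith) (by linarith)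
  have hC10 : 0 < C1 := by linarith
  have hA : ENNReal.ofReal C1 * scrM2 p a
      ≤ ENNReal.ofReal (C1 * Λ * (scrM2 p a).toReal * (1 + T) ^ ((p - d) / 2)) := by
    rw [← ENNReal.ofReal_toReal hM2, ← ENNReal.ofReal_mul hC10.le,
      ENNReal.toReal_ofReal ENNReal.toReal_nonneg]
    refine ENNReal.ofReal_le_ofReal ?_
    have h0 : 0 ≤ C1 * (scrM2 p a).toReal := mul_nonneg hC10.le ENNReal.toReal_nonneg
    calc C1 * (scrM2 p a).toReal ≤ C1 * (scrM2 p a).toReal * (Λ * (1 + T) ^ ((p - d) / 2)) :=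
          le_mul_of_one_le_right h0 (one_le_mul_of_one_le_of_one_le hΛ hT1)
      _ = _ := by ring
  have hB : (ENNReal.ofReal C1 * ∫⁻ s in Ioc 0 t, calM1 p δ a s ^ (2 / p) * eNrg v s ^ (2 / p))
        ^ (p / 2)
      ≤ ENNReal.ofReal ((C1 * C2) ^ (p / 2) * Λ * (scrM1 p δ a).toReal
          * (1 + T) ^ ((p - d) / 2)) := by
    refine (ENNReal.rpow_le_rpow (mul_le_mul_right hint2 _) (by positivity)).trans ?_
    rw [← ENNReal.ofReal_mul hC10.le, ENNReal.ofReal_rpow_of_nonneg (by positivity) (by positivity)]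
    refine ENNReal.ofReal_le_ofReal ?_
    have e1 : C1 * (Λ ^ (2 / p) * (C2 * I.toReal * (1 + t) ^ (1 - d / p)))
        = (C1 * C2) * Λ ^ (2 / p) * I.toReal * (1 + t) ^ (1 - d / p) := by ring
    rw [e1, Real.mul_rpow (by positivity) (by positivity),
      Real.mul_rpow (by positivity) (by positivity),
      Real.mul_rpow (by positivity) (by positivity), ← hS1, ← Real.rpow_mul hΛ0.le,
      ← Real.rpow_mul (by linarith), show 2 / p * (p / 2) = 1 by field_simp, Real.rpow_one,
      show (1 - d / p) * (p / 2) = (p - d) / 2 by field_simp]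
    refine mul_le_mul_of_nonneg_left (Real.rpow_le_rpow (by linarith) (by linarith)
      (by linarith)) (by positivity)
  refine (add_le_add hA hB).trans ?_
  rw [← ENNReal.ofReal_add (by positivity) (by positivity)]
  refine ENNReal.ofReal_le_ofReal ?_
  rw [ENNReal.toReal_add hM1 hM2]
  have hx : 0 ≤ (scrM1 p δ a).toReal := ENNReal.toReal_nonneg
  have hy : 0 ≤ (scrM2 p a).toReal := ENNReal.toReal_nonneg
  set X := (scrM1 p δ a).toReal
  set Y := (scrM2 p a).toReal
  set R := (1 + T) ^ ((p - d) / 2)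
  have hD : 0 ≤ (C1 * C2) ^ (p / 2) := by positivity
  calc _ = (C1 * Y + (C1 * C2) ^ (p / 2) * X) * (Λ * R) := by ring
    _ ≤ ((C1 + (C1 * C2) ^ (p / 2)) * (X + Y)) * (Λ * R) := by
        refine mul_le_mul_of_nonneg_right ?_ (by positivity)
        nlinarith [mul_nonneg hD hy, mul_nonneg hC10.le hx]
    _ ≤ (max 1 (C1 + (C1 * C2) ^ (p / 2)) * (X + Y)) * (Λ * R) := by gcongr; exact le_max_right _ _
    _ = _ := by ring

end ShortTimes

end GradPhi

namespace GradPhi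

/-! ### Closing the loop: energy decay up to time of order `L ^ 2` -/

section NashDecay

variable {d L : ℕ} {p p' δ : ℝ} {a : ℝ → Edge d L → ℝ} {v : ℝ → Torus d L → ℝ}

lemma le_of_mul_rpow_neg_le {E c m W ν r : ℝ} (hE : 0 < E) (hc : 0 < c) (hm : 0 < m) (hW : 0 < W)
    (hν : 0 < ν) (h : c * (m * W ^ (-r)) ≤ E ^ (-ν)) :
    E ≤ c ^ (-(1 / ν)) * m ^ (-(1 / ν)) * W ^ (r / ν) := by
  have h1 := Real.rpow_le_rpow_of_nonpos (z := -(1 / ν)) (by positivity) h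
    (neg_nonpos.2 (by positivity))
  rw [← Real.rpow_mul hE.le, show -ν * -(1 / ν) = 1 by field_simp, Real.rpow_one] at h1
  refine h1.trans (le_of_eq ?_)
  rw [Real.mul_rpow hc.le (by positivity), Real.mul_rpow hm.le (by positivity),
    ← Real.rpow_mul hW.le, ← mul_assoc, show -r * -(1 / ν) = r / ν by ring]

lemma one_le_toReal_scrM3 (hα : 0 < alphaE d p p') (hγ : 0 < gammaE d p p')
    (hfin : scrM3 p p' δ a ≠ ⊤) : 1 ≤ (scrM3 p p' δ a).toReal :=
  (ENNReal.ofReal_le_iff_le_toReal hfin).1 (by simpa using one_le_scrM3 hα hγ)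

/-- Polynomial decay of the averaged energies from a Nash inequality. -/
lemma IsSol.avgNrg_le_of_nash (hK : KernelSmall p δ) (hp : 2 < p) (hδ : 0 < δ) (hL : 1 ≤ L)
    (ha : IsEnv a) (hv : IsSol a v) (hα : 0 < alphaE d p p') (hγ : 0 < gammaE d p p')
    (hfin : scrM3 p p' δ a ≠ ⊤) (hv1 : ∀ t, 0 ≤ t → nrg v t ≤ 1) {ν C W : ℝ} (hν : 0 < ν)
    (hC : 1 ≤ C) (hW : 1 ≤ W) {n : ℕ} (hn : 0 < n)
    (h : ∀ t : ℝ, 0 ≤ t → t ≤ n → invM3 p p' δ a t * avgK p δ (eNrg v) t ^ (1 + ν)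
      ≤ ENNReal.ofReal (C * W ^ (gammaE d p p' / alphaE d p p')) * avgK p δ (eDsp a v) t) :
    avgNrg p δ v n ≤ ((1 - 2 ^ (-ν)) / C) ^ (-(1 / ν)) * (n : ℝ) ^ (-(1 / ν))
      * ((scrM3 p p' δ a).toReal * W) ^ (gammaE d p p' / alphaE d p p' / ν) := by
  have hS := one_le_toReal_scrM3 hα hγ hfin
  set S := (scrM3 p p' δ a).toReal with hSdef
  set r := gammaE d p p' / alphaE d p p' with hr
  have hr0 : 0 < r := div_pos hγ hα
  have hn0 : (0 : ℝ) < n := by exact_mod_cast hn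
  have h2ν : (2 : ℝ) ^ (-ν) < 1 := Real.rpow_lt_one_of_one_lt_of_neg (by norm_num) (by linarith)
  have h2ν' : 0 < 1 - (2 : ℝ) ^ (-ν) := by linarith
  have hc : 0 < (1 - 2 ^ (-ν)) / C := div_pos h2ν' (by linarith)
  rcases (avgNrg_nonneg (p := p) (δ := δ) v n).eq_or_lt with h0 | hpos
  · rw [← h0]
    have : 0 < S * W := by positivity
    positivity
  have hWr : 1 ≤ W ^ r := Real.one_le_rpow hW hr0.le
  have hA : 1 ≤ C * W ^ r := one_le_mul_of_one_le_of_one_le hC hWr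
  -- The averaged energy decreases, so its value at the end of a unit interval bounds the
  -- dissipation from below during the whole interval; hence the implicit scheme. Doubling `A` below
  -- brings the coefficient `2 / A` down to this `g ≤ 1`.
  have hrec := le_rpow_neg_of_recursion (ν := ν) (g := 1 / (C * W ^ r))
    (y := fun k => avgNrg p δ v k) (μ := fun k => stepM3 p p' δ a k) hν
    (by positivity) ((div_le_one (by linarith)).2 hA)
    (fun k => (hv.avgNrg_le hK hp hδ hL ha k).trans (hv1 _ (Nat.cast_nonneg k)))
    (fun k => stepM3_nonneg k) (fun k => stepM3_le_one hα k) (n := n) hpos (fun k hk => by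
      have hkn : ((k + 1 : ℕ) : ℝ) ≤ n := by exact_mod_cast hk
      have := hv.avgNrg_step hK hp hδ hL ha hα k (A := 2 * (C * W ^ r))
        (Q := avgNrg p δ v (k + 1) ^ (1 + ν)) (by positivity)
        (Real.rpow_nonneg (avgNrg_nonneg v _) _) (fun t ht => by
          have ht0 : 0 ≤ t := (Nat.cast_nonneg k).trans ht.1.le
          have htn : t ≤ n := ht.2.trans (by exact_mod_cast hk)
          have e1 : ENNReal.ofReal (avgNrg p δ v (k + 1) ^ (1 + ν))
              ≤ avgK p δ (eNrg v) t ^ (1 + ν) := by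
            rw [← ENNReal.ofReal_rpow_of_nonneg (avgNrg_nonneg v _) (by linarith),
              hv.ofReal_avgNrg hK hp hδ hL ha]
            exact ENNReal.rpow_le_rpow (hv.avgK_antitone hL ha ht0 (by exact_mod_cast ht.2))
              (by linarith)
          refine (mul_le_mul_right e1 _).trans ((h t ht0 htn).trans
            (mul_le_mul_left (ENNReal.ofReal_le_ofReal ?_) _))
          linarith)
      rw [show 2 / (2 * (C * W ^ r)) = 1 / (C * W ^ r) by field_simp] at this
      exact this)
  refine le_of_mul_rpow_neg_le hpos hc hn0 (by positivity) hν ?_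
  refine le_trans ?_ hrec
  have hsum := le_sum_stepM3 (p := p) (p' := p') (δ := δ) (a := a) hα hγ hfin n
  refine le_trans (le_of_eq ?_) (mul_le_mul_of_nonneg_left hsum (by positivity))
  rw [← hSdef, ← hr, Real.mul_rpow (by linarith) (by linarith), Real.rpow_neg (by linarith : 0 ≤ W)]
  field_simp

/-- By homogeneity the decay rate `-α / (β + γ)` and the moment growth `(p - d) / 2 * γ / (β + γ)`
add up to `-d / 2`. The constant `Λ` returns with power `γ / (β + γ) < 1`. -/
lemma nash_decay_arith {q α β γ : ℝ} (hd : 1 ≤ d) (hpd : (d : ℝ) ≤ p)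
    (hexp : NashExponents d p q α β γ) {c C Λ S12 S3 m n : ℝ} (hc : 0 < c) (hC : 1 ≤ C)
    (hΛ : 1 ≤ Λ) (hS12 : 1 ≤ S12) (hS3 : 1 ≤ S3) (hm : 0 < m) (hnm : 1 + n ≤ 3 * m) (hn : 0 ≤ n) :
    c ^ (-(1 / ((β + γ) / α))) * m ^ (-(1 / ((β + γ) / α)))
        * (S3 * (C * Λ * S12 * (1 + n) ^ ((p - d) / 2))) ^ (γ / α / ((β + γ) / α))
      ≤ (c ^ (-(1 / ((β + γ) / α))) * (C * 3 ^ ((p - d) / 2)) ^ (γ / (β + γ)))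
        * (Λ * (S12 * S3)) ^ (γ / (β + γ)) * m ^ (-((d : ℝ) / 2)) := by
  have hα := hexp.pos_α
  have hβ := hexp.pos_β
  have hγ := hexp.pos_γ
  have hd1 : (1 : ℝ) ≤ d := by exact_mod_cast hd
  have h2 := hexp.two_mul hd (by linarith)
  have e1 : γ / α / ((β + γ) / α) = γ / (β + γ) := by field_simp
  have e2 : -(1 / ((β + γ) / α)) + (p - d) / 2 * (γ / (β + γ)) = -((d : ℝ) / 2) := by
    field_simp
    linarith
  have h3 : S3 * (C * Λ * S12 * (1 + n) ^ ((p - d) / 2))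
      ≤ (C * 3 ^ ((p - d) / 2)) * (Λ * (S12 * S3)) * m ^ ((p - d) / 2) := by
    have h4 : (1 + n) ^ ((p - d) / 2) ≤ 3 ^ ((p - d) / 2) * m ^ ((p - d) / 2) := by
      rw [← Real.mul_rpow (by norm_num) hm.le]
      exact Real.rpow_le_rpow (by linarith) hnm (by linarith)
    calc _ ≤ S3 * (C * Λ * S12 * (3 ^ ((p - d) / 2) * m ^ ((p - d) / 2))) := by gcongr
      _ = _ := by ring
  rw [e1]
  have h5 := Real.rpow_le_rpow (z := γ / (β + γ)) (by positivity) h3 (by positivity)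
  rw [Real.mul_rpow (x := C * 3 ^ ((p - d) / 2) * (Λ * (S12 * S3))) (by positivity)
    (by positivity), Real.mul_rpow (x := C * 3 ^ ((p - d) / 2)) (by positivity) (by positivity), ← Real.rpow_mul hm.le] at h5
  calc _ ≤ c ^ (-(1 / ((β + γ) / α))) * m ^ (-(1 / ((β + γ) / α)))
        * ((C * 3 ^ ((p - d) / 2)) ^ (γ / (β + γ)) * (Λ * (S12 * S3)) ^ (γ / (β + γ))
          * m ^ ((p - d) / 2 * (γ / (β + γ)))) := by gcongr
    _ = _ := by
        rw [← e2, Real.rpow_add hm]; ring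

/-- Decay of the energy of the heat kernel up to the mixing time of the torus. -/
lemma exists_nrg_le (d : ℕ) (hd : 2 ≤ d) {p p' δ : ℝ} (hp : (d : ℝ) < p)
    (hp' : (d : ℝ) < p') (hδ : 0 < δ) (hK : KernelSmall p δ) : ∃ C : ℝ, 1 ≤ C ∧
    ∀ (L : ℕ) (_ : 1 ≤ L) (a : ℝ → Edge d L → ℝ) (v : ℝ → Torus d L → ℝ), IsEnv a → IsHeat a v →
    scrM1 p δ a ≠ ⊤ → scrM2 p a ≠ ⊤ → scrM3 p p' δ a ≠ ⊤ →
    ∀ s : ℝ, 0 ≤ s → s ≤ (L : ℝ) ^ 2 + 4 → nrg v s ≤ C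
      * ((scrM1 p δ a + scrM2 p a).toReal * (scrM3 p p' δ a).toReal)
        ^ (gammaE d p p' / betaE d p p') * (1 + s) ^ (-((d : ℝ) / 2)) := by
  have hd2 : (2 : ℝ) ≤ d := by exact_mod_cast hd
  have hp2 : 2 < p := by linarith
  have hexp := nashExponents hd hp hp'
  obtain ⟨C1, hC1, h1⟩ := exists_avgK_eMom_le_of_nrg_le d hd hp hδ hK
  obtain ⟨C2, hC2, h2⟩ := exists_invM3_mul_le d hd hp hp' hδ hK
  have hα := hexp.pos_α
  have hβ := hexp.pos_β
  have hγ := hexp.pos_γ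
  set α := alphaE d p p' with hαd
  set β := betaE d p p' with hβd
  set γ := gammaE d p p' with hγd
  set ν := (β + γ) / α with hνd
  have hν : 0 < ν := by positivity
  have h2ν : (2 : ℝ) ^ (-ν) < 1 := Real.rpow_lt_one_of_one_lt_of_neg (by norm_num) (by linarith)
  have h2ν' : 0 < 1 - (2 : ℝ) ^ (-ν) := by linarith
  set c := (1 - 2 ^ (-ν)) / C2 with hcd
  have hc : 0 < c := div_pos h2ν' (by linarith)
  set C3 := 2 ^ (p + 3) / δ with hC3
  have hC30 : 0 < C3 := by positivity
  set C4 := c ^ (-(1 / ν)) * (C1 * 3 ^ ((p - d) / 2)) ^ (γ / (β + γ)) with hC4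
  have hC40 : 0 < C4 := by positivity
  set C5 := C3 * C4 * 4 ^ ((d : ℝ) / 2) with hC5
  have hC50 : 0 < C5 := by positivity
  set C := 3 ^ ((d : ℝ) / 2) + C3 * C2 + C5 ^ ((β + γ) / β) with hCd
  have h3d : (1 : ℝ) ≤ 3 ^ ((d : ℝ) / 2) := Real.one_le_rpow (by norm_num) (by positivity)
  have hC50' : 0 < C5 ^ ((β + γ) / β) := by positivity
  have hC32 : 0 < C3 * C2 := by positivity
  have hCone : 1 ≤ C := by linarith
  refine ⟨C, hCone, ?_⟩
  intro L hL a v ha hv hM1 hM2 hM3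
  set S12 := (scrM1 p δ a + scrM2 p a).toReal with hS12d
  have hS12 : 1 ≤ S12 := by
    refine (ENNReal.ofReal_le_iff_le_toReal (ENNReal.add_ne_top.2 ⟨hM1, hM2⟩)).1 ?_
    rw [ENNReal.ofReal_one]
    exact (one_le_scrM1 (by linarith)).trans le_self_add
  have hS3 := one_le_toReal_scrM3 hα hγ hM3
  set S3 := (scrM3 p p' δ a).toReal with hS3d
  have hS : 1 ≤ S12 * S3 := one_le_mul_of_one_le_of_one_le hS12 hS3
  have hSr : 1 ≤ (S12 * S3) ^ (γ / β) := Real.one_le_rpow hS (by positivity)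
  -- The exponent `γ / β` is forced: `Λ` must dominate `Λ ^ (γ / (β + γ)) * (S12 * S3) ^ (γ / (β +
  -- γ))` up to a constant.
  set Λ := C * (S12 * S3) ^ (γ / β) with hΛd
  have hCΛ : C ≤ Λ := le_mul_of_one_le_right (by linarith) hSr
  have hΛ1 : 1 ≤ Λ := hCone.trans hCΛ
  have hΛ0 : 0 < Λ := by linarith
  -- The bootstrap closes at the same constant; this is why `C` contains `C5 ^ ((β + γ) / β)`.
  have hclose : C5 * (Λ * (S12 * S3)) ^ (γ / (β + γ)) ≤ Λ := by
    have e1 : C5 ≤ C ^ (β / (β + γ)) := by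
      have : C5 = (C5 ^ ((β + γ) / β)) ^ (β / (β + γ)) := by
        rw [← Real.rpow_mul hC50.le, show (β + γ) / β * (β / (β + γ)) = 1 by field_simp,
          Real.rpow_one]
      rw [this]
      exact Real.rpow_le_rpow hC50'.le (by linarith) (by positivity)
    have e2 : Λ ^ (β / (β + γ)) = C ^ (β / (β + γ)) * (S12 * S3) ^ (γ / (β + γ)) := by
      rw [hΛd, Real.mul_rpow (by linarith) (by positivity), ← Real.rpow_mul (by linarith),
        show γ / β * (β / (β + γ)) = γ / (β + γ) by field_simp]
    calc _ = (C5 * (S12 * S3) ^ (γ / (β + γ))) * Λ ^ (γ / (β + γ)) := by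
          rw [Real.mul_rpow hΛ0.le (by linarith)]; ring
      _ ≤ (C ^ (β / (β + γ)) * (S12 * S3) ^ (γ / (β + γ))) * Λ ^ (γ / (β + γ)) := by gcongr
      _ = Λ ^ (β / (β + γ) + γ / (β + γ)) := by rw [← e2, Real.rpow_add hΛ0]
      _ = Λ := by rw [← add_div, div_self (by positivity), Real.rpow_one]
  -- Induction by unit time: decay up to time `m + 1` bounds the averaged moment there, the Nash
  -- recursion then bounds the averaged energy at time `m`, which controls the energy from time `m +
  -- 1` on.
  have key : ∀ n : ℕ, (n : ℝ) ≤ (L : ℝ) ^ 2 + 3 → ∀ s : ℝ, 0 ≤ s → s ≤ n + 1 →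
      nrg v s ≤ Λ * (1 + s) ^ (-((d : ℝ) / 2)) := by
    have hsmall : ∀ s : ℝ, 0 ≤ s → s ≤ 2 → nrg v s ≤ Λ * (1 + s) ^ (-((d : ℝ) / 2)) := by
      intro s hs0 hs2
      refine (hv.nrg_le_one hL ha hs0).trans ?_
      rw [Real.rpow_neg (by linarith), ← div_eq_mul_inv, le_div_iff₀ (by positivity), one_mul]
      calc (1 + s) ^ ((d : ℝ) / 2) ≤ 3 ^ ((d : ℝ) / 2) :=
            Real.rpow_le_rpow (by linarith) (by linarith) (by positivity)
        _ ≤ Λ := by linarith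
    intro n
    induction n with
    | zero => intro _ s hs0 hs1; exact hsmall s hs0 (by push_cast at hs1; linarith)
    | succ m ih =>
      intro hn s hs0 hs1
      have ih' := ih (by push_cast at hn; linarith)
      rcases le_total s (m + 1) with hsm | hsm
      · exact ih' s hs0 hsm
      rcases Nat.eq_zero_or_pos m with rfl | hm
      · exact hsmall s hs0 (by push_cast at hs1; linarith)
      push_cast at hn hs1
      have hm1 : (1 : ℝ) ≤ m := by exact_mod_cast hm
      have hns : nrg v s ≤ C3 * avgNrg p δ v m :=
        (hv.toIsSol.nrg_antitone hL ha (by positivity) hsm).trans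
          (hv.toIsSol.nrg_add_one_le hK hp2 hδ hL ha m)
      -- Below the level of the uniform distribution the claim is immediate, because `1 + s ≤ (2 * L
      -- + 1) ^ 2` in this range of times. Above it, monotonicity gives the lower bound at all
      -- earlier times, and the Nash inequality applies throughout.
      rcases lt_or_ge (avgNrg p δ v m) (C2 / (2 * L + 1) ^ d) with hlt | hge
      · have h6 : (1 + s) ^ ((d : ℝ) / 2) ≤ (2 * L + 1) ^ d := by
          have hL1 : (1 : ℝ) ≤ L := by exact_mod_cast hL
          calc (1 + s) ^ ((d : ℝ) / 2) ≤ ((2 * (L : ℝ) + 1) ^ (2 : ℝ)) ^ ((d : ℝ) / 2) := by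
                refine Real.rpow_le_rpow (by linarith) ?_ (by positivity)
                rw [Real.rpow_two]; nlinarith
            _ = _ := by
                rw [← Real.rpow_mul (by positivity), mul_div_cancel₀ _ (by norm_num),
                  Real.rpow_natCast]
        rw [Real.rpow_neg (by linarith), ← div_eq_mul_inv, le_div_iff₀ (by positivity)]
        calc nrg v s * (1 + s) ^ ((d : ℝ) / 2)
            ≤ (C3 * (C2 / (2 * L + 1) ^ d)) * (2 * L + 1) ^ d := by
              refine mul_le_mul (hns.trans ?_) h6 (by positivity) (by positivity)
              exact mul_le_mul_of_nonneg_left hlt.le hC30.le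
          _ = C3 * C2 := by field_simp
          _ ≤ Λ := by linarith
      · have hT := h1 L hL a v ha hv hM1 hM2 Λ (m + 1) hΛ1 ih'
        set N := C1 * Λ * S12 * (1 + ((m : ℝ) + 1)) ^ ((p - d) / 2) with hNd
        have hN1 : 1 ≤ N := by
          have : (1 : ℝ) ≤ (1 + ((m : ℝ) + 1)) ^ ((p - d) / 2) :=
            Real.one_le_rpow (by linarith) (by linarith)
          exact one_le_mul_of_one_le_of_one_le (one_le_mul_of_one_le_of_one_le
            (one_le_mul_of_one_le_of_one_le hC1 hΛ1) hS12) this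
        have h7 := hv.toIsSol.avgNrg_le_of_nash hK hp2 hδ hL ha hα hγ hM3
          (fun t ht => hv.nrg_le_one hL ha ht) hν hC2 hN1 hm (fun t ht0 htm => by
            have h8 := h2 L hL a v ha hv t N ht0 (by linarith) (hT t ht0 (by linarith)) (by
              refine (ENNReal.ofReal_le_ofReal hge).trans ?_
              rw [hv.toIsSol.ofReal_avgNrg hK hp2 hδ hL ha]
              exact hv.toIsSol.avgK_antitone hL ha ht0 htm)
            rwa [show 1 / α = 1 + ν by
              rw [hνd, div_eq_iff hα.ne', add_mul, div_mul_cancel₀ _ hα.ne']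
              linarith [hexp.add_eq]] at h8)
        have h9 := h7.trans (nash_decay_arith (by omega) hp.le hexp hc hC1 hΛ1 hS12 hS3
          (by linarith) (by linarith) (by positivity))
        have h10 : (m : ℝ) ^ (-((d : ℝ) / 2)) ≤ 4 ^ ((d : ℝ) / 2) * (1 + s) ^ (-((d : ℝ) / 2)) := by
          have : (m : ℝ) ^ (-((d : ℝ) / 2)) ≤ ((1 + s) / 4) ^ (-((d : ℝ) / 2)) :=
            Real.rpow_le_rpow_of_nonpos (by linarith) (by linarith)
              (neg_nonpos.2 (by positivity))
          refine this.trans (le_of_eq ?_)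
          rw [Real.div_rpow (by linarith) (by norm_num), Real.rpow_neg (by norm_num : (0 : ℝ) ≤ 4),
            div_inv_eq_mul, mul_comm]
        calc nrg v s ≤ C3 * (C4 * (Λ * (S12 * S3)) ^ (γ / (β + γ)) * (m : ℝ) ^ (-((d : ℝ) / 2))) :=
              hns.trans (mul_le_mul_of_nonneg_left h9 hC30.le)
          _ ≤ C3 * (C4 * (Λ * (S12 * S3)) ^ (γ / (β + γ))
                * (4 ^ ((d : ℝ) / 2) * (1 + s) ^ (-((d : ℝ) / 2)))) := by gcongr
          _ = C5 * (Λ * (S12 * S3)) ^ (γ / (β + γ)) * (1 + s) ^ (-((d : ℝ) / 2)) := by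
              rw [hC5]; ring
          _ ≤ _ := by gcongr
  intro s hs0 hs
  have hf : ((L ^ 2 + 3 : ℕ) : ℝ) = (L : ℝ) ^ 2 + 3 := by push_cast; ring
  exact key (L ^ 2 + 3) hf.le s hs0 (by rw [hf]; linarith)

end NashDecay

end GradPhi

namespace GradPhi

/-! ### The centered solution: polynomial and exponential decay -/

section MeanZero

variable {d L : ℕ} {p p' δ : ℝ} {a : ℝ → Edge d L → ℝ} {v : ℝ → Torus d L → ℝ}

/-- Subtraction of the spatial mean of the heat kernel. -/
noncomputable def centered (v : ℝ → Torus d L → ℝ) (t : ℝ) (x : Torus d L) : ℝ :=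
  v t x - 1 / (Fintype.card (Torus d L) : ℝ)

lemma IsHeat.isSol_centered (hv : IsHeat a v) : IsSol a (centered v) :=
  hv.toIsSol.add_const (-(1 / (Fintype.card (Torus d L) : ℝ)))

lemma card_torus_pos : (0 : ℝ) < Fintype.card (Torus d L) := by
  exact_mod_cast Fintype.card_pos

lemma IsHeat.sum_centered (hL : 1 ≤ L) (ha : IsEnv a) (hv : IsHeat a v) {t : ℝ} (ht : 0 ≤ t) :
    ∑ x, centered v t x = 0 := by
  have hc := card_torus_pos (d := d) (L := L)
  simp only [centered, Finset.sum_sub_distrib, hv.sum_eq hL ha ht, Finset.sum_const,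
    Finset.card_univ, nsmul_eq_mul]
  rw [mul_one_div_cancel hc.ne', sub_self]

lemma IsHeat.sum_abs_centered_le (hL : 1 ≤ L) (ha : IsEnv a) (hv : IsHeat a v) {t : ℝ}
    (ht : 0 ≤ t) : ∑ x, |centered v t x| ≤ 2 := by
  have hc := card_torus_pos (d := d) (L := L)
  calc ∑ x, |centered v t x| ≤ ∑ x, (v t x + 1 / (Fintype.card (Torus d L) : ℝ)) := by
        refine Finset.sum_le_sum fun x _ => ?_
        have h1 := hv.nonneg hL ha ht x
        have h2 : 0 ≤ 1 / (Fintype.card (Torus d L) : ℝ) := by positivity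
        rw [centered, abs_le]
        constructor <;> linarith
    _ = 2 := by
        simp only [Finset.sum_add_distrib, hv.sum_eq hL ha ht, Finset.sum_const,
          Finset.card_univ, nsmul_eq_mul]
        rw [mul_one_div_cancel hc.ne']; norm_num

lemma IsHeat.nrg_centered_le (hL : 1 ≤ L) (ha : IsEnv a) (hv : IsHeat a v) {t : ℝ} (ht : 0 ≤ t) :
    nrg (centered v) t ≤ nrg v t := by
  have hc := card_torus_pos (d := d) (L := L)
  set c := 1 / (Fintype.card (Torus d L) : ℝ) with hcd
  have h : nrg v t = nrg (centered v) t + ∑ x, (2 * c * centered v t x + c ^ 2) := by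
    rw [nrg, nrg, ← Finset.sum_add_distrib]
    refine Finset.sum_congr rfl fun x _ => ?_
    rw [centered, ← hcd]; ring
  rw [h, Finset.sum_add_distrib, ← Finset.mul_sum, hv.sum_centered hL ha ht]
  have : 0 ≤ ∑ _x : Torus d L, c ^ 2 := Finset.sum_nonneg fun _ _ => sq_nonneg c
  linarith

/-- Interpolation between polynomial and exponential decay. -/
lemma geom_interp {q α β γ : ℝ} (hd : 1 ≤ d) (hp : 0 < p)
    (hexp : NashExponents d p q α β γ) {E B S ℓ n z : ℝ} (hE : 0 ≤ E) (hB : 0 < B)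
    (hS : 1 ≤ S) (hℓ : 0 < ℓ) (hn : 0 < n)
    (h1 : E ≤ B * n ^ (-(α / β)) * (S * ℓ ^ p) ^ (γ / β))
    (h2 : E ≤ B * S ^ (γ / β) * ℓ ^ (-(d : ℝ)) * Real.exp (-z)) :
    E ≤ B * S ^ (γ / β) * n ^ (-((d : ℝ) / 2)) * Real.exp (-(p * γ / (2 * α) * z)) := by
  have hα := hexp.pos_α
  have hβ := hexp.pos_β
  have hγ := hexp.pos_γ
  have hd1 : (1 : ℝ) ≤ d := by exact_mod_cast hd
  have h3 := hexp.two_mul hd hp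
  -- The weights `η` and `ϑ` sum to one by homogeneity, and with them the powers of `ℓ` in the two
  -- bounds cancel.
  set ϑ := p * γ / (2 * α) with hϑ
  set η := d * β / (2 * α) with hη
  have hsum : η + ϑ = 1 := by rw [hη, hϑ, ← add_div, ← h3, div_self (by positivity)]
  have hϑ0 : 0 < ϑ := by positivity
  have hη0 : 0 < η := by positivity
  have hS0 : 0 < S := by linarith
  have e0 : E = E ^ η * E ^ ϑ := by
    rw [← Real.rpow_add' hE (by rw [hsum]; norm_num), hsum, Real.rpow_one]
  have h1' := Real.rpow_le_rpow hE h1 hη0.le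
  have h2' := Real.rpow_le_rpow hE h2 hϑ0.le
  rw [Real.mul_rpow hS0.le (by positivity), ← Real.rpow_mul hℓ.le,
    Real.mul_rpow (by positivity) (by positivity), Real.mul_rpow (by positivity) (by positivity),
    Real.mul_rpow (by positivity) (by positivity), ← Real.rpow_mul hn.le,
    ← Real.rpow_mul hℓ.le] at h1'
  rw [Real.mul_rpow (by positivity) (by positivity), Real.mul_rpow (by positivity) (by positivity),
    Real.mul_rpow (by positivity) (by positivity), ← Real.rpow_mul hℓ.le, ← Real.exp_mul] at h2'
  have hSS : 0 < S ^ (γ / β) := by positivity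
  have eB : B ^ η * B ^ ϑ = B := by rw [← Real.rpow_add hB, hsum, Real.rpow_one]
  have eS : (S ^ (γ / β)) ^ η * (S ^ (γ / β)) ^ ϑ = S ^ (γ / β) := by
    rw [← Real.rpow_add hSS, hsum, Real.rpow_one]
  have eℓ : ℓ ^ (p * (γ / β) * η) * ℓ ^ (-(d : ℝ) * ϑ) = 1 := by
    rw [← Real.rpow_add hℓ, show p * (γ / β) * η + -(d : ℝ) * ϑ = 0 by
      rw [hη, hϑ]; field_simp; ring, Real.rpow_zero]
  have en : -(α / β) * η = -((d : ℝ) / 2) := by rw [hη]; field_simp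
  rw [en] at h1'
  calc E = E ^ η * E ^ ϑ := e0
    _ ≤ (B ^ η * n ^ (-((d : ℝ) / 2)) * ((S ^ (γ / β)) ^ η * ℓ ^ (p * (γ / β) * η)))
        * (B ^ ϑ * (S ^ (γ / β)) ^ ϑ * ℓ ^ (-(d : ℝ) * ϑ) * Real.exp (-z * ϑ)) :=
        mul_le_mul h1' h2' (by positivity) (by positivity)
    _ = (B ^ η * B ^ ϑ) * ((S ^ (γ / β)) ^ η * (S ^ (γ / β)) ^ ϑ)
        * (ℓ ^ (p * (γ / β) * η) * ℓ ^ (-(d : ℝ) * ϑ)) * n ^ (-((d : ℝ) / 2))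
        * Real.exp (-z * ϑ) := by ring
    _ = _ := by rw [eB, eS, eℓ, mul_one, show -z * ϑ = -(ϑ * z) by ring]

/-- Exponential decay of averaged energies from a Poincaré inequality. -/
lemma IsSol.avgNrg_le_mul_exp (hK : KernelSmall p δ) (hp : 2 < p) (hδ : 0 < δ) (hL : 1 ≤ L)
    (ha : IsEnv a) {u : ℝ → Torus d L → ℝ} (hu : IsSol a u) (hα : 0 < alphaE d p p')
    (hγ : 0 < gammaE d p p') (hfin : scrM3 p p' δ a ≠ ⊤) {A : ℝ} (hA : 1 ≤ A)
    (h : ∀ t : ℝ, 0 ≤ t → invM3 p p' δ a t * eNrg u (t + 1)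
      ≤ ENNReal.ofReal A * avgK p δ (eDsp a u) t) {m n : ℕ} (hmn : m ≤ n) :
    avgNrg p δ u (n + 1) ≤ avgNrg p δ u m * Real.exp (-((n * (scrM3 p p' δ a).toReal
      ^ (-(gammaE d p p' / alphaE d p p')) - m) / (4 * A))) := by
  have hA0 : 0 < A := by linarith
  have hanti : ∀ i j : ℕ, i ≤ j → avgNrg p δ u j ≤ avgNrg p δ u i := fun i j hij =>
    ENNReal.toReal_mono (hu.avgK_ne_top hK hp hδ hL ha (Nat.cast_nonneg i))
      (hu.avgK_antitone hL ha (Nat.cast_nonneg i) (by exact_mod_cast hij))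
  have hrec := mul_exp_le_of_recursion (y := fun k => avgNrg p δ u k)
    (g := fun k => stepM3 p p' δ a k / A) (fun k => avgNrg_nonneg u k)
    (fun k => div_nonneg (stepM3_nonneg k) hA0.le)
    (fun k => (div_le_one hA0).2 ((stepM3_le_one hα k).trans hA)) hmn (fun k _ => by
      have := hu.avgNrg_step hK hp hδ hL ha hα k (A := 2 * A) (Q := avgNrg p δ u (k + 2))
        (by linarith) (avgNrg_nonneg u _) (fun t ht => by
          have ht0 : 0 ≤ t := (Nat.cast_nonneg k).trans ht.1.le
          have e1 : ENNReal.ofReal (avgNrg p δ u (k + 2)) ≤ eNrg u (t + 1) := by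
            refine ENNReal.ofReal_le_ofReal ((hu.avgNrg_le hK hp hδ hL ha (k + 2)).trans ?_)
            refine hu.nrg_antitone hL ha (by linarith) ?_
            push_cast
            linarith [ht.2]
          exact (mul_le_mul_right e1 _).trans ((h t ht0).trans
            (mul_le_mul_left (ENNReal.ofReal_le_ofReal (by linarith)) _)))
      rw [show 2 / (2 * A) * stepM3 p p' δ a k = stepM3 p p' δ a k / A by field_simp] at this
      exact this)
  have hsum := le_sum_stepM3 (p := p) (p' := p') (δ := δ) (a := a) hα hγ hfin n
  rw [← Finset.sum_range_add_sum_Ico _ hmn] at hsum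
  have hm : ∑ k ∈ Finset.range m, stepM3 p p' δ a k ≤ m := by
    refine (Finset.sum_le_sum fun k _ => stepM3_le_one hα k).trans (by simp)
  set X := (n * (scrM3 p p' δ a).toReal ^ (-(gammaE d p p' / alphaE d p p')) - m) / (4 * A)
    with hX
  have hXle : 2 * X ≤ (∑ k ∈ Finset.Ico m n, stepM3 p p' δ a k / A) / 2 := by
    rw [← Finset.sum_div, hX, div_div, mul_div_assoc', div_le_div_iff₀ (by positivity)
      (by positivity)]
    nlinarith
  have hy0 := avgNrg_nonneg (p := p) (δ := δ) u
  -- The recursion controls products of consecutive terms; monotonicity converts them into squares.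
  -- The sum from `m` to `n` is the full sum minus at most `m`, since each step contributes at most
  -- one.
  have h1 : (avgNrg p δ u (n + 1) * Real.exp X) ^ 2 ≤ avgNrg p δ u m ^ 2 := by
    calc (avgNrg p δ u (n + 1) * Real.exp X) ^ 2
        = avgNrg p δ u (n + 1) * avgNrg p δ u (n + 1) * Real.exp (2 * X) := by
          rw [mul_pow, two_mul X, Real.exp_add]; ring
      _ ≤ avgNrg p δ u n * avgNrg p δ u (n + 1)
            * Real.exp ((∑ k ∈ Finset.Ico m n, stepM3 p p' δ a k / A) / 2) := by
          refine mul_le_mul (mul_le_mul_of_nonneg_right (hanti n (n + 1) (by omega)) (hy0 _))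
            (Real.exp_le_exp.2 hXle) (Real.exp_pos _).le (mul_nonneg (hy0 _) (hy0 _))
      _ ≤ _ := hrec
      _ ≤ avgNrg p δ u m * avgNrg p δ u m :=
          mul_le_mul_of_nonneg_left (hanti m (m + 1) (by omega)) (hy0 _)
      _ = _ := by ring
  have h2 := abs_le_of_sq_le_sq' h1 (hy0 _)
  rw [Real.exp_neg, ← div_eq_mul_inv, le_div_iff₀ (Real.exp_pos _)]
  exact h2.2

end MeanZero

end GradPhi

namespace GradPhi

/-! ### Decay of the centered energy at all times -/

section EnergyDecay

variable {d L : ℕ} {p p' δ : ℝ} {a : ℝ → Edge d L → ℝ} {v : ℝ → Torus d L → ℝ}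

set_option maxHeartbeats 1000000 in
/-- Decay of the energy of the centered heat kernel at all times. -/
lemma exists_nrg_centered_le (d : ℕ) (hd : 2 ≤ d) {p p' δ : ℝ} (hp : (d : ℝ) < p)
    (hp' : (d : ℝ) < p') (hδ : 0 < δ) (hK : KernelSmall p δ) : ∃ C : ℝ, 1 ≤ C ∧
    ∀ (L : ℕ) (_ : 1 ≤ L) (a : ℝ → Edge d L → ℝ) (v : ℝ → Torus d L → ℝ), IsEnv a → IsHeat a v →
    scrM1 p δ a ≠ ⊤ → scrM2 p a ≠ ⊤ → scrM3 p p' δ a ≠ ⊤ →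
    ∀ t : ℝ, 0 ≤ t → nrg (centered v) t ≤ C
      * ((scrM1 p δ a + scrM2 p a).toReal * (scrM3 p p' δ a).toReal)
        ^ (gammaE d p p' / betaE d p p') * (1 + t) ^ (-((d : ℝ) / 2))
      * Real.exp (-(t / (C * (L : ℝ) ^ 2
        * (scrM3 p p' δ a).toReal ^ (gammaE d p p' / alphaE d p p')))) := by
  have hd2 : (2 : ℝ) ≤ d := by exact_mod_cast hd
  have hp2 : 2 < p := by linarith
  have hexp := nashExponents hd hp hp'
  obtain ⟨C1, hC1, h1⟩ := exists_nrg_le d hd hp hp' hδ hK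
  obtain ⟨C2, hC2, h2⟩ := exists_invM3_mul_le_of_sum_eq_zero d hd hp hp' hδ hK
  have hα := hexp.pos_α
  have hβ := hexp.pos_β
  have hγ := hexp.pos_γ
  set α := alphaE d p p' with hαd
  set β := betaE d p p' with hβd
  set γ := gammaE d p p' with hγd
  set ν := β / α with hνd
  have hν : 0 < ν := by positivity
  have h2ν : (2 : ℝ) ^ (-ν) < 1 := Real.rpow_lt_one_of_one_lt_of_neg (by norm_num) (by linarith)
  have h2ν' : 0 < 1 - (2 : ℝ) ^ (-ν) := by linarith
  set c := ((1 - 2 ^ (-ν)) / C2) ^ (-(1 / ν)) with hcd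
  have hc : 0 < c := Real.rpow_pos_of_pos (div_pos h2ν' (by linarith)) _
  set C3 := 2 ^ (p + 3) / δ with hC3
  have hC30 : 0 < C3 := by positivity
  have hC1e : 0 < C1 * Real.exp 1 := mul_pos (by linarith) (Real.exp_pos 1)
  set B := c + C1 * Real.exp 1 with hBd
  have hB : 0 < B := by positivity
  set ϑ := p * γ / (2 * α) with hϑd
  have hϑ : 0 < ϑ := by positivity
  set C := C3 * B * 4 ^ ((d : ℝ) / 2) + 16 * C2 / ϑ + C1 * Real.exp 5 with hCd
  have hX1 : 0 < C3 * B * 4 ^ ((d : ℝ) / 2) := by positivity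
  have hX2 : 0 < 16 * C2 / ϑ := by positivity
  have hX3 : 0 < C1 * Real.exp 5 := by positivity
  have hCone : 1 ≤ C := by
    have : 1 ≤ C1 * Real.exp 5 :=
      one_le_mul_of_one_le_of_one_le hC1 (Real.one_le_exp (by norm_num))
    linarith
  have hC0 : 0 < C := by linarith
  refine ⟨C, hCone, ?_⟩
  intro L hL a v ha hv hM1 hM2 hM3 t ht
  set S12 := (scrM1 p δ a + scrM2 p a).toReal with hS12d
  have hS12 : 1 ≤ S12 := by
    refine (ENNReal.ofReal_le_iff_le_toReal (ENNReal.add_ne_top.2 ⟨hM1, hM2⟩)).1 ?_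
    rw [ENNReal.ofReal_one]
    exact (one_le_scrM1 (by linarith)).trans le_self_add
  have hS3 := one_le_toReal_scrM3 hα hγ hM3
  have hb1 := h1 L hL a v ha hv hM1 hM2 hM3
  have hL1 : (1 : ℝ) ≤ L := by exact_mod_cast hL
  have hu := hv.isSol_centered
  have hu1 : ∀ t, 0 ≤ t → nrg (centered v) t ≤ 1 := fun t ht =>
    (hv.nrg_centered_le hL ha ht).trans (hv.nrg_le_one hL ha ht)
  have hb2 := h2 L hL a _ ha hu (fun t ht => hv.sum_centered hL ha ht)
    (fun t ht => hv.sum_abs_centered_le hL ha ht)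
  have hnash : ∀ k : ℕ, 0 < k → avgNrg p δ (centered v) k ≤ c * (k : ℝ) ^ (-(α / β))
      * ((scrM3 p p' δ a).toReal * (L : ℝ) ^ p) ^ (γ / β) := by
    intro k hk
    have := hu.avgNrg_le_of_nash (p' := p') hK hp2 hδ hL ha hα hγ hM3 hu1 hν hC2
      (W := (L : ℝ) ^ p) (Real.one_le_rpow hL1 (by linarith)) hk (fun t ht0 _ => by
        rw [← Real.rpow_mul (by linarith)]
        exact (hb2 t ht0).1)
    rw [show γ / β = gammaE d p p' / alphaE d p p' / ν by
        rw [← hγd, ← hαd, hνd]; field_simp, show α / β = 1 / ν by rw [hνd, one_div_div]]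
    exact this
  have hexpdecay : ∀ n : ℕ, L ^ 2 ≤ n → avgNrg p δ (centered v) (n + 1)
      ≤ avgNrg p δ (centered v) (L ^ 2) * Real.exp (-((n * (scrM3 p p' δ a).toReal ^ (-(γ / α))
        - (L ^ 2 : ℕ)) / (4 * (C2 * (L : ℝ) ^ 2)))) := fun n hn =>
    hu.avgNrg_le_mul_exp hK hp2 hδ hL ha hα hγ hM3
      (one_le_mul_of_one_le_of_one_le hC2 (one_le_pow₀ hL1)) (fun t ht => (hb2 t ht).2) hn
  have hstart : avgNrg p δ (centered v) (L ^ 2) ≤ nrg v ((L ^ 2 : ℕ) : ℝ) :=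
    (hu.avgNrg_le hK hp2 hδ hL ha _).trans (hv.nrg_centered_le hL ha (by positivity))
  set S3 := (scrM3 p p' δ a).toReal with hS3d
  have hS : 1 ≤ S12 * S3 := one_le_mul_of_one_le_of_one_le hS12 hS3
  have hS0 : 0 < S12 * S3 := by linarith
  set G := (S12 * S3) ^ (γ / β) with hGd
  have hG : 0 < G := by positivity
  have hS3r : 1 ≤ S3 ^ (γ / α) := Real.one_le_rpow hS3 (by positivity)
  have hL2 : (1 : ℝ) ≤ (L : ℝ) ^ 2 := one_le_pow₀ hL1
  -- Up to this time the exponential factor is at least `exp (-5)`, since `L ^ 2 + 4 ≤ 5 * L ^ 2`,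
  -- and may be inserted at the price of a constant.
  rcases le_total t ((L : ℝ) ^ 2 + 4) with htL | htL
  · have h3 := (hv.nrg_centered_le hL ha ht).trans (hb1 t ht htL)
    have h4 : t / (C * (L : ℝ) ^ 2 * S3 ^ (γ / α)) ≤ 5 := by
      rw [div_le_iff₀ (by positivity)]
      have : (L : ℝ) ^ 2 ≤ C * (L : ℝ) ^ 2 * S3 ^ (γ / α) := by
        calc (L : ℝ) ^ 2 = 1 * (L : ℝ) ^ 2 * 1 := by ring
          _ ≤ _ := by gcongr
      linarith
    have h5 : 1 ≤ Real.exp 5 * Real.exp (-(t / (C * (L : ℝ) ^ 2 * S3 ^ (γ / α)))) := by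
      rw [← Real.exp_add]
      exact Real.one_le_exp (by linarith)
    calc _ ≤ C1 * G * (1 + t) ^ (-((d : ℝ) / 2)) := h3
      _ ≤ C1 * G * (1 + t) ^ (-((d : ℝ) / 2))
          * (Real.exp 5 * Real.exp (-(t / (C * (L : ℝ) ^ 2 * S3 ^ (γ / α))))) :=
          le_mul_of_one_le_right (by positivity) h5
      _ = (C1 * Real.exp 5) * G * (1 + t) ^ (-((d : ℝ) / 2))
          * Real.exp (-(t / (C * (L : ℝ) ^ 2 * S3 ^ (γ / α)))) := by ring
      _ ≤ _ := by gcongr; linarith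
  · have hfl : L ^ 2 + 4 ≤ ⌊t⌋₊ := Nat.le_floor (by push_cast; exact htL)
    -- One unit of time is lost in passing from the energy to its average and another in the delayed
    -- recursion.
    obtain ⟨n, hn⟩ : ∃ n, ⌊t⌋₊ = n + 2 := ⟨⌊t⌋₊ - 2, by omega⟩
    have hnt : (n : ℝ) + 2 ≤ t := by
      have := Nat.floor_le ht
      rw [hn] at this; exact_mod_cast this
    have htn : t < n + 3 := by
      have := Nat.lt_floor_add_one t
      rw [hn] at this; push_cast at this; linarith
    have hLn : L ^ 2 ≤ n := by omega
    have hE1 := hnash (n + 1) (Nat.succ_pos n)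
    have hE2 := hexpdecay n hLn
    have hE3 : nrg (centered v) t ≤ C3 * avgNrg p δ (centered v) (n + 1) :=
      (hu.nrg_antitone hL ha (by positivity) (by push_cast; linarith)).trans
        (hu.nrg_add_one_le hK hp2 hδ hL ha (n + 1))
    push_cast at hE1 hE2 hstart
    have hS30 : 0 < S3 := by linarith
    set z := n * S3 ^ (-(γ / α)) / (4 * (C2 * (L : ℝ) ^ 2)) with hz
    -- The polynomial bound at time `L ^ 2` is the starting value of the exponential phase.
    have hm : avgNrg p δ (centered v) (L ^ 2) ≤ C1 * G * (L : ℝ) ^ (-(d : ℝ)) := by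
      refine hstart.trans ((hb1 _ (by positivity) (by linarith)).trans ?_)
      refine mul_le_mul_of_nonneg_left ?_ (by positivity)
      calc (1 + (L : ℝ) ^ 2) ^ (-((d : ℝ) / 2)) ≤ ((L : ℝ) ^ (2 : ℝ)) ^ (-((d : ℝ) / 2)) := by
            refine Real.rpow_le_rpow_of_nonpos (by positivity) ?_ (neg_nonpos.2 (by positivity))
            rw [Real.rpow_two]; linarith
        _ = _ := by rw [← Real.rpow_mul (by linarith)]; congr 1; ring
    have hexp2 : Real.exp (-((n * S3 ^ (-(γ / α)) - (L : ℝ) ^ 2) / (4 * (C2 * (L : ℝ) ^ 2))))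
        ≤ Real.exp 1 * Real.exp (-z) := by
      rw [← Real.exp_add, Real.exp_le_exp, hz, sub_div]
      have : (L : ℝ) ^ 2 / (4 * (C2 * (L : ℝ) ^ 2)) ≤ 1 := by
        rw [div_le_one (by positivity)]; nlinarith
      linarith

    have hB1 : avgNrg p δ (centered v) (n + 1)
        ≤ B * ((n : ℝ) + 1) ^ (-(α / β)) * (S12 * S3 * (L : ℝ) ^ p) ^ (γ / β) := by
      refine hE1.trans ?_
      have e1 : (S3 * (L : ℝ) ^ p) ^ (γ / β) ≤ (S12 * S3 * (L : ℝ) ^ p) ^ (γ / β) := by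
        refine Real.rpow_le_rpow (by positivity) ?_ (by positivity)
        rw [mul_assoc]
        exact le_mul_of_one_le_left (by positivity) hS12
      have e2 : c ≤ B := by rw [hBd]; linarith
      gcongr
    have hB2 : avgNrg p δ (centered v) (n + 1)
        ≤ B * G * (L : ℝ) ^ (-(d : ℝ)) * Real.exp (-z) := by
      refine hE2.trans ?_
      calc _ ≤ (C1 * G * (L : ℝ) ^ (-(d : ℝ))) * (Real.exp 1 * Real.exp (-z)) :=
            mul_le_mul hm hexp2 (Real.exp_pos _).le (by positivity)
        _ = (C1 * Real.exp 1) * G * (L : ℝ) ^ (-(d : ℝ)) * Real.exp (-z) := by ring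
        _ ≤ _ := by
            have : C1 * Real.exp 1 ≤ B := by rw [hBd]; linarith
            gcongr
    have hgeo : avgNrg p δ (centered v) (n + 1)
        ≤ B * G * ((n : ℝ) + 1) ^ (-((d : ℝ) / 2)) * Real.exp (-(ϑ * z)) :=
      geom_interp (by omega) (by linarith) hexp (avgNrg_nonneg _ _) hB hS (by linarith)
        (by positivity) hB1 hB2
    have h5 : ((n : ℝ) + 1) ^ (-((d : ℝ) / 2)) ≤ 4 ^ ((d : ℝ) / 2) * (1 + t) ^ (-((d : ℝ) / 2)) := by
      have : ((n : ℝ) + 1) ^ (-((d : ℝ) / 2)) ≤ ((1 + t) / 4) ^ (-((d : ℝ) / 2)) :=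
        Real.rpow_le_rpow_of_nonpos (by linarith) (by linarith) (neg_nonpos.2 (by positivity))
      refine this.trans (le_of_eq ?_)
      rw [Real.div_rpow (by linarith) (by norm_num), Real.rpow_neg (by norm_num : (0 : ℝ) ≤ 4),
        div_inv_eq_mul, mul_comm]
    have h6 : t / (C * (L : ℝ) ^ 2 * S3 ^ (γ / α)) ≤ ϑ * z := by
      have e1 : ϑ * z = (4 * n) / (16 * C2 / ϑ * (L : ℝ) ^ 2 * S3 ^ (γ / α)) := by
        rw [hz, Real.rpow_neg hS30.le]; field_simp; ring
      rw [e1]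
      have e2 : 16 * C2 / ϑ ≤ C := by linarith
      have e3 : t ≤ 4 * n := by linarith
      gcongr
    calc nrg (centered v) t
        ≤ C3 * (B * G * ((n : ℝ) + 1) ^ (-((d : ℝ) / 2)) * Real.exp (-(ϑ * z))) :=
          hE3.trans (mul_le_mul_of_nonneg_left hgeo hC30.le)
      _ ≤ C3 * (B * G * (4 ^ ((d : ℝ) / 2) * (1 + t) ^ (-((d : ℝ) / 2)))
            * Real.exp (-(t / (C * (L : ℝ) ^ 2 * S3 ^ (γ / α))))) := by
          have e4 : Real.exp (-(ϑ * z)) ≤ Real.exp (-(t / (C * (L : ℝ) ^ 2 * S3 ^ (γ / α)))) :=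
            Real.exp_le_exp.2 (by linarith)
          gcongr
      _ = (C3 * B * 4 ^ ((d : ℝ) / 2)) * G * (1 + t) ^ (-((d : ℝ) / 2))
            * Real.exp (-(t / (C * (L : ℝ) ^ 2 * S3 ^ (γ / α)))) := by ring
      _ ≤ _ := by gcongr; linarith

end EnergyDecay

end GradPhi

namespace GradPhi

/-! ### Existence of solutions, needed for the reversed environment -/

section Existence

variable {d L : ℕ} {a : ℝ → Edge d L → ℝ}

lemma abs_flow_sub_flow_le (hL : 1 ≤ L) {A : Edge d L → ℝ} {M : ℝ}
    (hA : ∀ e, |A e| ≤ M) (f g : Torus d L → ℝ) (x : Torus d L) :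
    |flow A f x - flow A g x| ≤ Fintype.card (Edge d L) * (2 * M) * ‖f - g‖ := by
  rw [flow_eq hL, flow_eq hL, ← Finset.sum_sub_distrib]
  refine (Finset.abs_sum_le_sum_abs _ _).trans ?_
  calc _ ≤ ∑ _e : Edge d L, 2 * M * ‖f - g‖ := by
        refine Finset.sum_le_sum fun e _ => ?_
        have h1 : |edgeDiff f e - edgeDiff g e| ≤ 2 * ‖f - g‖ := by
          have e1 := norm_le_pi_norm (f - g) (shift e.1 e.2)
          have e2 := norm_le_pi_norm (f - g) e.1
          rw [Pi.sub_apply, Real.norm_eq_abs, abs_le] at e1 e2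
          rw [edgeDiff, edgeDiff, abs_le]
          constructor <;> linarith [e1.1, e1.2, e2.1, e2.2]
        have h2 : |((if e.1 = x then 1 else 0) - (if shift e.1 e.2 = x then 1 else 0) : ℝ)| ≤ 1 := by
          split_ifs <;> simp
        have hM : 0 ≤ M := (abs_nonneg _).trans (hA e)
        calc _ = |A e| * |edgeDiff f e - edgeDiff g e|
              * |((if e.1 = x then 1 else 0) - (if shift e.1 e.2 = x then 1 else 0) : ℝ)| := by
              rw [← abs_mul, ← abs_mul]; congr 1; ring
          _ ≤ M * (2 * ‖f - g‖) * 1 :=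
              mul_le_mul (mul_le_mul (hA e) h1 (abs_nonneg _) hM) h2 (abs_nonneg _) (by positivity)
          _ = _ := by ring
    _ = _ := by rw [Finset.sum_const, Finset.card_univ, nsmul_eq_mul]; ring

lemma lipschitzWith_flow (hL : 1 ≤ L) {A : Edge d L → ℝ} {M : ℝ≥0} (hA : ∀ e, |A e| ≤ M) :
    LipschitzWith (Fintype.card (Edge d L) * (2 * M)) (flow A) := by
  refine LipschitzWith.of_dist_le_mul fun f g => ?_
  rw [dist_eq_norm, dist_eq_norm, pi_norm_le_iff_of_nonneg (by positivity)]
  intro x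
  have := abs_flow_sub_flow_le hL hA f g x
  simpa using this

lemma IsEnv.exists_bound (ha : IsEnv a) (T : ℝ) : ∃ M : ℝ≥0, ∀ t ∈ Icc 0 T, ∀ e, |a t e| ≤ M := by
  have h : ∀ e, ∃ M : ℝ, ∀ t ∈ Icc 0 T, ‖a t e‖ ≤ M := fun e =>
    isCompact_Icc.exists_bound_of_continuousOn (ha.cont e).continuousOn
  choose M hM using h
  refine ⟨∑ e, (M e).toNNReal, fun t ht e => ?_⟩
  calc |a t e| ≤ M e := hM e t ht
    _ ≤ ((M e).toNNReal : ℝ) := Real.le_coe_toNNReal _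
    _ ≤ _ := by
        exact_mod_cast Finset.single_le_sum (f := fun e => (M e).toNNReal)
          (fun _ _ => zero_le) (Finset.mem_univ e)

lemma continuous_flow (hL : 1 ≤ L) (ha : IsEnv a) (f : Torus d L → ℝ) :
    Continuous fun t => flow (a t) f := by
  refine continuous_pi fun x => ?_
  simp only [flow_eq hL]
  exact continuous_finsetSum _ fun e _ => ((ha.cont e).mul_const _).mul_const _

/-- Coordinatewise truncation to `[-1, 1]`. -/
noncomputable def clamp (f : Torus d L → ℝ) (x : Torus d L) : ℝ := max (-1) (min 1 (f x))

lemma lipschitzWith_clamp : LipschitzWith 1 (clamp : (Torus d L → ℝ) → Torus d L → ℝ) := by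
  refine LipschitzWith.of_dist_le_mul fun f g => ?_
  rw [NNReal.coe_one, one_mul, dist_pi_le_iff dist_nonneg]
  intro x
  refine le_trans ?_ (dist_le_pi_dist f g x)
  have h : LipschitzWith 1 fun y : ℝ => max (-1) (min 1 y) :=
    (LipschitzWith.id.const_min 1).const_max (-1)
  simpa [clamp] using h.dist_le_mul (f x) (g x)

lemma norm_clamp_le (f : Torus d L → ℝ) : ‖clamp f‖ ≤ 1 := by
  rw [pi_norm_le_iff_of_nonneg zero_le_one]
  intro x
  rw [Real.norm_eq_abs, abs_le]
  exact ⟨le_max_left _ _, max_le (by norm_num) (min_le_left _ _)⟩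

lemma edgeDiff_clamp_mul_nonneg (f : Torus d L → ℝ) (e : Edge d L) :
    0 ≤ edgeDiff (clamp f) e * edgeDiff f e := by
  have hmono : Monotone fun y : ℝ => max (-1) (min 1 y) := fun y z h =>
    max_le_max le_rfl (min_le_min le_rfl h)
  rcases le_total (f e.1) (f (shift e.1 e.2)) with h | h
  · exact mul_nonneg (sub_nonneg.2 (hmono h)) (sub_nonneg.2 h)
  · exact mul_nonneg_of_nonpos_of_nonpos (sub_nonpos.2 (hmono h)) (sub_nonpos.2 h)

lemma flow_zero (A : Edge d L → ℝ) : flow A (0 : Torus d L → ℝ) = 0 := by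
  funext x
  simp [flow, edgeDiff, starSum]

/-- The generator is applied to the clamped function, which makes the vector field bounded and
solvable on all of `[0, T]` at once. The ℓ² norm of the solution does not increase, so every
coordinate stays in `[-1, 1]` and the clamp is never active. -/
lemma exists_isSol_Icc (hL : 1 ≤ L) (ha : IsEnv a) {f₀ : Torus d L → ℝ} (hf₀ : ∑ x, f₀ x ^ 2 ≤ 1)
    {T : ℝ} (hT : 0 ≤ T) : ∃ w : ℝ → Torus d L → ℝ, w 0 = f₀ ∧
      ∀ t ∈ Icc 0 T, HasDerivWithinAt w (flow (a t) (w t)) (Icc 0 T) t := by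
  obtain ⟨M, hM⟩ := ha.exists_bound T
  set K : ℝ≥0 := Fintype.card (Edge d L) * (2 * M) with hK
  have hlip : ∀ t ∈ Icc 0 T, LipschitzWith K (flow (a t)) := fun t ht =>
    lipschitzWith_flow hL (hM t ht)
  -- After clamping the speed is at most `K` everywhere, so a ball of radius `K * T` cannot be left
  -- before time `T`.
  have hpl : IsPicardLindelof (fun t f => flow (a t) (clamp f)) (tmin := 0) (tmax := T)
      ⟨0, le_rfl, hT⟩ f₀ (K * T.toNNReal) 0 K K := by
    refine ⟨fun t ht => ?_, fun f _ => ?_, fun t ht f _ => ?_, ?_⟩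
    · have := (hlip t ht).comp lipschitzWith_clamp
      rw [mul_one] at this
      exact this.lipschitzOnWith
    · exact (continuous_flow hL ha _).continuousOn
    · have := (hlip t ht).dist_le_mul (clamp f) 0
      rw [flow_zero, dist_zero_right, dist_zero_right] at this
      exact this.trans (mul_le_of_le_one_right K.2 (norm_clamp_le f))
    · simp [hT]
  obtain ⟨w, hw0, hw⟩ := hpl.exists_eq_forall_mem_Icc_hasDerivWithinAt₀
  refine ⟨w, hw0, fun t ht => ?_⟩
  have hcont : ContinuousOn w (Icc 0 T) := fun t ht => (hw t ht).continuousWithinAt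
  have hderiv : ∀ t ∈ Ioo 0 T, HasDerivAt (fun t => ∑ x, w t x ^ 2)
      (∑ x, 2 * w t x * flow (a t) (clamp (w t)) x) t := by
    intro t ht
    have h1 := (hw t (Ioo_subset_Icc_self ht)).hasDerivAt (Icc_mem_nhds ht.1 ht.2)
    rw [hasDerivAt_pi] at h1
    have := HasDerivAt.fun_sum (u := Finset.univ) fun x _ => (h1 x).pow 2
    simpa using this
  -- Clamping is monotone, so increments of `w` and of its clamp have the same sign and the
  -- dissipation is nonnegative.
  have hanti : AntitoneOn (fun t => ∑ x, w t x ^ 2) (Icc 0 T) := by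
    refine antitoneOn_of_deriv_nonpos (convex_Icc 0 T) ?_ ?_ ?_
    · exact continuousOn_finsetSum _ fun x _ =>
        ((continuous_apply x).comp_continuousOn hcont).pow 2
    · rw [interior_Icc]
      exact fun t ht => (hderiv t ht).differentiableAt.differentiableWithinAt
    · rw [interior_Icc]
      intro t ht
      rw [(hderiv t ht).deriv]
      have h2 := sum_mul_flow hL (a t) (clamp (w t)) (w t)
      have h3 : 0 ≤ ∑ e, a t e * edgeDiff (clamp (w t)) e * edgeDiff (w t) e :=
        Finset.sum_nonneg fun e _ => by
          rw [mul_assoc]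
          exact mul_nonneg (ha.nonneg t e) (edgeDiff_clamp_mul_nonneg _ _)
      calc ∑ x, 2 * w t x * flow (a t) (clamp (w t)) x
          = 2 * ∑ x, w t x * flow (a t) (clamp (w t)) x := by
            rw [Finset.mul_sum]; simp only [mul_assoc]
        _ ≤ 0 := by rw [h2]; linarith
  have hclamp : clamp (w t) = w t := by
    have h1 : ∑ x, w t x ^ 2 ≤ 1 := by
      have := hanti ⟨le_rfl, hT⟩ ht ht.1
      simp only at this hw0
      rw [hw0] at this
      exact this.trans hf₀
    funext x
    have h2 : w t x ^ 2 ≤ 1 :=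
      (Finset.single_le_sum (f := fun x => w t x ^ 2) (fun _ _ => sq_nonneg _)
        (Finset.mem_univ x)).trans h1
    have h3 := abs_le.1 ((sq_le_one_iff_abs_le_one _).1 h2)
    rw [clamp, min_eq_right h3.2, max_eq_right h3.1]
  have := hw t ht
  simp only [hclamp] at this
  exact this

/-- Existence of the heat kernel. -/
lemma exists_isSol (hL : 1 ≤ L) (ha : IsEnv a) {f₀ : Torus d L → ℝ} (hf₀ : ∑ x, f₀ x ^ 2 ≤ 1) :
    ∃ v : ℝ → Torus d L → ℝ, v 0 = f₀ ∧ IsSol a v := by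
  have hex : ∀ n : ℕ, ∃ w : ℝ → Torus d L → ℝ, w 0 = f₀ ∧
      ∀ t ∈ Icc (0 : ℝ) n, HasDerivWithinAt w (flow (a t) (w t)) (Icc (0 : ℝ) n) t := fun n =>
    exists_isSol_Icc hL ha hf₀ (Nat.cast_nonneg n)
  choose w hw0 hw using hex
  have hcont : ∀ n, ContinuousOn (w n) (Icc (0 : ℝ) n) := fun n t ht =>
    (hw n t ht).continuousWithinAt
  have hright : ∀ n m : ℕ, m ≤ n → ∀ t ∈ Ico (0 : ℝ) m,
      HasDerivWithinAt (w n) (flow (a t) (w n t)) (Ici t) t := by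
    intro n m hmn t ht
    have hmn' : (m : ℝ) ≤ n := by exact_mod_cast hmn
    refine (hw n t ⟨ht.1, ht.2.le.trans hmn'⟩).mono_of_mem_nhdsWithin ?_
    exact mem_of_superset (Icc_mem_nhdsGE (ht.2.trans_le hmn')) (Icc_subset_Icc_left ht.1)
  have heq : ∀ n m : ℕ, m ≤ n → EqOn (w n) (w m) (Icc (0 : ℝ) m) := by
    intro n m hmn
    have hmn' : (m : ℝ) ≤ n := by exact_mod_cast hmn
    obtain ⟨M, hM⟩ := ha.exists_bound m
    exact ODE_solution_unique_of_mem_Icc_right (s := fun _ => univ)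
      (fun t ht => (lipschitzWith_flow hL (hM t (Ico_subset_Icc_self ht))).lipschitzOnWith)
      ((hcont n).mono (Icc_subset_Icc_right hmn')) (hright n m hmn) (fun _ _ => mem_univ _)
      (hcont m) (hright m m le_rfl) (fun _ _ => mem_univ _) (by rw [hw0, hw0])
  -- The solutions on `[0, n]` agree by uniqueness and are glued; `max t 0` extends the result
  -- continuously by a constant to negative times.
  set v : ℝ → Torus d L → ℝ := fun t => w (⌊max t 0⌋₊ + 1) (max t 0) with hv
  have hvw : ∀ (n : ℕ) (t : ℝ), t < n → 0 < n → v t = w n (max t 0) := by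
    intro n t htn hn
    have h0 : 0 ≤ max t 0 := le_max_right _ _
    have h1 : ⌊max t 0⌋₊ + 1 ≤ n := by
      rw [Nat.succ_le_iff, Nat.floor_lt h0]
      exact max_lt htn (by exact_mod_cast hn)
    refine (heq n _ h1 ⟨h0, ?_⟩).symm
    push_cast
    exact (Nat.lt_floor_add_one _).le
  refine ⟨v, by simp [hv, hw0], fun x => ?_, fun t ht x => ?_⟩
  · refine continuous_iff_continuousAt.2 fun t => ?_
    obtain ⟨n, hn⟩ := exists_nat_gt (max t 0)
    have hn0 : (0 : ℝ) < n := (le_max_right _ _).trans_lt hn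
    have htn : t < n := (le_max_left _ _).trans_lt hn
    have h1 : (fun s => v s x) =ᶠ[nhds t] fun s => w n (max 0 (min s n)) x := by
      filter_upwards [Iio_mem_nhds htn] with s hs
      rw [hvw n s hs (by exact_mod_cast hn0), min_eq_left (le_of_lt hs), max_comm]
    refine ContinuousAt.congr ?_ h1.symm
    have h2 : Continuous fun s : ℝ => w n (max 0 (min s n)) := by
      refine (hcont n).comp_continuous (by fun_prop) fun s => ⟨le_max_left _ _, ?_⟩
      exact max_le hn0.le (min_le_right _ _)
    exact ((continuous_apply x).comp h2).continuousAt
  · obtain ⟨n, hn⟩ := exists_nat_gt t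
    have hn0 : (0 : ℝ) < n := ht.trans hn
    have h1 : ∀ s ∈ Ioo (0 : ℝ) n, v s = w n s := fun s hs => by
      rw [hvw n s hs.2 (by exact_mod_cast hn0), max_eq_left hs.1.le]
    have h2 := (hw n t ⟨ht.le, hn.le⟩).hasDerivAt (Icc_mem_nhds ht hn)
    rw [← h1 t ⟨ht, hn⟩, hasDerivAt_pi] at h2
    refine (h2 x).congr_of_eventuallyEq ?_
    filter_upwards [Ioo_mem_nhds ht hn] with s hs
    rw [h1 s hs]

lemma exists_isHeat (hL : 1 ≤ L) (ha : IsEnv a) : ∃ v : ℝ → Torus d L → ℝ, IsHeat a v := by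
  classical
  obtain ⟨v, h0, hv⟩ := exists_isSol hL ha (f₀ := fun x => if x = 0 then 1 else 0) (by simp)
  exact ⟨v, hv, fun x => by rw [h0]⟩

end Existence

end GradPhi

namespace GradPhi

/-! ### Duality between an environment and its reversal -/

section Duality

variable {d L : ℕ} {p p' δ : ℝ} {a : ℝ → Edge d L → ℝ} {v q : ℝ → Torus d L → ℝ}

lemma IsEnv.reversed (ha : IsEnv a) (t : ℝ) : IsEnv (reversed t a) :=
  ⟨fun e => (ha.cont e).comp (by fun_prop : Continuous fun s : ℝ => t - s),
    fun s e => ha.nonneg (t - s) e⟩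

lemma edgeDiff_mul_comm_sum (hL : 1 ≤ L) (A : Edge d L → ℝ) (f g : Torus d L → ℝ) :
    ∑ x, g x * flow A f x = ∑ x, f x * flow A g x := by
  rw [sum_mul_flow hL, sum_mul_flow hL]
  congr 1
  exact Finset.sum_congr rfl fun e _ => by ring

/-- Chapman–Kolmogorov identity for the heat kernels of an environment and of its reversal. -/
lemma IsHeat.eq_sum_mul (hL : 1 ≤ L) (hv : IsHeat a v) {t : ℝ} (ht : 0 ≤ t)
    (hq : IsHeat (reversed t a) q) : v t 0 = ∑ x, v (t / 2) x * q (t / 2) x := by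
  set F : ℝ → ℝ := fun s => ∑ x, v s x * q (t - s) x with hF
  have hcont : Continuous F := continuous_finsetSum _ fun x _ =>
    (hv.cont x).mul ((hq.cont x).comp (by fun_prop : Continuous fun s : ℝ => t - s))
  -- At time `t - s` the reversed environment is `a s`. Differentiating `q (t - s)` in `s` therefore
  -- gives minus the generator that drives `v s`, and symmetry cancels the two terms.
  have hderiv : ∀ s ∈ Ioo 0 t, HasDerivAt F 0 s := by
    intro s hs
    have h1 : HasDerivAt F (∑ x, (flow (a s) (v s) x * q (t - s) x
        + v s x * (-flow (a s) (q (t - s)) x))) s := by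
      refine HasDerivAt.fun_sum fun x _ => (hv.deriv s hs.1 x).mul ?_
      have h2 := hq.deriv (t - s) (by linarith [hs.2]) x
      rw [show GradPhi.reversed t a (t - s) = a s by
        funext e; simp [GradPhi.reversed]] at h2
      exact h2.comp_const_sub t s
    convert h1 using 1
    rw [Finset.sum_add_distrib]
    simp only [mul_neg, Finset.sum_neg_distrib]
    rw [← edgeDiff_mul_comm_sum hL]
    simp only [mul_comm, add_neg_cancel]
  have hconst : ∀ s ∈ Icc 0 t, F s = F t := by
    have hd : DifferentiableOn ℝ F (interior (Icc 0 t)) := by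
      rw [interior_Icc]
      exact fun s hs => (hderiv s hs).differentiableAt.differentiableWithinAt
    have h1 : AntitoneOn F (Icc 0 t) := antitoneOn_of_deriv_nonpos (convex_Icc 0 t)
      hcont.continuousOn hd (by rw [interior_Icc]; exact fun s hs => (hderiv s hs).deriv.le)
    have h2 : MonotoneOn F (Icc 0 t) := monotoneOn_of_deriv_nonneg (convex_Icc 0 t)
      hcont.continuousOn hd (by rw [interior_Icc]; exact fun s hs => (hderiv s hs).deriv.ge)
    exact fun s hs => le_antisymm (h2 hs ⟨ht, le_rfl⟩ hs.2) (h1 hs ⟨ht, le_rfl⟩ hs.2)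
  have h1 := hconst (t / 2) ⟨by linarith, by linarith⟩
  simp only [hF, sub_half, sub_self, hq.init, mul_ite, mul_one, mul_zero, Finset.sum_ite_eq',
    Finset.mem_univ, if_true] at h1
  exact h1.symm

lemma IsHeat.centered_eq_sum_mul (hL : 1 ≤ L) (ha : IsEnv a) (hv : IsHeat a v) {t : ℝ}
    (ht : 0 ≤ t) (hq : IsHeat (reversed t a) q) :
    centered v t 0 = ∑ x, centered v (t / 2) x * centered q (t / 2) x := by
  have hc := card_torus_pos (d := d) (L := L)
  set c := 1 / (Fintype.card (Torus d L) : ℝ) with hcd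
  have ht2 : 0 ≤ t / 2 := by linarith
  have h1 : ∀ x, centered v (t / 2) x * centered q (t / 2) x
      = v (t / 2) x * q (t / 2) x - c * v (t / 2) x - c * q (t / 2) x + c ^ 2 := fun x => by
    rw [centered, centered, ← hcd]; ring
  simp only [h1, Finset.sum_add_distrib, Finset.sum_sub_distrib, ← Finset.mul_sum]
  rw [← hv.eq_sum_mul hL ht hq, hv.sum_eq hL ha ht2, hq.sum_eq hL (ha.reversed t) ht2, centered,
    ← hcd, Finset.sum_const, Finset.card_univ, nsmul_eq_mul, hcd]
  field_simp
  ring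

lemma IsHeat.centered_le (hL : 1 ≤ L) (ha : IsEnv a) (hv : IsHeat a v) {t : ℝ}
    (ht : 0 ≤ t) (hq : IsHeat (reversed t a) q) :
    centered v t 0 ≤ √(nrg (centered v) (t / 2) * nrg (centered q) (t / 2)) := by
  rw [hv.centered_eq_sum_mul hL ha ht hq]
  exact Real.le_sqrt_of_sq_le (Finset.sum_mul_sq_le_sq_mul_sq _ _ _)

/-- Adding the mean back gives the solution started from an indicator, which is nonnegative and has
mass one. Freezing time at zero from the left provides the continuous extension demanded by `IsSol`.
-/
lemma IsHeatKernel.isHeat (hL : 1 ≤ L) {o : Edge d L → Bool} {H : ℝ → Torus d L → ℝ}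
    (hH : IsHeatKernel o a 0 0 H) :
    IsHeat a fun t x => H (max t 0) x + 1 / (Fintype.card (Torus d L) : ℝ) := by
  refine ⟨⟨fun x => ?_, fun t ht x => ?_⟩, fun x => ?_⟩
  · refine Continuous.add ?_ continuous_const
    exact (hH.continuousOn x).comp_continuous (by fun_prop) fun t => le_max_right t 0
  · have h1 := hH.hasDerivAt t ht x
    rw [divergence_eq_flow hL] at h1
    have h2 : flow (a t) (fun x => H (max t 0) x + 1 / (Fintype.card (Torus d L) : ℝ)) x
        = flow (a t) (H t) x := by
      simp only [flow, edgeDiff, add_sub_add_right_eq_sub, max_eq_left ht.le]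
    rw [h2]
    refine (h1.congr_of_eventuallyEq ?_).add_const _
    filter_upwards [Ioi_mem_nhds ht] with s hs
    rw [max_eq_left (le_of_lt hs)]
  · simp [hH.initial]

end Duality

/-! ### Assembly of the heat kernel bound -/

section Conclusion

variable {d L : ℕ} {p p' δ : ℝ} {a : ℝ → Edge d L → ℝ}

/-- `scrM1` and `scrM3` are at least one, so a finite product forces `scrM1`, `scrM2` and `scrM3` to
be finite; the exponent `1 - α - γ` is `β`. -/
lemma ne_top_of_scrM_ne_top (hd : 2 ≤ d) (hp : (d : ℝ) < p) (hp' : (d : ℝ) < p')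
    (h : scrM p p' δ a ≠ ⊤) :
    scrM1 p δ a ≠ ⊤ ∧ scrM2 p a ≠ ⊤ ∧ scrM3 p p' δ a ≠ ⊤ ∧
    scrM p p' δ a = ENNReal.ofReal (((scrM1 p δ a + scrM2 p a).toReal
      * (scrM3 p p' δ a).toReal) ^ (gammaE d p p' / betaE d p p')) := by
  have hd2 : (2 : ℝ) ≤ d := by exact_mod_cast hd
  have hexp := nashExponents hd hp hp'
  have hβ := hexp.pos_β
  have hγ := hexp.pos_γ
  have h1 : 1 ≤ scrM1 p δ a := one_le_scrM1 (by linarith)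
  have h3 : 1 ≤ scrM3 p p' δ a := one_le_scrM3 hexp.pos_α hγ
  have hr : 0 < gammaE d p p' / betaE d p p' := div_pos hγ hβ
  rw [scrM, one_sub_alphaE_sub_gammaE hexp] at h ⊢
  have hS : (scrM1 p δ a + scrM2 p a) * scrM3 p p' δ a ≠ ⊤ := fun e => by
    rw [e, ENNReal.top_rpow_of_pos hr] at h; exact h rfl
  have hS12 : scrM1 p δ a + scrM2 p a ≠ ⊤ := fun e => by
    rw [e, ENNReal.top_mul (one_pos.trans_le h3).ne'] at hS; exact hS rfl
  have hS3 : scrM3 p p' δ a ≠ ⊤ := fun e => by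
    rw [e, ENNReal.mul_top (one_pos.trans_le (h1.trans le_self_add)).ne'] at hS; exact hS rfl
  refine ⟨(ENNReal.add_ne_top.1 hS12).1, (ENNReal.add_ne_top.1 hS12).2, hS3, ?_⟩
  rw [← ENNReal.toReal_mul, ← ENNReal.ofReal_rpow_of_nonneg ENNReal.toReal_nonneg hr.le,
    ENNReal.ofReal_toReal hS]

lemma one_le_scrM (hd : 2 ≤ d) (hp : (d : ℝ) < p) (hp' : (d : ℝ) < p') : 1 ≤ scrM p p' δ a := by
  have hd2 : (2 : ℝ) ≤ d := by exact_mod_cast hd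
  have hexp := nashExponents hd hp hp'
  have h1 : 1 ≤ scrM1 p δ a := one_le_scrM1 (by linarith)
  have h3 : 1 ≤ scrM3 p p' δ a := one_le_scrM3 hexp.pos_α hexp.pos_γ
  rw [scrM, one_sub_alphaE_sub_gammaE hexp]
  exact ENNReal.one_le_rpow (one_le_mul (h1.trans le_self_add) h3)
    (div_pos hexp.pos_γ hexp.pos_β)

/-- The energy estimate yields the rate with this power of `scrM3`. The statement has a larger
exponent and the factor `scrM4`, and both bases are at least one, so the exponential in the
statement is the weaker one. -/
lemma rpow_scrM3_le_scrM' (hd : 2 ≤ d) (hp : (d : ℝ) < p) (hp' : (d : ℝ) < p') :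
    scrM3 p p' δ a ^ (gammaE d p p' / alphaE d p p') ≤ scrM' p p' δ a := by
  have hd2 : (2 : ℝ) ≤ d := by exact_mod_cast hd
  have hexp := nashExponents hd hp hp'
  have hα := hexp.pos_α
  have hβ := hexp.pos_β
  have hγ := hexp.pos_γ
  have hp0 : 0 < p := by linarith
  have h3 : 1 ≤ scrM3 p p' δ a := one_le_scrM3 hα hγ
  have h4 : 1 ≤ scrM4 p δ a := by
    rw [scrM4, ENNReal.one_le_inv]
    refine (iInf₂_le (1 : ℝ) (by simp)).trans ?_
    have h := setLIntegral_mono' (μ := volume) (measurableSet_Ioc (a := (0 : ℝ)) (b := 1))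
      (f := fun s => (calM4 p δ a s)⁻¹) (g := fun _ => 1) fun s _ =>
        ENNReal.inv_le_one.2 (by rw [calM4]; exact le_self_add)
    simpa [timeAvg] using h
  rw [scrM']
  refine le_trans (ENNReal.rpow_le_rpow_of_exponent_le h3 ?_) (le_mul_of_one_le_right' h4)
  have : 0 ≤ 2 * gammaE d p p' / (d * betaE d p p' + p * gammaE d p p') := by positivity
  linarith

/-- On-diagonal heat kernel decay for a fixed environment. -/
lemma exists_heatKernel_le (d : ℕ) (hd : 2 ≤ d) {p p' δ : ℝ} (hp : (d : ℝ) < p)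
    (hp' : (d : ℝ) < p') (hδ : 0 < δ) (hK : KernelSmall p δ) : ∃ C : ℝ, 1 ≤ C ∧
    ∀ (L : ℕ) (_ : 1 ≤ L) (o : Edge d L → Bool) (a : ℝ → Edge d L → ℝ)
      (H : ℝ → Torus d L → ℝ), IsEnv a → IsHeatKernel o a 0 0 H → ∀ t : ℝ, 0 ≤ t →
      ENNReal.ofReal (H t 0) ≤
        ENNReal.ofReal C * (scrM p p' δ a * scrM p p' δ (reversed t a)) ^ (1 / 2 : ℝ)
          / ENNReal.ofReal ((1 + t) ^ ((d : ℝ) / 2))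
          * ENNReal.ofReal (Real.exp (-(ENNReal.ofReal t /
              (ENNReal.ofReal C * scrM' p p' δ a * (L : ℝ≥0∞) ^ 2)).toReal)) := by
  obtain ⟨C, hC, h⟩ := exists_nrg_centered_le d hd hp hp' hδ hK
  have hexp := nashExponents hd hp hp'
  have h2d : (1 : ℝ) ≤ 2 ^ ((d : ℝ) / 2) := Real.one_le_rpow (by norm_num) (by positivity)
  have hC0 : 0 < C := by linarith
  have hCC : C * 2 ^ ((d : ℝ) / 2) ≤ 4 * C * 2 ^ ((d : ℝ) / 2) := by
    have : 0 ≤ C * 2 ^ ((d : ℝ) / 2) := by positivity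
    linarith
  have hC4 : 4 * C ≤ 4 * C * 2 ^ ((d : ℝ) / 2) := le_mul_of_one_le_right (by positivity) h2d
  -- The power of 2 comes from evaluating the energies at time `t / 2`, and the 4 from that halving
  -- combined with discarding the exponential of the reversed solution.
  refine ⟨4 * C * 2 ^ ((d : ℝ) / 2), by linarith, ?_⟩
  intro L hL o a H ha hH t ht
  set C' := 4 * C * 2 ^ ((d : ℝ) / 2) with hC'
  have hC'0 : 0 < C' := by positivity
  clear_value C'
  have ha' := ha.reversed t
  have hexp0 : ∀ x : ℝ, ENNReal.ofReal (Real.exp x) ≠ 0 := fun x => by simp [Real.exp_pos]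
  -- The right side is then infinite, because the exponential factor is positive in every case.
  by_cases htop : scrM p p' δ a * scrM p p' δ (reversed t a) = ⊤
  · rw [htop, ENNReal.top_rpow_of_pos (by norm_num), ENNReal.mul_top (by simpa using hC'0),
      ENNReal.top_div_of_ne_top ENNReal.ofReal_ne_top, ENNReal.top_mul (hexp0 _)]
    exact le_top
  have hM : scrM p p' δ a ≠ ⊤ := fun e => htop (by
    rw [e, ENNReal.top_mul (one_pos.trans_le (one_le_scrM hd hp hp')).ne'])
  have hM' : scrM p p' δ (reversed t a) ≠ ⊤ := fun e => htop (by
    rw [e, ENNReal.mul_top (one_pos.trans_le (one_le_scrM hd hp hp')).ne'])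
  obtain ⟨f1, f2, f3, fM⟩ := ne_top_of_scrM_ne_top hd hp hp' hM
  obtain ⟨g1, g2, g3, gM⟩ := ne_top_of_scrM_ne_top hd hp hp' hM'
  obtain ⟨q, hq⟩ := exists_isHeat hL ha'
  have hv := hH.isHeat hL
  set v : ℝ → Torus d L → ℝ := fun t x => H (max t 0) x + 1 / (Fintype.card (Torus d L) : ℝ)
  have hHv : H t 0 = centered v t 0 := by simp [centered, v, max_eq_left ht]
  have e1 := hv.centered_le hL ha ht hq
  have e2 := h L hL a v ha hv f1 f2 f3 (t / 2) (by linarith)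
  have e3 := h L hL _ q ha' hq g1 g2 g3 (t / 2) (by linarith)
  have hS3 := one_le_toReal_scrM3 hexp.pos_α hexp.pos_γ f3
  have hS3' := one_le_toReal_scrM3 hexp.pos_α hexp.pos_γ g3
  have hSr := rpow_scrM3_le_scrM' (δ := δ) (a := a) hd hp hp'
  rw [← ENNReal.ofReal_toReal f3, ENNReal.ofReal_rpow_of_pos (by linarith)] at hSr
  have hα := hexp.pos_α
  have hγ := hexp.pos_γ
  have hL1 : (1 : ℝ) ≤ L := by exact_mod_cast hL
  rw [fM, gM]
  have hG0 : 0 ≤ ((scrM1 p δ a + scrM2 p a).toReal * (scrM3 p p' δ a).toReal)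
      ^ (gammaE d p p' / betaE d p p') := by positivity
  have hG0' : 0 ≤ ((scrM1 p δ (reversed t a) + scrM2 p (reversed t a)).toReal
      * (scrM3 p p' δ (reversed t a)).toReal) ^ (gammaE d p p' / betaE d p p') := by positivity
  have hR : 0 < (scrM3 p p' δ a).toReal ^ (gammaE d p p' / alphaE d p p') := by positivity
  have hR' : 0 < (scrM3 p p' δ (reversed t a)).toReal ^ (gammaE d p p' / alphaE d p p') := by
    positivity
  generalize ((scrM1 p δ a + scrM2 p a).toReal * (scrM3 p p' δ a).toReal)
      ^ (gammaE d p p' / betaE d p p') = G at *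
  generalize ((scrM1 p δ (reversed t a) + scrM2 p (reversed t a)).toReal
      * (scrM3 p p' δ (reversed t a)).toReal) ^ (gammaE d p p' / betaE d p p') = G' at *
  generalize (scrM3 p p' δ a).toReal ^ (gammaE d p p' / alphaE d p p') = R at *
  generalize (scrM3 p p' δ (reversed t a)).toReal ^ (gammaE d p p' / alphaE d p p') = R' at *
  have hX : (ENNReal.ofReal t / (ENNReal.ofReal C' * scrM' p p' δ a * (L : ℝ≥0∞) ^ 2)).toReal
      ≤ t / (4 * C * R * (L : ℝ) ^ 2) := by
    refine ENNReal.toReal_le_of_le_ofReal (by positivity) ?_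
    rw [ENNReal.ofReal_div_of_pos (by positivity)]
    refine ENNReal.div_le_div_left ?_ _
    rw [ENNReal.ofReal_mul (by positivity), ENNReal.ofReal_mul (by positivity),
      ENNReal.ofReal_pow (by positivity), ENNReal.ofReal_natCast]
    exact mul_le_mul_left (mul_le_mul' (ENNReal.ofReal_le_ofReal hC4) hSr) _
  set X := (ENNReal.ofReal t / (ENNReal.ofReal C' * scrM' p p' δ a * (L : ℝ≥0∞) ^ 2)).toReal
  clear_value X
  rw [← ENNReal.ofReal_mul hG0, ENNReal.ofReal_rpow_of_nonneg (by positivity) (by norm_num),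
    ← ENNReal.ofReal_mul hC'0.le, ← ENNReal.ofReal_div_of_pos (by positivity),
    ← ENNReal.ofReal_mul (by positivity)]
  refine ENNReal.ofReal_le_ofReal ?_
  rw [hHv]
  refine e1.trans ?_
  have hD : (1 + t / 2) ^ (-((d : ℝ) / 2)) ≤ 2 ^ ((d : ℝ) / 2) / (1 + t) ^ ((d : ℝ) / 2) := by
    have : (1 + t / 2) ^ (-((d : ℝ) / 2)) ≤ ((1 + t) / 2) ^ (-((d : ℝ) / 2)) :=
      Real.rpow_le_rpow_of_nonpos (by linarith) (by linarith) (neg_nonpos.2 (by positivity))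
    refine this.trans (le_of_eq ?_)
    rw [Real.rpow_neg (by linarith), Real.div_rpow (by linarith) (by norm_num), inv_div]
  have e4 : nrg (centered v) (t / 2) ≤ (C * 2 ^ ((d : ℝ) / 2) / (1 + t) ^ ((d : ℝ) / 2))
      * (G * Real.exp (-X) ^ 2) := by
    refine e2.trans ?_
    -- The squared exponential comes from the forward solution alone, and the final square root
    -- returns `exp (-X)`.
    have hexpX : Real.exp (-(t / 2 / (C * (L : ℝ) ^ 2 * R))) ≤ Real.exp (-X) ^ 2 := by
      rw [← Real.exp_nat_mul, Real.exp_le_exp]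
      have : t / 2 / (C * (L : ℝ) ^ 2 * R) = 2 * (t / (4 * C * R * (L : ℝ) ^ 2)) := by
        field_simp; ring
      push_cast
      linarith
    calc _ ≤ C * G * (2 ^ ((d : ℝ) / 2) / (1 + t) ^ ((d : ℝ) / 2)) * Real.exp (-X) ^ 2 := by gcongr
      _ = _ := by ring
  have e5 : nrg (centered q) (t / 2) ≤ (C * 2 ^ ((d : ℝ) / 2) / (1 + t) ^ ((d : ℝ) / 2)) * G' := by
    refine e3.trans ?_
    have hexp1 : Real.exp (-(t / 2 / (C * (L : ℝ) ^ 2 * R'))) ≤ 1 :=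
      Real.exp_le_one_iff.2 (neg_nonpos.2 (by positivity))
    calc _ ≤ C * G' * (2 ^ ((d : ℝ) / 2) / (1 + t) ^ ((d : ℝ) / 2)) * 1 := by gcongr
      _ = _ := by ring
  have hB : C * 2 ^ ((d : ℝ) / 2) / (1 + t) ^ ((d : ℝ) / 2) ≤ C' / (1 + t) ^ ((d : ℝ) / 2) := by
    gcongr
  rw [← Real.sqrt_eq_rpow]
  refine Real.sqrt_le_iff.2 ⟨by positivity, ?_⟩
  calc _ ≤ (C * 2 ^ ((d : ℝ) / 2) / (1 + t) ^ ((d : ℝ) / 2)) * (G * Real.exp (-X) ^ 2)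
        * ((C * 2 ^ ((d : ℝ) / 2) / (1 + t) ^ ((d : ℝ) / 2)) * G') :=
        mul_le_mul e4 e5 (nrg_nonneg _ _) (by positivity)
    _ = (C * 2 ^ ((d : ℝ) / 2) / (1 + t) ^ ((d : ℝ) / 2)) ^ 2 * (G * G' * Real.exp (-X) ^ 2) := by
        ring
    _ ≤ (C' / (1 + t) ^ ((d : ℝ) / 2)) ^ 2 * (G * G' * Real.exp (-X) ^ 2) := by gcongr
    _ = _ := by
        rw [mul_pow, mul_div_right_comm, mul_pow, Real.sq_sqrt (by positivity)]; ring

end Conclusion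

end GradPhi

theorem proposition4p7 (d : ℕ) (hd : 2 ≤ d) (p p' δ : ℝ) (hp : (d : ℝ) < p) (hp' : (d : ℝ) < p')
    (hδ : 0 < δ) (hδK : KernelSmall p δ) :
    ∃ C : ℝ, 1 ≤ C ∧
      ∀ (V : ℝ → ℝ) (_ : IsPotential V) (L : ℕ) (_ : 1 ≤ L) (o : Edge d L → Bool)
        (Ω : Type*) (_ : MeasurableSpace Ω) (P : Measure Ω) (_ : IsProbabilityMeasure P)
        (B : Torus d L → ℝ≥0 → Ω → ℝ) (φ₀ : Ω → Torus d L → ℝ) (φ : Ω → ℝ → Torus d L → ℝ)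
        (_ : IsLangevin P o V B φ₀ φ)
        (a : Ω → ℝ → Edge d L → ℝ)
        (_ : ∀ᵐ ω ∂P, (∀ e, Continuous fun t => a ω t e) ∧ (∀ t e, 0 ≤ a ω t e) ∧
          ∀ t, 0 ≤ t → ∀ e, a ω t e = iteratedDeriv 2 V (grad o (φ ω t) e)),
        ∀ᵐ ω ∂P, ∀ Pa : ℝ → Torus d L → ℝ, IsHeatKernel o (a ω) 0 0 Pa →
          ∀ t : ℝ, 0 ≤ t →
            ENNReal.ofReal (Pa t 0) ≤
              ENNReal.ofReal C * (scrM p p' δ (a ω) * scrM p p' δ (reversed t (a ω))) ^ (1 / 2 : ℝ)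
                / ENNReal.ofReal ((1 + t) ^ ((d : ℝ) / 2))
                * ENNReal.ofReal (Real.exp (-(ENNReal.ofReal t /
                    (ENNReal.ofReal C * scrM' p p' δ (a ω) * (L : ℝ≥0∞) ^ 2)).toReal)) := by
  obtain ⟨C, hC, h⟩ := exists_heatKernel_le d hd hp hp' hδ hδK
  refine ⟨C, hC, ?_⟩
  intro V _ L hL o Ω _ P _ B φ₀ φ _ a ha
  -- Nonnegativity and continuity of the path of the environment suffice for the deterministic
  -- bound.
  filter_upwards [ha] with ω hω Pa hPa t ht
  exact h L hL o (a ω) Pa ⟨hω.1, hω.2.1⟩ hPa t ht
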